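/- **Setting.** Let $n\ge 1$, $k\in\mathbb N$, $s\in(0,1)$, $a=1-2s$, and write $X=(x,y)\in\mathbb R^{n}\times\mathbb R$. Put $\alpha^*=s$ if $s\le\frac12$ and $\alpha^*=2s-1$ if $s>\frac12$. For $X_0=(x_0,0)$ let $B_r^+(X_0)=\{|X-X_0|<r,\ y>0\}$, $\partial^+B_r^+(X_0)=\{|X-X_0|=r,\ y>0\}$, $\partial^0B_r^+(X_0)=\{(x,0):|x-x_0|<r\}$, $S_r^{n-1}(X_0)=\{(x,0):|x-x_0|=r\}$, and let $B_r^+=B_r^+(0)$, $B_1=\{|X|<1\}$. Let $\tau>0$ satisfy $(n-1)\tau<2$ and $(n-2s)\tau\le 4s$. **The class $\mathcal G^s(B_1^+)$.** It consists of the functions $\mathbf u=(u_1,\dots,u_k)$ such that, with functions $f_i:\mathbb R\to[0,\infty)$, $f_i(0)=0$, $f_i$ of class $C^{1}$ with $f_i'$ $\tau$-Hölder continuous on bounded intervals, and $F_i(t)=\int_0^tf_i$: 1. for every compact $K\subset B_1$, $\mathbf u\in H^{1,a}(K\cap B_1^+)$ (that is, $u_i$ has a weak gradient in $B_1^+$ and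 $\int_{K\cap B_1^+}y^a(|\mathbf u|^2+|\nabla\mathbf u|^2)\,dX<\infty$) and $\mathbf u\in C^{0,\alpha}(\overline{K\cap B_1^+})$ for all $\alpha\in(0,\alpha^*)$; 2. $u_iu_j=0$ on $\partial^0B_1^+$ for $i\ne j$, and $u_i$ solves weakly $-\mathrm{div}(y^a\nabla u_i)=0$ in $B_1^+$, $u_i\,(\lim_{y\to0}y^a\partial_yu_i+f_i(u_i))=0$ on $\partial^0B_1^+$; that is, $$\int_{B_1^+}y^a\nabla u_i\cdot\nabla\varphi\,dX=\int_{\partial^0B_1^+}f_i(u_i)\varphi\,dx$$ for every $\varphi\in C_c^\infty(B_1)$ whose support contains no point $(x,0)$ with $u_i(x,0)=0$; 3. for every $X_0=(x_0,0)\in\partial^0B_1^+$ and almost every $r\in(0,1-|x_0|)$, $$(1-a-n)\int_{B_r^+(X_0)}y^a|\nabla\mathbf u|^2dX+r\int_{\partial^+B_r^+(X_0)}y^a|\nabla\mathbf u|^2d\sigma+2n\int_{\partial^0B_r^+(X_0)}\sum_iF_i(u_i)\,dx-2r\int_{S_r^{n-1}(X_0)}\sum_iF_i(u_i)\,d\sigma=2r\int_{\partial^+B_r^+(X_0)}y^a|\partial_r\mathbf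 u|^2d\sigma .$$ **Notation.** Let $\Gamma(\mathbf u)=\{X\in\partial^0B_1^+:\mathbf u(X)=0\}$. For $X_0\in\Gamma(\mathbf u)$ put $$E(r)=\frac1{r^{n-1+a}}\Big(\int_{B_r^+(X_0)}y^a|\nabla\mathbf u|^2dX-\int_{\partial^0B_r^+(X_0)}\sum_iu_if_i(u_i)\,dx\Big),\quad H(r)=\frac1{r^{n+a}}\int_{\partial^+B_r^+(X_0)}y^a|\mathbf u|^2d\sigma,\quad N(r)=\frac{E(r)}{H(r)},$$ $$\psi(r)=r\Big(\frac1{r^n}\int_{\partial^0B_r^+(X_0)}|\mathbf u|^{2+\tau}dx\Big)^{\frac{\tau}{2+\tau}},\qquad \Psi(r)=\int_0^rt^{-a}(1+\psi'(t))\,dt .$$ **Proposition.** Let $\mathbf u\in\mathcal G^s(B_1^+)$ be bounded and not identically zero in $B_1^+$. There exist constants $C>0$ and $\bar r>0$ such that for every $X_0=(x_0,0)\in\Gamma(\mathbf u)$, with $R=\min(\bar r,1-|x_0|)$: - $H(r)>0$ and $N(r)>0$ for every $0<r<R$; - the map $r\mapsto e^{C\Psi(r)}(N(r)+1)$ is monotone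 increasing on $(0,R)$; - the limit $\lim_{r\to0^+}N(r)$ exists, is finite, and is at least $\alpha^*$. -/

import Mathlib

open scoped Topology ContDiff NNReal RealInnerProductSpace

noncomputable section

namespace Segregation

/-- The ambient space of points `X = (x, y)`, with `y` the last coordinate. -/
abbrev Space (n : ℕ) : Type := EuclideanSpace ℝ (Fin (n + 1))

/-- The space of boundary points `x`. -/
abbrev Flat (n : ℕ) : Type := EuclideanSpace ℝ (Fin n)

/-- The vertical coordinate `y` of `X = (x, y)`. -/
def height {n : ℕ} (X : Space n) : ℝ := X (Fin.last n)

/-- The point `(x, 0)`. -/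
def flat {n : ℕ} (x : Flat n) : Space n :=
  WithLp.toLp 2 (Fin.snoc (α := fun _ => ℝ) (fun i => x i) 0)

/-- The open half ball `B_r⁺(X₀)`. -/
def halfBall {n : ℕ} (X₀ : Space n) (r : ℝ) : Set (Space n) :=
  {X | X ∈ Metric.ball X₀ r ∧ 0 < height X}

/-- The integral `∫_{∂⁺B_r⁺(x₀,0)} h dσ` over the open upper half sphere, for the surface measure
of the sphere. The function `h` receives the point `X` and the outer unit normal `(X - X₀) / r`. -/
def halfSphereIntegral {n : ℕ} (x₀ : Flat n) (r : ℝ) (h : Space n → Space n → ℝ) : ℝ :=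
  r ^ n * ∫ θ in {θ : Metric.sphere (0 : Space n) 1 | 0 < height (θ : Space n)},
    h (flat x₀ + r • (θ : Space n)) (θ : Space n)
      ∂((MeasureTheory.volume : MeasureTheory.Measure (Space n)).toSphere)

/-- The integral `∫_{S_r^{n-1}(x₀)} h dσ` over the sphere of radius `r` in `{y = 0}`, for its
surface measure (the counting measure on two points if `n = 1`). -/
def flatSphereIntegral {n : ℕ} (x₀ : Flat n) (r : ℝ) (h : Flat n → ℝ) : ℝ :=
  r ^ ((n : ℝ) - 1) * ∫ θ : Metric.sphere (0 : Flat n) 1, h (x₀ + r • (θ : Flat n))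
    ∂((MeasureTheory.volume : MeasureTheory.Measure (Flat n)).toSphere)

/-- The exponent `a = 1 - 2s` of the weight. -/
def weightExp (s : ℝ) : ℝ := 1 - 2 * s

/-- The weight `y^a`, for `y > 0`. -/
def weight {n : ℕ} (s : ℝ) (X : Space n) : ℝ := height X ^ weightExp s

/-- The exponent `α*`. -/
def alphaStar (s : ℝ) : ℝ := if s ≤ 1 / 2 then s else 2 * s - 1

/-- `f` is nonnegative, vanishes at `0`, and is of class `C^{1,τ}` on bounded intervals. -/
structure IsReaction (τ : ℝ) (f : ℝ → ℝ) : Prop where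
  contDiff : ContDiff ℝ 1 f
  holder : ∀ M : ℝ, ∃ L : ℝ, ∀ p ∈ Set.Icc (-M) M, ∀ q ∈ Set.Icc (-M) M,
    |deriv f p - deriv f q| ≤ L * |p - q| ^ τ
  nonneg : ∀ t, 0 ≤ f t
  zero : f 0 = 0

/-- The primitive `F(t) = ∫₀ᵗ f`. -/
def primitive (f : ℝ → ℝ) (t : ℝ) : ℝ := ∫ q in (0 : ℝ)..t, f q

/-- `g` is the weak (distributional) gradient of `v` in the open set `Ω`. -/
def IsWeakGradient {n : ℕ} (Ω : Set (Space n)) (v : Space n → ℝ) (g : Space n → Space n) : Prop :=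
  ∀ φ : Space n → ℝ, ContDiff ℝ ∞ φ → HasCompactSupport φ → tsupport φ ⊆ Ω → ∀ e : Space n,
    ∫ X in Ω, v X * fderiv ℝ φ X e = - ∫ X in Ω, ⟪g X, e⟫ * φ X

/-- `v`, with weak gradient `g`, belongs to `H^{1,a}(K ∩ B₁⁺)` for every compact `K ⊂ B₁`. -/
structure IsWeightedSobolevLoc {n : ℕ} (s : ℝ) (v : Space n → ℝ) (g : Space n → Space n) :
    Prop where
  weakGradient : IsWeakGradient (halfBall 0 1) v g
  aestronglyMeasurable : MeasureTheory.AEStronglyMeasurable v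
    (MeasureTheory.volume.restrict (halfBall 0 1))
  aestronglyMeasurable_grad : MeasureTheory.AEStronglyMeasurable g
    (MeasureTheory.volume.restrict (halfBall 0 1))
  integrable_sq : ∀ K : Set (Space n), IsCompact K → K ⊆ Metric.ball 0 1 →
    MeasureTheory.IntegrableOn (fun X => weight s X * v X ^ 2) (K ∩ halfBall 0 1)
  integrable_grad_sq : ∀ K : Set (Space n), IsCompact K → K ⊆ Metric.ball 0 1 →
    MeasureTheory.IntegrableOn (fun X => weight s X * ‖g X‖ ^ 2) (K ∩ halfBall 0 1)

/-- `|∇u|²`, where `G i` is the gradient of the component `u i`. -/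
def gradSq {n k : ℕ} (G : Fin k → Space n → Space n) (X : Space n) : ℝ := ∑ i, ‖G i X‖ ^ 2

/-- The Dirichlet energy `∫_{B_r⁺(x₀,0)} y^a |∇u|² dX`. -/
def energy {n k : ℕ} (s : ℝ) (G : Fin k → Space n → Space n) (x₀ : Flat n) (r : ℝ) : ℝ :=
  ∫ X in halfBall (flat x₀) r, weight s X * gradSq G X

/-- The weak formulation of `-div(y^a ∇v) = 0` in `B₁⁺` and `v (lim y^a ∂_y v + f(v)) = 0` on
`∂⁰B₁⁺`, where `g` is the weak gradient of `v`: the condition `-lim y^a ∂_y v = f(v)` is imposed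
where the trace of `v` does not vanish. A test function supported in the open half ball gives the
equation in `B₁⁺`. -/
def IsWeakSolution {n : ℕ} (s : ℝ) (f : ℝ → ℝ) (v : Space n → ℝ) (g : Space n → Space n) : Prop :=
  ∀ φ : Space n → ℝ, ContDiff ℝ ∞ φ → HasCompactSupport φ → tsupport φ ⊆ Metric.ball 0 1 →
    (∀ x : Flat n, flat x ∈ tsupport φ → v (flat x) ≠ 0) →
    ∫ X in halfBall 0 1, weight s X * fderiv ℝ φ X (g X) =
      ∫ x in Metric.ball (0 : Flat n) 1, f (v (flat x)) * φ (flat x)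

/-- The Pohozaev type identity in `B_r⁺(x₀,0)`. -/
def PohozaevIdentity {n k : ℕ} (s : ℝ) (f : Fin k → ℝ → ℝ)
    (u : Space n → EuclideanSpace ℝ (Fin k)) (G : Fin k → Space n → Space n)
    (x₀ : Flat n) (r : ℝ) : Prop :=
  (1 - weightExp s - n) * energy s G x₀ r
      + r * halfSphereIntegral x₀ r (fun X _ => weight s X * gradSq G X)
      + 2 * n * (∫ x in Metric.ball x₀ r, ∑ i, primitive (f i) (u (flat x) i))
      - 2 * r * flatSphereIntegral x₀ r (fun x => ∑ i, primitive (f i) (u (flat x) i))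
    = 2 * r * halfSphereIntegral x₀ r (fun X ν => weight s X * ∑ i, ⟪G i X, ν⟫ ^ 2)

/-- `u` belongs to the class `𝒢ˢ(B₁⁺)` with nonlinearities `f i` of class `C^{1,τ}`; here `G i` is
(a representative of) the weak gradient of the component `u i`. Only the values of `u` at the points
`|X| < 1`, `y ≥ 0` matter, and the values at `y = 0` are the trace, since `u` is continuous up to
`y = 0`. As `G` is only determined up to null sets, the Pohozaev identity is required, for each
center, for almost every admissible radius; `1 - ‖x₀‖` is the distance from `(x₀, 0)` to the unit
sphere. -/
structure IsSegregated {n k : ℕ} (s τ : ℝ) (f : Fin k → ℝ → ℝ)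
    (u : Space n → EuclideanSpace ℝ (Fin k)) (G : Fin k → Space n → Space n) : Prop where
  sobolev : ∀ i, IsWeightedSobolevLoc s (fun X => u X i) (G i)
  holder : ∀ K : Set (Space n), IsCompact K → K ⊆ Metric.ball 0 1 →
    ∀ α : ℝ≥0, 0 < α → (α : ℝ) < alphaStar s →
      ∃ L : ℝ≥0, HolderOnWith L α u (closure (K ∩ halfBall 0 1))
  segregated : ∀ i j, i ≠ j → ∀ x : Flat n, ‖x‖ < 1 → u (flat x) i * u (flat x) j = 0
  reaction : ∀ i, IsReaction τ (f i)
  solution : ∀ i, IsWeakSolution s (f i) (fun X => u X i) (G i)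
  pohozaev : ∀ x₀ : Flat n, ‖x₀‖ < 1 →
    ∀ᵐ r : ℝ, 0 < r → r < 1 - ‖x₀‖ → PohozaevIdentity s f u G x₀ r

/-- The free boundary `Γ(u)`, as a subset of the open unit ball of `{y = 0}`. -/
def freeBoundary {n k : ℕ} (u : Space n → EuclideanSpace ℝ (Fin k)) : Set (Flat n) :=
  {x | ‖x‖ < 1 ∧ u (flat x) = 0}

/-- The function `E(r) = E(X₀, u, r)`. -/
def almgrenE {n k : ℕ} (s : ℝ) (f : Fin k → ℝ → ℝ)
    (u : Space n → EuclideanSpace ℝ (Fin k)) (G : Fin k → Space n → Space n)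
    (x₀ : Flat n) (r : ℝ) : ℝ :=
  1 / r ^ ((n : ℝ) - 1 + weightExp s) *
    (energy s G x₀ r - ∫ x in Metric.ball x₀ r, ∑ i, u (flat x) i * f i (u (flat x) i))

/-- The function `H(r) = H(X₀, u, r)`. -/
def almgrenH {n k : ℕ} (s : ℝ) (u : Space n → EuclideanSpace ℝ (Fin k))
    (x₀ : Flat n) (r : ℝ) : ℝ :=
  1 / r ^ ((n : ℝ) + weightExp s) *
    halfSphereIntegral x₀ r (fun X _ => weight s X * ‖u X‖ ^ 2)

/-- Almgren's frequency `N(r) = E(r) / H(r)`. -/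
def almgrenN {n k : ℕ} (s : ℝ) (f : Fin k → ℝ → ℝ)
    (u : Space n → EuclideanSpace ℝ (Fin k)) (G : Fin k → Space n → Space n)
    (x₀ : Flat n) (r : ℝ) : ℝ :=
  almgrenE s f u G x₀ r / almgrenH s u x₀ r

/-- The auxiliary function `ψ(r)`. -/
def psi {n k : ℕ} (τ : ℝ) (u : Space n → EuclideanSpace ℝ (Fin k)) (x₀ : Flat n) (r : ℝ) : ℝ :=
  r * (1 / r ^ (n : ℝ) * ∫ x in Metric.ball x₀ r, ‖u (flat x)‖ ^ (2 + τ)) ^ (τ / (2 + τ))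

/-- The auxiliary function `Ψ(r) = ∫₀ʳ t^{-a} (1 + ψ'(t)) dt`. -/
def bigPsi {n k : ℕ} (s τ : ℝ) (u : Space n → EuclideanSpace ℝ (Fin k)) (x₀ : Flat n) (r : ℝ) :
    ℝ :=
  ∫ t in (0 : ℝ)..r, t ^ (-weightExp s) * (1 + deriv (psi τ u x₀) t)

end Segregation

end

noncomputable section

namespace Segregation

open MeasureTheory Set Filter Metric
open scoped ENNReal

/-! ### Polar coordinates in balls, half balls and flat balls -/

section Polar

/-! This is Almgren's monotonicity argument, with the reaction terms treated as a perturbation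
controlled by ψ. Write D for the energy, V for the integral of Σ u_i f_i(u_i), p = n - 1 + a, T for
the weighted integral of |∂_r u|² over the half sphere, and g for the integral of |u|^(2+τ) over the
flat ball of radius r. Testing the equation with u gives, for almost every r, that D - V is the
weighted integral of u·∂_r u over the half sphere (`IsWeakSolution.ae_radialFlux_eq`); hence H' =
2E/r. The Pohozaev identity expresses D' through D and 2T, and Cauchy-Schwarz gives (D - V)² ≤
r^(n+a) H T. So E' H - 2E²/r is nonnegative up to an error of size r^(-p) (g/r + g') H, because f_i
≥ 0 = f_i(0) forces f_i'(0) = 0 and therefore f_i(t) = O(|t|^(1+τ)).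

The error is absorbed into E + H by a trace inequality (`exists_trace_le`): with γ = g/r^n and S =
r^(-p) D + H, the power γ^(2/(2+τ)) is at most a constant times S. The remaining power of γ is ψ/r,
which is bounded since u is. Moreover (n-1)τ < 2 makes both terms of ψ' nonnegative, so r^(1-n) g'
is at most a constant times ψ' S. For small r one also has S ≤ 2(E + H). Hence (log(N+1))' ≥ -C
r^(-a)(1 + ψ'), which is the monotonicity. This rate is integrable at 0 because (n-2s)τ ≤ 4s makes
r^(-a) ψ nondecreasing.

Positivity of H is unique continuation. If H vanishes at one radius, that radius is an interior
minimum, so E vanishes there as well and H vanishes at all smaller radii; the frequency bound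
prevents H from leaving zero at larger radii (`FrequencyData.eq_zero_of_eq_zero`). The radius
reached is uniform in the centre, so vanishing spreads over the flat boundary by connectedness. Then
the trace is zero, the reaction terms disappear, no smallness of the radius is needed any more, and
u vanishes in the whole half ball.

The limit of N is at least α* because Hölder continuity gives H(r) ≤ C r^(2α) for every α < α*.
Finally N > 0, since the monotone quantity stays above 1 + α* while exp(CΨ) < 1 + α* for small
radii.

Two analytic inputs are proved from scratch. The energy identity requires test functions that avoid
the zero set of the trace, so u is approximated by upward shifted mollifications and truncated near
the value 0. The trace inequality comes from averaging over segments that join a boundary point to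
an interior ball, combined with Hedberg's splitting of the resulting potential. -/

theorem map_val_volumeIoiPow (d : ℕ) :
    (Measure.volumeIoiPow d).map (Subtype.val : Ioi (0 : ℝ) → ℝ) =
      (volume.restrict (Ioi (0 : ℝ))).withDensity fun r => ENNReal.ofReal (r ^ d) := by
  have hme := MeasurableEmbedding.subtype_coe (measurableSet_Ioi (a := (0 : ℝ)))
  ext t ht
  rw [Measure.map_apply measurable_subtype_coe ht, Measure.volumeIoiPow,
    withDensity_apply _ (measurable_subtype_coe ht), withDensity_apply _ ht]
  rw [← map_comap_subtype_coe measurableSet_Ioi, hme.restrict_map, hme.lintegral_map]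

section Polar

variable {E : Type*} [NormedAddCommGroup E] [NormedSpace ℝ E] [MeasurableSpace E] [BorelSpace E]
  [FiniteDimensional ℝ E]

/-- Polar coordinates, as a measure preserving map. -/
theorem measurePreserving_polar [Nontrivial E] (μ : Measure E) [μ.IsAddHaarMeasure] :
    MeasurePreserving (fun p : sphere (0 : E) 1 × ℝ => p.2 • (p.1 : E))
      (μ.toSphere.prod ((volume.restrict (Ioi (0 : ℝ))).withDensity
        fun r => ENNReal.ofReal (r ^ (Module.finrank ℝ E - 1)))) μ := by
  have hmeas : Measurable (fun p : sphere (0 : E) 1 × ℝ => p.2 • (p.1 : E)) := by fun_prop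
  refine ⟨hmeas, ?_⟩
  rw [← map_val_volumeIoiPow]
  have h1 : μ.toSphere.prod ((Measure.volumeIoiPow (Module.finrank ℝ E - 1)).map
      (Subtype.val : Ioi (0 : ℝ) → ℝ)) =
      (μ.toSphere.prod (Measure.volumeIoiPow (Module.finrank ℝ E - 1))).map
        (Prod.map id Subtype.val) := by
    have : SFinite ((Measure.volumeIoiPow (Module.finrank ℝ E - 1)).map
      (Subtype.val : Ioi (0 : ℝ) → ℝ)) := inferInstance
    rw [← Measure.map_prod_map _ _ measurable_id measurable_subtype_coe, Measure.map_id]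
  rw [h1, Measure.map_map hmeas (by fun_prop)]
  have h2 := (μ.measurePreserving_homeomorphUnitSphereProd).map_eq
  rw [← h2, Measure.map_map (by fun_prop) (Homeomorph.measurable _)]
  have h3 : ((fun p : sphere (0 : E) 1 × ℝ => p.2 • (p.1 : E)) ∘ Prod.map id Subtype.val) ∘
      (homeomorphUnitSphereProd E) = Subtype.val := by
    ext x
    have hx : ‖(x : E)‖ ≠ 0 := norm_ne_zero_iff.2 x.2
    simp [smul_smul, mul_inv_cancel₀ hx]
  rw [h3, map_comap_subtype_coe (measurableSet_singleton _).compl, restrict_compl_singleton]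

/-- Fubini through `measurePreserving_polar`. The last clause records integrability on almost every
sphere, which is needed when integrals over single spheres are manipulated. -/
theorem polar_integrable [Nontrivial E] (μ : Measure E) [μ.IsAddHaarMeasure] {F : E → ℝ}
    (hF : Integrable F μ) :
    IntegrableOn (fun ρ : ℝ => ρ ^ (Module.finrank ℝ E - 1) *
        ∫ θ : sphere (0 : E) 1, F (ρ • (θ : E)) ∂μ.toSphere) (Ioi 0) ∧
      ∫ X, F X ∂μ = ∫ ρ in Ioi (0 : ℝ), ρ ^ (Module.finrank ℝ E - 1) *
        ∫ θ : sphere (0 : E) 1, F (ρ • (θ : E)) ∂μ.toSphere ∧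
      ∀ᵐ ρ : ℝ, 0 < ρ → Integrable (fun θ : sphere (0 : E) 1 => F (ρ • (θ : E))) μ.toSphere := by
  set d := Module.finrank ℝ E - 1
  have hmp := measurePreserving_polar (E := E) μ
  have hmeasd : Measurable fun r : ℝ => (r ^ d).toNNReal := by fun_prop
  have : SFinite ((volume.restrict (Ioi (0 : ℝ))).withDensity
        fun r => ENNReal.ofReal (r ^ d)) := inferInstance
  have hint := hmp.integrable_comp_of_integrable hF
  have hI : ∫ X, F X ∂μ = ∫ p : sphere (0 : E) 1 × ℝ, F (p.2 • (p.1 : E))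
      ∂(μ.toSphere.prod ((volume.restrict (Ioi (0 : ℝ))).withDensity
        fun r => ENNReal.ofReal (r ^ d))) := by
    conv_lhs => rw [← hmp.map_eq]
    rw [integral_map hmp.measurable.aemeasurable]
    rw [hmp.map_eq]; exact hF.aestronglyMeasurable
  have h1 := hint.integral_prod_right
  have h2 := hint.prod_left_ae
  simp only [Function.comp_def] at h1 h2
  refine ⟨?_, ?_, ?_⟩
  · change Integrable _ ((volume.restrict (Ioi (0 : ℝ))).withDensity
        fun r => ((r ^ d).toNNReal : ℝ≥0∞)) at h1
    rw [integrable_withDensity_iff_integrable_smul hmeasd] at h1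
    refine h1.congr ?_
    filter_upwards [ae_restrict_mem measurableSet_Ioi] with r hr
    simp [NNReal.smul_def, Real.coe_toNNReal _ (pow_nonneg (le_of_lt hr) d)]
  · rw [hI]
    refine (integral_prod_symm _ hint).trans ?_
    change ∫ y, _ ∂((volume.restrict (Ioi (0 : ℝ))).withDensity
        fun r => ((r ^ d).toNNReal : ℝ≥0∞)) = _
    rw [integral_withDensity_eq_integral_smul hmeasd]
    refine setIntegral_congr_fun measurableSet_Ioi fun r hr => ?_
    simp [NNReal.smul_def, Real.coe_toNNReal _ (pow_nonneg (le_of_lt hr) d)]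
  · rw [ae_withDensity_iff (by fun_prop), ae_restrict_iff' measurableSet_Ioi] at h2
    filter_upwards [h2] with r hr h0
    exact hr h0 (by simp [pow_pos h0])

/-- Only integrability on the ball is available, so `polar_integrable` is applied to the translated
extension by zero. -/
theorem polar_ball [Nontrivial E] (μ : Measure E) [μ.IsAddHaarMeasure] {F : E → ℝ} (x₀ : E)
    {R : ℝ} (hF : IntegrableOn F (ball x₀ R) μ) :
    IntegrableOn (fun ρ : ℝ => ρ ^ (Module.finrank ℝ E - 1) *
        ∫ θ : sphere (0 : E) 1, F (x₀ + ρ • (θ : E)) ∂μ.toSphere) (Ioo 0 R) ∧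
      (∀ r, r ≤ R → ∫ X in ball x₀ r, F X ∂μ =
        ∫ ρ in Ioo (0 : ℝ) r, ρ ^ (Module.finrank ℝ E - 1) *
        ∫ θ : sphere (0 : E) 1, F (x₀ + ρ • (θ : E)) ∂μ.toSphere) ∧
      ∀ᵐ ρ : ℝ, ρ ∈ Ioo 0 R →
        Integrable (fun θ : sphere (0 : E) 1 => F (x₀ + ρ • (θ : E))) μ.toSphere := by
  have key : ∀ r, r ≤ R → Integrable (fun X => (ball x₀ r).indicator F (x₀ + X)) μ := by
    intro r hr
    exact ((integrable_indicator_iff measurableSet_ball).2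
      (hF.mono_set (ball_subset_ball hr))).comp_add_left x₀
  have hind : ∀ r ρ : ℝ, 0 < ρ → ∀ θ : sphere (0 : E) 1,
      (ball x₀ r).indicator F (x₀ + ρ • (θ : E)) =
        if ρ < r then F (x₀ + ρ • (θ : E)) else 0 := by
    intro r ρ hρ θ
    have : x₀ + ρ • (θ : E) ∈ ball x₀ r ↔ ρ < r := by
      simp [mem_ball, dist_eq_norm, norm_smul, abs_of_pos hρ]
    simp only [indicator, this]
  refine ⟨?_, ?_, ?_⟩
  · have := (polar_integrable μ (key R le_rfl)).1
    refine (this.mono_set Ioo_subset_Ioi_self).congr_fun (fun ρ hρ => ?_) measurableSet_Ioo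
    simp only [hind R ρ hρ.1, hρ.2, if_true]
  · intro r hr
    have := (polar_integrable μ (key r hr)).2.1
    rw [integral_add_left_eq_self (fun X => (ball x₀ r).indicator F X) x₀,
      integral_indicator measurableSet_ball] at this
    rw [this, ← Ioi_inter_Iio, ← setIntegral_indicator measurableSet_Iio]
    refine setIntegral_congr_fun measurableSet_Ioi fun ρ hρ => ?_
    have hh := hind r ρ hρ
    by_cases h : ρ < r
    · simp only [hh, h, if_true, indicator_of_mem (show ρ ∈ Iio r from h)]
    · simp [hh, h]
  · filter_upwards [(polar_integrable μ (key R le_rfl)).2.2] with ρ h hρ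
    simpa only [hind R ρ hρ.1, hρ.2, if_true] using h hρ.1

end Polar

/-! ### Coordinates X = (x, y) and the weight in the half space -/

variable {n : ℕ}

theorem height_add (X Y : Space n) : height (X + Y) = height X + height Y := rfl
theorem height_sub (X Y : Space n) : height (X - Y) = height X - height Y := rfl
theorem height_smul (c : ℝ) (X : Space n) : height (c • X) = c * height X := rfl

theorem continuous_height : Continuous (height : Space n → ℝ) := by
  unfold height; fun_prop

theorem measurable_height : Measurable (height : Space n → ℝ) := continuous_height.measurable

theorem abs_height_le (X : Space n) : |height X| ≤ ‖X‖ := by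
  simpa [height] using PiLp.norm_apply_le X (Fin.last n)

theorem height_flat (x : Flat n) : height (flat x) = 0 := by simp [height, flat]

/-- The vertical unit vector. -/
def vert : Space n := EuclideanSpace.single (Fin.last n) 1

theorem height_vert : height (vert : Space n) = 1 := by simp [height, vert]

theorem norm_vert : ‖(vert : Space n)‖ = 1 := by simp [vert]

theorem flat_apply_castSucc (x : Flat n) (i : Fin n) : flat x i.castSucc = x i := by
  simp [flat]

theorem flat_apply_last (x : Flat n) : flat x (Fin.last n) = 0 := by
  simp [flat]

theorem flat_add (x y : Flat n) : flat (x + y) = flat x + flat y := by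
  ext i; refine Fin.lastCases ?_ (fun j => ?_) i <;>
    simp [flat_apply_last, flat_apply_castSucc]

theorem flat_smul (c : ℝ) (x : Flat n) : flat (c • x) = c • flat x := by
  ext i; refine Fin.lastCases ?_ (fun j => ?_) i <;>
    simp [flat_apply_last, flat_apply_castSucc]

theorem norm_sq_flat_add (x : Flat n) (y : ℝ) :
    ‖flat x + y • (vert : Space n)‖ ^ 2 = ‖x‖ ^ 2 + y ^ 2 := by
  rw [EuclideanSpace.norm_sq_eq, EuclideanSpace.norm_sq_eq, Fin.sum_univ_castSucc]
  simp [flat_apply_last, flat_apply_castSucc, vert]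

theorem norm_flat (x : Flat n) : ‖flat x‖ = ‖x‖ := by
  have := norm_sq_flat_add x 0
  simp only [zero_smul, add_zero, ne_eq, OfNat.ofNat_ne_zero, not_false_eq_true, zero_pow] at this
  exact (sq_eq_sq₀ (norm_nonneg _) (norm_nonneg _)).1 this

theorem flat_zero : flat (0 : Flat n) = 0 := by
  rw [← norm_eq_zero, norm_flat, norm_zero]

theorem flat_sub (x y : Flat n) : flat (x - y) = flat x - flat y := by
  rw [eq_sub_iff_add_eq, ← flat_add, sub_add_cancel]

theorem isometry_flat : Isometry (flat : Flat n → Space n) :=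
  Isometry.of_dist_eq fun x y => by rw [dist_eq_norm, dist_eq_norm, ← flat_sub, norm_flat]

theorem continuous_flat : Continuous (flat : Flat n → Space n) := isometry_flat.continuous

theorem height_flat_add (x : Flat n) (y : ℝ) : height (flat x + y • (vert : Space n)) = y := by
  rw [height_add, height_smul, height_flat, height_vert]; ring

theorem exists_eq_flat_add (X : Space n) : ∃ x : Flat n, X = flat x + height X • vert := by
  refine ⟨WithLp.toLp 2 fun i => X i.castSucc, ?_⟩
  ext i
  refine Fin.lastCases ?_ (fun j => ?_) i
  · simp [flat_apply_last, vert, height]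
  · simp [flat_apply_castSucc, vert]

/-- The decomposition `X = (x, y)`, as a linear isometry. -/
def flatProd (n : ℕ) : WithLp 2 (Flat n × ℝ) ≃ₗᵢ[ℝ] Space n :=
  LinearIsometryEquiv.ofSurjective
    { toFun := fun p => flat p.fst + p.snd • vert
      map_add' := fun p q => by
        simp only [WithLp.add_fst, WithLp.add_snd, flat_add, add_smul]; abel
      map_smul' := fun c p => by
        simp only [WithLp.smul_fst, WithLp.smul_snd, flat_smul, smul_add, smul_smul, RingHom.id_apply,
          smul_eq_mul]
      norm_map' := fun p => by
        refine (sq_eq_sq₀ (norm_nonneg _) (norm_nonneg _)).1 ?_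
        rw [WithLp.prod_norm_sq_eq_of_L2]
        simp [norm_sq_flat_add] }
    (fun X => by
      obtain ⟨x, hx⟩ := exists_eq_flat_add X
      exact ⟨WithLp.toLp 2 (x, height X), hx.symm⟩)

theorem measurePreserving_flatProd :
    MeasurePreserving (fun p : Flat n × ℝ => flat p.1 + p.2 • (vert : Space n)) := by
  have h1 := (flatProd n).measurePreserving
  have h2 := WithLp.volume_preserving_toLp (Flat n) ℝ
  exact h1.comp h2

theorem lintegral_space {F : Space n → ℝ≥0∞} (hF : Measurable F) :
    ∫⁻ X, F X = ∫⁻ y : ℝ, ∫⁻ x : Flat n, F (flat x + y • vert) := by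
  rw [← measurePreserving_flatProd.lintegral_comp hF, Measure.volume_eq_prod,
    lintegral_prod_symm']
  exact hF.comp measurePreserving_flatProd.measurable

/-- The open upper half space. -/
def upper (n : ℕ) : Set (Space n) := {X | 0 < height X}

theorem isOpen_upper : IsOpen (upper n) := isOpen_lt continuous_const continuous_height

theorem measurableSet_upper : MeasurableSet (upper n) := isOpen_upper.measurableSet

theorem halfBall_eq (X₀ : Space n) (r : ℝ) : halfBall X₀ r = ball X₀ r ∩ upper n := rfl

theorem isOpen_halfBall (X₀ : Space n) (r : ℝ) : IsOpen (halfBall X₀ r) :=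
  isOpen_ball.inter isOpen_upper

theorem measurableSet_halfBall (X₀ : Space n) (r : ℝ) : MeasurableSet (halfBall X₀ r) :=
  (isOpen_halfBall X₀ r).measurableSet

/-- The half ball sits in a cylinder, where Tonelli reduces the claim to integrability of y^b at 0.
It is used with b = a and also with b = -a. -/
theorem lintegral_height_rpow_lt_top {b : ℝ} (hb : -1 < b) (R : ℝ) :
    ∫⁻ X in halfBall (0 : Space n) R, ENNReal.ofReal (height X ^ b) < ⊤ := by
  have hsub : halfBall (0 : Space n) R ⊆ {X | 0 < height X ∧ height X < R ∧ ‖X‖ < R} := by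
    intro X hX
    have h1 : ‖X‖ < R := by simpa [halfBall] using hX.1
    exact ⟨hX.2, ((le_abs_self _).trans (abs_height_le X)).trans_lt h1, h1⟩
  have hmeas : Measurable fun X : Space n => ENNReal.ofReal (height X ^ b) :=
    (measurable_height.pow_const b).ennreal_ofReal
  have hms : MeasurableSet (halfBall (0 : Space n) R) := measurableSet_halfBall _ _
  rw [← lintegral_indicator hms, lintegral_space (hmeas.indicator hms)]
  have hle : ∀ (y : ℝ) (x : Flat n), (halfBall (0 : Space n) R).indicator
      (fun X => ENNReal.ofReal (height X ^ b)) (flat x + y • vert) ≤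
      (Ioo 0 R).indicator (fun y => ENNReal.ofReal (y ^ b)) y *
        (closedBall (0 : Flat n) R).indicator (fun _ => 1) x := by
    intro y x
    by_cases h : flat x + y • vert ∈ halfBall (0 : Space n) R
    · obtain ⟨h1, h2, h3⟩ := hsub h
      rw [height_flat_add] at h1 h2
      have h4 : ‖x‖ ≤ R := by
        have := norm_sq_flat_add x y
        by_contra hcon
        push Not at hcon
        nlinarith [norm_nonneg (flat x + y • (vert : Space n)), sq_nonneg y, norm_nonneg x]
      have h4' : x ∈ closedBall (0 : Flat n) R := by simpa using h4
      rw [indicator_of_mem h, indicator_of_mem (show y ∈ Ioo 0 R from ⟨h1, h2⟩),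
        indicator_of_mem h4', height_flat_add, mul_one]
    · rw [indicator_of_notMem h]; exact zero_le
  refine (lintegral_mono fun y => lintegral_mono fun x => hle y x).trans_lt ?_
  have : ∀ y : ℝ, ∫⁻ x : Flat n, (Ioo 0 R).indicator (fun y => ENNReal.ofReal (y ^ b)) y *
        (closedBall (0 : Flat n) R).indicator (fun _ => 1) x =
        (Ioo 0 R).indicator (fun y => ENNReal.ofReal (y ^ b)) y *
          volume (closedBall (0 : Flat n) R) := by
    intro y
    rw [lintegral_const_mul _ (measurable_const.indicator measurableSet_closedBall),
      lintegral_indicator measurableSet_closedBall]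
    simp
  simp_rw [this]
  have hm1 : Measurable ((Ioo 0 R).indicator (fun y : ℝ => ENNReal.ofReal (y ^ b))) :=
    Measurable.indicator (by fun_prop) measurableSet_Ioo
  rw [lintegral_mul_const _ hm1]
  refine ENNReal.mul_lt_top ?_ measure_closedBall_lt_top
  rw [lintegral_indicator measurableSet_Ioo]
  have hii : IntegrableOn (fun y : ℝ => y ^ b) (Ioo 0 R) := by
    rcases le_or_gt R 0 with hR | hR
    · simp [Ioo_eq_empty_of_le hR]
    · exact (intervalIntegral.integrableOn_Ioo_rpow_iff hR).2 hb
  exact hii.setLIntegral_lt_top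

theorem integrableOn_height_rpow {b : ℝ} (hb : -1 < b) (R : ℝ) :
    IntegrableOn (fun X : Space n => height X ^ b) (halfBall 0 R) := by
  refine ⟨(measurable_height.pow_const b).aestronglyMeasurable, ?_⟩
  rw [hasFiniteIntegral_iff_ofReal]
  · exact lintegral_height_rpow_lt_top hb R
  · filter_upwards [ae_restrict_mem (measurableSet_halfBall _ _)] with X hX
    exact Real.rpow_nonneg (le_of_lt hX.2) _

theorem measurable_weight (s : ℝ) : Measurable (weight s : Space n → ℝ) :=
  measurable_height.pow_const _

theorem weight_pos {s : ℝ} {X : Space n} (h : 0 < height X) : 0 < weight s X :=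
  Real.rpow_pos_of_pos h _

theorem weight_nonneg {s : ℝ} {X : Space n} (h : 0 ≤ height X) : 0 ≤ weight s X :=
  Real.rpow_nonneg h _

/-- Polar coordinates in a half ball. -/
theorem polar_halfBall (x₀ : Flat n) {R : ℝ} (h : Space n → Space n → ℝ)
    (hF : IntegrableOn (fun X => h X (‖X - flat x₀‖⁻¹ • (X - flat x₀))) (halfBall (flat x₀) R)) :
    IntegrableOn (fun ρ => halfSphereIntegral x₀ ρ h) (Ioo 0 R) ∧
      (∀ r, r ≤ R → ∫ X in halfBall (flat x₀) r, h X (‖X - flat x₀‖⁻¹ • (X - flat x₀)) =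
        ∫ ρ in Ioo 0 r, halfSphereIntegral x₀ ρ h) ∧
      ∀ᵐ ρ : ℝ, ρ ∈ Ioo 0 R →
        IntegrableOn (fun θ : sphere (0 : Space n) 1 => h (flat x₀ + ρ • (θ : Space n)) θ)
          {θ | 0 < height (θ : Space n)} (volume : Measure (Space n)).toSphere := by
  have hmsθ : MeasurableSet {θ : sphere (0 : Space n) 1 | 0 < height (θ : Space n)} :=
    measurableSet_lt measurable_const (measurable_height.comp measurable_subtype_coe)
  -- Extending by zero below {y = 0} turns half balls and half spheres into full ones.
  set F : Space n → ℝ := (upper n).indicator fun X => h X (‖X - flat x₀‖⁻¹ • (X - flat x₀)) with hFdef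
  have hFi : IntegrableOn F (ball (flat x₀) R) := by
    rw [IntegrableOn, integrable_indicator_iff measurableSet_upper, IntegrableOn,
      Measure.restrict_restrict measurableSet_upper, inter_comm]
    exact hF
  have hval : ∀ ρ : ℝ, 0 < ρ → ∀ θ : sphere (0 : Space n) 1, F (flat x₀ + ρ • (θ : Space n)) =
      {θ : sphere (0 : Space n) 1 | 0 < height (θ : Space n)}.indicator
        (fun θ => h (flat x₀ + ρ • (θ : Space n)) θ) θ := by
    intro ρ hρ θ
    have hθ : ‖(θ : Space n)‖ = 1 := by simp
    have h1 : (flat x₀ + ρ • (θ : Space n) ∈ upper n) ↔ 0 < height (θ : Space n) := by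
      simp only [upper, mem_ofPred_eq, height_add, height_flat, height_smul, zero_add]
      exact mul_pos_iff_of_pos_left hρ
    by_cases hc : 0 < height (θ : Space n)
    · rw [hFdef, indicator_of_mem (h1.2 hc), indicator_of_mem (by exact hc)]
      congr 1
      rw [add_sub_cancel_left, norm_smul, hθ, mul_one, Real.norm_of_nonneg hρ.le, smul_smul,
        inv_mul_cancel₀ hρ.ne', one_smul]
    · rw [hFdef, indicator_of_notMem (fun hh => hc (h1.1 hh)),
        indicator_of_notMem (by exact hc)]
  have hdim : Module.finrank ℝ (Space n) - 1 = n := by simp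
  obtain ⟨p1, p2, p3⟩ := polar_ball (volume : Measure (Space n)) (flat x₀) hFi
  have hhs : ∀ ρ, 0 < ρ → ρ ^ (Module.finrank ℝ (Space n) - 1) *
      ∫ θ : sphere (0 : Space n) 1, F (flat x₀ + ρ • (θ : Space n))
        ∂(volume : Measure (Space n)).toSphere = halfSphereIntegral x₀ ρ h := by
    intro ρ hρ
    simp only [hval ρ hρ, hdim, halfSphereIntegral]
    rw [integral_indicator hmsθ]
  refine ⟨p1.congr_fun (fun ρ hρ => hhs ρ hρ.1) measurableSet_Ioo, fun r hr => ?_, ?_⟩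
  · have := p2 r hr
    rw [setIntegral_indicator measurableSet_upper] at this
    rw [halfBall_eq, this]
    exact setIntegral_congr_fun measurableSet_Ioo fun ρ hρ => hhs ρ hρ.1
  · filter_upwards [p3] with ρ hp hρ
    have := hp hρ
    simp only [hval ρ hρ.1] at this
    rwa [integrable_indicator_iff hmsθ] at this

/-- Polar coordinates in a ball of the boundary hyperplane. -/
theorem polar_flat (hn : 1 ≤ n) (x₀ : Flat n) {R : ℝ} (h : Flat n → ℝ)
    (hF : IntegrableOn h (ball x₀ R)) :
    IntegrableOn (fun ρ => flatSphereIntegral x₀ ρ h) (Ioo 0 R) ∧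
      ∀ r, r ≤ R → ∫ x in ball x₀ r, h x = ∫ ρ in Ioo 0 r, flatSphereIntegral x₀ ρ h := by
  have : Nonempty (Fin n) := ⟨⟨0, hn⟩⟩
  have : Nontrivial (Flat n) := inferInstance
  obtain ⟨p1, p2, -⟩ := polar_ball (volume : Measure (Flat n)) x₀ hF
  have hdim : Module.finrank ℝ (Flat n) - 1 = n - 1 := by simp
  have hhs : ∀ ρ : ℝ, 0 < ρ → ρ ^ (Module.finrank ℝ (Flat n) - 1) *
      ∫ θ : sphere (0 : Flat n) 1, h (x₀ + ρ • (θ : Flat n))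
        ∂(volume : Measure (Flat n)).toSphere = flatSphereIntegral x₀ ρ h := by
    intro ρ hρ
    rw [hdim, flatSphereIntegral, show (n : ℝ) - 1 = ((n - 1 : ℕ) : ℝ) by
      rw [Nat.cast_sub hn]; simp, Real.rpow_natCast]
  refine ⟨p1.congr_fun (fun ρ hρ => hhs ρ hρ.1) measurableSet_Ioo, fun r hr => ?_⟩
  rw [p2 r hr]
  exact setIntegral_congr_fun measurableSet_Ioo fun ρ hρ => hhs ρ hρ.1

end Polar

/-! ### The weighted measure and the upward shifted kernel -/

section Kernel

theorem sq_lintegral_le {α : Type*} [MeasurableSpace α] (μ : Measure α) {p : α → ℝ≥0∞}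
    (hp : AEMeasurable p μ) : (∫⁻ x, p x ∂μ) ^ 2 ≤ μ univ * ∫⁻ x, p x ^ 2 ∂μ := by
  have h := ENNReal.lintegral_mul_le_Lp_mul_Lq μ Real.HolderConjugate.two_two hp
    (aemeasurable_const (b := (1 : ℝ≥0∞)))
  simp only [Pi.mul_apply, mul_one, ENNReal.one_rpow, lintegral_one] at h
  calc (∫⁻ x, p x ∂μ) ^ 2 ≤ ((∫⁻ x, p x ^ (2 : ℝ) ∂μ) ^ (1 / 2 : ℝ) * μ univ ^ (1 / 2 : ℝ)) ^ 2 := by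
        gcongr
    _ = _ := by
        rw [mul_pow, ← ENNReal.rpow_natCast, ← ENNReal.rpow_natCast, ← ENNReal.rpow_mul,
          ← ENNReal.rpow_mul]
        norm_num
        rw [mul_comm]

theorem lintegral_scale {E : Type*} [NormedAddCommGroup E] [NormedSpace ℝ E] [MeasurableSpace E]
    [BorelSpace E] [FiniteDimensional ℝ E] (μ : Measure E) [μ.IsAddHaarMeasure] (G : E → ℝ≥0∞)
    (x₀ : E) {r : ℝ} (hr : 0 < r) :
    ∫⁻ X, G X ∂μ = ENNReal.ofReal (r ^ Module.finrank ℝ E) * ∫⁻ X, G (x₀ + r • X) ∂μ := by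
  have h1 : ∫⁻ X, G (x₀ + r • X) ∂μ = ∫⁻ X, G (x₀ + X) ∂(Measure.map (r • ·) μ) := by
    rw [(measurableEmbedding_const_smul₀ hr.ne').lintegral_map]
  rw [h1, Measure.map_addHaar_smul μ hr.ne', lintegral_smul_measure,
    lintegral_add_left_eq_self, smul_eq_mul, ← mul_assoc, ← ENNReal.ofReal_mul (by positivity),
    abs_of_pos (by positivity), mul_inv_cancel₀ (by positivity), ENNReal.ofReal_one, one_mul]

variable {n : ℕ}

theorem flat_add_smul_mem_halfBall (x₀ : Flat n) {r R : ℝ} (hr : 0 < r) (X : Space n) :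
    flat x₀ + r • X ∈ halfBall (flat x₀) (r * R) ↔ X ∈ halfBall 0 R := by
  simp only [halfBall, mem_ofPred_eq, mem_ball, dist_eq_norm, add_sub_cancel_left, norm_smul,
    height_add, height_flat, height_smul, zero_add, sub_zero, Real.norm_of_nonneg hr.le]
  rw [mul_lt_mul_iff_right₀ hr, mul_pos_iff_of_pos_left hr]

theorem lintegral_halfBall_scale (G : Space n → ℝ≥0∞) (x₀ : Flat n) {r R : ℝ} (hr : 0 < r) :
    ∫⁻ X in halfBall (flat x₀) (r * R), G X =
      ENNReal.ofReal (r ^ (n + 1)) * ∫⁻ X in halfBall 0 R, G (flat x₀ + r • X) := by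
  rw [← lintegral_indicator (measurableSet_halfBall _ _),
    ← lintegral_indicator (measurableSet_halfBall _ _), lintegral_scale volume _ (flat x₀) hr]
  congr 1
  · simp
  · refine lintegral_congr fun X => ?_
    by_cases h : X ∈ halfBall 0 R
    · rw [indicator_of_mem h, indicator_of_mem ((flat_add_smul_mem_halfBall x₀ hr X).2 h)]
    · rw [indicator_of_notMem h,
        indicator_of_notMem fun h' => h ((flat_add_smul_mem_halfBall x₀ hr X).1 h')]

/-- The measure `y^a dX` on the upper half space. -/
def wvol (n : ℕ) (s : ℝ) : Measure (Space n) :=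
  (volume.restrict (upper n)).withDensity fun X => ENNReal.ofReal (weight s X)

theorem measurable_ofReal_weight (s : ℝ) :
    Measurable fun X : Space n => ENNReal.ofReal (weight s X) :=
  (measurable_weight s).ennreal_ofReal

theorem lintegral_wvol (s : ℝ) {F : Space n → ℝ≥0∞} (hF : Measurable F) :
    ∫⁻ X, F X ∂wvol n s = ∫⁻ X in upper n, ENNReal.ofReal (weight s X) * F X := by
  rw [wvol, lintegral_withDensity_eq_lintegral_mul _ (measurable_ofReal_weight s) hF]; rfl

theorem isFiniteMeasureOnCompacts_wvol {s : ℝ} (hs : s < 1) :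
    IsFiniteMeasureOnCompacts (wvol n s) := by
  refine ⟨fun K hK => ?_⟩
  obtain ⟨R, hR⟩ := hK.isBounded.subset_ball 0
  refine (measure_mono hR).trans_lt ?_
  rw [wvol, withDensity_apply _ measurableSet_ball, Measure.restrict_restrict measurableSet_ball]
  exact lintegral_height_rpow_lt_top (by simp [weightExp]; linarith) R

/-- A smooth probability density concentrated near `-2δ` times the vertical unit vector. -/
def kernBump (n : ℕ) (δ : ℝ) (hδ : 0 < δ) : ContDiffBump (-(2 * δ) • vert : Space n) :=
  ⟨δ / 2, δ, by positivity, by linarith⟩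

/-- The kernel of an upward shifted mollification at scale `δ`. -/
def kern (n : ℕ) (δ : ℝ) (hδ : 0 < δ) : Space n → ℝ := (kernBump n δ hδ).normed volume

theorem kern_nonneg {δ : ℝ} (hδ : 0 < δ) (X : Space n) : 0 ≤ kern n δ hδ X :=
  (kernBump n δ hδ).nonneg_normed X

theorem contDiff_kern {δ : ℝ} (hδ : 0 < δ) : ContDiff ℝ ∞ (kern n δ hδ) :=
  (kernBump n δ hδ).contDiff_normed

theorem integral_kern {δ : ℝ} (hδ : 0 < δ) : ∫ X, kern n δ hδ X = 1 :=
  (kernBump n δ hδ).integral_normed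

theorem integrable_kern {δ : ℝ} (hδ : 0 < δ) : Integrable (kern n δ hδ) :=
  integrable_of_integral_eq_one (integral_kern hδ)

theorem lintegral_kern {δ : ℝ} (hδ : 0 < δ) : ∫⁻ X, ENNReal.ofReal (kern n δ hδ X) = 1 := by
  rw [← ofReal_integral_eq_lintegral_ofReal (integrable_kern hδ)
    (Eventually.of_forall (kern_nonneg hδ)), integral_kern, ENNReal.ofReal_one]

theorem hasCompactSupport_kern {δ : ℝ} (hδ : 0 < δ) : HasCompactSupport (kern n δ hδ) :=
  (kernBump n δ hδ).hasCompactSupport_normed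

theorem tsupport_kern {δ : ℝ} (hδ : 0 < δ) :
    tsupport (kern n δ hδ) = closedBall (-(2 * δ) • vert) δ :=
  (kernBump n δ hδ).tsupport_normed_eq

theorem norm_lt_of_mem_tsupport_kern {δ : ℝ} (hδ : 0 < δ) {X : Space n}
    (h : X ∈ tsupport (kern n δ hδ)) : ‖X‖ ≤ 3 * δ ∧ height X ≤ -δ ∧ -(3 * δ) ≤ height X := by
  rw [tsupport_kern, mem_closedBall, dist_eq_norm] at h
  have h2 := (abs_height_le _).trans h
  rw [height_sub, height_smul, height_vert, abs_le] at h2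
  refine ⟨?_, by linarith [h2.2], by linarith [h2.1]⟩
  calc ‖X‖ = ‖(X - -(2 * δ) • vert) + -(2 * δ) • (vert : Space n)‖ := by congr 1; abel
    _ ≤ δ + 2 * δ := by
        refine (norm_add_le _ _).trans ?_
        have : ‖-(2 * δ) • (vert : Space n)‖ = 2 * δ := by
          rw [norm_smul, norm_vert, mul_one, Real.norm_eq_abs, abs_neg, abs_of_pos (by linarith)]
        rw [this]; linarith
    _ = 3 * δ := by ring

theorem support_kern_subset {δ : ℝ} (hδ : 0 < δ) :
    Function.support (kern n δ hδ) ⊆ ball 0 (4 * δ) := by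
  intro X hX
  have := (norm_lt_of_mem_tsupport_kern hδ (subset_tsupport _ hX)).1
  rw [mem_ball_zero_iff]; linarith

/-- The weight `y^a` is almost invariant under averaging against the shifted kernel. -/
theorem exists_kern_bound {s : ℝ} (hs₀ : 0 < s) (hs₁ : s < 1) :
    ∃ C : ℝ≥0∞, C ≠ ⊤ ∧ ∀ (δ : ℝ) (hδ : 0 < δ) (Y : Space n), 0 < height Y →
      ∫⁻ X in upper n, ENNReal.ofReal (weight s X) * ENNReal.ofReal (kern n δ hδ (X - Y)) ≤
        C * ENNReal.ofReal (weight s Y) := by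
  set a := weightExp s with ha
  have ha1 : -1 < a := by simp [ha, weightExp]; linarith
  have ha2 : a < 1 := by simp [ha, weightExp]; linarith
  set m : ℝ≥0∞ := ∫⁻ X in halfBall (0 : Space n) 4, ENNReal.ofReal (weight s X) with hm
  have hm' : m < ⊤ := lintegral_height_rpow_lt_top ha1 4
  set V : ℝ := (volume : Measure (Space n)).real (closedBall 0 1) with hV
  have hVpos : 0 < V := ENNReal.toReal_pos (measure_closedBall_pos _ _ one_pos).ne'
    measure_closedBall_lt_top.ne
  -- The kernel has mass one at scale δ, so its height is of order δ^(-(n+1)).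
  have hkern : ∀ (δ : ℝ) (hδ : 0 < δ) (X : Space n), kern n δ hδ X ≤ 2 ^ (n + 1) / V / δ ^ (n + 1) := by
    intro δ hδ X
    refine ((kernBump n δ hδ).normed_le_div_measure_closedBall_rIn volume X).trans (le_of_eq ?_)
    have : (volume : Measure (Space n)).real (closedBall (-(2 * δ) • vert) (kernBump n δ hδ).rIn) =
        (δ / 2) ^ (n + 1) * V := by
      rw [measureReal_def, Measure.addHaar_closedBall' _ _ (by simp [kernBump]; positivity),
        ENNReal.toReal_mul, ENNReal.toReal_ofReal (by simp [kernBump]; positivity)]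
      simp [kernBump, hV, measureReal_def]
    rw [this, div_pow]; field_simp
  refine ⟨ENNReal.ofReal ((1 / 4) ^ a) * (m * ENNReal.ofReal (2 ^ (n + 1) / V)) +
    ENNReal.ofReal ((1 / 4) ^ a) + 1, ?_, ?_⟩
  · refine ENNReal.add_ne_top.2 ⟨ENNReal.add_ne_top.2 ⟨ENNReal.mul_ne_top ENNReal.ofReal_ne_top
      (ENNReal.mul_ne_top hm'.ne ENNReal.ofReal_ne_top), ENNReal.ofReal_ne_top⟩, ENNReal.one_ne_top⟩
  intro δ hδ Y hY
  have hsupp : ∀ X : Space n, kern n δ hδ (X - Y) ≠ 0 →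
      height X ≤ height Y ∧ height Y - 3 * δ ≤ height X := by
    intro X hX
    have := norm_lt_of_mem_tsupport_kern hδ (subset_tsupport _ hX)
    rw [height_sub] at this
    exact ⟨by linarith, by linarith⟩
  -- Any pointwise bound for the weight on the support of the kernel passes to the average, since
  -- the kernel has mass one.
  have hone : ∀ c : ℝ≥0∞, (∀ X : Space n, 0 < height X → kern n δ hδ (X - Y) ≠ 0 →
      ENNReal.ofReal (weight s X) ≤ c) →
      ∫⁻ X in upper n, ENNReal.ofReal (weight s X) * ENNReal.ofReal (kern n δ hδ (X - Y)) ≤ c := by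
    intro c hc
    calc _ ≤ ∫⁻ X in upper n, c * ENNReal.ofReal (kern n δ hδ (X - Y)) := by
          refine setLIntegral_mono' measurableSet_upper fun X hX => ?_
          by_cases h : kern n δ hδ (X - Y) = 0
          · simp [h]
          · gcongr; exact hc X hX h
      _ ≤ ∫⁻ X, c * ENNReal.ofReal (kern n δ hδ (X - Y)) := setLIntegral_le_lintegral _ _
      _ = c := by
          rw [lintegral_const_mul, lintegral_sub_right_eq_self
            (fun X => ENNReal.ofReal (kern n δ hδ X)), lintegral_kern, mul_one]
          have := (contDiff_kern (n := n) hδ).continuous.measurable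
          fun_prop
  -- For a ≥ 0 the weight increases with the height, and the kernel only sees points X lying below
  -- Y.
  rcases le_or_gt 0 a with h0 | h0
  · refine (hone (ENNReal.ofReal (weight s Y)) fun X hX hk => ENNReal.ofReal_le_ofReal ?_).trans ?_
    · exact Real.rpow_le_rpow hX.le (hsupp X hk).1 h0
    · calc _ = 1 * ENNReal.ofReal (weight s Y) := (one_mul _).symm
        _ ≤ _ := by gcongr; exact le_add_self
  -- For a < 0 and Y at height at least 4δ, the points X seen by the kernel have at least a quarter
  -- of the height of Y, so the weights are comparable.
  · rcases le_or_gt (4 * δ) (height Y) with h4 | h4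
    · refine (hone (ENNReal.ofReal ((1 / 4) ^ a) * ENNReal.ofReal (weight s Y))
        fun X hX hk => ?_).trans ?_
      · rw [← ENNReal.ofReal_mul (by positivity)]
        refine ENNReal.ofReal_le_ofReal ?_
        rw [weight, weight, ← ha, ← Real.mul_rpow (by norm_num) hY.le]
        exact Real.rpow_le_rpow_of_nonpos (by linarith) (by linarith [(hsupp X hk).2]) h0.le
      · gcongr
        refine le_trans ?_ le_self_add
        exact le_add_self
    -- For a < 0 and Y close to the boundary, the kernel is bounded by its maximum and the weight is
    -- integrated over a half ball of radius 4δ. Scaling gives δ^a, which is comparable with the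
    -- weight at Y because Y has height below 4δ.
    · obtain ⟨x, hx⟩ := exists_eq_flat_add Y
      have hball : ∀ X : Space n, 0 < height X → kern n δ hδ (X - Y) ≠ 0 →
          X ∈ halfBall (flat x) (δ * 4) := by
        intro X hX hk
        have h1 := subset_tsupport _ hk
        rw [tsupport_kern, mem_closedBall, dist_eq_norm] at h1
        refine ⟨?_, hX⟩
        rw [mem_ball, dist_eq_norm]
        have : X - flat x = (X - Y - -(2 * δ) • vert) + (height Y - 2 * δ) • (vert : Space n) := by
          conv_rhs => rw [hx]
          simp only [height_add, height_flat, height_smul, height_vert, sub_smul, neg_smul]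
          rw [zero_add, mul_one]; abel
        rw [this]
        refine (norm_add_le _ _).trans_lt ?_
        rw [norm_smul, norm_vert, mul_one, Real.norm_eq_abs]
        have : |height Y - 2 * δ| ≤ 2 * δ := abs_le.2 ⟨by linarith, by linarith⟩
        linarith
      calc _ ≤ ∫⁻ X in upper n, (halfBall (flat x) (δ * 4)).indicator
            (fun X => ENNReal.ofReal (weight s X) *
              ENNReal.ofReal (2 ^ (n + 1) / V / δ ^ (n + 1))) X := by
            refine setLIntegral_mono' measurableSet_upper fun X hX => ?_
            by_cases h : kern n δ hδ (X - Y) = 0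
            · simp [h]
            · rw [indicator_of_mem (hball X hX h)]
              gcongr
              exact hkern δ hδ _
        _ ≤ ∫⁻ X, (halfBall (flat x) (δ * 4)).indicator
            (fun X => ENNReal.ofReal (weight s X) *
              ENNReal.ofReal (2 ^ (n + 1) / V / δ ^ (n + 1))) X := setLIntegral_le_lintegral _ _
        _ = ENNReal.ofReal (δ ^ a) * (m * ENNReal.ofReal (2 ^ (n + 1) / V)) := by
            rw [lintegral_indicator (measurableSet_halfBall _ _),
              lintegral_mul_const _ (measurable_ofReal_weight s), lintegral_halfBall_scale _ _ hδ]
            have : ∀ X ∈ halfBall (0 : Space n) 4, ENNReal.ofReal (weight s (flat x + δ • X)) =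
                ENNReal.ofReal (δ ^ a) * ENNReal.ofReal (weight s X) := by
              intro X hX
              rw [← ENNReal.ofReal_mul (by positivity)]
              simp only [weight, height_add, height_flat, height_smul, zero_add]
              rw [Real.mul_rpow hδ.le hX.2.le]
            rw [setLIntegral_congr_fun (measurableSet_halfBall _ _) this,
              lintegral_const_mul _ (measurable_ofReal_weight s), ← hm, div_eq_mul_inv _ (δ ^ (n + 1)),
              ENNReal.ofReal_mul (by positivity)]
            have h1 : ENNReal.ofReal (δ ^ (n + 1)) * ENNReal.ofReal ((δ ^ (n + 1))⁻¹) = 1 := by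
              rw [← ENNReal.ofReal_mul (by positivity), mul_inv_cancel₀ (by positivity),
                ENNReal.ofReal_one]
            calc _ = (ENNReal.ofReal (δ ^ (n + 1)) * ENNReal.ofReal ((δ ^ (n + 1))⁻¹)) *
                  (ENNReal.ofReal (δ ^ a) * (m * ENNReal.ofReal (2 ^ (n + 1) / V))) := by ring
              _ = _ := by rw [h1, one_mul]
        _ ≤ (ENNReal.ofReal ((1 / 4) ^ a) * ENNReal.ofReal (weight s Y)) *
              (m * ENNReal.ofReal (2 ^ (n + 1) / V)) := by
            gcongr
            rw [← ENNReal.ofReal_mul (by positivity)]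
            refine ENNReal.ofReal_le_ofReal ?_
            rw [weight, ← ha, ← Real.mul_rpow (by norm_num) hY.le]
            exact Real.rpow_le_rpow_of_nonpos (by linarith) (by linarith) h0.le
        _ = (ENNReal.ofReal ((1 / 4) ^ a) * (m * ENNReal.ofReal (2 ^ (n + 1) / V))) *
              ENNReal.ofReal (weight s Y) := by ring
        _ ≤ _ := by
            gcongr
            rw [add_assoc]
            exact le_self_add

end Kernel

/-! ### Shifted mollification in weighted L² -/

section Mollification

variable {n : ℕ} {F : Type*} [NormedAddCommGroup F] [NormedSpace ℝ F]

/-- The upward shifted mollification. -/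
def mollify (δ : ℝ) (hδ : 0 < δ) (p : Space n → F) : Space n → F :=
  MeasureTheory.convolution (kern n δ hδ) p (ContinuousLinearMap.lsmul ℝ ℝ) volume

theorem mollify_apply {δ : ℝ} (hδ : 0 < δ) (p : Space n → F) (X : Space n) :
    mollify δ hδ p X = ∫ Y, kern n δ hδ (X - Y) • p Y := by
  rw [mollify, convolution_lsmul_swap]

theorem integrable_kern_smul {δ : ℝ} (hδ : 0 < δ) {p : Space n → F} (hp : Integrable p)
    (X : Space n) : Integrable fun Y => kern n δ hδ (X - Y) • p Y := by
  have hc : Continuous (kern n δ hδ) := (contDiff_kern hδ).continuous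
  obtain ⟨B, hB⟩ := hc.bounded_above_of_compact_support (hasCompactSupport_kern hδ)
  refine hp.bdd_smul (C := B) ?_ ?_
  · exact (hc.comp (continuous_const.sub continuous_id)).aestronglyMeasurable
  · exact Eventually.of_forall fun Y => hB _

theorem mollify_sub {δ : ℝ} (hδ : 0 < δ) {p q : Space n → F} (hp : Integrable p)
    (hq : Integrable q) : mollify δ hδ (p - q) = mollify δ hδ p - mollify δ hδ q := by
  ext X
  rw [Pi.sub_apply, mollify_apply, mollify_apply, mollify_apply,
    ← integral_sub (integrable_kern_smul hδ hp X) (integrable_kern_smul hδ hq X)]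
  simp [smul_sub]

theorem contDiff_mollify {δ : ℝ} (hδ : 0 < δ) {p : Space n → F} (hp : LocallyIntegrable p) :
    ContDiff ℝ ∞ (mollify δ hδ p) :=
  (hasCompactSupport_kern hδ).contDiff_convolution_left _ (contDiff_kern hδ) hp

theorem lintegral_wvol_swap (s : ℝ) {K : Space n → Space n → ℝ≥0∞}
    (hK : Measurable fun q : Space n × Space n => K q.1 q.2) :
    ∫⁻ X, ∫⁻ Y, K X Y ∂volume ∂wvol n s =
      ∫⁻ Y, ∫⁻ X in upper n, ENNReal.ofReal (weight s X) * K X Y := by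
  have hm : Measurable fun X => ∫⁻ Y, K X Y := hK.lintegral_prod_right'
  rw [lintegral_wvol s hm]
  have h1 : ∀ X, ENNReal.ofReal (weight s X) * ∫⁻ Y, K X Y =
      ∫⁻ Y, ENNReal.ofReal (weight s X) * K X Y := fun X =>
    (lintegral_const_mul _ (hK.comp measurable_prodMk_left)).symm
  simp_rw [h1]
  exact lintegral_lintegral_swap
    (((measurable_ofReal_weight s).comp measurable_fst).mul hK).aemeasurable

/-- Cauchy-Schwarz for the probability density of the kernel bounds the square of the average by the
average of the squares; exchanging the integrals then leaves the averaged weight, which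
`exists_kern_bound` controls uniformly in δ. -/
theorem eLpNorm_mollify_le {s : ℝ} (hs₀ : 0 < s) (hs₁ : s < 1) :
    ∃ C : ℝ≥0∞, C ≠ ⊤ ∧ ∀ (δ : ℝ) (hδ : 0 < δ) (p : Space n → F), StronglyMeasurable p →
      eLpNorm (mollify δ hδ p) 2 (wvol n s) ≤ C * eLpNorm p 2 (wvol n s) := by
  obtain ⟨C, hC, hbound⟩ := exists_kern_bound (n := n) hs₀ hs₁
  refine ⟨C ^ (1 / 2 : ℝ), ENNReal.rpow_ne_top_of_nonneg (by norm_num) hC, fun δ hδ p hp => ?_⟩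
  have hkm : Measurable (kern n δ hδ) := (contDiff_kern hδ).continuous.measurable
  have hpm : Measurable fun Y => ‖p Y‖ₑ := hp.enorm
  have hpt : ∀ X, ‖mollify δ hδ p X‖ₑ ^ 2 ≤
      ∫⁻ Y, ENNReal.ofReal (kern n δ hδ (X - Y)) * ‖p Y‖ₑ ^ 2 := by
    intro X
    have hd : Measurable fun Y => ENNReal.ofReal (kern n δ hδ (X - Y)) := by fun_prop
    have h1 : ‖mollify δ hδ p X‖ₑ ≤
        ∫⁻ Y, ‖p Y‖ₑ ∂(volume.withDensity fun Y => ENNReal.ofReal (kern n δ hδ (X - Y))) := by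
      rw [mollify_apply, lintegral_withDensity_eq_lintegral_mul _ hd hpm]
      refine (enorm_integral_le_lintegral_enorm _).trans (le_of_eq ?_)
      refine lintegral_congr fun Y => ?_
      rw [enorm_smul, Pi.mul_apply, Real.enorm_of_nonneg (kern_nonneg hδ _)]
    calc _ ≤ _ := by gcongr
      _ ≤ _ := sq_lintegral_le _ hpm.aemeasurable
      _ = _ := by
        rw [withDensity_apply _ MeasurableSet.univ, Measure.restrict_univ,
          lintegral_sub_left_eq_self (fun Y => ENNReal.ofReal (kern n δ hδ Y)), lintegral_kern, one_mul,
          lintegral_withDensity_eq_lintegral_mul _ hd (hpm.pow_const 2)]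
        rfl
  have hmain : ∫⁻ X, ‖mollify δ hδ p X‖ₑ ^ 2 ∂wvol n s ≤ C * ∫⁻ X, ‖p X‖ₑ ^ 2 ∂wvol n s := by
    have hF2 : Measurable fun q : Space n × Space n =>
        ENNReal.ofReal (kern n δ hδ (q.1 - q.2)) * ‖p q.2‖ₑ ^ 2 := by
      refine Measurable.mul (by fun_prop) ((hpm.comp measurable_snd).pow_const 2)
    calc _ ≤ ∫⁻ X, ∫⁻ Y, ENNReal.ofReal (kern n δ hδ (X - Y)) * ‖p Y‖ₑ ^ 2 ∂volume ∂wvol n s :=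
          lintegral_mono hpt
      _ = ∫⁻ Y, ∫⁻ X in upper n, ENNReal.ofReal (weight s X) *
            (ENNReal.ofReal (kern n δ hδ (X - Y)) * ‖p Y‖ₑ ^ 2) :=
          lintegral_wvol_swap s hF2
      _ ≤ ∫⁻ Y, (upper n).indicator
            (fun Y => C * (ENNReal.ofReal (weight s Y) * ‖p Y‖ₑ ^ 2)) Y := by
          refine lintegral_mono fun Y => ?_
          by_cases hY : Y ∈ upper n
          · rw [indicator_of_mem hY]
            calc _ = ∫⁻ X in upper n, ENNReal.ofReal (weight s X) *
                  ENNReal.ofReal (kern n δ hδ (X - Y)) * ‖p Y‖ₑ ^ 2 := by simp only [mul_assoc]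
              _ = (∫⁻ X in upper n, ENNReal.ofReal (weight s X) *
                  ENNReal.ofReal (kern n δ hδ (X - Y))) * ‖p Y‖ₑ ^ 2 := by
                    refine lintegral_mul_const _ ((measurable_ofReal_weight s).mul ?_)
                    fun_prop
              _ ≤ C * ENNReal.ofReal (weight s Y) * ‖p Y‖ₑ ^ 2 := by
                    gcongr; exact hbound δ hδ Y hY
              _ = _ := by ring
          -- A point Y with nonpositive height is never reached from the upper half space, because
          -- the kernel forces Y to lie strictly above X.
          · rw [indicator_of_notMem hY]
            refine le_of_eq (setLIntegral_eq_zero measurableSet_upper fun X hX => ?_)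
            have : kern n δ hδ (X - Y) = 0 := by
              by_contra hk
              have h1 := (norm_lt_of_mem_tsupport_kern hδ (subset_tsupport _ hk)).2.1
              rw [height_sub] at h1
              have h2 : 0 < height X := hX
              exact hY (show 0 < height Y by linarith)
            simp [this]
      _ = _ := by
          rw [lintegral_indicator measurableSet_upper, lintegral_const_mul,
            lintegral_wvol _ (hpm.pow_const 2)]
          exact (measurable_ofReal_weight s).mul (hpm.pow_const 2)
  rw [eLpNorm_eq_lintegral_rpow_enorm_toReal (by norm_num) (by norm_num),
    eLpNorm_eq_lintegral_rpow_enorm_toReal (by norm_num) (by norm_num)]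
  have h := ENNReal.rpow_le_rpow hmain (by norm_num : (0 : ℝ) ≤ 1 / 2)
  rw [ENNReal.mul_rpow_of_nonneg _ _ (by norm_num)] at h
  simpa using h

theorem dist_mollify_le [CompleteSpace F] {δ : ℝ} (hδ : 0 < δ) {p : Space n → F}
    (hp : AEStronglyMeasurable p)
    {ε : ℝ} {X : Space n} {z : F} (hε : 0 ≤ ε) (h : ∀ Y ∈ ball X (4 * δ), dist (p Y) z ≤ ε) :
    dist (mollify δ hδ p X) z ≤ ε :=
  dist_convolution_le hε (support_kern_subset hδ) (kern_nonneg hδ) (integral_kern hδ) hp h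

/-- Shifted mollification converges in the weighted `L²` space. -/
theorem tendsto_eLpNorm_mollify [CompleteSpace F] {s : ℝ} (hs₀ : 0 < s) (hs₁ : s < 1)
    {p : Space n → F}
    (hp : StronglyMeasurable p) (hp1 : Integrable p) (hp2 : MemLp p 2 (wvol n s)) {ε : ℝ≥0∞}
    (hε : ε ≠ 0) : ∃ δ₀ > 0, ∀ (δ : ℝ) (hδ : 0 < δ), δ < δ₀ →
      eLpNorm (mollify δ hδ p - p) 2 (wvol n s) ≤ ε := by
  obtain ⟨C, hC, hbound⟩ := eLpNorm_mollify_le (n := n) (F := F) hs₀ hs₁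
  have := isFiniteMeasureOnCompacts_wvol (n := n) hs₁
  -- The budget: the error p - q enters once through the bounded operator and once directly, so (C +
  -- 1) ε₁ ≤ ε / 3 is what is needed.
  set ε₁ : ℝ≥0∞ := ε / (3 * (C + 1)) with hε₁
  have hε₁0 : ε₁ ≠ 0 := by
    refine (ENNReal.div_pos hε ?_).ne'
    exact ENNReal.mul_ne_top (by norm_num) (ENNReal.add_ne_top.2 ⟨hC, ENNReal.one_ne_top⟩)
  have hε₁C : (C + 1) * ε₁ ≤ ε / 3 := by
    rw [hε₁, ENNReal.div_eq_inv_mul, ENNReal.div_eq_inv_mul,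
      ENNReal.mul_inv (Or.inl (by norm_num)) (Or.inl (by norm_num))]
    calc (C + 1) * (3⁻¹ * (C + 1)⁻¹ * ε) = ((C + 1) * (C + 1)⁻¹) * (3⁻¹ * ε) := by ring
      _ ≤ 1 * (3⁻¹ * ε) := by gcongr; exact ENNReal.mul_inv_le_one _
      _ = _ := one_mul _
  obtain ⟨q, hqs, hq1, hqc, hq2⟩ := hp2.exists_hasCompactSupport_eLpNorm_sub_le (by norm_num) hε₁0
  -- Only δ < 1 is used below, so the kernel reaches less than 4 and the mollification of q vanishes
  -- outside K.
  set K := cthickening 4 (tsupport q) with hK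
  have hKc : IsCompact K := hqs.isCompact.cthickening
  have hqK : ∀ X ∉ K, ∀ Y ∈ ball X 4, q Y = 0 := by
    intro X hX Y hY
    by_contra hne
    refine hX (mem_cthickening_of_dist_le X Y 4 _ (subset_tsupport _ hne) ?_)
    rw [dist_comm]; exact (mem_ball.1 hY).le
  obtain ⟨η, hη0, hη⟩ : ∃ η : ℝ, 0 < η ∧
      ENNReal.ofReal η * (wvol n s) K ^ (1 / (2 : ℝ≥0∞).toReal) ≤ ε / 3 := by
    have hfin : (wvol n s) K ^ (1 / (2 : ℝ≥0∞).toReal) ≠ ⊤ :=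
      ENNReal.rpow_ne_top_of_nonneg (by positivity) hKc.measure_lt_top.ne
    set M := (wvol n s) K ^ (1 / (2 : ℝ≥0∞).toReal)
    have h3 : ε / 3 ≠ 0 := by simp [hε]
    obtain ⟨η, h1, h2⟩ := ENNReal.exists_nnreal_pos_mul_lt hfin h3
    exact ⟨η, h1, by simpa using h2.le⟩
  obtain ⟨δ₁, hδ₁, huc⟩ := Metric.uniformContinuous_iff.1
    (hqs.uniformContinuous_of_continuous hqc) η hη0
  refine ⟨min (δ₁ / 4) 1, by positivity, fun δ hδ hlt => ?_⟩
  have hδ1 : 4 * δ < δ₁ := by have := hlt.trans_le (min_le_left _ _); linarith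
  have hδ2 : 4 * δ < 4 := by have := hlt.trans_le (min_le_right _ _); linarith
  have hqi : Integrable q := hqc.integrable_of_hasCompactSupport hqs
  have hqm : StronglyMeasurable q := hqc.stronglyMeasurable
  have hq3 : eLpNorm (mollify δ hδ q - q) 2 (wvol n s) ≤ ε / 3 := by
    refine le_trans ?_ hη
    refine eLpNorm_sub_le_of_dist_bdd _ (by norm_num) hKc.isClosed.measurableSet hη0.le ?_ ?_ ?_
    · intro X
      refine dist_mollify_le hδ hqm.aestronglyMeasurable hη0.le fun Y hY => (huc ?_).le
      exact (mem_ball.1 hY).trans hδ1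
    · intro X hX
      by_contra hXK
      refine hX ?_
      refine dist_eq_zero.1 (le_antisymm (dist_mollify_le hδ hqm.aestronglyMeasurable le_rfl fun Y hY => ?_)
        dist_nonneg)
      rw [hqK X hXK Y (ball_subset_ball hδ2.le hY), dist_self]
    · exact (subset_tsupport q).trans (self_subset_cthickening _)
  have hsm : ∀ p' : Space n → F, Integrable p' → AEStronglyMeasurable (mollify δ hδ p') (wvol n s) :=
    fun p' h' => (contDiff_mollify hδ h'.locallyIntegrable).continuous.aestronglyMeasurable
  have hdecomp : mollify δ hδ p - p =
      mollify δ hδ (p - q) + ((mollify δ hδ q - q) + (q - p)) := by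
    rw [mollify_sub hδ hp1 hqi]; abel
  rw [hdecomp]
  have hqp : eLpNorm (q - p) 2 (wvol n s) ≤ ε₁ := by rw [eLpNorm_sub_comm]; exact hq1
  calc _ ≤ eLpNorm (mollify δ hδ (p - q)) 2 (wvol n s) +
        (eLpNorm (mollify δ hδ q - q) 2 (wvol n s) + eLpNorm (q - p) 2 (wvol n s)) := by
        refine (eLpNorm_add_le (hsm _ (hp1.sub hqi)) (((hsm _ hqi).sub
          hqm.aestronglyMeasurable).add (hqm.aestronglyMeasurable.sub hp.aestronglyMeasurable))
          (by norm_num)).trans ?_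
        gcongr
        exact eLpNorm_add_le ((hsm _ hqi).sub hqm.aestronglyMeasurable)
          (hqm.aestronglyMeasurable.sub hp.aestronglyMeasurable) (by norm_num)
    _ ≤ C * ε₁ + (ε / 3 + ε₁) := by
        gcongr
        exact (hbound δ hδ _ (hp.sub hqm)).trans (by gcongr)
    _ = (C + 1) * ε₁ + ε / 3 := by ring
    _ ≤ ε / 3 + ε / 3 := by gcongr
    _ ≤ ε := by
        calc ε / 3 + ε / 3 ≤ ε / 3 + ε / 3 + ε / 3 := le_self_add
          _ = ε := ENNReal.add_thirds ε

end Mollification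

/-! ### Smooth approximation up to the flat boundary -/

section Approximation

variable {n : ℕ}

/-- Even reflection of a point into the closed upper half space. -/
def fold (X : Space n) : Space n := X + (|height X| - height X) • vert

theorem continuous_fold : Continuous (fold : Space n → Space n) := by
  unfold fold
  have := continuous_height (n := n)
  fun_prop

theorem height_fold (X : Space n) : height (fold X) = |height X| := by
  simp only [fold, height_add, height_smul, height_vert]; ring

theorem norm_fold (X : Space n) : ‖fold X‖ = ‖X‖ := by
  obtain ⟨x, hx⟩ := exists_eq_flat_add X
  have h1 : fold X = flat x + |height X| • vert := by
    rw [fold]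
    conv_lhs => enter [1]; rw [hx]
    rw [add_assoc, ← add_smul]; congr 2; ring
  refine (sq_eq_sq₀ (norm_nonneg _) (norm_nonneg _)).1 ?_
  rw [h1, norm_sq_flat_add, sq_abs, ← norm_sq_flat_add, ← hx]

theorem fold_eq {X : Space n} (h : 0 ≤ height X) : fold X = X := by
  simp [fold, abs_of_nonneg h]

/-- The part `{y ≥ 0}` of the open unit ball. -/
def closedUpper (n : ℕ) (ρ : ℝ) : Set (Space n) := {X | ‖X‖ < ρ ∧ 0 ≤ height X}

theorem continuous_gradient {f : Space n → ℝ} (hf : ContDiff ℝ ∞ f) : Continuous (gradient f) :=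
  (InnerProductSpace.toDual ℝ (Space n)).symm.continuous.comp (hf.continuous_fderiv (by simp))

theorem inner_gradient (f : Space n → ℝ) (X e : Space n) : ⟪gradient f X, e⟫ = fderiv ℝ f X e := by
  rw [gradient, InnerProductSpace.toDual_symm_apply]

theorem norm_gradient (f : Space n → ℝ) (X : Space n) : ‖gradient f X‖ = ‖fderiv ℝ f X‖ := by
  rw [gradient, LinearIsometryEquiv.norm_map]

/-- Unweighted integrability follows from 2|p| ≤ y^a |p|² + y^(-a), where y^(-a) is integrable near
{y = 0} because a < 1. -/
theorem integrable_of_weighted_sq {s : ℝ} (hs₀ : 0 < s) {F : Type*}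
    [NormedAddCommGroup F] {p : Space n → F} (hp : StronglyMeasurable p) {K : Set (Space n)}
    (hK : MeasurableSet K) (hsupp : ∀ X, X ∉ K ∩ halfBall 0 1 → p X = 0)
    (hint : IntegrableOn (fun X => weight s X * ‖p X‖ ^ 2) (K ∩ halfBall 0 1)) :
    MemLp p 2 (wvol n s) ∧ Integrable p := by
  have hms : MeasurableSet (K ∩ halfBall (0 : Space n) 1) := hK.inter (measurableSet_halfBall _ _)
  constructor
  · rw [memLp_two_iff_integrable_sq_norm hp.aestronglyMeasurable, wvol,
      integrable_withDensity_iff_integrable_smul' (measurable_ofReal_weight s)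
        (Eventually.of_forall fun _ => ENNReal.ofReal_lt_top)]
    have h1 : Integrable (fun X => weight s X * ‖p X‖ ^ 2) :=
      hint.integrable_of_forall_notMem_eq_zero fun X hX => by simp [hsupp X hX]
    refine h1.integrableOn.congr_fun (fun X hX => ?_) measurableSet_upper
    simp [ENNReal.toReal_ofReal (weight_nonneg (le_of_lt hX))]
  · refine IntegrableOn.integrable_of_forall_notMem_eq_zero (s := K ∩ halfBall 0 1) ?_ hsupp
    have hb : -1 < -weightExp s := by simp [weightExp]; linarith
    have h2 := (integrableOn_height_rpow (n := n) hb 1).mono_set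
      (inter_subset_right (s := K))
    refine Integrable.mono' (hint.add h2) hp.aestronglyMeasurable.restrict ?_
    filter_upwards [ae_restrict_mem hms] with X hX
    have hpos : 0 < weight s X := weight_pos hX.2.2
    have hinv : height X ^ (-weightExp s) = (weight s X)⁻¹ := Real.rpow_neg hX.2.2.le _
    simp only [Pi.add_apply, hinv]
    have : ‖p X‖ * (2 * weight s X) ≤ (weight s X * ‖p X‖ ^ 2 + (weight s X)⁻¹) * weight s X := by
      rw [add_mul, inv_mul_cancel₀ hpos.ne']
      nlinarith [sq_nonneg (weight s X * ‖p X‖ - 1)]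
    have h3 : 0 ≤ ‖p X‖ * weight s X := by positivity
    nlinarith

/-- The derivative falls on the kernel, and for X at height at least 0 the function Y ↦ η(Y) k(X -
Y) is compactly supported in the open half ball, since the shift keeps Y strictly above X. It is
therefore an admissible test function for the weak gradient, and no boundary term appears at {y =
0}. This is the purpose of the shift. -/
theorem gradient_mollify_eq {δ : ℝ} (hδ : 0 < δ) {v : Space n → ℝ} {g : Space n → Space n}
    (hvg : IsWeakGradient (halfBall 0 1) v g) {η : Space n → ℝ} (hη : ContDiff ℝ ∞ η)
    {R : ℝ} (hR : R < 1) (hηR : tsupport η ⊆ closedBall 0 R)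
    {V : Space n → ℝ} (hV : Continuous V) (hVs : ∀ X, 1 ≤ ‖X‖ → V X = 0)
    (hVeq : ∀ X ∈ halfBall (0 : Space n) 1, V X = η X * v X)
    {P₁ P₂ : Space n → Space n} (hP₁ : Integrable P₁) (hP₂ : Integrable P₂)
    (hP₁z : ∀ X ∉ halfBall (0 : Space n) 1, P₁ X = 0)
    (hP₂z : ∀ X ∉ halfBall (0 : Space n) 1, P₂ X = 0)
    (hP₁e : ∀ᵐ X ∂volume.restrict (halfBall (0 : Space n) 1), P₁ X = η X • g X)
    (hP₂e : ∀ᵐ X ∂volume.restrict (halfBall (0 : Space n) 1), P₂ X = v X • gradient η X)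
    {X : Space n} (hX : 0 ≤ height X) :
    gradient (mollify δ hδ V) X = mollify δ hδ (P₁ + P₂) X := by
  have hk := contDiff_kern (n := n) hδ
  have hks := hasCompactSupport_kern (n := n) hδ
  refine ext_inner_right ℝ fun e => ?_
  set L := ContinuousLinearMap.lsmul ℝ ℝ (E := ℝ) with hL
  have hfd : HasFDerivAt (mollify δ hδ V) _ X :=
    hks.hasFDerivAt_convolution_left L (hk.of_le (by simp)) hV.locallyIntegrable X
  have hex : Integrable fun Y => fderiv ℝ (kern n δ hδ) (X - Y) e * V Y := by
    have hc : Continuous fun Y => fderiv ℝ (kern n δ hδ) (X - Y) e * V Y :=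
      (((hk.continuous_fderiv (by simp)).comp (continuous_const.sub continuous_id)).clm_apply
        continuous_const).mul hV
    refine hc.integrable_of_hasCompactSupport ?_
    refine HasCompactSupport.of_support_subset_isCompact (isCompact_closedBall 0 1) fun Y hY => ?_
    rw [mem_closedBall_zero_iff]
    by_contra hcon
    exact hY (by simp [hVs Y (le_of_lt (not_le.1 hcon))])
  have hcv : ConvolutionExistsAt (fderiv ℝ (kern n δ hδ)) V X (L.precompL (Space n)) volume :=
    (hks.fderiv ℝ).convolutionExists_left _ (hk.continuous_fderiv (by simp)) hV.locallyIntegrable X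
  have hB : fderiv ℝ (mollify δ hδ V) X e = ∫ Y, fderiv ℝ (kern n δ hδ) (X - Y) e * V Y := by
    rw [hfd.fderiv, convolution_eq_swap, ContinuousLinearMap.integral_apply hcv.integrable_swap]
    rfl
  have hi1 := integrable_kern_smul hδ hP₁ X
  have hi2 := integrable_kern_smul hδ hP₂ X
  have hA : ⟪mollify δ hδ (P₁ + P₂) X, e⟫ =
      (∫ Y, kern n δ hδ (X - Y) * ⟪P₁ Y, e⟫) + ∫ Y, kern n δ hδ (X - Y) * ⟪P₂ Y, e⟫ := by
    rw [mollify_apply, real_inner_comm, ← integral_inner (integrable_kern_smul hδ (hP₁.add hP₂) X),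
      ← integral_add]
    · refine integral_congr_ae (Eventually.of_forall fun Y => ?_)
      simp only [Pi.add_apply, smul_add, inner_add_right, real_inner_smul_right]
      rw [real_inner_comm e, real_inner_comm e]
    · simpa [real_inner_smul_left] using hi1.inner_const (𝕜 := ℝ) e
    · simpa [real_inner_smul_left] using hi2.inner_const (𝕜 := ℝ) e
  rw [inner_gradient, hA, hB]
  set φ : Space n → ℝ := fun Y => η Y * kern n δ hδ (X - Y) with hφ
  have hφc : ContDiff ℝ ∞ φ := hη.mul (hk.comp (contDiff_const.sub contDiff_id))
  have hφs : tsupport φ ⊆ closedBall 0 R ∩ {Y | X - Y ∈ tsupport (kern n δ hδ)} := by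
    refine closure_minimal ?_ (isClosed_closedBall.inter
      ((isClosed_tsupport _).preimage (continuous_const.sub continuous_id)))
    intro Y hY
    refine ⟨hηR (subset_tsupport _ ?_), subset_tsupport (kern n δ hδ) ?_⟩
    · exact left_ne_zero_of_mul hY
    · exact right_ne_zero_of_mul hY
  have hφh : tsupport φ ⊆ halfBall 0 1 := by
    intro Y hY
    obtain ⟨h1, h2⟩ := hφs hY
    have h3 := (norm_lt_of_mem_tsupport_kern hδ h2).2.1
    rw [height_sub] at h3
    refine ⟨?_, by linarith⟩
    rw [mem_closedBall_zero_iff] at h1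
    rw [mem_ball_zero_iff]; linarith
  have hφk : HasCompactSupport φ :=
    HasCompactSupport.of_support_subset_isCompact (isCompact_closedBall 0 R) fun Y hY =>
      (hφs (subset_tsupport _ hY)).1
  have hfφ : ∀ Y, fderiv ℝ φ Y e =
      fderiv ℝ η Y e * kern n δ hδ (X - Y) - η Y * fderiv ℝ (kern n δ hδ) (X - Y) e := by
    intro Y
    have h1 : HasFDerivAt η (fderiv ℝ η Y) Y := (hη.differentiable (by simp) Y).hasFDerivAt
    have h2 : HasFDerivAt (fun Y => kern n δ hδ (X - Y))
        ((fderiv ℝ (kern n δ hδ) (X - Y)).comp (-ContinuousLinearMap.id ℝ (Space n))) Y :=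
      (hk.differentiable (by simp) (X - Y)).hasFDerivAt.comp Y ((hasFDerivAt_id Y).const_sub X)
    have h3 : fderiv ℝ φ Y = _ := (h1.mul h2).fderiv
    rw [h3]
    simp; ring
  have hweak := hvg φ hφc hφk hφh e
  have hms := measurableSet_halfBall (0 : Space n) 1
  have hz : ∀ f : Space n → ℝ, (∀ Y ∉ halfBall (0 : Space n) 1, f Y = 0) →
      ∫ Y, f Y = ∫ Y in halfBall 0 1, f Y := fun f hf =>
    (setIntegral_eq_integral_of_forall_compl_eq_zero hf).symm
  have hi1' : Integrable fun Y => kern n δ hδ (X - Y) * ⟪P₁ Y, e⟫ := by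
    simpa [real_inner_smul_left] using hi1.inner_const (𝕜 := ℝ) e
  have hi2' : Integrable fun Y => kern n δ hδ (X - Y) * ⟪P₂ Y, e⟫ := by
    simpa [real_inner_smul_left] using hi2.inner_const (𝕜 := ℝ) e
  rw [hz (fun Y => kern n δ hδ (X - Y) * ⟪P₁ Y, e⟫) fun Y hY => by rw [hP₁z Y hY]; simp,
    hz (fun Y => kern n δ hδ (X - Y) * ⟪P₂ Y, e⟫) fun Y hY => by rw [hP₂z Y hY]; simp,
    hz (fun Y => fderiv ℝ (kern n δ hδ) (X - Y) e * V Y)]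
  · have e1 : ∫ Y in halfBall 0 1, v Y * fderiv ℝ φ Y e =
        (∫ Y in halfBall 0 1, kern n δ hδ (X - Y) * ⟪P₂ Y, e⟫) -
          ∫ Y in halfBall 0 1, fderiv ℝ (kern n δ hδ) (X - Y) e * V Y := by
      rw [← integral_sub hi2'.integrableOn hex.integrableOn]
      refine integral_congr_ae ?_
      filter_upwards [hP₂e, ae_restrict_mem hms] with Y h1 h2
      rw [h1, hVeq Y h2, hfφ, real_inner_smul_left, inner_gradient]; ring
    have e2 : ∫ Y in halfBall 0 1, ⟪g Y, e⟫ * φ Y =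
        ∫ Y in halfBall 0 1, kern n δ hδ (X - Y) * ⟪P₁ Y, e⟫ := by
      refine integral_congr_ae ?_
      filter_upwards [hP₁e] with Y h1
      rw [h1, hφ, real_inner_smul_left]; ring
    rw [e1, e2] at hweak
    linarith
  · intro Y hY
    by_cases h1 : ‖Y‖ < 1
    · have h2 : height Y ≤ 0 := not_lt.1 fun h => hY ⟨mem_ball_zero_iff.2 h1, h⟩
      have : X - Y ∉ tsupport (kern n δ hδ) := by
        intro h
        have := (norm_lt_of_mem_tsupport_kern hδ h).2.1
        rw [height_sub] at this; linarith
      rw [fderiv_of_notMem_tsupport ℝ this]; simp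
    · rw [hVs Y (not_lt.1 h1), mul_zero]

/-- A function which is continuous up to the boundary and has a weak gradient in weighted `L²`
is approximated by smooth functions uniformly and in the weighted Sobolev norm. -/
theorem exists_smooth_approx {s : ℝ} (hs₀ : 0 < s) (hs₁ : s < 1) {v : Space n → ℝ}
    {g : Space n → Space n} (hv : ContinuousOn v (closedUpper n 1))
    (hg : IsWeightedSobolevLoc s v g) {ρ : ℝ} (hρ₀ : 0 < ρ) (hρ₁ : ρ < 1) :
    ∃ w : ℕ → Space n → ℝ, (∀ j, ContDiff ℝ ∞ (w j)) ∧
      TendstoUniformlyOn w v atTop (closedUpper n ρ) ∧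
      Tendsto (fun j => eLpNorm (fun X => gradient (w j) X - g X) 2 ((wvol n s).restrict (ball 0 ρ)))
        atTop (𝓝 0) := by
  set R : ℝ := (1 + ρ) / 2 with hRdef
  have hR1 : R < 1 := by rw [hRdef]; linarith
  have hρR : ρ < R := by rw [hRdef]; linarith
  let b : ContDiffBump (0 : Space n) := ⟨ρ, R, hρ₀, hρR⟩
  set η : Space n → ℝ := ⇑b with hηdef
  have hη : ContDiff ℝ ∞ η := b.contDiff
  have hηR : tsupport η ⊆ closedBall 0 R := b.tsupport_eq.subset
  have hηone : ∀ X : Space n, ‖X‖ < ρ → η X = 1 := fun X hX =>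
    b.one_of_mem_closedBall (by simpa [b] using hX.le)
  have hη01 : ∀ X, |η X| ≤ 1 := fun X => abs_le.2 ⟨by linarith [b.nonneg (x := X)], b.le_one⟩
  have hηz : ∀ X, X ∉ closedBall (0 : Space n) R → η X = 0 := fun X hX =>
    image_eq_zero_of_notMem_tsupport fun h => hX (hηR h)
  have hgηz : ∀ X, X ∉ closedBall (0 : Space n) R → gradient η X = 0 := fun X hX => by
    rw [← norm_eq_zero, norm_gradient, fderiv_of_notMem_tsupport ℝ fun h => hX (hηR h), norm_zero]
  have hgηc := continuous_gradient hη
  obtain ⟨B, hB⟩ : ∃ B, ∀ X, ‖gradient η X‖ ≤ B := by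
    obtain ⟨B, hB⟩ := (isCompact_closedBall (0 : Space n) R).exists_bound_of_continuousOn
      hgηc.continuousOn
    refine ⟨max B 0, fun X => ?_⟩
    by_cases h : X ∈ closedBall (0 : Space n) R
    · exact (hB X h).trans (le_max_left _ _)
    · rw [hgηz X h, norm_zero]; exact le_max_right _ _
  -- Even reflection serves only to make the cut off function continuous on the whole space. Its
  -- values below {y = 0} do not enter at points with y ≥ 0, because the kernel looks upward.
  set V : Space n → ℝ := fun X => η (fold X) * v (fold X) with hVdef
  have hVs : ∀ X, R < ‖X‖ → V X = 0 := fun X hX => by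
    rw [hVdef]
    simp only
    rw [hηz (fold X) (by rw [mem_closedBall_zero_iff, norm_fold]; exact not_le.2 hX), zero_mul]
  have hVc : Continuous V := by
    rw [continuous_iff_continuousAt]
    intro X
    by_cases h : ‖X‖ < 1
    · have h1 : ContinuousOn (fun X => v (fold X)) (ball (0 : Space n) 1) := by
        refine hv.comp continuous_fold.continuousOn fun Y hY => ⟨?_, ?_⟩
        · rw [norm_fold]; exact mem_ball_zero_iff.1 hY
        · rw [height_fold]; exact abs_nonneg _
      exact ((hη.continuous.comp continuous_fold).continuousAt).mul
        (h1.continuousAt (isOpen_ball.mem_nhds (mem_ball_zero_iff.2 h)))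
    · have : V =ᶠ[𝓝 X] fun _ => 0 := by
        have ho : IsOpen {Y : Space n | R < ‖Y‖} := isOpen_lt continuous_const continuous_norm
        filter_upwards [ho.mem_nhds (show R < ‖X‖ by linarith [not_lt.1 h])] with Y hY
        exact hVs Y hY
      exact continuousAt_const.congr this.symm
  have hVk : HasCompactSupport V :=
    HasCompactSupport.of_support_subset_isCompact (isCompact_closedBall 0 R) fun Y hY => by
      rw [mem_closedBall_zero_iff]
      by_contra hcon
      exact hY (hVs Y (not_le.1 hcon))
  have hms := measurableSet_halfBall (0 : Space n) 1
  set gm := hg.aestronglyMeasurable_grad.mk g with hgm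
  set vm := hg.aestronglyMeasurable.mk v with hvm
  have hgme : g =ᵐ[volume.restrict (halfBall 0 1)] gm := hg.aestronglyMeasurable_grad.ae_eq_mk
  have hvme : v =ᵐ[volume.restrict (halfBall 0 1)] vm := hg.aestronglyMeasurable.ae_eq_mk
  -- The two terms η g and v ∇η of the product rule, taken with measurable representatives and
  -- extended by zero.
  set P₁ : Space n → Space n := (halfBall 0 1).indicator fun X => η X • gm X with hP₁
  set P₂ : Space n → Space n := (halfBall 0 1).indicator fun X => vm X • gradient η X with hP₂
  have hP₁m : StronglyMeasurable P₁ := (hη.continuous.stronglyMeasurable.smul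
    hg.aestronglyMeasurable_grad.stronglyMeasurable_mk).indicator hms
  have hP₂m : StronglyMeasurable P₂ := (hg.aestronglyMeasurable.stronglyMeasurable_mk.smul
    hgηc.stronglyMeasurable).indicator hms
  have hKs : closedBall (0 : Space n) R ⊆ ball 0 1 := closedBall_subset_ball hR1
  have hKm : MeasurableSet (closedBall (0 : Space n) R) := measurableSet_closedBall
  have hle : volume.restrict (closedBall (0 : Space n) R ∩ halfBall 0 1) ≤
      volume.restrict (halfBall 0 1) := Measure.restrict_mono_set _ inter_subset_right
  have hmsK := hKm.inter hms
  have hI₁ := integrable_of_weighted_sq hs₀ hP₁m hKm (fun X hX => by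
      by_cases h : X ∈ halfBall (0 : Space n) 1
      · rw [hP₁, indicator_of_mem h, hηz X fun h' => hX ⟨h', h⟩, zero_smul]
      · rw [hP₁, indicator_of_notMem h]) (by
      refine Integrable.mono' (hg.integrable_grad_sq _ (isCompact_closedBall 0 R) hKs)
        ((measurable_weight s).aestronglyMeasurable.mul
          ((hP₁m.norm.aestronglyMeasurable).pow 2)) ?_
      filter_upwards [ae_restrict_mem hmsK, ae_mono hle hgme] with X hX hgX
      rw [Real.norm_of_nonneg (mul_nonneg (weight_nonneg hX.2.2.le) (sq_nonneg _)), hP₁,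
        indicator_of_mem hX.2, ← hgX, norm_smul, mul_pow]
      have h1 : ‖η X‖ ^ 2 ≤ 1 := by
        rw [Real.norm_eq_abs]; exact pow_le_one₀ (abs_nonneg _) (hη01 X)
      refine mul_le_mul_of_nonneg_left ?_ (weight_nonneg hX.2.2.le)
      nlinarith [sq_nonneg ‖g X‖])
  have hI₂ := integrable_of_weighted_sq hs₀ hP₂m hKm (fun X hX => by
      by_cases h : X ∈ halfBall (0 : Space n) 1
      · rw [hP₂, indicator_of_mem h, hgηz X fun h' => hX ⟨h', h⟩, smul_zero]
      · rw [hP₂, indicator_of_notMem h]) (by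
      refine Integrable.mono' ((hg.integrable_sq _ (isCompact_closedBall 0 R) hKs).const_mul (B ^ 2))
        ((measurable_weight s).aestronglyMeasurable.mul
          ((hP₂m.norm.aestronglyMeasurable).pow 2)) ?_
      filter_upwards [ae_restrict_mem hmsK, ae_mono hle hvme] with X hX hgX
      rw [Real.norm_of_nonneg (mul_nonneg (weight_nonneg hX.2.2.le) (sq_nonneg _)), hP₂,
        indicator_of_mem hX.2, ← hgX, norm_smul, mul_pow, Real.norm_eq_abs, sq_abs]
      have h1 : ‖gradient η X‖ ^ 2 ≤ B ^ 2 := pow_le_pow_left₀ (norm_nonneg _) (hB X) 2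
      have h2 : 0 ≤ weight s X * v X ^ 2 := mul_nonneg (weight_nonneg hX.2.2.le) (sq_nonneg _)
      calc weight s X * (v X ^ 2 * ‖gradient η X‖ ^ 2) =
            ‖gradient η X‖ ^ 2 * (weight s X * v X ^ 2) := by ring
        _ ≤ _ := mul_le_mul_of_nonneg_right h1 h2)
  have hgrad : ∀ (δ : ℝ) (hδ : 0 < δ) (X : Space n), 0 ≤ height X →
      gradient (mollify δ hδ V) X = mollify δ hδ (P₁ + P₂) X := by
    intro δ hδ X hX
    refine gradient_mollify_eq hδ hg.weakGradient hη hR1 hηR hVc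
      (fun X hX => hVs X (hR1.trans_le hX)) (fun X hX => ?_) hI₁.2 hI₂.2
      (fun X hX => indicator_of_notMem hX _) (fun X hX => indicator_of_notMem hX _) ?_ ?_ hX
    · rw [hVdef]; simp only; rw [fold_eq hX.2.le]
    · filter_upwards [ae_restrict_mem hms, hgme] with Y h1 h2
      rw [hP₁, indicator_of_mem h1, h2]
    · filter_upwards [ae_restrict_mem hms, hvme] with Y h1 h2
      rw [hP₂, indicator_of_mem h1, h2]
  have hchoose : ∀ j : ℕ, ∃ w : Space n → ℝ, ContDiff ℝ ∞ w ∧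
      (∀ X ∈ closedUpper n ρ, dist (v X) (w X) ≤ 1 / ((j : ℝ) + 1)) ∧
      eLpNorm (fun X => gradient w X - g X) 2 ((wvol n s).restrict (ball 0 ρ)) ≤
        ENNReal.ofReal (1 / ((j : ℝ) + 1)) := by
    intro j
    have hj : (0 : ℝ) < 1 / ((j : ℝ) + 1) := by positivity
    obtain ⟨δ₁, hδ₁, huc⟩ := Metric.uniformContinuous_iff.1
      (hVk.uniformContinuous_of_continuous hVc) _ hj
    obtain ⟨δ₂, hδ₂, hL2⟩ := tendsto_eLpNorm_mollify hs₀ hs₁ (hP₁m.add hP₂m) (hI₁.2.add hI₂.2)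
      (hI₁.1.add hI₂.1) (ENNReal.ofReal_pos.2 hj).ne'
    set δ := min (δ₁ / 4) δ₂ / 2 with hδdef
    have hδm : 0 < min (δ₁ / 4) δ₂ := by positivity
    have hδ : 0 < δ := by positivity
    have hδlt : δ < min (δ₁ / 4) δ₂ := half_lt_self hδm
    refine ⟨mollify δ hδ V, contDiff_mollify hδ hVc.locallyIntegrable, fun X hX => ?_, ?_⟩
    · rw [dist_comm]
      refine dist_mollify_le hδ hVc.aestronglyMeasurable hj.le fun Y hY => ?_
      have h1 : V X = v X := by
        rw [hVdef]; simp only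
        rw [fold_eq hX.2, hηone X hX.1, one_mul]
      rw [← h1]
      refine (huc ((mem_ball.1 hY).trans ?_)).le
      have := hδlt.trans_le (min_le_left _ _)
      linarith
    · refine le_trans ?_ (hL2 δ hδ (hδlt.trans_le (min_le_right _ _)))
      calc eLpNorm (fun X => gradient (mollify δ hδ V) X - g X) 2 ((wvol n s).restrict (ball 0 ρ))
          = eLpNorm (mollify δ hδ (P₁ + P₂) - (P₁ + P₂)) 2 ((wvol n s).restrict (ball 0 ρ)) := by
            refine eLpNorm_congr_ae ?_
            have hac : (wvol n s).restrict (ball 0 ρ) ≪ volume.restrict (halfBall 0 1) := by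
              rw [wvol, restrict_withDensity measurableSet_ball,
                Measure.restrict_restrict measurableSet_ball]
              refine (withDensity_absolutelyContinuous _ _).trans ?_
              refine Measure.absolutelyContinuous_of_le (Measure.restrict_mono_set _ ?_)
              exact fun X hX => ⟨ball_subset_ball hρ₁.le hX.1, hX.2⟩
            filter_upwards [hac hgme, hac (ae_restrict_mem hms),
              ae_restrict_mem measurableSet_ball] with X h1 h2 h3
            rw [hgrad δ hδ X h2.2.le, Pi.sub_apply, Pi.add_apply, hP₁, hP₂, indicator_of_mem h2,
              indicator_of_mem h2, hηone X (mem_ball_zero_iff.1 h3), one_smul]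
            -- The cutoff is constant on the ball of radius ρ, so there the sum of the two terms
            -- reduces to g.
            have : gradient η X = 0 := by
              have hev : η =ᶠ[𝓝 X] fun _ => 1 := by
                filter_upwards [isOpen_ball.mem_nhds h3] with Y hY
                exact hηone Y (mem_ball_zero_iff.1 hY)
              rw [← norm_eq_zero, norm_gradient, hev.fderiv_eq]; simp
            rw [this, smul_zero, add_zero, h1]
        _ ≤ _ := eLpNorm_mono_measure _ Measure.restrict_le_self
  choose w hw1 hw2 hw3 using hchoose
  refine ⟨w, hw1, ?_, ?_⟩
  · rw [Metric.tendstoUniformlyOn_iff]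
    intro ε hε
    obtain ⟨N, hN⟩ := exists_nat_one_div_lt hε
    filter_upwards [eventually_ge_atTop N] with j hj X hX
    refine (hw2 j X hX).trans_lt (lt_of_le_of_lt ?_ hN)
    gcongr
  · refine tendsto_of_tendsto_of_tendsto_of_le_of_le tendsto_const_nhds ?_ (fun _ => zero_le) hw3
    rw [← ENNReal.ofReal_zero]
    exact ENNReal.tendsto_ofReal tendsto_one_div_add_atTop_nhds_zero_nat

end Approximation

/-! ### Limits of products, and the weighted measure on half spheres -/

section WeightedSphere

/-- Writing b_j A_j = b_j (A_j - A') + b_j A', the first part is small because b_j is bounded, and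
the second converges by domination. -/
theorem tendsto_integral_mul_of_L1 {α : Type*} [MeasurableSpace α] {μ : Measure α}
    {A : ℕ → α → ℝ} {A' : α → ℝ} {b : ℕ → α → ℝ} {b' : α → ℝ} {B : ℝ}
    (hA : ∀ j, Integrable (A j) μ) (hA' : Integrable A' μ)
    (hL : Tendsto (fun j => eLpNorm (fun x => A j x - A' x) 1 μ) atTop (𝓝 0))
    (hbm : ∀ j, AEStronglyMeasurable (b j) μ)
    (hbB : ∀ᶠ j in atTop, ∀ᵐ x ∂μ, |b j x| ≤ B)
    (hb : ∀ᵐ x ∂μ, Tendsto (fun j => b j x) atTop (𝓝 (b' x))) :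
    Tendsto (fun j => ∫ x, b j x * A j x ∂μ) atTop (𝓝 (∫ x, b' x * A' x ∂μ)) := by
  have t1 : Tendsto (fun j => ∫ x, b j x * A' x ∂μ) atTop (𝓝 (∫ x, b' x * A' x ∂μ)) := by
    refine tendsto_integral_filter_of_dominated_convergence (fun x => B * |A' x|)
      (Eventually.of_forall fun j => (hbm j).mul hA'.aestronglyMeasurable) ?_
      (hA'.abs.const_mul B) ?_
    · filter_upwards [hbB] with j hj
      filter_upwards [hj] with x hx
      rw [norm_mul, Real.norm_eq_abs, Real.norm_eq_abs]
      gcongr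
    · filter_upwards [hb] with x hx
      exact hx.mul_const _
  have t2 : Tendsto (fun j => ∫ x, b j x * (A j x - A' x) ∂μ) atTop (𝓝 0) := by
    have hz : Tendsto (fun j => B * (eLpNorm (fun x => A j x - A' x) 1 μ).toReal) atTop (𝓝 0) := by
      have := (ENNReal.tendsto_toReal ENNReal.zero_ne_top).comp hL
      simpa using this.const_mul B
    refine squeeze_zero_norm' ?_ hz
    filter_upwards [hbB] with j hj
    refine (norm_integral_le_integral_norm _).trans ?_
    have h1 : (eLpNorm (fun x => A j x - A' x) 1 μ).toReal = ∫ x, ‖A j x - A' x‖ ∂μ := by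
      rw [eLpNorm_one_eq_lintegral_enorm, integral_norm_eq_lintegral_enorm
        (f := fun x => A j x - A' x) ((hA j).sub hA').aestronglyMeasurable]
    rw [h1, ← integral_const_mul]
    refine integral_mono_of_nonneg (Eventually.of_forall fun x => norm_nonneg _)
      (((hA j).sub hA').norm.const_mul B) ?_
    filter_upwards [hj] with x hx
    simp only [norm_mul, Real.norm_eq_abs]
    gcongr
  have := t2.add t1
  rw [zero_add] at this
  refine this.congr' ?_
  filter_upwards [hbB] with j hj
  have hi : ∀ C : α → ℝ, Integrable C μ → Integrable (fun x => b j x * C x) μ := fun C hC =>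
    hC.bdd_mul (c := B) (hbm j) (by filter_upwards [hj] with x hx using hx)
  rw [← integral_add (hi (fun x => A j x - A' x) ((hA j).sub hA')) (hi _ hA')]
  refine integral_congr_ae (Eventually.of_forall fun x => ?_)
  simp only; ring

/-- Hölder's inequality with exponents 2 and 2 applied to the difference. -/
theorem tendsto_eLpNorm_inner {α F : Type*} [MeasurableSpace α] {μ : Measure α}
    [NormedAddCommGroup F] [InnerProductSpace ℝ F] {p : ℕ → α → F} {g h : α → F}
    (hp : ∀ j, AEStronglyMeasurable (p j) μ) (hg : AEStronglyMeasurable g μ) (hh : MemLp h 2 μ)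
    (hL : Tendsto (fun j => eLpNorm (fun x => p j x - g x) 2 μ) atTop (𝓝 0)) :
    Tendsto (fun j => eLpNorm (fun x => ⟪p j x, h x⟫ - ⟪g x, h x⟫) 1 μ) atTop (𝓝 0) := by
  have hle : ∀ j, eLpNorm (fun x => ⟪p j x, h x⟫ - ⟪g x, h x⟫) 1 μ ≤
      eLpNorm (fun x => p j x - g x) 2 μ * eLpNorm h 2 μ := by
    intro j
    have := eLpNorm_le_eLpNorm_mul_eLpNorm_of_nnnorm (p := 2) (q := 2) (r := 1) (μ := μ)
      (f := fun x => p j x - g x) (g := h) ((hp j).sub hg) hh.aestronglyMeasurable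
      (fun a b => ⟪a, b⟫) 1 (Eventually.of_forall fun x => by
        rw [← NNReal.coe_le_coe]
        simpa using norm_inner_le_norm (𝕜 := ℝ) (p j x - g x) (h x))
    simpa [inner_sub_left] using this
  refine tendsto_of_tendsto_of_tendsto_of_le_of_le tendsto_const_nhds ?_ (fun _ => zero_le) hle
  have := ENNReal.Tendsto.mul_const hL (Or.inr hh.eLpNorm_ne_top) (b := eLpNorm h 2 μ)
  simpa using this

variable {n : ℕ}

theorem setIntegral_wvol (s : ℝ) (F : Space n → ℝ) {A : Set (Space n)} (hA : MeasurableSet A) :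
    ∫ X in A, F X ∂wvol n s = ∫ X in A ∩ upper n, weight s X * F X := by
  rw [wvol, restrict_withDensity hA, Measure.restrict_restrict hA]
  have hm : Measurable fun X : Space n => (weight s X).toNNReal :=
    (measurable_weight s).real_toNNReal
  change ∫ X, F X ∂((volume.restrict (A ∩ upper n)).withDensity
    fun X => ((weight s X).toNNReal : ℝ≥0∞)) = _
  rw [integral_withDensity_eq_integral_smul hm]
  refine setIntegral_congr_fun (hA.inter measurableSet_upper) fun X hX => ?_
  simp [NNReal.smul_def, Real.coe_toNNReal _ (weight_nonneg (le_of_lt hX.2))]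

theorem integrableOn_wvol (s : ℝ) (F : Space n → ℝ) {A : Set (Space n)} (hA : MeasurableSet A) :
    IntegrableOn F A (wvol n s) ↔ IntegrableOn (fun X => weight s X * F X) (A ∩ upper n) := by
  rw [IntegrableOn, wvol, restrict_withDensity hA, Measure.restrict_restrict hA]
  have hm : Measurable fun X : Space n => (weight s X).toNNReal :=
    (measurable_weight s).real_toNNReal
  change Integrable F ((volume.restrict (A ∩ upper n)).withDensity
    fun X => ((weight s X).toNNReal : ℝ≥0∞)) ↔ _
  rw [integrable_withDensity_iff_integrable_smul hm]
  refine integrableOn_congr_fun (fun X hX => ?_) (hA.inter measurableSet_upper)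
  simp [NNReal.smul_def, Real.coe_toNNReal _ (weight_nonneg (le_of_lt hX.2))]

theorem wvol_restrict_ball_ac (s : ℝ) {ρ : ℝ} (hρ : ρ ≤ 1) :
    (wvol n s).restrict (ball 0 ρ) ≪ volume.restrict (halfBall 0 1) := by
  rw [wvol, restrict_withDensity measurableSet_ball,
    Measure.restrict_restrict measurableSet_ball]
  refine (withDensity_absolutelyContinuous _ _).trans ?_
  refine Measure.absolutelyContinuous_of_le (Measure.restrict_mono_set _ ?_)
  exact fun X hX => ⟨ball_subset_ball hρ hX.1, hX.2⟩

theorem wvol_ball_lt_top {s : ℝ} (hs : s < 1) (X : Space n) (ρ : ℝ) : wvol n s (ball X ρ) < ⊤ := by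
  have := isFiniteMeasureOnCompacts_wvol (n := n) hs
  exact (measure_mono ball_subset_closedBall).trans_lt (isCompact_closedBall X ρ).measure_lt_top

theorem ae_wvol_pos (s : ℝ) (A : Set (Space n)) (hA : MeasurableSet A) :
    ∀ᵐ X ∂(wvol n s).restrict A, X ∈ A ∧ 0 < height X := by
  rw [wvol, restrict_withDensity hA, Measure.restrict_restrict hA]
  refine (withDensity_absolutelyContinuous _ _) ?_
  filter_upwards [ae_restrict_mem (hA.inter measurableSet_upper)] with X hX using hX

theorem IsWeightedSobolevLoc.memLp_grad {s : ℝ} {v : Space n → ℝ} {g : Space n → Space n}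
    (hg : IsWeightedSobolevLoc s v g) {ρ : ℝ} (hρ : ρ < 1) :
    MemLp g 2 ((wvol n s).restrict (ball 0 ρ)) := by
  have hm : AEStronglyMeasurable g ((wvol n s).restrict (ball 0 ρ)) :=
    hg.aestronglyMeasurable_grad.mono_ac (wvol_restrict_ball_ac s hρ.le)
  rw [memLp_two_iff_integrable_sq_norm hm]
  refine (integrableOn_wvol s _ measurableSet_ball).2
    ((hg.integrable_grad_sq (closedBall 0 ρ) (isCompact_closedBall _ _)
      (closedBall_subset_ball hρ)).mono_set ?_)
  exact fun X hX => ⟨ball_subset_closedBall hX.1, ball_subset_ball hρ.le hX.1, hX.2⟩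

theorem memLp_of_continuous_ball {s : ℝ} (hs : s < 1) {F : Type*} [NormedAddCommGroup F]
    {p : Space n → F} (hp : Continuous p) (q : ℝ≥0∞) (ρ : ℝ) :
    MemLp p q ((wvol n s).restrict (ball 0 ρ)) := by
  have : IsFiniteMeasure ((wvol n s).restrict (ball 0 ρ)) :=
    ⟨by rw [Measure.restrict_apply_univ]; exact wvol_ball_lt_top hs 0 ρ⟩
  obtain ⟨B, hB⟩ := (isCompact_closedBall (0 : Space n) ρ).exists_bound_of_continuousOn
    hp.continuousOn
  have := (isFiniteMeasureOnCompacts_wvol (n := n) hs)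
  refine MemLp.of_bound (C := B) ?_ ?_
  · exact hp.aestronglyMeasurable
  · filter_upwards [ae_restrict_mem measurableSet_ball] with X hX
    exact hB X (ball_subset_closedBall hX)

theorem closedUpper_mono {ρ ρ' : ℝ} (h : ρ ≤ ρ') : closedUpper n ρ ⊆ closedUpper n ρ' :=
  fun _ hX => ⟨hX.1.trans_le h, hX.2⟩

theorem exists_bound_closedUpper {v : Space n → ℝ} (hv : ContinuousOn v (closedUpper n 1)) {ρ : ℝ}
    (hρ : ρ < 1) : ∃ B, 0 ≤ B ∧ ∀ X ∈ closedUpper n ρ, |v X| ≤ B := by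
  have hc : IsCompact (closedBall (0 : Space n) ρ ∩ {X | 0 ≤ height X}) :=
    (isCompact_closedBall _ _).inter_right (isClosed_le continuous_const continuous_height)
  obtain ⟨B, hB⟩ := hc.exists_bound_of_continuousOn (f := v) (hv.mono fun X hX =>
    ⟨(mem_closedBall_zero_iff.1 hX.1).trans_lt hρ, hX.2⟩)
  refine ⟨max B 0, le_max_right _ _, fun X hX => (hB X ⟨?_, hX.2⟩).trans (le_max_left _ _)⟩
  exact mem_closedBall_zero_iff.2 hX.1.le

/-- The open upper half of the unit sphere. -/
def upperSphere (n : ℕ) : Set (sphere (0 : Space n) 1) := {θ | 0 < height (θ : Space n)}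

theorem measurableSet_upperSphere : MeasurableSet (upperSphere n) :=
  measurableSet_lt measurable_const (measurable_height.comp measurable_subtype_coe)

/-- The measure `y^a dσ` on the upper half of the unit sphere. -/
def wsphere (n : ℕ) (s : ℝ) : Measure (sphere (0 : Space n) 1) :=
  ((volume : Measure (Space n)).toSphere.restrict (upperSphere n)).withDensity
    fun θ => ENNReal.ofReal (weight s (θ : Space n))

theorem measurable_weight_sphere (s : ℝ) :
    Measurable fun θ : sphere (0 : Space n) 1 => weight s (θ : Space n) :=
  (measurable_weight s).comp measurable_subtype_coe

theorem integral_wsphere (s : ℝ) (F : sphere (0 : Space n) 1 → ℝ) :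
    ∫ θ, F θ ∂wsphere n s = ∫ θ in upperSphere n, weight s (θ : Space n) * F θ
      ∂(volume : Measure (Space n)).toSphere := by
  rw [wsphere]
  have hm : Measurable fun θ : sphere (0 : Space n) 1 => (weight s (θ : Space n)).toNNReal :=
    (measurable_weight_sphere s).real_toNNReal
  change ∫ θ, F θ ∂(((volume : Measure (Space n)).toSphere.restrict (upperSphere n)).withDensity
    fun θ => ((weight s (θ : Space n)).toNNReal : ℝ≥0∞)) = _
  rw [integral_withDensity_eq_integral_smul hm]
  refine setIntegral_congr_fun measurableSet_upperSphere fun θ hθ => ?_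
  simp [NNReal.smul_def, Real.coe_toNNReal _ (weight_nonneg (le_of_lt hθ))]

theorem weight_smul {s ρ : ℝ} (hρ : 0 ≤ ρ) (x₀ : Flat n) {X : Space n} (hX : 0 ≤ height X) :
    weight s (flat x₀ + ρ • X) = ρ ^ weightExp s * weight s X := by
  simp only [weight, height_add, height_flat, height_smul, zero_add]
  rw [Real.mul_rpow hρ hX]

/-- No computation of surface measure is needed: the weight is integrable on the half ball, hence on
almost every half sphere, and homogeneity transports this from one such sphere to the unit one. -/
theorem integrableOn_weight_upperSphere {s : ℝ} (hs : s < 1) :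
    IntegrableOn (fun θ : sphere (0 : Space n) 1 => weight s (θ : Space n)) (upperSphere n)
      (volume : Measure (Space n)).toSphere := by
  have h := (polar_halfBall (0 : Flat n) (R := 1) (fun X _ => weight s X) (by
    rw [flat_zero]
    exact integrableOn_height_rpow (by simp [weightExp]; linarith) 1)).2.2
  -- A property valid for almost every radius in (0, 1) holds for at least one.
  have h2 : ∃ ρ ∈ Ioo (0 : ℝ) 1, IntegrableOn (fun θ : sphere (0 : Space n) 1 =>
      weight s (flat (0 : Flat n) + ρ • (θ : Space n))) {θ | 0 < height (θ : Space n)}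
      (volume : Measure (Space n)).toSphere := by
    by_contra hcon
    push Not at hcon
    have h3 : ∀ᵐ ρ : ℝ, ρ ∉ Ioo (0 : ℝ) 1 := by
      filter_upwards [h] with ρ hρ hmem
      exact hcon ρ hmem (hρ hmem)
    rw [ae_iff] at h3
    have h4 : volume (Ioo (0 : ℝ) 1) = 0 := by
      convert h3 using 2; ext; simp
    simp at h4
  obtain ⟨ρ, hρ, hi⟩ := h2
  have h4 := hi.const_mul ((ρ ^ weightExp s)⁻¹)
  refine IntegrableOn.congr_fun h4 (fun θ hθ => ?_) measurableSet_upperSphere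
  have h5 : 0 < ρ ^ weightExp s := Real.rpow_pos_of_pos hρ.1 _
  rw [weight_smul hρ.1.le _ (le_of_lt hθ), ← mul_assoc, inv_mul_cancel₀ h5.ne', one_mul]

theorem isFiniteMeasure_wsphere {s : ℝ} (hs : s < 1) : IsFiniteMeasure (wsphere n s) := by
  refine ⟨?_⟩
  rw [wsphere, withDensity_apply _ MeasurableSet.univ, Measure.restrict_univ]
  exact (integrableOn_weight_upperSphere hs).lintegral_lt_top

theorem ae_wsphere_pos (s : ℝ) : ∀ᵐ θ : sphere (0 : Space n) 1 ∂wsphere n s, 0 < height (θ : Space n) := by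
  rw [wsphere]
  refine (withDensity_absolutelyContinuous _ _).ae_le ?_
  filter_upwards [ae_restrict_mem measurableSet_upperSphere] with θ hθ using hθ

/-- Weighted integrals over half spheres in terms of the measure `y^a dσ` on the unit sphere. -/
theorem halfSphereIntegral_weight {s ρ : ℝ} (hρ : 0 < ρ) (x₀ : Flat n)
    (F : Space n → Space n → ℝ) :
    halfSphereIntegral x₀ ρ (fun X ν => weight s X * F X ν) =
      ρ ^ ((n : ℝ) + weightExp s) * ∫ θ, F (flat x₀ + ρ • (θ : Space n)) θ ∂wsphere n s := by
  rw [halfSphereIntegral, integral_wsphere, Real.rpow_add hρ, Real.rpow_natCast, mul_assoc]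
  congr 1
  rw [← integral_const_mul]
  refine setIntegral_congr_fun measurableSet_upperSphere fun θ hθ => ?_
  rw [weight_smul hρ.le _ (le_of_lt hθ), mul_assoc]

end WeightedSphere

/-! ### Spherical means of squares and the radial flux -/

section SphereMean

variable {n : ℕ}

/-- The normalized integral of `v²` over the half sphere of radius `r`. -/
def sphereMean (s : ℝ) (v : Space n → ℝ) (x₀ : Flat n) (r : ℝ) : ℝ :=
  ∫ θ, v (flat x₀ + r • (θ : Space n)) ^ 2 ∂wsphere n s

/-- The boundary flux `∫_{∂⁺B_r⁺} y^a v ∂_r v dσ`. -/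
def radialFlux (s : ℝ) (v : Space n → ℝ) (g : Space n → Space n) (x₀ : Flat n) (r : ℝ) : ℝ :=
  halfSphereIntegral x₀ r fun X ν => weight s X * (v X * ⟪g X, ν⟫)

/-- The outer unit normal of the spheres centered at `(x₀, 0)`. -/
def normalDir (x₀ : Flat n) (X : Space n) : Space n := ‖X - flat x₀‖⁻¹ • (X - flat x₀)

theorem measurable_normalDir (x₀ : Flat n) : Measurable (normalDir x₀) := by
  unfold normalDir; fun_prop

theorem norm_normalDir_le (x₀ : Flat n) (X : Space n) : ‖normalDir x₀ X‖ ≤ 1 := by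
  rw [normalDir, norm_smul, norm_inv, norm_norm]
  exact inv_mul_le_one

theorem memLp_normalDir {s : ℝ} (hs : s < 1) (x₀ : Flat n) (ρ : ℝ) :
    MemLp (normalDir x₀) 2 ((wvol n s).restrict (ball 0 ρ)) := by
  have : IsFiniteMeasure ((wvol n s).restrict (ball 0 ρ)) :=
    ⟨by rw [Measure.restrict_apply_univ]; exact wvol_ball_lt_top hs 0 ρ⟩
  exact MemLp.of_bound (measurable_normalDir x₀).aestronglyMeasurable 1
    (Eventually.of_forall (norm_normalDir_le x₀))

theorem norm_smul_sphere (θ : sphere (0 : Space n) 1) {r : ℝ} (hr : 0 ≤ r) :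
    ‖r • (θ : Space n)‖ = r := by
  rw [norm_smul, Real.norm_of_nonneg hr]; simp

theorem mem_closedUpper_of_sphere {x₀ : Flat n} {r ρ : ℝ} (hr : 0 ≤ r) (h : ‖x₀‖ + r < ρ)
    {θ : sphere (0 : Space n) 1} (hθ : 0 ≤ height (θ : Space n)) :
    flat x₀ + r • (θ : Space n) ∈ closedUpper n ρ := by
  refine ⟨(norm_add_le _ _).trans_lt ?_, ?_⟩
  · rw [norm_flat, norm_smul_sphere θ hr]; exact h
  · rw [height_add, height_flat, height_smul, zero_add]
    exact mul_nonneg hr hθ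

theorem ball_flat_subset {x₀ : Flat n} {r ρ : ℝ} (h : ‖x₀‖ + r ≤ ρ) :
    ball (flat x₀) r ⊆ ball 0 ρ := by
  refine ball_subset_ball' ?_
  rw [dist_zero_right, norm_flat]; linarith

/-- The radial density `2 |X - X₀|^{-(n+a)}` on an annulus. -/
def annulusKernel (s : ℝ) (x₀ : Flat n) (r₁ r₂ : ℝ) (X : Space n) : ℝ :=
  (Ico r₁ r₂).indicator (fun ρ => 2 * ρ ^ (-((n : ℝ) + weightExp s))) ‖X - flat x₀‖

theorem measurable_annulusKernel (s : ℝ) (x₀ : Flat n) (r₁ r₂ : ℝ) :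
    Measurable (annulusKernel s x₀ r₁ r₂) := by
  unfold annulusKernel
  have : Measurable ((Ico r₁ r₂).indicator fun ρ : ℝ => 2 * ρ ^ (-((n : ℝ) + weightExp s))) :=
    Measurable.indicator (by fun_prop) measurableSet_Ico
  exact this.comp (by fun_prop)

theorem exists_bound_annulusKernel (s : ℝ) (x₀ : Flat n) {r₁ : ℝ} (hr₁ : 0 < r₁) (r₂ : ℝ) :
    ∃ B, 0 ≤ B ∧ ∀ X, |annulusKernel s x₀ r₁ r₂ X| ≤ B := by
  have hc : ContinuousOn (fun ρ : ℝ => 2 * ρ ^ (-((n : ℝ) + weightExp s))) (Icc r₁ r₂) := by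
    refine continuousOn_const.mul (ContinuousOn.rpow_const continuousOn_id fun x hx => Or.inl ?_)
    exact (hr₁.trans_le hx.1).ne'
  obtain ⟨B, hB⟩ := isCompact_Icc.exists_bound_of_continuousOn hc
  refine ⟨max B 0, le_max_right _ _, fun X => ?_⟩
  unfold annulusKernel
  by_cases h : ‖X - flat x₀‖ ∈ Ico r₁ r₂
  · rw [indicator_of_mem h]
    exact (hB _ (Ico_subset_Icc_self h)).trans (le_max_left _ _)
  · rw [indicator_of_notMem h, abs_zero]; exact le_max_right _ _

/-- Gradients converge only in volume integrals and not on individual spheres. The flux integrated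
over radii is therefore written as a volume integral over an annulus, in a form that survives the
approximation. -/
theorem integral_annulusKernel {s : ℝ} {x₀ : Flat n} {r₁ r₂ ρ : ℝ} (hr₁ : 0 < r₁) (hr : r₁ ≤ r₂)
    (hρ : ‖x₀‖ + r₂ ≤ ρ) {v : Space n → ℝ} {g : Space n → Space n}
    (hint : Integrable (fun X => annulusKernel s x₀ r₁ r₂ X * v X * ⟪g X, normalDir x₀ X⟫)
      ((wvol n s).restrict (ball 0 ρ))) :
    IntervalIntegrable (fun t => 2 * t ^ (-((n : ℝ) + weightExp s)) * radialFlux s v g x₀ t)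
      volume r₁ r₂ ∧
    ∫ X, annulusKernel s x₀ r₁ r₂ X * v X * ⟪g X, normalDir x₀ X⟫ ∂(wvol n s).restrict (ball 0 ρ) =
      ∫ t in r₁..r₂, 2 * t ^ (-((n : ℝ) + weightExp s)) * radialFlux s v g x₀ t := by
  set K : ℝ → ℝ := (Ico r₁ r₂).indicator fun ρ => 2 * ρ ^ (-((n : ℝ) + weightExp s)) with hK
  have hsub := ball_flat_subset hρ
  have hmb : MeasurableSet (ball (flat x₀ : Space n) r₂) := measurableSet_ball
  have h1 : ∫ X in ball 0 ρ, annulusKernel s x₀ r₁ r₂ X * v X * ⟪g X, normalDir x₀ X⟫ ∂wvol n s =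
      ∫ X in ball (flat x₀) r₂, annulusKernel s x₀ r₁ r₂ X * v X * ⟪g X, normalDir x₀ X⟫
        ∂wvol n s := by
    refine setIntegral_eq_of_subset_of_forall_sdiff_eq_zero measurableSet_ball hsub fun X hX => ?_
    have : ‖X - flat x₀‖ ∉ Ico r₁ r₂ := fun h => hX.2 (by rw [mem_ball, dist_eq_norm]; exact h.2)
    rw [annulusKernel, indicator_of_notMem this]; simp
  have h2 : IntegrableOn (fun X => annulusKernel s x₀ r₁ r₂ X * v X * ⟪g X, normalDir x₀ X⟫)
      (ball (flat x₀) r₂) (wvol n s) := IntegrableOn.mono_set hint hsub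
  rw [integrableOn_wvol s _ hmb] at h2
  obtain ⟨p1, p2, -⟩ := polar_halfBall x₀ (R := r₂)
    (fun X ν => weight s X * (annulusKernel s x₀ r₁ r₂ X * v X * ⟪g X, ν⟫)) h2
  have hval : ∀ t ∈ Ioo 0 r₂, halfSphereIntegral x₀ t (fun X ν =>
      weight s X * (annulusKernel s x₀ r₁ r₂ X * v X * ⟪g X, ν⟫)) =
      (Ico r₁ r₂).indicator
        (fun t => 2 * t ^ (-((n : ℝ) + weightExp s)) * radialFlux s v g x₀ t) t := by
    intro t ht
    have h3 : halfSphereIntegral x₀ t (fun X ν =>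
      weight s X * (annulusKernel s x₀ r₁ r₂ X * v X * ⟪g X, ν⟫)) =
      K t * radialFlux s v g x₀ t := by
      rw [radialFlux, halfSphereIntegral_weight ht.1, halfSphereIntegral_weight ht.1,
        mul_left_comm (K t)]
      congr 1
      rw [← integral_const_mul]
      refine integral_congr_ae (Eventually.of_forall fun θ => ?_)
      have : annulusKernel s x₀ r₁ r₂ (flat x₀ + t • (θ : Space n)) = K t := by
        rw [annulusKernel, add_sub_cancel_left, norm_smul_sphere θ ht.1.le]
      simp only [this]; ring
    rw [h3, hK]
    by_cases h : t ∈ Ico r₁ r₂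
    · rw [indicator_of_mem h, indicator_of_mem h]
    · rw [indicator_of_notMem h, indicator_of_notMem h, zero_mul]
  have hinter : Ioo 0 r₂ ∩ Ico r₁ r₂ = Ico r₁ r₂ := by
    refine inter_eq_right.2 fun t ht => ⟨hr₁.trans_le ht.1, ht.2⟩
  constructor
  · rw [intervalIntegrable_iff_integrableOn_Ico_of_le hr]
    have h4 := p1.congr_fun hval measurableSet_Ioo
    rw [IntegrableOn, integrable_indicator_iff measurableSet_Ico, IntegrableOn,
      Measure.restrict_restrict measurableSet_Ico, inter_comm, hinter] at h4
    exact h4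
  · rw [h1, setIntegral_wvol s _ hmb, ← halfBall_eq]
    refine (p2 r₂ le_rfl).trans ?_
    rw [setIntegral_congr_fun measurableSet_Ioo hval, setIntegral_indicator measurableSet_Ico,
      hinter, intervalIntegral.integral_of_le hr, integral_Ico_eq_integral_Ioo,
      integral_Ioc_eq_integral_Ioo]

/-- The fundamental theorem of calculus for w² along each ray, followed by Fubini over the sphere.
The radial power cancels the surface factor contained in the flux. -/
theorem sphereMean_sub_smooth {s : ℝ} (hs : s < 1) (x₀ : Flat n) {r₁ r₂ : ℝ} (hr₁ : 0 < r₁)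
    (hr : r₁ ≤ r₂) {w : Space n → ℝ} (hw : ContDiff ℝ ∞ w) :
    sphereMean s w x₀ r₂ - sphereMean s w x₀ r₁ =
      ∫ t in r₁..r₂, 2 * t ^ (-((n : ℝ) + weightExp s)) * radialFlux s w (gradient w) x₀ t := by
  have := isFiniteMeasure_wsphere (n := n) hs
  have hgc := continuous_gradient hw
  set f : ℝ → sphere (0 : Space n) 1 → ℝ := fun t θ =>
    2 * (w (flat x₀ + t • (θ : Space n)) * ⟪gradient w (flat x₀ + t • (θ : Space n)), (θ : Space n)⟫)
    with hf
  have hfc : Continuous fun q : ℝ × sphere (0 : Space n) 1 => f q.1 q.2 := by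
    have hwc := hw.continuous
    have h1 : Continuous fun q : ℝ × sphere (0 : Space n) 1 => flat x₀ + q.1 • (q.2 : Space n) := by
      fun_prop
    exact continuous_const.mul ((hwc.comp h1).mul
      ((hgc.comp h1).inner (continuous_subtype_val.comp continuous_snd)))
  have e1 : ∀ t ∈ Ioc r₁ r₂, 2 * t ^ (-((n : ℝ) + weightExp s)) * radialFlux s w (gradient w) x₀ t =
      ∫ θ, f t θ ∂wsphere n s := by
    intro t ht
    have ht0 : 0 < t := hr₁.trans ht.1
    have h1 : t ^ (-((n : ℝ) + weightExp s)) * t ^ ((n : ℝ) + weightExp s) = 1 := by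
      rw [← Real.rpow_add ht0, neg_add_cancel, Real.rpow_zero]
    have h2 : ∫ θ, f t θ ∂wsphere n s = 2 * ∫ θ : sphere (0 : Space n) 1,
        w (flat x₀ + t • (θ : Space n)) * ⟪gradient w (flat x₀ + t • (θ : Space n)), (θ : Space n)⟫
          ∂wsphere n s := integral_const_mul _ _
    rw [h2, radialFlux, halfSphereIntegral_weight ht0, mul_assoc 2, ← mul_assoc (t ^ _), h1, one_mul]
  have hint : Integrable (fun q : ℝ × sphere (0 : Space n) 1 => f q.1 q.2)
      ((volume.restrict (Ioc r₁ r₂)).prod (wsphere n s)) := by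
    have hcpt : IsCompact (Icc r₁ r₂ ×ˢ (univ : Set (sphere (0 : Space n) 1))) :=
      isCompact_Icc.prod isCompact_univ
    obtain ⟨B, hB⟩ := hcpt.exists_bound_of_continuousOn hfc.continuousOn
    refine Integrable.of_bound hfc.aestronglyMeasurable B ?_
    have : ∀ᵐ q : ℝ × sphere (0 : Space n) 1 ∂((volume.restrict (Ioc r₁ r₂)).prod (wsphere n s)),
        q.1 ∈ Ioc r₁ r₂ :=
      Measure.quasiMeasurePreserving_fst.ae (ae_restrict_mem measurableSet_Ioc)
    filter_upwards [this] with q hq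
    exact hB q ⟨Ioc_subset_Icc_self hq, mem_univ _⟩
  rw [intervalIntegral.integral_of_le hr, setIntegral_congr_fun measurableSet_Ioc e1,
    integral_integral_swap hint]
  have e2 : ∀ θ : sphere (0 : Space n) 1, ∫ t in Ioc r₁ r₂, f t θ =
      w (flat x₀ + r₂ • (θ : Space n)) ^ 2 - w (flat x₀ + r₁ • (θ : Space n)) ^ 2 := by
    intro θ
    rw [← intervalIntegral.integral_of_le hr]
    refine intervalIntegral.integral_eq_sub_of_hasDerivAt
      (f := fun t => w (flat x₀ + t • (θ : Space n)) ^ 2) (fun t _ => ?_) ?_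
    · have h1 : HasDerivAt (fun t : ℝ => flat x₀ + t • (θ : Space n)) (θ : Space n) t := by
        simpa using ((hasDerivAt_id t).smul_const (θ : Space n)).const_add (flat x₀)
      have h2 := ((hw.differentiable (by simp) _).hasFDerivAt.comp_hasDerivAt t h1).pow 2
      refine h2.congr_deriv ?_
      rw [hf]
      simp only [inner_gradient, Function.comp_apply]
      simp; ring
    · exact (hfc.comp (by fun_prop : Continuous fun t : ℝ => (t, θ))).intervalIntegrable _ _
  simp_rw [e2]
  have hi : ∀ r : ℝ, Integrable (fun θ : sphere (0 : Space n) 1 =>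
      w (flat x₀ + r • (θ : Space n)) ^ 2) (wsphere n s) := by
    intro r
    have hc : Continuous fun θ : sphere (0 : Space n) 1 => w (flat x₀ + r • (θ : Space n)) ^ 2 := by
      have := hw.continuous
      fun_prop
    obtain ⟨B, hB⟩ := isCompact_univ.exists_bound_of_continuousOn hc.continuousOn
    exact Integrable.of_bound hc.aestronglyMeasurable B (Eventually.of_forall fun θ => hB θ trivial)
  rw [integral_sub (hi r₂) (hi r₁)]
  rfl

/-- Smooth approximations together with the bounds needed for passing to the limit. -/
structure IsApprox (s ρ : ℝ) (v : Space n → ℝ) (g : Space n → Space n) (w : ℕ → Space n → ℝ) :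
    Prop where
  contDiff : ∀ j, ContDiff ℝ ∞ (w j)
  unif : TendstoUniformlyOn w v atTop (closedUpper n ρ)
  tendsto_grad : Tendsto (fun j => eLpNorm (fun X => gradient (w j) X - g X) 2
    ((wvol n s).restrict (ball 0 ρ))) atTop (𝓝 0)
  bound : ∃ B, 0 ≤ B ∧ (∀ X ∈ closedUpper n ρ, |v X| ≤ B) ∧
    ∀ᶠ j in atTop, ∀ X ∈ closedUpper n ρ, |w j X| ≤ B

theorem exists_isApprox {s : ℝ} (hs₀ : 0 < s) (hs₁ : s < 1) {v : Space n → ℝ}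
    {g : Space n → Space n} (hv : ContinuousOn v (closedUpper n 1))
    (hg : IsWeightedSobolevLoc s v g) {ρ : ℝ} (hρ₀ : 0 < ρ) (hρ₁ : ρ < 1) :
    ∃ w : ℕ → Space n → ℝ, IsApprox s ρ v g w := by
  obtain ⟨w, h1, h2, h3⟩ := exists_smooth_approx hs₀ hs₁ hv hg hρ₀ hρ₁
  obtain ⟨B, hB0, hB⟩ := exists_bound_closedUpper hv hρ₁
  refine ⟨w, h1, h2, h3, B + 1, by linarith, fun X hX => (hB X hX).trans (by linarith), ?_⟩
  filter_upwards [Metric.tendstoUniformlyOn_iff.1 h2 1 one_pos] with j hj X hX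
  have h4 := hj X hX
  rw [Real.dist_eq] at h4
  have h5 := hB X hX
  rw [abs_le] at h5 ⊢
  rw [abs_lt] at h4
  constructor <;> linarith [h5.1, h5.2, h4.1, h4.2]

theorem IsApprox.tendsto {s ρ : ℝ} {v : Space n → ℝ} {g : Space n → Space n}
    {w : ℕ → Space n → ℝ} (hw : IsApprox s ρ v g w) {X : Space n} (hX : X ∈ closedUpper n ρ) :
    Tendsto (fun j => w j X) atTop (𝓝 (v X)) :=
  hw.unif.tendsto_at hX

theorem integrable_inner_of_memLp {α F : Type*} [MeasurableSpace α] {μ : Measure α}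
    [NormedAddCommGroup F] [InnerProductSpace ℝ F] {p q : α → F} (hp : MemLp p 2 μ)
    (hq : MemLp q 2 μ) : Integrable (fun x => ⟪p x, q x⟫) μ := by
  have := (hp.norm.integrable_mul hq.norm)
  refine Integrable.mono' this (hp.aestronglyMeasurable.inner hq.aestronglyMeasurable) ?_
  exact Eventually.of_forall fun x => norm_inner_le_norm _ _

theorem aestronglyMeasurable_wvol_of_sobolev {s : ℝ} {v : Space n → ℝ} {g : Space n → Space n}
    (hg : IsWeightedSobolevLoc s v g) {ρ : ℝ} (hρ : ρ ≤ 1) :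
    AEStronglyMeasurable v ((wvol n s).restrict (ball 0 ρ)) :=
  hg.aestronglyMeasurable.mono_ac (wvol_restrict_ball_ac s hρ)

theorem ae_mem_closedUpper (s ρ : ℝ) :
    ∀ᵐ X ∂(wvol n s).restrict (ball 0 ρ), X ∈ closedUpper n ρ := by
  filter_upwards [ae_wvol_pos s (ball 0 ρ) measurableSet_ball] with X hX
  exact ⟨mem_ball_zero_iff.1 hX.1, hX.2.le⟩

/-- The normalized spherical integral of `v²` is the integral of the radial flux. -/
theorem sphereMean_sub {s : ℝ} (hs₀ : 0 < s) (hs₁ : s < 1) {v : Space n → ℝ}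
    {g : Space n → Space n} (hv : ContinuousOn v (closedUpper n 1))
    (hg : IsWeightedSobolevLoc s v g) {x₀ : Flat n} {r₁ r₂ : ℝ} (hr₁ : 0 < r₁) (hr : r₁ ≤ r₂)
    (hr₂ : ‖x₀‖ + r₂ < 1) :
    IntervalIntegrable (fun t => 2 * t ^ (-((n : ℝ) + weightExp s)) * radialFlux s v g x₀ t)
      volume r₁ r₂ ∧
    sphereMean s v x₀ r₂ - sphereMean s v x₀ r₁ =
      ∫ t in r₁..r₂, 2 * t ^ (-((n : ℝ) + weightExp s)) * radialFlux s v g x₀ t := by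
  set ρ := (‖x₀‖ + r₂ + 1) / 2 with hρdef
  have hρ1 : ρ < 1 := by rw [hρdef]; linarith
  have hρr : ‖x₀‖ + r₂ < ρ := by rw [hρdef]; linarith
  have hρ0 : 0 < ρ := by have := norm_nonneg x₀; linarith
  obtain ⟨w, hw⟩ := exists_isApprox hs₀ hs₁ hv hg hρ0 hρ1
  obtain ⟨B, hB0, hBv, hBw⟩ := hw.bound
  obtain ⟨Bk, hBk0, hBk⟩ := exists_bound_annulusKernel s x₀ hr₁ r₂
  set μ := (wvol n s).restrict (ball 0 ρ) with hμ
  have : IsFiniteMeasure (wsphere n s) := isFiniteMeasure_wsphere hs₁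
  have hgL := hg.memLp_grad hρ1
  have hnL := memLp_normalDir hs₁ x₀ ρ
  have hwL : ∀ j, MemLp (gradient (w j)) 2 μ := fun j =>
    memLp_of_continuous_ball hs₁ (continuous_gradient (hw.contDiff j)) 2 ρ
  have hKm := (measurable_annulusKernel s x₀ r₁ r₂).aestronglyMeasurable (μ := μ)
  have hlim := tendsto_integral_mul_of_L1 (μ := μ) (B := Bk * B)
    (A := fun j X => ⟪gradient (w j) X, normalDir x₀ X⟫) (A' := fun X => ⟪g X, normalDir x₀ X⟫)
    (b := fun j X => annulusKernel s x₀ r₁ r₂ X * w j X)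
    (b' := fun X => annulusKernel s x₀ r₁ r₂ X * v X)
    (fun j => integrable_inner_of_memLp (hwL j) hnL) (integrable_inner_of_memLp hgL hnL)
    (tendsto_eLpNorm_inner (fun j => (hwL j).1) hgL.1 hnL hw.tendsto_grad)
    (fun j => hKm.mul (hw.contDiff j).continuous.aestronglyMeasurable)
    (by
      filter_upwards [hBw] with j hj
      filter_upwards [ae_mem_closedUpper s ρ] with X hX
      rw [abs_mul]
      exact mul_le_mul (hBk X) (hj X hX) (abs_nonneg _) hBk0)
    (by
      filter_upwards [ae_mem_closedUpper s ρ] with X hX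
      exact (hw.tendsto hX).const_mul _)
  have hvi : Integrable (fun X => annulusKernel s x₀ r₁ r₂ X * v X * ⟪g X, normalDir x₀ X⟫) μ := by
    refine (integrable_inner_of_memLp hgL hnL).bdd_mul (c := Bk * B)
      (hKm.mul (aestronglyMeasurable_wvol_of_sobolev hg hρ1.le)) ?_
    filter_upwards [ae_mem_closedUpper s ρ] with X hX
    rw [norm_mul]
    exact mul_le_mul (hBk X) (hBv X hX) (norm_nonneg _) hBk0
  obtain ⟨i1, i2⟩ := integral_annulusKernel hr₁ hr hρr.le hvi
  refine ⟨i1, ?_⟩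
  rw [← i2]
  -- On a fixed sphere the means converge by the uniform convergence up to {y = 0}; gradients play
  -- no role in this term.
  have hlim2 : ∀ r, 0 ≤ r → ‖x₀‖ + r < ρ →
      Tendsto (fun j => sphereMean s (w j) x₀ r) atTop (𝓝 (sphereMean s v x₀ r)) := by
    intro r hr0 hrρ
    refine tendsto_integral_filter_of_dominated_convergence (fun _ => B ^ 2) ?_ ?_
      (integrable_const _) ?_
    · refine Eventually.of_forall fun j => Continuous.aestronglyMeasurable ?_
      have := (hw.contDiff j).continuous
      fun_prop
    · filter_upwards [hBw] with j hj
      filter_upwards [ae_wsphere_pos s] with θ hθ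
      have := hj _ (mem_closedUpper_of_sphere hr0 hrρ hθ.le)
      rw [norm_pow]
      exact pow_le_pow_left₀ (norm_nonneg _) this 2
    · filter_upwards [ae_wsphere_pos s] with θ hθ
      exact (hw.tendsto (mem_closedUpper_of_sphere hr0 hrρ hθ.le)).pow 2
  have hlim3 := (hlim2 r₂ (by linarith) hρr).sub (hlim2 r₁ hr₁.le (by linarith))
  refine tendsto_nhds_unique hlim3 (hlim.congr fun j => ?_)
  rw [sphereMean_sub_smooth hs₁ x₀ hr₁ hr (hw.contDiff j)]
  refine (integral_annulusKernel hr₁ hr hρr.le ?_).2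
  refine (integrable_inner_of_memLp (hwL j) hnL).bdd_mul (c := Bk * (Classical.choose
    ((isCompact_closedBall (0 : Space n) ρ).exists_bound_of_continuousOn
      (hw.contDiff j).continuous.continuousOn)))
    (hKm.mul (hw.contDiff j).continuous.aestronglyMeasurable) ?_
  filter_upwards [ae_restrict_mem measurableSet_ball] with X hX
  rw [norm_mul]
  exact mul_le_mul (hBk X) (Classical.choose_spec
    ((isCompact_closedBall (0 : Space n) ρ).exists_bound_of_continuousOn
      (hw.contDiff j).continuous.continuousOn) X (ball_subset_closedBall hX)) (norm_nonneg _) hBk0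

end SphereMean

/-! ### Truncations and admissible test functions -/

section Truncation

variable {n : ℕ}

/-- A smooth function vanishing near `0` and equal to the identity far from `0`. -/
def cutId (t : ℝ) : ℝ := t * (1 - (⟨1, 2, one_pos, one_lt_two⟩ : ContDiffBump (0 : ℝ)) t)

theorem contDiff_cutId : ContDiff ℝ ∞ cutId :=
  contDiff_id.mul (contDiff_const.sub (ContDiffBump.contDiff _))

theorem cutId_eq_zero {t : ℝ} (h : |t| ≤ 1) : cutId t = 0 := by
  rw [cutId, ContDiffBump.one_of_mem_closedBall, sub_self, mul_zero]
  simpa [Real.dist_eq] using h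

theorem cutId_eq_self {t : ℝ} (h : 2 ≤ |t|) : cutId t = t := by
  rw [cutId, ContDiffBump.zero_of_le_dist, sub_zero, mul_one]
  simpa [Real.dist_eq] using h

theorem abs_cutId_le (t : ℝ) : |cutId t| ≤ |t| := by
  rw [cutId, abs_mul]
  refine mul_le_of_le_one_right (abs_nonneg _) ?_
  rw [abs_le]
  constructor
  · linarith [ContDiffBump.le_one (⟨1, 2, one_pos, one_lt_two⟩ : ContDiffBump (0 : ℝ)) (x := t)]
  · linarith [ContDiffBump.nonneg (⟨1, 2, one_pos, one_lt_two⟩ : ContDiffBump (0 : ℝ)) (x := t)]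

theorem deriv_cutId_eq_one {t : ℝ} (h : 2 < |t|) : deriv cutId t = 1 := by
  have : cutId =ᶠ[𝓝 t] id := by
    have h1 : ∀ᶠ q in 𝓝 t, 2 < |q| := (continuous_abs.tendsto t).eventually (lt_mem_nhds h)
    filter_upwards [h1] with q hq
    exact cutId_eq_self hq.le
  rw [this.deriv_eq]; simp

theorem deriv_cutId_zero : deriv cutId 0 = 0 := by
  have : cutId =ᶠ[𝓝 0] fun _ => (0 : ℝ) := by
    have h1 : ∀ᶠ q : ℝ in 𝓝 0, |q| < 1 := by
      refine (continuous_abs.tendsto (0 : ℝ)).eventually (gt_mem_nhds ?_)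
      simp
    filter_upwards [h1] with q hq
    exact cutId_eq_zero hq.le
  rw [this.deriv_eq]; simp

theorem exists_bound_deriv_cutId : ∃ C, 1 ≤ C ∧ ∀ t, |deriv cutId t| ≤ C := by
  have hc : Continuous (deriv cutId) := contDiff_cutId.continuous_deriv (by simp)
  obtain ⟨C, hC⟩ := (isCompact_Icc (a := (-2 : ℝ)) (b := 2)).exists_bound_of_continuousOn
    hc.continuousOn
  refine ⟨max C 1, le_max_right _ _, fun t => ?_⟩
  by_cases h : |t| ≤ 2
  · exact (hC t (abs_le.1 h)).trans (le_max_left _ _)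
  · rw [deriv_cutId_eq_one (not_le.1 h), abs_one]; exact le_max_right _ _

/-- Rescaled truncations converging to the identity. -/
def truncId (m : ℕ) (t : ℝ) : ℝ := ((m : ℝ) + 1)⁻¹ * cutId (((m : ℝ) + 1) * t)

theorem contDiff_truncId (m : ℕ) : ContDiff ℝ ∞ (truncId m) :=
  contDiff_const.mul (contDiff_cutId.comp (contDiff_const.mul contDiff_id))

theorem deriv_truncId (m : ℕ) (t : ℝ) : deriv (truncId m) t = deriv cutId (((m : ℝ) + 1) * t) := by
  have hm : (m : ℝ) + 1 ≠ 0 := by positivity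
  have h1 : HasDerivAt cutId (deriv cutId (((m : ℝ) + 1) * t)) (((m : ℝ) + 1) * t) :=
    (contDiff_cutId.differentiable (by simp) _).hasDerivAt
  have h2 : HasDerivAt (fun q : ℝ => ((m : ℝ) + 1) * q) ((m : ℝ) + 1) t := by
    simpa using (hasDerivAt_id t).const_mul ((m : ℝ) + 1)
  have h3 := (h1.comp t h2).const_mul ((m : ℝ) + 1)⁻¹
  refine h3.deriv.trans ?_
  field_simp

theorem abs_truncId_le (m : ℕ) (t : ℝ) : |truncId m t| ≤ |t| := by
  have hm : (0 : ℝ) < (m : ℝ) + 1 := by positivity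
  rw [truncId, abs_mul, abs_of_pos (inv_pos.2 hm), inv_mul_le_iff₀ hm]
  refine (abs_cutId_le _).trans ?_
  rw [abs_mul, abs_of_pos hm]

theorem truncId_eq_zero {m : ℕ} {t : ℝ} (h : |t| ≤ ((m : ℝ) + 1)⁻¹) : truncId m t = 0 := by
  have hm : (0 : ℝ) < (m : ℝ) + 1 := by positivity
  rw [truncId, cutId_eq_zero, mul_zero]
  rw [abs_mul, abs_of_pos hm]
  calc _ ≤ ((m : ℝ) + 1) * ((m : ℝ) + 1)⁻¹ := by gcongr
    _ = 1 := mul_inv_cancel₀ hm.ne'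

theorem eventually_large {t : ℝ} (ht : t ≠ 0) : ∀ᶠ m : ℕ in atTop, 2 < |((m : ℝ) + 1) * t| := by
  have h : Tendsto (fun m : ℕ => ((m : ℝ) + 1) * |t|) atTop atTop :=
    (tendsto_atTop_add_const_right _ _ tendsto_natCast_atTop_atTop).atTop_mul_const (abs_pos.2 ht)
  filter_upwards [h.eventually_gt_atTop 2] with m hm
  rw [abs_mul, abs_of_pos (by positivity)]; exact hm

theorem tendsto_truncId (t : ℝ) : Tendsto (fun m => truncId m t) atTop (𝓝 t) := by
  by_cases ht : t = 0
  · subst ht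
    refine tendsto_const_nhds.congr fun m => ?_
    rw [truncId_eq_zero]; simp; positivity
  · refine tendsto_const_nhds.congr' ?_
    filter_upwards [eventually_large ht] with m hm
    rw [truncId, cutId_eq_self hm.le, inv_mul_cancel_left₀ (by positivity)]

theorem tendsto_deriv_truncId (t : ℝ) :
    Tendsto (fun m => deriv (truncId m) t) atTop (𝓝 (({0}ᶜ : Set ℝ).indicator 1 t)) := by
  by_cases ht : t = 0
  · subst ht
    refine tendsto_const_nhds.congr fun m => ?_
    rw [deriv_truncId, mul_zero, deriv_cutId_zero]; simp
  · refine tendsto_const_nhds.congr' ?_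
    filter_upwards [eventually_large ht] with m hm
    rw [deriv_truncId, deriv_cutId_eq_one hm, indicator_of_mem (by simpa using ht)]; rfl

theorem continuousOn_trace {v : Space n → ℝ} {ρ : ℝ} (hv : ContinuousOn v (closedUpper n ρ)) :
    ContinuousOn (fun x : Flat n => v (flat x)) (ball 0 ρ) := by
  refine hv.comp continuous_flat.continuousOn fun x hx => ?_
  exact ⟨by rw [norm_flat]; exact mem_ball_zero_iff.1 hx, (height_flat x).ge⟩

theorem flat_mem_closedUpper {x : Flat n} {ρ : ℝ} (h : ‖x‖ < ρ) : flat x ∈ closedUpper n ρ :=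
  ⟨by rwa [norm_flat], (height_flat x).ge⟩

theorem memLp_compactSupport_gradient {s : ℝ} (hs : s < 1) {ζ : Space n → ℝ} (hζ : ContDiff ℝ ∞ ζ)
    (ρ : ℝ) : MemLp (gradient ζ) 2 ((wvol n s).restrict (ball 0 ρ)) :=
  memLp_of_continuous_ball hs (continuous_gradient hζ) 2 ρ

theorem exists_radius {ζ : Space n → ℝ} (h : tsupport ζ ⊆ ball 0 1) :
    ∃ ρ, 0 < ρ ∧ ρ < 1 ∧ tsupport ζ ⊆ ball 0 ρ := by
  obtain ⟨ρ, hρ, h1⟩ := exists_pos_lt_subset_ball one_pos (isClosed_tsupport ζ) h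
  exact ⟨ρ, hρ.1, hρ.2, h1⟩

theorem trace_bounds {v : Space n → ℝ} {f : ℝ → ℝ} (hf : Continuous f) {ρ : ℝ}
    (hv : ContinuousOn v (closedUpper n ρ)) {B : ℝ} (hB : ∀ X ∈ closedUpper n ρ, |v X| ≤ B) :
    IntegrableOn (fun x : Flat n => f (v (flat x))) (ball 0 ρ) := by
  obtain ⟨C, hC⟩ := (isCompact_Icc (a := -B) (b := B)).exists_bound_of_continuousOn hf.continuousOn
  refine IntegrableOn.of_bound measure_ball_lt_top
    ((hf.comp_continuousOn (continuousOn_trace hv)).aestronglyMeasurable measurableSet_ball) C ?_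
  filter_upwards [ae_restrict_mem measurableSet_ball] with x hx
  exact hC _ (abs_le.1 (hB _ (flat_mem_closedUpper (mem_ball_zero_iff.1 hx))))

/-- The weak formulation tested with `ζ S(v)`. -/
theorem IsWeakSolution.test_comp {s : ℝ} (hs₁ : s < 1) {v : Space n → ℝ}
    {g : Space n → Space n} {f : ℝ → ℝ} (hf : Continuous f) (hsol : IsWeakSolution s f v g)
    (hv : ContinuousOn v (closedUpper n 1)) (hg : IsWeightedSobolevLoc s v g)
    {ζ : Space n → ℝ} (hζ : ContDiff ℝ ∞ ζ) (hζc : HasCompactSupport ζ) {ρ : ℝ} (hρ₁ : ρ < 1)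
    (hζρ : tsupport ζ ⊆ ball 0 ρ) {w : ℕ → Space n → ℝ} (hw : IsApprox s ρ v g w)
    {S : ℝ → ℝ} (hS : ContDiff ℝ ∞ S)
    (hadm : ∀ᶠ j in atTop, ∀ x : Flat n, flat x ∈ tsupport (fun X => ζ X * S (w j X)) →
      v (flat x) ≠ 0) :
    Integrable (fun X => S (v X) * ⟪gradient ζ X, g X⟫) ((wvol n s).restrict (ball 0 ρ)) ∧
    Integrable (fun X => ζ X * deriv S (v X) * ⟪g X, g X⟫) ((wvol n s).restrict (ball 0 ρ)) ∧
    ∫ X, S (v X) * ⟪gradient ζ X, g X⟫ ∂(wvol n s).restrict (ball 0 ρ) +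
      ∫ X, ζ X * deriv S (v X) * ⟪g X, g X⟫ ∂(wvol n s).restrict (ball 0 ρ) =
    ∫ x in ball (0 : Flat n) ρ, S (v (flat x)) * (f (v (flat x)) * ζ (flat x)) := by
  obtain ⟨B, hB0, hBv, hBw⟩ := hw.bound
  set μ := (wvol n s).restrict (ball 0 ρ) with hμ
  have hgL := hg.memLp_grad hρ₁
  have hwL : ∀ j, MemLp (gradient (w j)) 2 μ := fun j =>
    memLp_of_continuous_ball hs₁ (continuous_gradient (hw.contDiff j)) 2 ρ
  have hζL := memLp_compactSupport_gradient hs₁ hζ ρ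
  have hSd : Continuous (deriv S) := hS.continuous_deriv (by simp)
  have hvm := aestronglyMeasurable_wvol_of_sobolev hg hρ₁.le
  obtain ⟨C, hC⟩ := (isCompact_Icc (a := -B) (b := B)).exists_bound_of_continuousOn
    hS.continuous.continuousOn
  obtain ⟨C', hC'⟩ := (isCompact_Icc (a := -B) (b := B)).exists_bound_of_continuousOn
    hSd.continuousOn
  obtain ⟨Z, hZ⟩ := hζc.exists_bound_of_continuous hζ.continuous
  have hZ0 : 0 ≤ Z := (norm_nonneg _).trans (hZ 0)
  have i1 := integrable_inner_of_memLp hζL hgL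
  have i2 := integrable_inner_of_memLp hgL hgL
  -- Three limits as j tends to infinity. The factors S(w_j) and S'(w_j) are bounded and converge
  -- pointwise, while the gradients converge in weighted L².
  have l1 := tendsto_integral_mul_of_L1 (μ := μ) (B := C)
    (A := fun _ X => ⟪gradient ζ X, g X⟫) (A' := fun X => ⟪gradient ζ X, g X⟫)
    (b := fun j X => S (w j X)) (b' := fun X => S (v X)) (fun _ => i1) i1
    (by simp)
    (fun j => (hS.continuous.comp (hw.contDiff j).continuous).aestronglyMeasurable)
    (by
      filter_upwards [hBw] with j hj
      filter_upwards [ae_mem_closedUpper s ρ] with X hX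
      exact hC _ (abs_le.1 (hj X hX)))
    (by
      filter_upwards [ae_mem_closedUpper s ρ] with X hX
      exact (hS.continuous.tendsto _).comp (hw.tendsto hX))
  have l2 := tendsto_integral_mul_of_L1 (μ := μ) (B := Z * C')
    (A := fun j X => ⟪gradient (w j) X, g X⟫) (A' := fun X => ⟪g X, g X⟫)
    (b := fun j X => ζ X * deriv S (w j X)) (b' := fun X => ζ X * deriv S (v X))
    (fun j => integrable_inner_of_memLp (hwL j) hgL) i2
    (tendsto_eLpNorm_inner (fun j => (hwL j).1) hgL.1 hgL hw.tendsto_grad)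
    (fun j => (hζ.continuous.mul (hSd.comp (hw.contDiff j).continuous)).aestronglyMeasurable)
    (by
      filter_upwards [hBw] with j hj
      filter_upwards [ae_mem_closedUpper s ρ] with X hX
      rw [abs_mul]
      exact mul_le_mul (hZ X) (hC' _ (abs_le.1 (hj X hX))) (abs_nonneg _) hZ0)
    (by
      filter_upwards [ae_mem_closedUpper s ρ] with X hX
      exact ((hSd.tendsto _).comp (hw.tendsto hX)).const_mul _)
  have hvρ := hv.mono (closedUpper_mono hρ₁.le)
  have i3 : IntegrableOn (fun x : Flat n => f (v (flat x)) * ζ (flat x)) (ball 0 ρ) := by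
    refine Integrable.mul_bdd (c := Z) (trace_bounds hf hvρ hBv)
      (hζ.continuous.comp continuous_flat).aestronglyMeasurable ?_
    exact Eventually.of_forall fun x => hZ _
  have l3 := tendsto_integral_mul_of_L1 (μ := volume.restrict (ball (0 : Flat n) ρ)) (B := C)
    (A := fun _ x => f (v (flat x)) * ζ (flat x)) (A' := fun x => f (v (flat x)) * ζ (flat x))
    (b := fun j x => S (w j (flat x))) (b' := fun x => S (v (flat x))) (fun _ => i3) i3
    (by simp)
    (fun j => ((hS.continuous.comp (hw.contDiff j).continuous).comp
      continuous_flat).aestronglyMeasurable)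
    (by
      filter_upwards [hBw] with j hj
      filter_upwards [ae_restrict_mem measurableSet_ball] with x hx
      exact hC _ (abs_le.1 (hj _ (flat_mem_closedUpper (mem_ball_zero_iff.1 hx)))))
    (by
      filter_upwards [ae_restrict_mem measurableSet_ball] with x hx
      exact (hS.continuous.tendsto _).comp
        (hw.tendsto (flat_mem_closedUpper (mem_ball_zero_iff.1 hx))))
  refine ⟨?_, ?_, tendsto_nhds_unique (l1.add l2) (l3.congr' ?_)⟩
  · refine i1.bdd_mul (c := C) (hS.continuous.comp_aestronglyMeasurable hvm) ?_
    filter_upwards [ae_mem_closedUpper s ρ] with X hX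
    exact hC _ (abs_le.1 (hBv X hX))
  · refine i2.bdd_mul (c := Z * C') (hζ.continuous.aestronglyMeasurable.mul
      (hSd.comp_aestronglyMeasurable hvm)) ?_
    filter_upwards [ae_mem_closedUpper s ρ] with X hX
    rw [norm_mul]
    exact mul_le_mul (hZ X) (hC' _ (abs_le.1 (hBv X hX))) (norm_nonneg _) hZ0
  -- For large j the product ζ S(w_j) is smooth and admissible; expanding its derivative identifies
  -- the weak formulation with the approximating identity.
  filter_upwards [hadm, hBw] with j hj hjB
  set φ : Space n → ℝ := fun X => ζ X * S (w j X) with hφ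
  have hsupp : tsupport φ ⊆ tsupport ζ := tsupport_mul_subset_left
  have hφd : ContDiff ℝ ∞ φ := hζ.mul (hS.comp (hw.contDiff j))
  have key := hsol φ hφd hζc.mul_right
    (hsupp.trans (hζρ.trans (ball_subset_ball hρ₁.le))) hj
  have hder : ∀ X, fderiv ℝ φ X (g X) = S (w j X) * ⟪gradient ζ X, g X⟫ +
      ζ X * deriv S (w j X) * ⟪gradient (w j) X, g X⟫ := by
    intro X
    have d1 := (hζ.differentiable (by simp) X).hasFDerivAt
    have d2 := ((hS.differentiable (by simp) (w j X)).hasDerivAt).comp_hasFDerivAt X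
      ((hw.contDiff j).differentiable (by simp) X).hasFDerivAt
    have d3 := (d1.mul d2).fderiv
    have d4 : fderiv ℝ φ X = fderiv ℝ (ζ * S ∘ w j) X := rfl
    rw [d4, d3, inner_gradient, inner_gradient]
    simp only [add_apply, FunLike.coe_smul, Pi.smul_apply, smul_eq_mul, Function.comp_apply]
    ring
  have hR : ∫ x in ball (0 : Flat n) ρ, S (w j (flat x)) * (f (v (flat x)) * ζ (flat x)) =
      ∫ x in ball (0 : Flat n) 1, f (v (flat x)) * φ (flat x) := by
    rw [setIntegral_eq_of_subset_of_forall_sdiff_eq_zero (s := ball (0 : Flat n) ρ) (t := ball 0 1)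
      measurableSet_ball (ball_subset_ball hρ₁.le)]
    · refine integral_congr_ae (Eventually.of_forall fun x => ?_)
      simp only [hφ]; ring
    · intro x hx
      have : ζ (flat x) = 0 := by
        by_contra h
        have := hζρ (subset_tsupport ζ h)
        rw [mem_ball_zero_iff, norm_flat] at this
        exact hx.2 (mem_ball_zero_iff.2 this)
      simp [hφ, this]
  have hL : ∫ X in halfBall 0 1, weight s X * fderiv ℝ φ X (g X) =
      ∫ X, fderiv ℝ φ X (g X) ∂μ := by
    rw [halfBall_eq, ← setIntegral_wvol s _ measurableSet_ball]
    refine setIntegral_eq_of_subset_of_forall_sdiff_eq_zero measurableSet_ball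
      (ball_subset_ball hρ₁.le) fun X hX => ?_
    have : X ∉ tsupport φ := fun h => hX.2 (hζρ (hsupp h))
    have h0 : fderiv ℝ φ X = 0 := by
      by_contra h
      exact this (tsupport_fderiv_subset ℝ (subset_tsupport _ h))
    simp [h0]
  rw [hR, ← key, hL, ← integral_add]
  · exact integral_congr_ae (Eventually.of_forall fun X => hder X)
  · refine i1.bdd_mul (c := C)
      (hS.continuous.comp (hw.contDiff j).continuous).aestronglyMeasurable ?_
    filter_upwards [ae_mem_closedUpper s ρ] with X hX
    exact hC _ (abs_le.1 (hjB X hX))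
  · refine (integrable_inner_of_memLp (hwL j) hgL).bdd_mul (c := Z * C')
      (hζ.continuous.mul (hSd.comp (hw.contDiff j).continuous)).aestronglyMeasurable ?_
    filter_upwards [ae_mem_closedUpper s ρ] with X hX
    rw [norm_mul]
    exact mul_le_mul (hZ X) (hC' _ (abs_le.1 (hjB X hX))) (norm_nonneg _) hZ0

end Truncation

/-! ### The energy identity with a cutoff -/

section Testing

variable {n : ℕ}

/-- With ζ supported away from {y = 0} every product ζ w_j is admissible, so no truncation is needed
and the full gradient appears. Comparison with the truncated identity will show that the gradient
vanishes on the zero set. -/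
theorem IsWeakSolution.test_id {s : ℝ} (hs₀ : 0 < s) (hs₁ : s < 1) {v : Space n → ℝ}
    {g : Space n → Space n} {f : ℝ → ℝ} (hf : Continuous f) (hsol : IsWeakSolution s f v g)
    (hv : ContinuousOn v (closedUpper n 1)) (hg : IsWeightedSobolevLoc s v g)
    {ζ : Space n → ℝ} (hζ : ContDiff ℝ ∞ ζ) (hζc : HasCompactSupport ζ) {ρ : ℝ} (hρ₀ : 0 < ρ)
    (hρ₁ : ρ < 1) (hζρ : tsupport ζ ⊆ ball 0 ρ) (hpos : tsupport ζ ⊆ upper n) :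
    ∫ X, v X * ⟪gradient ζ X, g X⟫ ∂(wvol n s).restrict (ball 0 ρ) +
      ∫ X, ζ X * ⟪g X, g X⟫ ∂(wvol n s).restrict (ball 0 ρ) = 0 := by
  obtain ⟨w, hw⟩ := exists_isApprox hs₀ hs₁ hv hg hρ₀ hρ₁
  have hn : ∀ x : Flat n, flat x ∉ tsupport ζ := fun x hx => by
    have : 0 < height (flat x) := hpos hx
    rw [height_flat] at this
    exact lt_irrefl _ this
  have := (hsol.test_comp hs₁ hf hv hg hζ hζc hρ₁ hζρ hw (S := id) contDiff_id
    (Eventually.of_forall fun j x hx => absurd (tsupport_mul_subset_left hx) (hn x))).2.2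
  simp only [id, deriv_id, mul_one] at this
  rw [this]
  refine integral_eq_zero_of_ae (Eventually.of_forall fun x => ?_)
  have : ζ (flat x) = 0 := by
    by_contra h
    exact hn x (subset_tsupport ζ h)
  simp [this]

/-- At a zero of the trace, uniform convergence makes |w_j| smaller than the truncation level, by
continuity even in a neighbourhood; there the truncation vanishes, so the point lies outside the
support. -/
theorem admissible_truncId {s ρ : ℝ} {v : Space n → ℝ} {g : Space n → Space n}
    {w : ℕ → Space n → ℝ} (hw : IsApprox s ρ v g w) {ζ : Space n → ℝ}
    (hζρ : tsupport ζ ⊆ ball 0 ρ) (m : ℕ) :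
    ∀ᶠ j in atTop, ∀ x : Flat n, flat x ∈ tsupport (fun X => ζ X * truncId m (w j X)) →
      v (flat x) ≠ 0 := by
  have hm : (0 : ℝ) < ((m : ℝ) + 1)⁻¹ := by positivity
  filter_upwards [Metric.tendstoUniformlyOn_iff.1 hw.unif _ hm] with j hj x hx h0
  have hx1 : flat x ∈ tsupport ζ := tsupport_mul_subset_left hx
  have h1 := hj (flat x) (flat_mem_closedUpper
    (by have := hζρ hx1; rwa [mem_ball_zero_iff, norm_flat] at this))
  rw [h0, Real.dist_eq, zero_sub, abs_neg] at h1
  have h2 : ∀ᶠ X in 𝓝 (flat x), ζ X * truncId m (w j X) = 0 := by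
    have : ∀ᶠ X in 𝓝 (flat x), |w j X| < ((m : ℝ) + 1)⁻¹ :=
      ((hw.contDiff j).continuous.abs.tendsto _).eventually (gt_mem_nhds h1)
    filter_upwards [this] with X hX
    rw [truncId_eq_zero hX.le, mul_zero]
  exact (notMem_tsupport_iff_eventuallyEq.2 h2) hx

/-- The energy identity with a cutoff, the gradient being restricted to `{v ≠ 0}`. -/
theorem IsWeakSolution.test_indicator {s : ℝ} (hs₀ : 0 < s) (hs₁ : s < 1) {v : Space n → ℝ}
    {g : Space n → Space n} {f : ℝ → ℝ} (hf : Continuous f) (hsol : IsWeakSolution s f v g)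
    (hv : ContinuousOn v (closedUpper n 1)) (hg : IsWeightedSobolevLoc s v g)
    {ζ : Space n → ℝ} (hζ : ContDiff ℝ ∞ ζ) (hζc : HasCompactSupport ζ) {ρ : ℝ} (hρ₀ : 0 < ρ)
    (hρ₁ : ρ < 1) (hζρ : tsupport ζ ⊆ ball 0 ρ) :
    ∫ X, v X * ⟪gradient ζ X, g X⟫ ∂(wvol n s).restrict (ball 0 ρ) +
      ∫ X, ζ X * (({0}ᶜ : Set ℝ).indicator 1 (v X) * ⟪g X, g X⟫)
        ∂(wvol n s).restrict (ball 0 ρ) =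
    ∫ x in ball (0 : Flat n) ρ, v (flat x) * (f (v (flat x)) * ζ (flat x)) := by
  obtain ⟨w, hw⟩ := exists_isApprox hs₀ hs₁ hv hg hρ₀ hρ₁
  obtain ⟨B, hB0, hBv, hBw⟩ := hw.bound
  set μ := (wvol n s).restrict (ball 0 ρ) with hμ
  have hgL := hg.memLp_grad hρ₁
  have hζL := memLp_compactSupport_gradient hs₁ hζ ρ
  have hvm := aestronglyMeasurable_wvol_of_sobolev hg hρ₁.le
  obtain ⟨C, hC1, hC⟩ := exists_bound_deriv_cutId
  obtain ⟨Z, hZ⟩ := hζc.exists_bound_of_continuous hζ.continuous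
  have hZ0 : 0 ≤ Z := (norm_nonneg _).trans (hZ 0)
  have i1 := integrable_inner_of_memLp hζL hgL
  have i2 := integrable_inner_of_memLp hgL hgL
  have hTd : ∀ m, Continuous (deriv (truncId m)) := fun m =>
    (contDiff_truncId m).continuous_deriv (by simp)
  have l1 := tendsto_integral_mul_of_L1 (μ := μ) (B := B)
    (A := fun _ X => ⟪gradient ζ X, g X⟫) (A' := fun X => ⟪gradient ζ X, g X⟫)
    (b := fun m X => truncId m (v X)) (b' := fun X => v X) (fun _ => i1) i1
    (by simp)
    (fun m => (contDiff_truncId m).continuous.comp_aestronglyMeasurable hvm)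
    (Eventually.of_forall fun m => by
      filter_upwards [ae_mem_closedUpper s ρ] with X hX
      exact (abs_truncId_le _ _).trans (hBv X hX))
    (Eventually.of_forall fun X => tendsto_truncId _)
  -- The derivatives of the truncations at 0 vanish for every m and tend to 1 elsewhere, which
  -- produces the indicator of {v ≠ 0}.
  have l2 := tendsto_integral_mul_of_L1 (μ := μ) (B := Z * C)
    (A := fun _ X => ⟪g X, g X⟫) (A' := fun X => ⟪g X, g X⟫)
    (b := fun m X => ζ X * deriv (truncId m) (v X))
    (b' := fun X => ζ X * ({0}ᶜ : Set ℝ).indicator 1 (v X)) (fun _ => i2) i2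
    (by simp)
    (fun m => hζ.continuous.aestronglyMeasurable.mul ((hTd m).comp_aestronglyMeasurable hvm))
    (Eventually.of_forall fun m => by
      refine Eventually.of_forall fun X => ?_
      rw [abs_mul, deriv_truncId]
      exact mul_le_mul (hZ X) (hC _) (abs_nonneg _) hZ0)
    (Eventually.of_forall fun X => (tendsto_deriv_truncId _).const_mul _)
  have i3 : IntegrableOn (fun x : Flat n => f (v (flat x)) * ζ (flat x)) (ball 0 ρ) := by
    refine Integrable.mul_bdd (c := Z) (trace_bounds hf (hv.mono (closedUpper_mono hρ₁.le)) hBv)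
      (hζ.continuous.comp continuous_flat).aestronglyMeasurable ?_
    exact Eventually.of_forall fun x => hZ _
  have l3 := tendsto_integral_mul_of_L1 (μ := volume.restrict (ball (0 : Flat n) ρ)) (B := B)
    (A := fun _ x => f (v (flat x)) * ζ (flat x)) (A' := fun x => f (v (flat x)) * ζ (flat x))
    (b := fun m x => truncId m (v (flat x))) (b' := fun x => v (flat x)) (fun _ => i3) i3
    (by simp)
    (fun m => (contDiff_truncId m).continuous.comp_aestronglyMeasurable
      ((continuousOn_trace (hv.mono (closedUpper_mono hρ₁.le))).aestronglyMeasurable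
        measurableSet_ball))
    (Eventually.of_forall fun m => by
      filter_upwards [ae_restrict_mem measurableSet_ball] with x hx
      exact (abs_truncId_le _ _).trans (hBv _ (flat_mem_closedUpper (mem_ball_zero_iff.1 hx))))
    (Eventually.of_forall fun x => tendsto_truncId _)
  have := tendsto_nhds_unique (l1.add l2) (l3.congr fun m =>
    ((hsol.test_comp hs₁ hf hv hg hζ hζc hρ₁ hζρ hw (contDiff_truncId m)
      (admissible_truncId hw hζρ m)).2.2).symm)
  rw [← this]
  simp only [mul_assoc]

/-- The gradient vanishes almost everywhere on the zero set. -/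
theorem IsWeakSolution.grad_eq_zero {s : ℝ} (hs₀ : 0 < s) (hs₁ : s < 1) {v : Space n → ℝ}
    {g : Space n → Space n} {f : ℝ → ℝ} (hf : Continuous f) (hsol : IsWeakSolution s f v g)
    (hv : ContinuousOn v (closedUpper n 1)) (hg : IsWeightedSobolevLoc s v g) :
    ∀ᵐ X ∂volume.restrict (halfBall (0 : Space n) 1), v X = 0 → g X = 0 := by
  -- The weighted energy density on the zero set; it suffices that its integral against every
  -- interior test function vanishes.
  set Q : Space n → ℝ := fun X => weight s X * (({0} : Set ℝ).indicator 1 (v X) * ⟪g X, g X⟫)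
    with hQ
  have hQm : ∀ ρ < 1, IntegrableOn Q (halfBall (0 : Space n) ρ) := by
    intro ρ hρ
    have hgL := hg.memLp_grad hρ
    have : Integrable (fun X => ({0} : Set ℝ).indicator (1 : ℝ → ℝ) (v X) * ⟪g X, g X⟫)
        ((wvol n s).restrict (ball 0 ρ)) := by
      refine (integrable_inner_of_memLp hgL hgL).bdd_mul (c := 1) ?_
        (Eventually.of_forall fun X => ?_)
      · have h1 : Measurable (({0} : Set ℝ).indicator (1 : ℝ → ℝ)) :=
          measurable_one.indicator (measurableSet_singleton 0)
        exact (h1.comp_aemeasurable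
          (aestronglyMeasurable_wvol_of_sobolev hg hρ.le).aemeasurable).aestronglyMeasurable
      · by_cases h : v X = 0 <;> simp [h]
    exact (integrableOn_wvol s _ measurableSet_ball).1 this
  have h0 : ∀ᵐ X ∂volume, X ∈ halfBall (0 : Space n) 1 → Q X = 0 := by
    refine (isOpen_halfBall 0 1).ae_eq_zero_of_integral_contDiff_smul_eq_zero ?_ ?_
    · refine (locallyIntegrableOn_iff (isOpen_halfBall 0 1).isLocallyClosed).2 ?_
      intro K hK hKc
      obtain ⟨ρ, hρ, h1⟩ := exists_pos_lt_subset_ball one_pos hKc.isClosed (hK.trans fun X hX => hX.1)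
      exact (hQm ρ hρ.2).mono_set fun X hX => ⟨h1 hX, (hK hX).2⟩
    · intro ζ hζ hζc hζs
      -- The interior identity contains the whole gradient and the truncated one only its part on {v
      -- ≠ 0}; the flat term is zero for this ζ, so the difference is the integral of ζ Q.
      obtain ⟨ρ, hρ0, hρ1, hζρ⟩ := exists_radius (hζs.trans fun X hX => hX.1)
      have e1 := hsol.test_id hs₀ hs₁ hf hv hg hζ hζc hρ0 hρ1 hζρ (hζs.trans fun X hX => hX.2)
      have e2 := hsol.test_indicator hs₀ hs₁ hf hv hg hζ hζc hρ0 hρ1 hζρ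
      have e3 : ∫ x in ball (0 : Flat n) ρ, v (flat x) * (f (v (flat x)) * ζ (flat x)) = 0 := by
        refine integral_eq_zero_of_ae (Eventually.of_forall fun x => ?_)
        have : ζ (flat x) = 0 := by
          by_contra h
          have : 0 < height (flat x) := (hζs (subset_tsupport ζ h)).2
          rw [height_flat] at this
          exact lt_irrefl _ this
        simp [this]
      have hgL := hg.memLp_grad hρ1
      obtain ⟨Z, hZ⟩ := hζc.exists_bound_of_continuous hζ.continuous
      have j1 : Integrable (fun X => ζ X * ⟪g X, g X⟫) ((wvol n s).restrict (ball 0 ρ)) :=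
        (integrable_inner_of_memLp hgL hgL).bdd_mul (c := Z) hζ.continuous.aestronglyMeasurable
          (Eventually.of_forall hZ)
      have e4 : ∫ X, ζ X * ⟪g X, g X⟫ ∂(wvol n s).restrict (ball 0 ρ) -
          ∫ X, ζ X * (({0}ᶜ : Set ℝ).indicator 1 (v X) * ⟪g X, g X⟫)
            ∂(wvol n s).restrict (ball 0 ρ) = 0 := by linarith
      rw [← integral_sub j1] at e4
      · have e5 : ∀ X, ζ X * ⟪g X, g X⟫ - ζ X * (({0}ᶜ : Set ℝ).indicator 1 (v X) * ⟪g X, g X⟫) =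
            ζ X * (({0} : Set ℝ).indicator 1 (v X) * ⟪g X, g X⟫) := by
          intro X
          by_cases h : v X = 0 <;> simp [h]
        simp only [e5] at e4
        rw [setIntegral_wvol s _ measurableSet_ball, ← halfBall_eq] at e4
        rw [← e4]
        symm
        rw [← integral_indicator (measurableSet_halfBall 0 ρ)]
        refine integral_congr_ae (Eventually.of_forall fun X => ?_)
        by_cases hX : X ∈ halfBall 0 ρ
        · simp only [indicator_of_mem hX, hQ, smul_eq_mul]; ring
        · have : ζ X = 0 := by
            by_contra h
            have h1 := subset_tsupport ζ h
            exact hX ⟨hζρ h1, (hζs h1).2⟩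
          simp [this]
      · refine (integrable_inner_of_memLp hgL hgL).bdd_mul (c := 1) ?_
          (Eventually.of_forall fun X => ?_) |>.bdd_mul (c := Z)
            hζ.continuous.aestronglyMeasurable (Eventually.of_forall hZ)
        · have h1 : Measurable (({0}ᶜ : Set ℝ).indicator (1 : ℝ → ℝ)) :=
            measurable_one.indicator (measurableSet_singleton 0).compl
          exact (h1.comp_aemeasurable
            (aestronglyMeasurable_wvol_of_sobolev hg hρ1.le).aemeasurable).aestronglyMeasurable
        · by_cases h : v X = 0 <;> simp [h]
  rw [ae_restrict_iff' (measurableSet_halfBall 0 1)]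
  filter_upwards [h0] with X hX hXm hv0
  have := hX hXm
  simp only [hQ, hv0, mem_singleton_iff, indicator_of_mem, Pi.one_apply, one_mul,
    mul_eq_zero, (weight_pos hXm.2).ne', false_or, inner_self_eq_zero] at this
  exact this

/-- The energy identity with a cutoff. -/
theorem IsWeakSolution.test_self {s : ℝ} (hs₀ : 0 < s) (hs₁ : s < 1) {v : Space n → ℝ}
    {g : Space n → Space n} {f : ℝ → ℝ} (hf : Continuous f) (hsol : IsWeakSolution s f v g)
    (hv : ContinuousOn v (closedUpper n 1)) (hg : IsWeightedSobolevLoc s v g)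
    {ζ : Space n → ℝ} (hζ : ContDiff ℝ ∞ ζ) (hζc : HasCompactSupport ζ) {ρ : ℝ} (hρ₀ : 0 < ρ)
    (hρ₁ : ρ < 1) (hζρ : tsupport ζ ⊆ ball 0 ρ) :
    ∫ X, v X * ⟪gradient ζ X, g X⟫ ∂(wvol n s).restrict (ball 0 ρ) +
      ∫ X, ζ X * ‖g X‖ ^ 2 ∂(wvol n s).restrict (ball 0 ρ) =
    ∫ x in ball (0 : Flat n) ρ, ζ (flat x) * (v (flat x) * f (v (flat x))) := by
  have h1 := hsol.test_indicator hs₀ hs₁ hf hv hg hζ hζc hρ₀ hρ₁ hζρ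
  have h2 : ∀ᵐ X ∂(wvol n s).restrict (ball 0 ρ), v X = 0 → g X = 0 :=
    (wvol_restrict_ball_ac s hρ₁.le).ae_le (hsol.grad_eq_zero hs₀ hs₁ hf hv hg)
  rw [integral_congr_ae (f := fun X => ζ X * (({0}ᶜ : Set ℝ).indicator 1 (v X) * ⟪g X, g X⟫))
    (g := fun X => ζ X * ‖g X‖ ^ 2)] at h1
  · rw [h1]
    exact integral_congr_ae (Eventually.of_forall fun x => by simp only; ring)
  · filter_upwards [h2] with X hX
    by_cases h : v X = 0
    · simp [hX h]
    · rw [real_inner_self_eq_norm_sq, indicator_of_mem (by simpa using h)]; simp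

end Testing

/-! ### From cutoffs to the energy identity on half balls -/

section Flux

variable {n : ℕ}

/-- The layer cake formula: a radial weight that is itself an integral of ξ becomes, by Fubini, ξ
integrated against the integrals of F over the sublevel sets of N. -/
theorem integral_tail {α : Type*} [MeasurableSpace α] {μ : Measure α} [SFinite μ] {N : α → ℝ}
    (hN : Measurable N) {R : ℝ} (h0 : ∀ᵐ x ∂μ, 0 ≤ N x) (hR : ∀ᵐ x ∂μ, N x ≤ R) {F : α → ℝ}
    (hF : Integrable F μ) {ξ : ℝ → ℝ} (hξ : Continuous ξ) :
    IntegrableOn (fun t => ∫ x in {x | N x < t}, F x ∂μ) (Ioo 0 R) ∧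
    ∫ x, (∫ t in (N x)..R, ξ t) * F x ∂μ =
      ∫ t in Ioo 0 R, ξ t * ∫ x in {x | N x < t}, F x ∂μ := by
  have hset : MeasurableSet {q : α × ℝ | N q.1 < q.2} :=
    measurableSet_lt (hN.comp measurable_fst) measurable_snd
  have hint : ∀ ξ : ℝ → ℝ, Continuous ξ → Integrable
      (fun q : α × ℝ => ξ q.2 * {q : α × ℝ | N q.1 < q.2}.indicator (fun q => F q.1) q)
      (μ.prod (volume.restrict (Ioo 0 R))) := by
    intro ξ hξ
    obtain ⟨Z, hZ⟩ := (isCompact_Icc (a := (0 : ℝ)) (b := R)).exists_bound_of_continuousOn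
      hξ.continuousOn
    have h1 : Integrable (fun q : α × ℝ => F q.1) (μ.prod (volume.restrict (Ioo 0 R))) := by
      have := hF.mul_prod (integrable_const (1 : ℝ) (μ := volume.restrict (Ioo 0 R)))
      simpa using this
    refine (h1.indicator hset).bdd_mul (c := Z) (hξ.measurable.comp measurable_snd).aestronglyMeasurable ?_
    have : ∀ᵐ q ∂μ.prod (volume.restrict (Ioo 0 R)), q.2 ∈ Ioo 0 R :=
      Measure.quasiMeasurePreserving_snd.ae (ae_restrict_mem measurableSet_Ioo)
    filter_upwards [this] with q hq
    exact hZ _ (Ioo_subset_Icc_self hq)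
  have hin : ∀ t, ∫ x, {q : α × ℝ | N q.1 < q.2}.indicator (fun q => F q.1) (x, t) ∂μ =
      ∫ x in {x | N x < t}, F x ∂μ := by
    intro t
    rw [← integral_indicator (measurableSet_lt hN measurable_const)]
    rfl
  constructor
  · have := (hint (fun _ => 1) continuous_const).integral_prod_right
    simp only [one_mul, hin] at this
    exact this
  · calc ∫ x, (∫ t in (N x)..R, ξ t) * F x ∂μ
        = ∫ x, (∫ t in Ioo 0 R, ξ t *
            {q : α × ℝ | N q.1 < q.2}.indicator (fun q => F q.1) (x, t)) ∂μ := by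
          refine integral_congr_ae ?_
          filter_upwards [h0, hR] with x hx0 hxR
          have h1 : ∀ t, ξ t * {q : α × ℝ | N q.1 < q.2}.indicator (fun q => F q.1) (x, t) =
              (Ioi (N x)).indicator (fun t => ξ t * F x) t := by
            intro t
            by_cases h : N x < t
            · rw [indicator_of_mem (show (x, t) ∈ {q : α × ℝ | N q.1 < q.2} from h),
                indicator_of_mem (show t ∈ Ioi (N x) from h)]
            · rw [indicator_of_notMem (show (x, t) ∉ {q : α × ℝ | N q.1 < q.2} from h),
                indicator_of_notMem (show t ∉ Ioi (N x) from h), mul_zero]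
          simp only [h1]
          rw [setIntegral_indicator measurableSet_Ioi, integral_mul_const,
            intervalIntegral.integral_of_le hxR, integral_Ioc_eq_integral_Ioo]
          congr 3
          ext t
          simp only [mem_inter_iff, mem_Ioo, mem_Ioi]
          constructor
          · rintro ⟨h1, h2⟩; exact ⟨⟨by linarith, h2⟩, h1⟩
          · rintro ⟨⟨h1, h2⟩, h3⟩; exact ⟨h3, h2⟩
      _ = ∫ t in Ioo 0 R, ∫ x, ξ t *
            {q : α × ℝ | N q.1 < q.2}.indicator (fun q => F q.1) (x, t) ∂μ :=
          integral_integral_swap (hint ξ hξ)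
      _ = _ := by
          refine integral_congr_ae (Eventually.of_forall fun t => ?_)
          simp only [integral_const_mul, hin]

/-- The norm is not smooth at the centre, but a density ξ vanishing near 0 makes the radial
primitive constant there. -/
theorem contDiff_radial {ξ : ℝ → ℝ} (hξ : ContDiff ℝ ∞ ξ) {c : ℝ} (hc : 0 < c)
    (hξ0 : ∀ t ≤ c, ξ t = 0) (R : ℝ) (X₀ : Space n) :
    ContDiff ℝ ∞ (fun X : Space n => ∫ t in ‖X - X₀‖..R, ξ t) ∧
    ∀ X, gradient (fun X : Space n => ∫ t in ‖X - X₀‖..R, ξ t) X =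
      -(ξ ‖X - X₀‖) • (‖X - X₀‖⁻¹ • (X - X₀)) := by
  have hk : ∀ t, HasDerivAt (fun q => ∫ t in q..R, ξ t) (-ξ t) t := fun t =>
    intervalIntegral.integral_hasDerivAt_left (hξ.continuous.intervalIntegrable _ _)
      hξ.continuous.stronglyMeasurable.stronglyMeasurableAtFilter hξ.continuous.continuousAt
  have hkd : ContDiff ℝ ∞ (fun q => ∫ t in q..R, ξ t) := by
    have : deriv (fun q => ∫ t in q..R, ξ t) = fun t => -ξ t := funext fun t => (hk t).deriv
    rw [contDiff_infty_iff_deriv]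
    exact ⟨fun t => (hk t).differentiableAt, by rw [this]; exact hξ.neg⟩
  have hnear : ∀ᶠ X in 𝓝 X₀, (∫ t in ‖X - X₀‖..R, ξ t) = ∫ t in (0 : ℝ)..R, ξ t := by
    filter_upwards [ball_mem_nhds X₀ hc] with X hX
    rw [mem_ball, dist_eq_norm] at hX
    have h1 : ∫ t in (0 : ℝ)..‖X - X₀‖, ξ t = 0 := by
      rw [intervalIntegral.integral_congr (g := fun _ => (0 : ℝ))]
      · simp
      · intro t ht
        rw [uIcc_of_le (norm_nonneg _)] at ht
        exact hξ0 t (ht.2.trans hX.le)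
    rw [← intervalIntegral.integral_add_adjacent_intervals (a := 0) (b := ‖X - X₀‖)
      (hξ.continuous.intervalIntegrable _ _) (hξ.continuous.intervalIntegrable _ _), h1, zero_add]
  constructor
  · rw [contDiff_iff_contDiffAt]
    intro X
    by_cases h : X = X₀
    · subst h
      exact contDiffAt_const.congr_of_eventuallyEq hnear
    · exact hkd.contDiffAt.comp X
        ((contDiffAt_norm ℝ (sub_ne_zero.2 h)).comp X (contDiffAt_id.sub contDiffAt_const))
  · intro X
    by_cases h : X = X₀
    · subst h
      have : HasGradientAt (fun Y : Space n => ∫ t in ‖Y - X‖..R, ξ t) 0 X := by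
        rw [hasGradientAt_iff_hasFDerivAt, map_zero]
        exact (hasFDerivAt_const _ _).congr_of_eventuallyEq hnear
      rw [this.gradient]; simp
    · have hne := sub_ne_zero.2 h
      have hN : HasGradientAt (fun Y : Space n => ‖Y - X₀‖) (‖X - X₀‖⁻¹ • (X - X₀)) X := by
        rw [hasGradientAt_iff_hasFDerivAt]
        have h2 : HasFDerivAt (fun Y : Space n => ‖Y - X₀‖ ^ 2) _ X :=
          ((hasFDerivAt_id X).sub_const X₀).norm_sq
        have h3 := h2.sqrt (by positivity)
        simp only [Real.sqrt_sq (norm_nonneg _)] at h3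
        refine h3.congr_fderiv ?_
        ext e
        simp [InnerProductSpace.toDual_apply_apply]
        field_simp
      rw [hasGradientAt_iff_hasFDerivAt] at hN
      have := (hk ‖X - X₀‖).comp_hasFDerivAt X hN
      refine HasGradientAt.gradient ?_
      rw [hasGradientAt_iff_hasFDerivAt, map_smul]
      exact this

/-- The energy identity on almost every half ball. -/
theorem IsWeakSolution.ae_radialFlux_eq {s : ℝ} (hs₀ : 0 < s) (hs₁ : s < 1)
    {v : Space n → ℝ} {g : Space n → Space n} {f : ℝ → ℝ} (hf : Continuous f)
    (hsol : IsWeakSolution s f v g) (hv : ContinuousOn v (closedUpper n 1))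
    (hg : IsWeightedSobolevLoc s v g) {x₀ : Flat n} {R : ℝ} (hR₀ : 0 < R) (hR : ‖x₀‖ + R < 1) :
    ∀ᵐ t ∂volume, t ∈ Ioo 0 R → radialFlux s v g x₀ t =
      (∫ X in halfBall (flat x₀) t, weight s X * ‖g X‖ ^ 2) -
        ∫ x in ball x₀ t, v (flat x) * f (v (flat x)) := by
  set ρ := (‖x₀‖ + R + 1) / 2 with hρdef
  have hρ1 : ρ < 1 := by rw [hρdef]; linarith
  have hρR : ‖x₀‖ + R < ρ := by rw [hρdef]; linarith
  have hρ0 : 0 < ρ := by have := norm_nonneg x₀; linarith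
  obtain ⟨B, hB0, hB⟩ := exists_bound_closedUpper hv hρ1
  have hgL := hg.memLp_grad hρ1
  have hnL := memLp_normalDir hs₁ x₀ ρ
  have hvm := aestronglyMeasurable_wvol_of_sobolev hg hρ1.le
  have hvρ := hv.mono (closedUpper_mono hρ1.le)
  have hsub : ball (flat x₀ : Space n) R ⊆ ball 0 ρ := ball_flat_subset hρR.le
  have hsubf : ball x₀ R ⊆ ball (0 : Flat n) ρ := ball_subset_ball' (by
    rw [dist_zero_right]; linarith)
  set μ := (wvol n s).restrict (ball (flat x₀) R) with hμ
  set ν := (volume : Measure (Flat n)).restrict (ball x₀ R) with hν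
  have : IsFiniteMeasure μ := ⟨by
    rw [hμ, Measure.restrict_apply_univ]; exact wvol_ball_lt_top hs₁ _ _⟩
  have a1 : Integrable (fun X => ‖g X‖ ^ 2) ((wvol n s).restrict (ball 0 ρ)) := by
    simpa only [real_inner_self_eq_norm_sq] using integrable_inner_of_memLp hgL hgL
  have a1' : Integrable (fun X => ‖g X‖ ^ 2) μ := IntegrableOn.mono_set a1 hsub
  have a2 : Integrable (fun X => v X * ⟪g X, normalDir x₀ X⟫) ((wvol n s).restrict (ball 0 ρ)) := by
    refine (integrable_inner_of_memLp hgL hnL).bdd_mul (c := B) hvm ?_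
    filter_upwards [ae_mem_closedUpper s ρ] with X hX using hB X hX
  have a2' : IntegrableOn (fun X => v X * ⟪g X, normalDir x₀ X⟫) (ball (flat x₀) R) (wvol n s) :=
    IntegrableOn.mono_set a2 hsub
  have a3 : Integrable (fun x : Flat n => v (flat x) * f (v (flat x))) ν := by
    have := trace_bounds (f := fun t => t * f t) (continuous_id.mul hf) hvρ hB
    exact this.mono_set hsubf
  have mN : Measurable fun X : Space n => ‖X - flat x₀‖ := by fun_prop
  have mn : Measurable fun x : Flat n => ‖x - x₀‖ := by fun_prop
  have bN : ∀ᵐ X ∂μ, ‖X - flat x₀‖ ≤ R := by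
    filter_upwards [ae_restrict_mem measurableSet_ball] with X hX
    rw [mem_ball, dist_eq_norm] at hX; exact hX.le
  have bn : ∀ᵐ x ∂ν, ‖x - x₀‖ ≤ R := by
    filter_upwards [ae_restrict_mem measurableSet_ball] with X hX
    rw [mem_ball, dist_eq_norm] at hX; exact hX.le
  have T1 := fun (ξ : ℝ → ℝ) (hξ : Continuous ξ) => integral_tail mN
    (Eventually.of_forall fun X => norm_nonneg _) bN a1' hξ
  have T2 := fun (ξ : ℝ → ℝ) (hξ : Continuous ξ) => integral_tail mn
    (Eventually.of_forall fun X => norm_nonneg _) bn a3 hξ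
  have D1 : ∀ t ∈ Ioo 0 R, ∫ X in {X | ‖X - flat x₀‖ < t}, ‖g X‖ ^ 2 ∂μ =
      ∫ X in halfBall (flat x₀) t, weight s X * ‖g X‖ ^ 2 := by
    intro t ht
    have hs1 : {X : Space n | ‖X - flat x₀‖ < t} = ball (flat x₀) t := by
      ext X; simp [dist_eq_norm]
    rw [hs1, hμ, Measure.restrict_restrict measurableSet_ball,
      inter_eq_left.2 (ball_subset_ball ht.2.le), setIntegral_wvol s _ measurableSet_ball]
    rfl
  have D2 : ∀ t ∈ Ioo 0 R, ∫ x in {x | ‖x - x₀‖ < t}, v (flat x) * f (v (flat x)) ∂ν =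
      ∫ x in ball x₀ t, v (flat x) * f (v (flat x)) := by
    intro t ht
    have hs1 : {x : Flat n | ‖x - x₀‖ < t} = ball x₀ t := by
      ext X; simp [dist_eq_norm]
    rw [hs1, hν, Measure.restrict_restrict measurableSet_ball,
      inter_eq_left.2 (ball_subset_ball ht.2.le)]
  -- Only the integrability clause, which does not depend on ξ, is wanted, hence the zero density.
  have I1 := (T1 _ continuous_zero).1.congr_fun D1 measurableSet_Ioo
  have I2 := (T2 _ continuous_zero).1.congr_fun D2 measurableSet_Ioo
  have hpol := (integrableOn_wvol s _ measurableSet_ball).1 a2'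
  have I3 : IntegrableOn (fun t => radialFlux s v g x₀ t) (Ioo 0 R) :=
    (polar_halfBall x₀ (R := R) (fun X ν => weight s X * (v X * ⟪g X, ν⟫)) hpol).1
  -- By the fundamental lemma of the calculus of variations in the radius, the identity need only be
  -- checked after integration against every test function ξ on (0, R).
  have hz : ∀ᵐ t ∂volume, t ∈ Ioo 0 R → radialFlux s v g x₀ t -
      ((∫ X in halfBall (flat x₀) t, weight s X * ‖g X‖ ^ 2) -
        ∫ x in ball x₀ t, v (flat x) * f (v (flat x))) = 0 := by
    refine isOpen_Ioo.ae_eq_zero_of_integral_contDiff_smul_eq_zero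
      (I3.sub (I1.sub I2)).locallyIntegrableOn ?_
    intro ξ hξ hξc hξs
    -- The support of ξ stays away from 0, which makes the radial cutoff smooth, and away from R,
    -- which keeps its support inside the ball of radius R.
    obtain ⟨c, hc0, hcs⟩ : ∃ c, 0 < c ∧ ∀ t ≤ c, ξ t = 0 := by
      by_cases he : (tsupport ξ).Nonempty
      · obtain ⟨c, hc, hmin⟩ := hξc.isCompact.exists_isLeast he
        have hc0 := (hξs hc).1
        refine ⟨c / 2, by linarith, fun t ht => ?_⟩
        by_contra h
        have := hmin (subset_tsupport ξ h)
        linarith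
      · refine ⟨1, one_pos, fun t _ => ?_⟩
        by_contra h
        exact he ⟨t, subset_tsupport ξ h⟩
    obtain ⟨b, hb0, hbR, hbs⟩ : ∃ b, 0 < b ∧ b < R ∧ ∀ t, b ≤ t → ξ t = 0 := by
      by_cases he : (tsupport ξ).Nonempty
      · obtain ⟨b, hb, hmax⟩ := hξc.isCompact.exists_isGreatest he
        have hb0 := hξs hb
        refine ⟨(b + R) / 2, by linarith [hb0.1], by linarith [hb0.2], fun t ht => ?_⟩
        by_contra h
        have := hmax (subset_tsupport ξ h)
        linarith [hb0.2]
      · refine ⟨R / 2, by linarith, by linarith, fun t _ => ?_⟩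
        by_contra h
        exact he ⟨t, subset_tsupport ξ h⟩
    obtain ⟨hζ, hζg⟩ := contDiff_radial hξ hc0 hcs R (flat x₀ : Space n)
    set ζ : Space n → ℝ := fun X => ∫ t in ‖X - flat x₀‖..R, ξ t with hζdef
    have hζ0 : ∀ X, b ≤ ‖X - flat x₀‖ → ζ X = 0 := by
      intro X hX
      simp only [hζdef]
      rw [intervalIntegral.integral_congr (g := fun _ => (0 : ℝ))]
      · simp
      · intro t ht
        have : min ‖X - flat x₀‖ R ≤ t := ht.1
        exact hbs t ((le_min hX hbR.le).trans this)
    have hζt : tsupport ζ ⊆ closedBall (flat x₀) b := by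
      refine closure_minimal (fun X hX => ?_) isClosed_closedBall
      by_contra h
      rw [mem_closedBall, dist_eq_norm, not_le] at h
      exact hX (hζ0 X h.le)
    have hζc : HasCompactSupport ζ := (isCompact_closedBall _ _).of_isClosed_subset
      (isClosed_tsupport _) hζt
    have hζR : tsupport ζ ⊆ ball (flat x₀) R := hζt.trans (closedBall_subset_ball hbR)
    -- The cutoff has radial derivative -ξ: its gradient term yields the flux, and its values yield
    -- energy and potential through `integral_tail`.
    have key := hsol.test_self hs₀ hs₁ hf hv hg hζ hζc hρ0 hρ1 (hζR.trans hsub)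
    have hflat : ∀ x : Flat n, ‖flat x - flat x₀‖ = ‖x - x₀‖ := fun x => by
      rw [← flat_sub, norm_flat]
    have k1 : ∫ X, ζ X * ‖g X‖ ^ 2 ∂(wvol n s).restrict (ball 0 ρ) =
        ∫ t in Ioo 0 R, ξ t * ∫ X in halfBall (flat x₀) t, weight s X * ‖g X‖ ^ 2 := by
      rw [setIntegral_eq_of_subset_of_forall_sdiff_eq_zero measurableSet_ball hsub,
        (T1 ξ hξ.continuous).2, setIntegral_congr_fun measurableSet_Ioo]
      · intro t ht
        simp only [D1 t ht]
      · intro X hX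
        have : ζ X = 0 := by
          by_contra h
          exact hX.2 (hζR (subset_tsupport ζ h))
        simp [this]
    have k2 : ∫ x in ball (0 : Flat n) ρ, ζ (flat x) * (v (flat x) * f (v (flat x))) =
        ∫ t in Ioo 0 R, ξ t * ∫ x in ball x₀ t, v (flat x) * f (v (flat x)) := by
      rw [setIntegral_eq_of_subset_of_forall_sdiff_eq_zero measurableSet_ball hsubf]
      · simp only [hζdef, hflat]
        rw [(T2 ξ hξ.continuous).2, setIntegral_congr_fun measurableSet_Ioo]
        intro t ht
        simp only [D2 t ht]
      · intro x hx
        have : ζ (flat x) = 0 := by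
          refine hζ0 _ ?_
          rw [hflat]
          have := hx.2
          rw [mem_ball, dist_eq_norm, not_lt] at this
          linarith
        simp [this]
    have hgrad : ∀ X, ⟪gradient ζ X, g X⟫ = -(ξ ‖X - flat x₀‖ * ⟪g X, normalDir x₀ X⟫) := by
      intro X
      rw [hζg X, inner_smul_left, real_inner_comm]
      simp [normalDir]
    have k3 : ∫ X, v X * ⟪gradient ζ X, g X⟫ ∂(wvol n s).restrict (ball 0 ρ) =
        -∫ t in Ioo 0 R, ξ t * radialFlux s v g x₀ t := by
      obtain ⟨Z, hZ⟩ := hξc.exists_bound_of_continuous hξ.continuous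
      have h1 : IntegrableOn (fun X => ξ ‖X - flat x₀‖ * (v X * ⟪g X, normalDir x₀ X⟫))
          (ball (flat x₀) R) (wvol n s) :=
        Integrable.bdd_mul (c := Z) a2' (hξ.continuous.comp (by fun_prop)).aestronglyMeasurable
          (Eventually.of_forall fun X => hZ _)
      have h2 := (polar_halfBall x₀ (R := R)
        (fun X ν => weight s X * (ξ ‖X - flat x₀‖ * (v X * ⟪g X, ν⟫)))
        ((integrableOn_wvol s _ measurableSet_ball).1 h1)).2.1 R le_rfl
      rw [setIntegral_eq_of_subset_of_forall_sdiff_eq_zero measurableSet_ball hsub]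
      · have h3 : ∀ X, v X * ⟪gradient ζ X, g X⟫ =
            -(ξ ‖X - flat x₀‖ * (v X * ⟪g X, normalDir x₀ X⟫)) := fun X => by rw [hgrad]; ring
        simp only [h3]
        rw [integral_neg, setIntegral_wvol s _ measurableSet_ball, ← halfBall_eq]
        refine congrArg _ (h2.trans (setIntegral_congr_fun measurableSet_Ioo fun t ht => ?_))
        simp only [radialFlux]
        rw [halfSphereIntegral_weight ht.1, halfSphereIntegral_weight ht.1, mul_left_comm (ξ t),
          ← integral_const_mul (μ := wsphere n s) (ξ t)]
        congr 2
        funext θ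
        rw [add_sub_cancel_left, norm_smul_sphere θ ht.1.le]
      · intro X hX
        have : gradient ζ X = 0 := by
          have h5 := hX.2
          rw [mem_ball, dist_eq_norm, not_lt] at h5
          rw [hζg X, hbs _ (by linarith)]; simp
        simp [this]
    rw [k1, k2, k3] at key
    have hb : ∀ {F : ℝ → ℝ}, IntegrableOn F (Ioo 0 R) → IntegrableOn (fun t => ξ t * F t) (Ioo 0 R) := by
      intro F hF
      obtain ⟨Z, hZ⟩ := hξc.exists_bound_of_continuous hξ.continuous
      exact Integrable.bdd_mul (c := Z) hF hξ.continuous.aestronglyMeasurable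
        (Eventually.of_forall fun X => hZ _)
    have hfin : ∫ t, ξ t • (radialFlux s v g x₀ t -
      ((∫ X in halfBall (flat x₀) t, weight s X * ‖g X‖ ^ 2) -
        ∫ x in ball x₀ t, v (flat x) * f (v (flat x)))) = ∫ t in Ioo 0 R, ξ t * (radialFlux s v g x₀ t -
      ((∫ X in halfBall (flat x₀) t, weight s X * ‖g X‖ ^ 2) -
        ∫ x in ball x₀ t, v (flat x) * f (v (flat x)))) := by
      symm
      refine setIntegral_eq_integral_of_forall_compl_eq_zero fun t ht => ?_
      have : ξ t = 0 := by
        by_contra h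
        exact ht (hξs (subset_tsupport ξ h))
      simp [this]
    rw [hfin]
    simp only [mul_sub]
    refine (integral_sub (hb I3) ((hb I1).sub (hb I2))).trans ?_
    refine (congrArg (fun z => (∫ t in Ioo 0 R, ξ t * radialFlux s v g x₀ t) - z)
      (integral_sub (hb I1) (hb I2))).trans ?_
    linarith
  filter_upwards [hz] with t ht hmem
  exact sub_eq_zero.1 (ht hmem)

end Flux

/-! ### Hedberg's splitting and integrals along segments -/

section Paths

theorem lintegral_rpow_head {b c : ℝ} (hb : -1 < b) (hc : 0 ≤ c) :
    ∫⁻ t in Ioo 0 c, ENNReal.ofReal (t ^ b) = ENNReal.ofReal (c ^ (b + 1) / (b + 1)) := by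
  rcases hc.eq_or_lt with rfl | hc
  · simp [Real.zero_rpow (show b + 1 ≠ 0 by linarith)]
  rw [← ofReal_integral_eq_lintegral_ofReal ((intervalIntegral.integrableOn_Ioo_rpow_iff hc).2 hb)]
  · rw [← integral_Ioc_eq_integral_Ioo, ← intervalIntegral.integral_of_le hc.le,
      integral_rpow (Or.inl hb), Real.zero_rpow (by linarith), sub_zero]
  · filter_upwards [ae_restrict_mem measurableSet_Ioo] with t ht
    exact Real.rpow_nonneg ht.1.le _

theorem lintegral_rpow_tail {b c : ℝ} (hb : b < -1) (hc : 0 < c) :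
    ∫⁻ t in Ioi c, ENNReal.ofReal (t ^ b) = ENNReal.ofReal (-c ^ (b + 1) / (b + 1)) := by
  rw [← ofReal_integral_eq_lintegral_ofReal (integrableOn_Ioi_rpow_of_lt hb hc),
    integral_Ioi_rpow_of_lt hb hc]
  filter_upwards [ae_restrict_mem measurableSet_Ioi] with t ht
  exact Real.rpow_nonneg (hc.trans ht).le _

/-- Hedberg's splitting argument for one dimensional integrals. -/
theorem lintegral_sqrt_le {N σ : ℝ} (hσ : 0 < σ) (hN : 2 * σ < N) :
    ∃ C : ℝ, 0 < C ∧ ∀ (m : ℝ → ℝ≥0∞) (D J T : ℝ), Measurable m → 0 < D → 0 < J →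
      (∀ t ∈ Ioo 0 T, m t ≤ ENNReal.ofReal (D * t ^ (-(N + 2 - 2 * σ)))) →
      (∫⁻ t in Ioo 0 T, ENNReal.ofReal (t ^ (1 - 2 * σ)) * m t ≤ ENNReal.ofReal J) →
      ∫⁻ t in Ioo 0 T, m t ^ (1 / 2 : ℝ) ≤
        ENNReal.ofReal (C * (D ^ (σ / N) * J ^ (1 / 2 - σ / N))) := by
  have hN0 : 0 < N := by linarith
  refine ⟨(1 / (2 * σ)) ^ (1 / 2 : ℝ) + 2 / (N - 2 * σ), by positivity, ?_⟩
  intro m D J T hm hD hJ hmb hmJ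
  have hDJ : 0 < D / J := div_pos hD hJ
  -- The splitting point balances the small t bound, of order l^σ J^(1/2), against the large t
  -- bound, of order l^(-(N-2σ)/2) D^(1/2).
  set l : ℝ := (D / J) ^ (1 / N) with hl
  have hl0 : 0 < l := Real.rpow_pos_of_pos hDJ _
  have hsq : ∀ z : ℝ≥0∞, (z ^ (1 / 2 : ℝ)) ^ (2 : ℝ) = z := fun z => by
    rw [← ENNReal.rpow_mul]; norm_num
  -- Near 0, Cauchy-Schwarz with the weight t^(1-2σ) uses the integral bound J; the dual weight
  -- t^(2σ-1) is integrable because σ > 0.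
  have h1 : ∫⁻ t in Ioo 0 T ∩ Iio l, m t ^ (1 / 2 : ℝ) ≤
      ENNReal.ofReal ((1 / (2 * σ)) ^ (1 / 2 : ℝ) * (l ^ σ * J ^ (1 / 2 : ℝ))) := by
    have hcs := ENNReal.lintegral_mul_le_Lp_mul_Lq (volume.restrict (Ioo 0 T ∩ Iio l))
      Real.HolderConjugate.two_two (f := fun t => ENNReal.ofReal (t ^ (2 * σ - 1)) ^ (1 / 2 : ℝ))
      (g := fun t => (ENNReal.ofReal (t ^ (1 - 2 * σ)) * m t) ^ (1 / 2 : ℝ))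
      (by fun_prop) (by fun_prop)
    simp only [hsq, Pi.mul_apply] at hcs
    calc ∫⁻ t in Ioo 0 T ∩ Iio l, m t ^ (1 / 2 : ℝ)
        = ∫⁻ t in Ioo 0 T ∩ Iio l, ENNReal.ofReal (t ^ (2 * σ - 1)) ^ (1 / 2 : ℝ) *
            (ENNReal.ofReal (t ^ (1 - 2 * σ)) * m t) ^ (1 / 2 : ℝ) := by
          refine setLIntegral_congr_fun (measurableSet_Ioo.inter measurableSet_Iio) fun t ht => ?_
          rw [← ENNReal.mul_rpow_of_nonneg _ _ (by norm_num), ← mul_assoc,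
            ← ENNReal.ofReal_mul (Real.rpow_nonneg ht.1.1.le _), ← Real.rpow_add ht.1.1]
          simp
      _ ≤ _ := hcs
      _ ≤ ENNReal.ofReal (l ^ (2 * σ) / (2 * σ)) ^ (1 / 2 : ℝ) * ENNReal.ofReal J ^ (1 / 2 : ℝ) := by
          gcongr
          · refine (lintegral_mono_set (t := Ioo 0 l) fun t ht => ⟨ht.1.1, ht.2⟩).trans ?_
            rw [lintegral_rpow_head (by linarith) hl0.le]
            simp
          · exact (lintegral_mono_set inter_subset_left).trans hmJ
      _ = _ := by
          rw [ENNReal.ofReal_rpow_of_nonneg (by positivity) (by norm_num),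
            ENNReal.ofReal_rpow_of_nonneg hJ.le (by norm_num), ← ENNReal.ofReal_mul (by positivity),
            div_eq_mul_one_div, Real.mul_rpow (by positivity) (by positivity), ← Real.rpow_mul hl0.le]
          congr 1
          rw [show 2 * σ * (1 / 2) = σ by ring]
          ring
  -- Beyond l the pointwise bound is used; its square root is integrable at infinity because 2σ < N.
  have h2 : ∫⁻ t in Ioo 0 T ∩ Ici l, m t ^ (1 / 2 : ℝ) ≤
      ENNReal.ofReal (2 / (N - 2 * σ) * (l ^ (-((N - 2 * σ) / 2)) * D ^ (1 / 2 : ℝ))) := by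
    calc ∫⁻ t in Ioo 0 T ∩ Ici l, m t ^ (1 / 2 : ℝ)
        ≤ ∫⁻ t in Ioo 0 T ∩ Ici l, ENNReal.ofReal (D ^ (1 / 2 : ℝ)) *
            ENNReal.ofReal (t ^ (-((N - 2 * σ) / 2) - 1)) := by
          refine setLIntegral_mono (by fun_prop) fun t ht => ?_
          have ht0 := ht.1.1
          rw [← ENNReal.ofReal_mul (by positivity)]
          refine (ENNReal.rpow_le_rpow (hmb t ht.1) (by norm_num)).trans_eq ?_
          rw [ENNReal.ofReal_rpow_of_nonneg (by positivity) (by norm_num),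
            Real.mul_rpow hD.le (by positivity), ← Real.rpow_mul ht0.le]
          congr 3; ring
      _ ≤ ∫⁻ t in Ici l, ENNReal.ofReal (D ^ (1 / 2 : ℝ)) *
            ENNReal.ofReal (t ^ (-((N - 2 * σ) / 2) - 1)) := lintegral_mono_set inter_subset_right
      _ = _ := by
          rw [lintegral_const_mul _ (by fun_prop), setLIntegral_congr Ioi_ae_eq_Ici.symm,
            lintegral_rpow_tail (by linarith) hl0, ← ENNReal.ofReal_mul (by positivity)]
          congr 1
          have : N - 2 * σ ≠ 0 := by linarith
          rw [sub_add_cancel]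
          field_simp
  have e1 : l ^ σ * J ^ (1 / 2 : ℝ) = D ^ (σ / N) * J ^ (1 / 2 - σ / N) := by
    rw [hl, ← Real.rpow_mul hDJ.le, Real.div_rpow hD.le hJ.le, Real.rpow_sub hJ]
    rw [show 1 / N * σ = σ / N by ring]
    ring
  have e2 : l ^ (-((N - 2 * σ) / 2)) * D ^ (1 / 2 : ℝ) = D ^ (σ / N) * J ^ (1 / 2 - σ / N) := by
    rw [hl, ← Real.rpow_mul hDJ.le, Real.div_rpow hD.le hJ.le,
      show 1 / N * -((N - 2 * σ) / 2) = -(1 / 2 - σ / N) by field_simp,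
      Real.rpow_neg hJ.le, div_inv_eq_mul, mul_right_comm, ← Real.rpow_add hD]
    congr 2; ring
  rw [e1] at h1
  rw [e2] at h2
  have hsplit : Ioo 0 T = (Ioo 0 T ∩ Iio l) ∪ (Ioo 0 T ∩ Ici l) := by
    rw [← inter_union_distrib_left, Iio_union_Ici, inter_univ]
  rw [hsplit]
  refine (lintegral_union_le _ _ _).trans ((add_le_add h1 h2).trans_eq ?_)
  rw [← ENNReal.ofReal_add (by positivity) (by positivity)]
  congr 1; ring

variable {n : ℕ}

/-- A ball in the upper half of the unit ball. -/
def interiorBall (n : ℕ) : Set (Space n) := ball ((3 / 8 : ℝ) • vert) (1 / 8)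

theorem interiorBall_bounds {Z : Space n} (hZ : Z ∈ interiorBall n) :
    ‖Z‖ < 1 ∧ 1 / 4 < height Z ∧ height Z < 1 / 2 := by
  rw [interiorBall, mem_ball, dist_eq_norm] at hZ
  have h1 := (abs_height_le _).trans_lt hZ
  rw [height_sub, height_smul, height_vert, abs_lt] at h1
  have h2 := norm_add_le (Z - (3 / 8 : ℝ) • vert) ((3 / 8 : ℝ) • (vert : Space n))
  rw [sub_add_cancel, norm_smul, norm_vert, Real.norm_of_nonneg (by norm_num)] at h2
  exact ⟨by linarith, by linarith [h1.1], by linarith [h1.2]⟩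

theorem measurableSet_interiorBall : MeasurableSet (interiorBall n) := measurableSet_ball

theorem path_mem_halfBall {x : Flat n} (hx : ‖x‖ < 1) {Z : Space n} (hZ : Z ∈ interiorBall n) {t : ℝ}
    (ht : t ∈ Ioc 0 1) : (1 - t) • flat x + t • Z ∈ halfBall (0 : Space n) 1 := by
  obtain ⟨h1, h2, h3⟩ := interiorBall_bounds hZ
  refine ⟨?_, ?_⟩
  · have := (convex_ball (0 : Space n) 1) (x := flat x) (y := Z)
      (mem_ball_zero_iff.2 (by rwa [norm_flat])) (mem_ball_zero_iff.2 h1) (a := 1 - t) (b := t)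
      (by linarith [ht.2]) ht.1.le (by ring)
    exact this
  · rw [height_add, height_smul, height_smul, height_flat]
    have : 0 < t * height Z := mul_pos ht.1 (by linarith)
    linarith

theorem rpow_weightExp_le {s h : ℝ} (hs₀ : 0 < s) (h1 : 1 / 4 < h) (h2 : h < 1 / 2) :
    1 ≤ 4 * h ^ weightExp s := by
  have ha : weightExp s ≤ 1 := by unfold weightExp; linarith
  have h4 : h ^ (1 : ℝ) ≤ h ^ weightExp s :=
    Real.rpow_le_rpow_of_exponent_ge (by linarith) (by linarith) ha
  rw [Real.rpow_one] at h4
  linarith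

/-- The map Z ↦ (1-t)x + tZ has Jacobian t^(n+1), and the image of the interior ball has height
comparable with t, so that the weight there is at least t^a / 4. Together this costs t^(-(n+2-2s)),
and lowering s to σ only weakens the bound for t < 1. -/
theorem lintegral_path_le {s : ℝ} (hs₀ : 0 < s) {σ : ℝ} (hσ : σ ≤ s)
    {P : Space n → ℝ≥0∞} (hP : Measurable P) (x : Flat n) {t : ℝ} (ht₀ : 0 < t) (ht₁ : t < 1) :
    ∫⁻ Z in interiorBall n, P ((1 - t) • flat x + t • Z) ≤
      ENNReal.ofReal (4 * t ^ (-((n : ℝ) + 2 - 2 * σ))) * ∫⁻ X, P X ∂wvol n s := by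
  set W : Space n → ℝ≥0∞ := (upper n).indicator fun X => ENNReal.ofReal (weight s X) * P X with hW
  have hWm : Measurable W :=
    ((measurable_ofReal_weight s).mul hP).indicator measurableSet_upper
  have h1 : ∀ Z ∈ interiorBall n, P ((1 - t) • flat x + t • Z) ≤
      ENNReal.ofReal (4 * t ^ (-weightExp s)) * W ((1 - t) • flat x + t • Z) := by
    intro Z hZ
    obtain ⟨-, h2, h3⟩ := interiorBall_bounds hZ
    have hh : height ((1 - t) • flat x + t • Z) = t * height Z := by
      rw [height_add, height_smul, height_smul, height_flat]; ring
    have hpos : 0 < t * height Z := mul_pos ht₀ (by linarith)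
    have hmem : (1 - t) • flat x + t • Z ∈ upper n := by
      change 0 < height _
      rwa [hh]
    rw [hW, indicator_of_mem hmem, ← mul_assoc, ← ENNReal.ofReal_mul (by positivity)]
    refine le_mul_of_one_le_left zero_le ?_
    rw [ENNReal.one_le_ofReal, weight, hh, Real.mul_rpow ht₀.le (by linarith), Real.rpow_neg ht₀.le]
    have h5 : (t ^ weightExp s)⁻¹ * t ^ weightExp s = 1 :=
      inv_mul_cancel₀ (Real.rpow_pos_of_pos ht₀ _).ne'
    calc (1 : ℝ) ≤ 4 * height Z ^ weightExp s := rpow_weightExp_le hs₀ h2 h3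
      _ = 4 * ((t ^ weightExp s)⁻¹ * t ^ weightExp s) * height Z ^ weightExp s := by rw [h5, mul_one]
      _ = _ := by ring
  have h6 : ∫⁻ X, P X ∂wvol n s = ENNReal.ofReal (t ^ (n + 1)) *
      ∫⁻ Z, W ((1 - t) • flat x + t • Z) := by
    rw [lintegral_wvol s hP, ← lintegral_indicator measurableSet_upper,
      lintegral_scale volume _ ((1 - t) • flat x) ht₀]
    congr 2
    simp
  calc ∫⁻ Z in interiorBall n, P ((1 - t) • flat x + t • Z)
      ≤ ∫⁻ Z in interiorBall n, ENNReal.ofReal (4 * t ^ (-weightExp s)) *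
          W ((1 - t) • flat x + t • Z) := setLIntegral_mono (by fun_prop) h1
    _ ≤ ∫⁻ Z, ENNReal.ofReal (4 * t ^ (-weightExp s)) *
          W ((1 - t) • flat x + t • Z) := setLIntegral_le_lintegral _ _
    _ = ENNReal.ofReal (4 * t ^ (-weightExp s)) * ∫⁻ Z, W ((1 - t) • flat x + t • Z) :=
        lintegral_const_mul _ (by fun_prop)
    _ ≤ (ENNReal.ofReal (4 * t ^ (-((n : ℝ) + 2 - 2 * σ))) * ENNReal.ofReal (t ^ (n + 1))) *
          ∫⁻ Z, W ((1 - t) • flat x + t • Z) := by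
        gcongr
        rw [← ENNReal.ofReal_mul (by positivity)]
        refine ENNReal.ofReal_le_ofReal ?_
        rw [mul_assoc]
        gcongr
        rw [← Real.rpow_natCast, ← Real.rpow_add ht₀]
        refine Real.rpow_le_rpow_of_exponent_ge ht₀ ht₁.le ?_
        push_cast
        rw [weightExp]; linarith
    _ = _ := by rw [h6, mul_assoc]

/-- Integrating over x first, for fixed t and Z, sweeps the horizontal slice at height t times the
height of Z, with Jacobian (1-t)^n ≥ 2^(-n). The factor t^(1-2σ) is dominated by the weight at that
height, so the t integral adds up the slices to the total weighted integral of P. -/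
theorem lintegral_lintegral_path_le {s : ℝ} (hs₀ : 0 < s) {σ : ℝ} (hσ : σ ≤ s)
    {P : Space n → ℝ≥0∞} (hP : Measurable P) :
    ∫⁻ x : Flat n, ∫⁻ t in Ioo (0 : ℝ) (1 / 2), ENNReal.ofReal (t ^ (1 - 2 * σ)) *
        ∫⁻ Z in interiorBall n, P ((1 - t) • flat x + t • Z) ≤
      ENNReal.ofReal (16 * 2 ^ n) * volume (interiorBall n) * ∫⁻ X, P X ∂wvol n s := by
  set Φ : ℝ → ℝ≥0∞ := fun y => ∫⁻ x : Flat n, P (flat x + y • vert) with hΦ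
  have hcont : Continuous fun q : ℝ × Flat n => flat q.2 + q.1 • (vert : Space n) :=
    (continuous_flat.comp continuous_snd).add (continuous_fst.smul continuous_const)
  have hΦm : Measurable Φ :=
    Measurable.lintegral_prod_right' (f := fun q : ℝ × Flat n => P (flat q.2 + q.1 • vert))
      (hP.comp hcont.measurable)
  have hPm3 : Measurable fun q : (Flat n × ℝ) × Space n => P ((1 - q.1.2) • flat q.1.1 + q.1.2 • q.2) := by
    refine hP.comp (Continuous.measurable ?_)
    have := continuous_flat (n := n)
    fun_prop
  have hD : ∫⁻ X, P X ∂wvol n s = ∫⁻ y in Ioi (0 : ℝ), ENNReal.ofReal (y ^ weightExp s) * Φ y := by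
    rw [lintegral_wvol s hP, ← lintegral_indicator measurableSet_upper, lintegral_space
      (F := (upper n).indicator fun X => ENNReal.ofReal (weight s X) * P X)
      (((measurable_ofReal_weight s).mul hP).indicator measurableSet_upper),
      ← lintegral_indicator measurableSet_Ioi]
    refine lintegral_congr fun y => ?_
    by_cases hy : 0 < y
    · rw [indicator_of_mem (show y ∈ Ioi 0 from hy), hΦ]
      simp only
      have hPy : Measurable fun x : Flat n => P (flat x + y • vert) :=
        hP.comp (hcont.comp (by fun_prop : Continuous fun x => (y, x))).measurable
      rw [← lintegral_const_mul _ hPy]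
      refine lintegral_congr fun x => ?_
      have : flat x + y • vert ∈ upper n := by
        change 0 < height _
        rwa [height_flat_add]
      rw [indicator_of_mem this, weight, height_flat_add]
    · rw [indicator_of_notMem (show y ∉ Ioi 0 from hy)]
      rw [lintegral_eq_zero_of_ae_eq_zero]
      refine Eventually.of_forall fun x => ?_
      have : flat x + y • vert ∉ upper n := by
        change ¬ 0 < height _
        rwa [height_flat_add]
      simp only [indicator_of_notMem this]; rfl
  -- The order of integration becomes t, then Z, then x, so that slices can be recognised.
  have hswap : ∫⁻ x : Flat n, ∫⁻ t in Ioo (0 : ℝ) (1 / 2), ENNReal.ofReal (t ^ (1 - 2 * σ)) *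
        ∫⁻ Z in interiorBall n, P ((1 - t) • flat x + t • Z) =
      ∫⁻ t in Ioo (0 : ℝ) (1 / 2), ENNReal.ofReal (t ^ (1 - 2 * σ)) *
        ∫⁻ Z in interiorBall n, ∫⁻ x : Flat n, P ((1 - t) • flat x + t • Z) := by
    rw [lintegral_lintegral_swap]
    · refine lintegral_congr fun t => ?_
      rw [lintegral_const_mul]
      · congr 1
        rw [lintegral_lintegral_swap]
        exact (hPm3.comp (by fun_prop : Measurable
          fun q : Flat n × Space n => ((q.1, t), q.2))).aemeasurable
      · exact (Measurable.lintegral_prod_right' (ν := volume.restrict (interiorBall n)) hPm3).comp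
          (by fun_prop : Measurable fun x : Flat n => (x, t))
    · refine (Measurable.mul (by fun_prop) ?_).aemeasurable
      exact Measurable.lintegral_prod_right' (ν := volume.restrict (interiorBall n)) hPm3
  rw [hswap]
  have hin : ∀ t ∈ Ioo (0 : ℝ) (1 / 2), ∀ Z : Space n,
      ∫⁻ x : Flat n, P ((1 - t) • flat x + t • Z) ≤ ENNReal.ofReal (2 ^ n) * Φ (t * height Z) := by
    intro t ht Z
    obtain ⟨ζ, hζ⟩ := exists_eq_flat_add Z
    have h1t : 0 < 1 - t := by linarith [ht.2]
    have h1 := lintegral_scale (volume : Measure (Flat n))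
      (fun x => P (flat x + (t * height Z) • vert)) (t • ζ) h1t
    have h2 : ∀ x : Flat n, (1 - t) • flat x + t • Z =
        flat (t • ζ + (1 - t) • x) + (t * height Z) • vert := by
      intro x
      rw [flat_add, flat_smul, flat_smul]
      nth_rewrite 1 [hζ]
      module
    simp only [h2]
    rw [hΦ]
    simp only
    rw [h1, ← mul_assoc, ← ENNReal.ofReal_mul (by positivity)]
    refine le_mul_of_one_le_left zero_le ?_
    rw [ENNReal.one_le_ofReal, finrank_euclideanSpace_fin, ← mul_pow]
    exact one_le_pow₀ (by linarith [ht.2])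
  have hone : ∀ Z ∈ interiorBall n, ∫⁻ t in Ioo (0 : ℝ) (1 / 2), ENNReal.ofReal (t ^ (1 - 2 * σ)) *
      Φ (t * height Z) ≤ ENNReal.ofReal 16 * ∫⁻ X, P X ∂wvol n s := by
    intro Z hZ
    obtain ⟨-, h2, h3⟩ := interiorBall_bounds hZ
    have hh : 0 < height Z := by linarith
    set Y : ℝ → ℝ≥0∞ := (Ioi 0).indicator fun y => ENNReal.ofReal (y ^ weightExp s) * Φ y with hY
    have hYm : Measurable Y := by
      refine Measurable.indicator ?_ measurableSet_Ioi
      exact Measurable.mul (by fun_prop) hΦm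
    have h4 : ∀ t ∈ Ioo (0 : ℝ) (1 / 2), ENNReal.ofReal (t ^ (1 - 2 * σ)) * Φ (t * height Z) ≤
        ENNReal.ofReal 4 * Y (0 + height Z • t) := by
      intro t ht
      have hp : 0 < height Z * t := mul_pos hh ht.1
      rw [zero_add, smul_eq_mul, hY, indicator_of_mem (show height Z * t ∈ Ioi 0 from hp), mul_comm t,
        ← mul_assoc, ← ENNReal.ofReal_mul (by norm_num)]
      gcongr
      rw [Real.mul_rpow hh.le ht.1.le]
      have h5 := rpow_weightExp_le hs₀ h2 h3
      have h6 : t ^ (1 - 2 * σ) ≤ t ^ weightExp s :=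
        Real.rpow_le_rpow_of_exponent_ge ht.1 (by linarith [ht.2]) (by rw [weightExp]; linarith)
      have h7 : 0 ≤ t ^ weightExp s := Real.rpow_nonneg ht.1.le _
      nlinarith
    calc _ ≤ ∫⁻ t in Ioo (0 : ℝ) (1 / 2), ENNReal.ofReal 4 * Y (0 + height Z • t) :=
          setLIntegral_mono (by fun_prop) h4
      _ ≤ ∫⁻ t, ENNReal.ofReal 4 * Y (0 + height Z • t) := setLIntegral_le_lintegral _ _
      _ = ENNReal.ofReal 4 * ∫⁻ t, Y (0 + height Z • t) := lintegral_const_mul _ (by fun_prop)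
      _ ≤ ENNReal.ofReal 4 * (ENNReal.ofReal 4 * (ENNReal.ofReal (height Z ^ Module.finrank ℝ ℝ) *
            ∫⁻ t, Y (0 + height Z • t))) := by
          gcongr
          rw [← mul_assoc, ← ENNReal.ofReal_mul (by norm_num)]
          refine le_mul_of_one_le_left zero_le ?_
          rw [ENNReal.one_le_ofReal, Module.finrank_self, pow_one]
          linarith
      _ = _ := by
          rw [← lintegral_scale volume Y 0 hh, hY, lintegral_indicator measurableSet_Ioi, ← hD,
            ← mul_assoc, ← ENNReal.ofReal_mul (by norm_num)]
          norm_num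
  calc _ ≤ ∫⁻ t in Ioo (0 : ℝ) (1 / 2), ENNReal.ofReal (t ^ (1 - 2 * σ)) *
        ∫⁻ Z in interiorBall n, ENNReal.ofReal (2 ^ n) * Φ (t * height Z) := by
        refine setLIntegral_mono' measurableSet_Ioo fun t ht => ?_
        gcongr _ * ?_
        exact lintegral_mono fun Z => hin t ht Z
    _ = ∫⁻ t in Ioo (0 : ℝ) (1 / 2), ∫⁻ Z in interiorBall n, ENNReal.ofReal (2 ^ n) *
          (ENNReal.ofReal (t ^ (1 - 2 * σ)) * Φ (t * height Z)) := by
        refine lintegral_congr fun t => ?_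
        have hm : Measurable fun Z : Space n => Φ (t * height Z) :=
          hΦm.comp (measurable_const.mul measurable_height)
        rw [← lintegral_const_mul _ (hm.const_mul _)]
        refine lintegral_congr fun Z => ?_
        ring
    _ = ∫⁻ Z in interiorBall n, ∫⁻ t in Ioo (0 : ℝ) (1 / 2), ENNReal.ofReal (2 ^ n) *
          (ENNReal.ofReal (t ^ (1 - 2 * σ)) * Φ (t * height Z)) := by
        refine lintegral_lintegral_swap (Measurable.aemeasurable ?_)
        refine measurable_const.mul (Measurable.mul (by fun_prop) (hΦm.comp ?_))
        exact measurable_fst.mul (measurable_height.comp measurable_snd)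
    _ ≤ ∫⁻ Z in interiorBall n, ENNReal.ofReal (2 ^ n) *
          (ENNReal.ofReal 16 * ∫⁻ X, P X ∂wvol n s) := by
        refine setLIntegral_mono' measurableSet_interiorBall fun Z hZ => ?_
        rw [lintegral_const_mul]
        · gcongr
          exact hone Z hZ
        · exact Measurable.mul (by fun_prop) (hΦm.comp (by fun_prop))
    _ = _ := by
        rw [setLIntegral_const, ← mul_assoc, ← ENNReal.ofReal_mul (by positivity), mul_right_comm,
          mul_comm (2 ^ n : ℝ)]

end Paths

/-! ### Spherical means away from the centre -/

section PathEstimates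

variable {n : ℕ}

/-- The square of the norm of the gradient in the unit ball. -/
def gradDensity (w : Space n → ℝ) : Space n → ℝ≥0∞ :=
  (ball 0 1).indicator fun X => ‖gradient w X‖ₑ ^ 2

theorem measurable_gradDensity {w : Space n → ℝ} (hw : ContDiff ℝ ∞ w) :
    Measurable (gradDensity w) := by
  have := continuous_gradient hw
  exact Measurable.indicator (by fun_prop) measurableSet_ball

theorem setLIntegral_wvol (s : ℝ) {F : Space n → ℝ≥0∞} (hF : Measurable F) {A : Set (Space n)}
    (hA : MeasurableSet A) :
    ∫⁻ X in A, F X ∂wvol n s = ∫⁻ X in A ∩ upper n, ENNReal.ofReal (weight s X) * F X := by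
  rw [← lintegral_indicator hA, lintegral_wvol s (hF.indicator hA),
    ← Measure.restrict_restrict hA, ← lintegral_indicator hA]
  refine lintegral_congr fun X => ?_
  by_cases h : X ∈ A <;> simp [h]

theorem continuous_sphereMean {s : ℝ} (hs : s < 1) {w : Space n → ℝ} (hw : Continuous w)
    (x₀ : Flat n) : Continuous (sphereMean s w x₀) := by
  have := isFiniteMeasure_wsphere (n := n) hs
  have hc : Continuous (Function.uncurry fun (r : ℝ) (θ : sphere (0 : Space n) 1) =>
      w (flat x₀ + r • (θ : Space n)) ^ 2) := by
    simp only [Function.uncurry_def]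
    fun_prop
  have := continuous_parametric_integral_of_continuous (μ := wsphere n s) hc isCompact_univ
  simp only [Measure.restrict_univ] at this
  exact this

theorem integrable_wsphere_of_continuous {s : ℝ} (hs : s < 1) {F : sphere (0 : Space n) 1 → ℝ}
    (hF : Continuous F) : Integrable F (wsphere n s) := by
  have := isFiniteMeasure_wsphere (n := n) hs
  obtain ⟨B, hB⟩ := isCompact_univ.exists_bound_of_continuousOn hF.continuousOn
  exact Integrable.of_bound hF.aestronglyMeasurable B (Eventually.of_forall fun θ => hB θ trivial)

theorem integral_halfBall_continuous {s : ℝ} (hs : s < 1) {F : Space n → ℝ} (hF : Continuous F) :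
    IntegrableOn (fun t => t ^ ((n : ℝ) + weightExp s) * ∫ θ, F (t • (θ : Space n)) ∂wsphere n s)
      (Ioo 0 1) ∧
    ∫ X in ball 0 1, F X ∂wvol n s =
      ∫ t in Ioo 0 1, t ^ ((n : ℝ) + weightExp s) * ∫ θ, F (t • (θ : Space n)) ∂wsphere n s := by
  have hi : Integrable F ((wvol n s).restrict (ball 0 1)) :=
    memLp_one_iff_integrable.1 (memLp_of_continuous_ball hs hF 1 1)
  have h1 := (integrableOn_wvol s _ measurableSet_ball).1 hi
  have h2 := polar_halfBall (0 : Flat n) (R := 1) (fun X _ => weight s X * F X)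
    (by rw [flat_zero]; exact h1)
  have hv : ∀ t ∈ Ioo (0 : ℝ) 1, halfSphereIntegral (0 : Flat n) t (fun X _ => weight s X * F X) =
      t ^ ((n : ℝ) + weightExp s) * ∫ θ, F (t • (θ : Space n)) ∂wsphere n s := by
    intro t ht
    rw [halfSphereIntegral_weight ht.1 _ fun X _ => F X]
    simp only [flat_zero, zero_add]
  refine ⟨h2.1.congr_fun hv measurableSet_Ioo, ?_⟩
  have h3 := h2.2.1 1 le_rfl
  rw [flat_zero] at h3
  rw [setIntegral_wvol s _ measurableSet_ball, ← halfBall_eq, h3]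
  exact setIntegral_congr_fun measurableSet_Ioo hv

/-- From radius 1 inward the mean changes by the radial integral of 2 w ∂_r w, which is at most w²/2
+ 2|∇w|² pointwise. At the radius where the mean is maximal the first term is absorbed. The power of
8 is the price of comparing t^(n+a) with 1 for t ≥ 1/8. -/
theorem sphereMean_le {s : ℝ} (hs₀ : 0 < s) (hs : s < 1) {w : Space n → ℝ} (hw : ContDiff ℝ ∞ w) :
    ∀ ρ ∈ Icc (1 / 8 : ℝ) 1, sphereMean s w 0 ρ ≤ 2 * sphereMean s w 0 1 +
      4 * 8 ^ (n + 1) * ∫ X in ball 0 1, ‖gradient w X‖ ^ 2 ∂wvol n s := by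
  have hgc := continuous_gradient hw
  have hwc := hw.continuous
  set D := ∫ X in ball 0 1, ‖gradient w X‖ ^ 2 ∂wvol n s with hD
  set Gm : ℝ → ℝ := fun t => ∫ θ, ‖gradient w (t • (θ : Space n))‖ ^ 2 ∂wsphere n s with hGm
  obtain ⟨p1, p2⟩ := integral_halfBall_continuous (n := n) hs (F := fun X => ‖gradient w X‖ ^ 2)
    (by fun_prop)
  have hGm0 : ∀ t, 0 ≤ Gm t := fun t => integral_nonneg fun θ => by positivity
  have hGmc : Continuous Gm := by
    have := isFiniteMeasure_wsphere (n := n) hs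
    have hc : Continuous (Function.uncurry fun (r : ℝ) (θ : sphere (0 : Space n) 1) =>
        ‖gradient w (r • (θ : Space n))‖ ^ 2) := by
      simp only [Function.uncurry_def]
      fun_prop
    have := continuous_parametric_integral_of_continuous (μ := wsphere n s) hc isCompact_univ
    simp only [Measure.restrict_univ] at this
    exact this
  have hMc := continuous_sphereMean hs hwc (0 : Flat n)
  have hGmD : ∀ ρ ∈ Icc (1 / 8 : ℝ) 1, ∫ t in ρ..1, Gm t ≤ 8 ^ (n + 1) * D := by
    intro ρ hρ
    rw [hD, p2, intervalIntegral.integral_of_le hρ.2, integral_Ioc_eq_integral_Ioo,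
      ← integral_const_mul]
    refine (setIntegral_mono_on ((hGmc.integrableOn_Icc (a := 0) (b := 1)).mono_set
      fun t ht => ⟨by linarith [ht.1, hρ.1], ht.2.le⟩)
      (IntegrableOn.mono_set (p1.const_mul (8 ^ (n + 1)))
        fun t ht => ⟨by linarith [ht.1, hρ.1], ht.2⟩) measurableSet_Ioo fun t ht => ?_).trans ?_
    · change Gm t ≤ 8 ^ (n + 1) * (t ^ ((n : ℝ) + weightExp s) * Gm t)
      have ht8 : 1 / 8 ≤ t := by linarith [ht.1, hρ.1]
      have ht0 : 0 < t := by linarith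
      rw [← mul_assoc]
      refine le_mul_of_one_le_left (hGm0 t) ?_
      have h1 : t ^ ((n : ℝ) + 1) ≤ t ^ ((n : ℝ) + weightExp s) :=
        Real.rpow_le_rpow_of_exponent_ge ht0 ht.2.le (by rw [weightExp]; linarith)
      have h2 : (1 / 8 : ℝ) ^ (n + 1) ≤ t ^ ((n : ℝ) + 1) := by
        rw [show (n : ℝ) + 1 = ((n + 1 : ℕ) : ℝ) by push_cast; ring, Real.rpow_natCast]
        gcongr
      calc (1 : ℝ) = 8 ^ (n + 1) * (1 / 8) ^ (n + 1) := by rw [← mul_pow]; norm_num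
        _ ≤ _ := by gcongr; exact h2.trans h1
    · refine setIntegral_mono_set (p1.const_mul (8 ^ (n + 1))) ?_
        (Eventually.of_forall fun t (ht : t ∈ Ioo ρ 1) => ⟨by linarith [ht.1, hρ.1], ht.2⟩)
      filter_upwards [ae_restrict_mem measurableSet_Ioo] with t ht
      have := hGm0 t
      have := Real.rpow_nonneg ht.1.le ((n : ℝ) + weightExp s)
      simp only [Pi.zero_apply]
      positivity
  -- The maximum m of the mean over [1/8, 1]; the bound proved next contains m/2 and is then applied
  -- at ρm itself.
  obtain ⟨ρm, hρm, hmax⟩ := (isCompact_Icc (a := (1 / 8 : ℝ)) (b := 1)).exists_isMaxOn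
    ⟨1, by norm_num⟩ hMc.continuousOn
  set m := sphereMean s w 0 ρm with hm
  have hM0 : ∀ t, 0 ≤ sphereMean s w 0 t := fun t => integral_nonneg fun θ => by positivity
  have hbound : ∀ ρ ∈ Icc (1 / 8 : ℝ) 1, sphereMean s w 0 ρ ≤ sphereMean s w 0 1 + m / 2 +
      2 * (8 ^ (n + 1) * D) := by
    intro ρ hρ
    have hρ0 : 0 < ρ := by linarith [hρ.1]
    have h1 := sphereMean_sub_smooth hs (0 : Flat n) hρ0 hρ.2 hw
    have h2 : ∀ t ∈ Ioo ρ 1, -(2 * t ^ (-((n : ℝ) + weightExp s)) *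
        radialFlux s w (gradient w) 0 t) ≤ m / 2 + 2 * Gm t := by
      intro t ht
      have ht0 : 0 < t := hρ0.trans ht.1
      have h3 : t ^ (-((n : ℝ) + weightExp s)) * t ^ ((n : ℝ) + weightExp s) = 1 := by
        rw [← Real.rpow_add ht0, neg_add_cancel, Real.rpow_zero]
      rw [radialFlux, halfSphereIntegral_weight ht0, mul_assoc 2, ← mul_assoc (t ^ _), h3, one_mul,
        ← integral_const_mul, ← integral_neg]
      have h4 : sphereMean s w 0 t ≤ m := hmax (show t ∈ Icc (1 / 8 : ℝ) 1 from
        ⟨by linarith [ht.1, hρ.1], ht.2.le⟩)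
      have i1 : Integrable (fun θ : sphere (0 : Space n) 1 =>
          w (flat 0 + t • (θ : Space n)) ^ 2) (wsphere n s) :=
        integrable_wsphere_of_continuous hs (by fun_prop)
      have i2 : Integrable (fun θ : sphere (0 : Space n) 1 =>
          ‖gradient w (t • (θ : Space n))‖ ^ 2) (wsphere n s) :=
        integrable_wsphere_of_continuous hs (by fun_prop)
      calc _ ≤ ∫ θ : sphere (0 : Space n) 1, (1 / 2 * w (flat 0 + t • (θ : Space n)) ^ 2 +
            2 * ‖gradient w (t • (θ : Space n))‖ ^ 2) ∂wsphere n s := by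
            refine integral_mono (integrable_wsphere_of_continuous hs ?_)
              ((i1.const_mul _).add (i2.const_mul _)) fun θ => ?_
            · fun_prop
            · have h5 := abs_real_inner_le_norm (gradient w (flat 0 + t • (θ : Space n))) (θ : Space n)
              have h6 : ‖(θ : Space n)‖ = 1 := by simp
              rw [h6, mul_one, flat_zero, zero_add] at h5
              simp only [flat_zero, zero_add]
              set A := w (t • (θ : Space n))
              set I := ⟪gradient w (t • (θ : Space n)), (θ : Space n)⟫
              have h7 : I ^ 2 ≤ ‖gradient w (t • (θ : Space n))‖ ^ 2 := sq_le_sq' (by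
                linarith [neg_abs_le I]) ((le_abs_self I).trans h5)
              nlinarith [sq_nonneg (A + 2 * I)]
        _ = 1 / 2 * sphereMean s w 0 t + 2 * Gm t := by
            rw [integral_add (i1.const_mul _) (i2.const_mul _), integral_const_mul,
              integral_const_mul]
            rfl
        _ ≤ _ := by linarith
    have hint : IntervalIntegrable (fun t => 2 * t ^ (-((n : ℝ) + weightExp s)) *
        radialFlux s w (gradient w) 0 t) volume ρ 1 := by
      refine (integral_annulusKernel (ρ := 1) hρ0 hρ.2 (by simp) ?_).1
      obtain ⟨B, hB0, hB⟩ := exists_bound_annulusKernel s (0 : Flat n) hρ0 1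
      have hwB := memLp_of_continuous_ball (n := n) hs hwc 2 1
      have h5 := (hwB.integrable_mul
        (memLp_of_continuous_ball (n := n) hs (F := ℝ) hgc.norm 2 1))
      have hnm : AEStronglyMeasurable (fun X => ⟪gradient w X, normalDir (0 : Flat n) X⟫)
          ((wvol n s).restrict (ball 0 1)) :=
        hgc.aestronglyMeasurable.inner (measurable_normalDir _).aestronglyMeasurable
      refine Integrable.mono' (h5.norm.const_mul B)
        (((measurable_annulusKernel s _ _ _).aestronglyMeasurable.mul
          hwc.aestronglyMeasurable).mul hnm) (Eventually.of_forall fun X => ?_)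
      rw [norm_mul, norm_mul, mul_assoc]
      refine mul_le_mul (hB X) ?_ (by positivity) hB0
      rw [Pi.mul_apply, norm_mul, norm_norm]
      gcongr
      refine (norm_inner_le_norm _ _).trans ?_
      exact mul_le_of_le_one_right (norm_nonneg _) (norm_normalDir_le _ _)
    have h8 : ∫ t in ρ..1, -(2 * t ^ (-((n : ℝ) + weightExp s)) *
        radialFlux s w (gradient w) 0 t) ≤ ∫ t in ρ..1, (m / 2 + 2 * Gm t) := by
      refine intervalIntegral.integral_mono_on_of_le_Ioo hρ.2 hint.neg
        (Continuous.intervalIntegrable (by fun_prop) _ _) h2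
    rw [intervalIntegral.integral_neg, intervalIntegral.integral_add
      (Continuous.intervalIntegrable (by fun_prop) _ _)
      (Continuous.intervalIntegrable (by fun_prop) _ _), intervalIntegral.integral_const,
      intervalIntegral.integral_const_mul, smul_eq_mul] at h8
    have h9 := hGmD ρ hρ
    have h10 : (1 - ρ) * (m / 2) ≤ m / 2 := by
      have : 0 ≤ m := hM0 _
      nlinarith
    linarith
  intro ρ hρ
  have h1 := hbound ρm hρm
  have h2 : sphereMean s w 0 ρ ≤ m := hmax hρ
  have h3 := hbound ρ hρ
  rw [← hm] at h1
  linarith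

end PathEstimates

/-! ### The trace inequality in the unit half ball -/

section TraceUnit

variable {n : ℕ}

/-- The fundamental theorem of calculus on the first half of the segment from the boundary point to
Z, whose length is at most 2. Stopping at t = 1/2 keeps the Jacobian (1-t)^n bounded below and ends
at a point well inside the half ball. -/
theorem enorm_trace_le {w : Space n → ℝ} (hw : ContDiff ℝ ∞ w) {x : Flat n} (hx : ‖x‖ < 1)
    {Z : Space n} (hZ : Z ∈ interiorBall n) :
    ‖w (flat x)‖ₑ ≤ ‖w ((1 - (1 / 2 : ℝ)) • flat x + (1 / 2 : ℝ) • Z)‖ₑ +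
      2 * ∫⁻ t in Ioo (0 : ℝ) (1 / 2), gradDensity w ((1 - t) • flat x + t • Z) ^ (1 / 2 : ℝ) := by
  set P : ℝ → Space n := fun t => (1 - t) • flat x + t • Z with hP
  have hPd : ∀ t, HasDerivAt P (Z - flat x) t := by
    intro t
    have h1 : HasDerivAt (fun t : ℝ => (1 - t) • flat x) ((-1 : ℝ) • flat x) t := by
      simpa using (((hasDerivAt_id t).const_sub 1).smul_const (flat x))
    have h2 : HasDerivAt (fun t : ℝ => t • Z) ((1 : ℝ) • Z) t := (hasDerivAt_id t).smul_const Z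
    refine (h1.add h2).congr_deriv ?_
    module
  have hPc : Continuous P := by fun_prop
  have hgc := continuous_gradient hw
  have hfc : Continuous fun t => ⟪gradient w (P t), Z - flat x⟫ := by fun_prop
  have hder : ∀ t, HasDerivAt (fun t => w (P t)) ⟪gradient w (P t), Z - flat x⟫ t := by
    intro t
    rw [inner_gradient]
    exact (hw.differentiable (by simp) (P t)).hasFDerivAt.comp_hasDerivAt t (hPd t)
  have hftc := intervalIntegral.integral_eq_sub_of_hasDerivAt (a := 0) (b := 1 / 2)
    (fun t _ => hder t) (hfc.intervalIntegrable _ _)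
  have hP0 : P 0 = flat x := by simp [hP]
  have hw0 : w (flat x) = w (P (1 / 2)) + -∫ t in (0 : ℝ)..1 / 2, ⟪gradient w (P t), Z - flat x⟫ := by
    rw [hftc, hP0]; ring
  rw [hw0]
  refine (enorm_add_le _ _).trans (add_le_add le_rfl ?_)
  rw [enorm_neg, intervalIntegral.integral_of_le (by norm_num), integral_Ioc_eq_integral_Ioo]
  refine (enorm_integral_le_lintegral_enorm _).trans ?_
  have hm : Measurable fun t : ℝ => gradDensity w ((1 - t) • flat x + t • Z) ^ (1 / 2 : ℝ) :=
    ((measurable_gradDensity hw).comp hPc.measurable).pow_const _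
  rw [← lintegral_const_mul _ hm]
  refine setLIntegral_mono' measurableSet_Ioo fun t ht => ?_
  have hmem : P t ∈ ball (0 : Space n) 1 :=
    (path_mem_halfBall hx hZ ⟨ht.1, by linarith [ht.2]⟩).1
  have h0 : gradDensity w ((1 - t) • flat x + t • Z) ^ (1 / 2 : ℝ) = ‖gradient w (P t)‖ₑ := by
    rw [gradDensity, indicator_of_mem hmem, ← ENNReal.rpow_natCast, ← ENNReal.rpow_mul]
    norm_num
  rw [h0]
  have h1 := (interiorBall_bounds hZ).1
  have h2 : ‖⟪gradient w (P t), Z - flat x⟫‖ ≤ 2 * ‖gradient w (P t)‖ := by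
    refine (norm_inner_le_norm _ _).trans ?_
    rw [mul_comm]
    gcongr
    calc ‖Z - flat x‖ ≤ ‖Z‖ + ‖flat x‖ := norm_sub_le _ _
      _ ≤ 2 := by rw [norm_flat]; linarith
  calc ‖⟪gradient w (P t), Z - flat x⟫‖ₑ = ENNReal.ofReal ‖⟪gradient w (P t), Z - flat x⟫‖ :=
        (ofReal_norm _).symm
    _ ≤ ENNReal.ofReal (2 * ‖gradient w (P t)‖) := ENNReal.ofReal_le_ofReal h2
    _ = _ := by rw [ENNReal.ofReal_mul (by norm_num), ofReal_norm, ENNReal.ofReal_ofNat]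

/-- Integrates `sphereMean_le` over the radii in [1/8, 1). The factor t^(n+a) is at most 1 because n
≥ 1 > -a. -/
theorem lintegral_annulus_le {s : ℝ} (hs₀ : 0 < s) (hs : s < 1) {w : Space n → ℝ}
    (hw : ContDiff ℝ ∞ w) {S : ℝ} (hS : 0 ≤ S)
    (hD : ∫⁻ X, gradDensity w X ∂wvol n s ≤ ENNReal.ofReal S) (hH : sphereMean s w 0 1 ≤ S)
    (hn : 1 ≤ n) :
    ∫⁻ X in {X | X ∈ ball 0 1 ∧ 1 / 8 ≤ ‖X‖}, ‖w X‖ₑ ^ 2 ∂wvol n s ≤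
      ENNReal.ofReal ((2 + 4 * 8 ^ (n + 1)) * S) := by
  have hwc := hw.continuous
  have hgc := continuous_gradient hw
  set A : Set (Space n) := {X | X ∈ ball 0 1 ∧ 1 / 8 ≤ ‖X‖} with hA
  have hAm : MeasurableSet A := measurableSet_ball.inter (measurableSet_le measurable_const
    measurable_norm)
  have hDr : ∫ X in ball 0 1, ‖gradient w X‖ ^ 2 ∂wvol n s ≤ S := by
    rw [integral_eq_lintegral_of_nonneg_ae (Eventually.of_forall fun X => by positivity)
      (by fun_prop)]
    refine ENNReal.toReal_le_of_le_ofReal hS (le_trans (le_of_eq ?_) hD)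
    rw [← lintegral_indicator measurableSet_ball]
    refine lintegral_congr fun X => ?_
    rw [gradDensity]
    congr 1
    funext X
    rw [ENNReal.ofReal_pow (norm_nonneg _), ofReal_norm]
  have hM := sphereMean_le (n := n) hs₀ hs hw
  set K := (2 + 4 * 8 ^ (n + 1)) * S with hK
  have hMK : ∀ ρ ∈ Icc (1 / 8 : ℝ) 1, sphereMean s w 0 ρ ≤ K := by
    intro ρ hρ
    refine (hM ρ hρ).trans ?_
    rw [hK, add_mul]
    gcongr
  have hi : IntegrableOn (fun X => w X ^ 2) (ball 0 1) (wvol n s) :=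
    memLp_one_iff_integrable.1 (memLp_of_continuous_ball hs (by fun_prop) 1 1)
  have hi2 : IntegrableOn (fun X => A.indicator (fun X => w X ^ 2) X) (ball 0 1) (wvol n s) :=
    hi.indicator hAm
  have h1 : ∫⁻ X in A, ‖w X‖ₑ ^ 2 ∂wvol n s =
      ENNReal.ofReal (∫ X in ball 0 1, A.indicator (fun X => w X ^ 2) X ∂wvol n s) := by
    rw [ofReal_integral_eq_lintegral_ofReal hi2
      (Eventually.of_forall fun X => indicator_nonneg (fun X _ => by positivity) _)]
    rw [← lintegral_indicator hAm, ← lintegral_indicator measurableSet_ball]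
    refine lintegral_congr fun X => ?_
    by_cases h : X ∈ A
    · rw [indicator_of_mem h, indicator_of_mem h.1, indicator_of_mem h, ← ofReal_norm,
        ← ENNReal.ofReal_pow (norm_nonneg _), Real.norm_eq_abs, sq_abs]
    · rw [indicator_of_notMem h]
      by_cases h' : X ∈ ball (0 : Space n) 1 <;> simp [h, h']
  rw [h1]
  refine ENNReal.ofReal_le_ofReal ?_
  have h2 := polar_halfBall (0 : Flat n) (R := 1)
    (fun X _ => weight s X * A.indicator (fun X => w X ^ 2) X)
    (by rw [flat_zero]; exact (integrableOn_wvol s _ measurableSet_ball).1 hi2)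
  have h3 := h2.2.1 1 le_rfl
  rw [flat_zero] at h3
  rw [setIntegral_wvol s _ measurableSet_ball, ← halfBall_eq, h3]
  have hK0 : 0 ≤ K := by positivity
  have h4 : ∀ t ∈ Ioo (0 : ℝ) 1, halfSphereIntegral (0 : Flat n) t (fun X _ =>
      weight s X * A.indicator (fun X => w X ^ 2) X) ≤ K := by
    intro t ht
    rw [halfSphereIntegral_weight ht.1 _ fun X _ => A.indicator (fun X => w X ^ 2) X]
    by_cases h8 : 1 / 8 ≤ t
    · have h5 : ∫ θ : sphere (0 : Space n) 1, A.indicator (fun X => w X ^ 2)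
          (flat 0 + t • (θ : Space n)) ∂wsphere n s = sphereMean s w 0 t := by
        refine integral_congr_ae (Eventually.of_forall fun θ => ?_)
        have hnorm : ‖flat (0 : Flat n) + t • (θ : Space n)‖ = t := by
          rw [flat_zero, zero_add, norm_smul_sphere θ ht.1.le]
        have : flat (0 : Flat n) + t • (θ : Space n) ∈ A :=
          ⟨mem_ball_zero_iff.2 (by rw [hnorm]; exact ht.2), by rw [hnorm]; exact h8⟩
        simp only [indicator_of_mem this]
      rw [h5]
      have h6 : t ^ ((n : ℝ) + weightExp s) ≤ 1 := by
        refine Real.rpow_le_one ht.1.le ht.2.le ?_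
        have : (1 : ℝ) ≤ n := by exact_mod_cast hn
        rw [weightExp]; linarith
      have h7 := hMK t ⟨h8, ht.2.le⟩
      have h9 : 0 ≤ t ^ ((n : ℝ) + weightExp s) := Real.rpow_nonneg ht.1.le _
      nlinarith
    · have h5 : ∫ θ : sphere (0 : Space n) 1, A.indicator (fun X => w X ^ 2)
          (flat 0 + t • (θ : Space n)) ∂wsphere n s = 0 := by
        refine integral_eq_zero_of_ae (Eventually.of_forall fun θ => ?_)
        have : flat (0 : Flat n) + t • (θ : Space n) ∉ A := fun h => h8 (by
          have := h.2
          rwa [flat_zero, zero_add, norm_smul_sphere θ ht.1.le] at this)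
        simp only [indicator_of_notMem this]; rfl
      rw [h5, mul_zero]; exact hK0
  refine (setIntegral_mono_on h2.1 (integrableOn_const (by simp) (by simp)) measurableSet_Ioo h4).trans ?_
  simp

theorem lintegral_sqrt_le_mul {α : Type*} [MeasurableSpace α] (μ : Measure α) {p : α → ℝ≥0∞}
    (hp : Measurable p) : ∫⁻ x, p x ^ (1 / 2 : ℝ) ∂μ ≤
      μ univ ^ (1 / 2 : ℝ) * (∫⁻ x, p x ∂μ) ^ (1 / 2 : ℝ) := by
  have h := sq_lintegral_le μ (p := fun x => p x ^ (1 / 2 : ℝ)) (by fun_prop)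
  have h1 : ∀ z : ℝ≥0∞, (z ^ (1 / 2 : ℝ)) ^ 2 = z := fun z => by
    rw [← ENNReal.rpow_natCast, ← ENNReal.rpow_mul]; norm_num
  have h2 : ∀ z : ℝ≥0∞, (z ^ 2) ^ (1 / 2 : ℝ) = z := fun z => by
    rw [← ENNReal.rpow_natCast, ← ENNReal.rpow_mul]; norm_num
  simp only [h1] at h
  have h3 := ENNReal.rpow_le_rpow h (show (0 : ℝ) ≤ 1 / 2 by norm_num)
  rwa [h2, ENNReal.mul_rpow_of_nonneg _ _ (by norm_num)] at h3

/-- The midpoints have height at least 1/8, so they lie where `lintegral_annulus_le` applies;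
Cauchy-Schwarz and the change of variables at t = 1/2 do the rest. -/
theorem lintegral_interior_le (hn : 1 ≤ n) {s : ℝ} (hs₀ : 0 < s) (hs : s < 1) {w : Space n → ℝ}
    (hw : ContDiff ℝ ∞ w) {S : ℝ} (hS : 0 < S)
    (hD : ∫⁻ X, gradDensity w X ∂wvol n s ≤ ENNReal.ofReal S) (hH : sphereMean s w 0 1 ≤ S)
    {x : Flat n} (hx : ‖x‖ < 1) :
    ∫⁻ Z in interiorBall n, ‖w ((1 - (1 / 2 : ℝ)) • flat x + (1 / 2 : ℝ) • Z)‖ₑ ≤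
      (volume (interiorBall n) * (ENNReal.ofReal (4 * (1 / 2 : ℝ) ^ (-((n : ℝ) + 2 - 2 * s))) *
        ENNReal.ofReal (2 + 4 * 8 ^ (n + 1)))) ^ (1 / 2 : ℝ) * ENNReal.ofReal S ^ (1 / 2 : ℝ) := by
  have hwc := hw.continuous
  set F : Space n → ℝ≥0∞ :=
    ({X | X ∈ ball 0 1 ∧ 1 / 8 ≤ ‖X‖} : Set (Space n)).indicator fun X => ‖w X‖ₑ ^ 2 with hF
  have hAm : MeasurableSet ({X | X ∈ ball 0 1 ∧ 1 / 8 ≤ ‖X‖} : Set (Space n)) :=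
    measurableSet_ball.inter (measurableSet_le measurable_const measurable_norm)
  have hFm : Measurable F := Measurable.indicator (by fun_prop) hAm
  have h2 : ∀ z : ℝ≥0∞, (z ^ 2) ^ (1 / 2 : ℝ) = z := fun z => by
    rw [← ENNReal.rpow_natCast, ← ENNReal.rpow_mul]; norm_num
  have hcs := lintegral_sqrt_le_mul (volume.restrict (interiorBall n))
    (p := fun Z => ‖w ((1 - (1 / 2 : ℝ)) • flat x + (1 / 2 : ℝ) • Z)‖ₑ ^ 2)
    (Continuous.measurable (by fun_prop))
  simp only [h2] at hcs
  have h1 : ∫⁻ Z in interiorBall n, ‖w ((1 - (1 / 2 : ℝ)) • flat x + (1 / 2 : ℝ) • Z)‖ₑ ^ 2 ≤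
      ENNReal.ofReal (4 * (1 / 2 : ℝ) ^ (-((n : ℝ) + 2 - 2 * s))) *
        (ENNReal.ofReal (2 + 4 * 8 ^ (n + 1)) * ENNReal.ofReal S) := by
    calc _ ≤ ∫⁻ Z in interiorBall n, F ((1 - (1 / 2 : ℝ)) • flat x + (1 / 2 : ℝ) • Z) := by
          refine setLIntegral_mono' measurableSet_interiorBall fun Z hZ => ?_
          have hm := path_mem_halfBall hx hZ (t := 1 / 2) (by norm_num)
          have hh : 1 / 8 ≤ ‖(1 - (1 / 2 : ℝ)) • flat x + (1 / 2 : ℝ) • Z‖ := by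
            refine le_trans ?_ ((le_abs_self _).trans (abs_height_le _))
            rw [height_add, height_smul, height_smul, height_flat]
            have := (interiorBall_bounds hZ).2.1
            linarith
          have hmem : (1 - (1 / 2 : ℝ)) • flat x + (1 / 2 : ℝ) • Z ∈
            ({X | X ∈ ball 0 1 ∧ 1 / 8 ≤ ‖X‖} : Set (Space n)) := ⟨hm.1, hh⟩
          rw [hF, indicator_of_mem hmem]
      _ ≤ _ := lintegral_path_le hs₀ le_rfl hFm x (by norm_num) (by norm_num)
      _ ≤ _ := by
          gcongr
          rw [hF, lintegral_indicator hAm, ← ENNReal.ofReal_mul (by positivity)]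
          exact lintegral_annulus_le hs₀ hs hw hS.le hD hH hn
  refine hcs.trans ?_
  rw [Measure.restrict_apply_univ, ENNReal.mul_rpow_of_nonneg (volume (interiorBall n)) _ (by norm_num),
    mul_assoc, ← ENNReal.mul_rpow_of_nonneg _ (ENNReal.ofReal S) (by norm_num)]
  gcongr _ * ?_
  refine ENNReal.rpow_le_rpow ?_ (by norm_num)
  rw [mul_assoc]
  exact h1

/-- The integral of `p` over the points at time `t` of the segments from `x` to the interior ball. -/
def pathMean (p : Space n → ℝ≥0∞) (x : Flat n) (t : ℝ) : ℝ≥0∞ :=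
  ∫⁻ Z in interiorBall n, p ((1 - t) • flat x + t • Z)

/-- The Riesz type potential of `p` built from segments. -/
def pathPotential (σ : ℝ) (p : Space n → ℝ≥0∞) (x : Flat n) : ℝ≥0∞ :=
  ∫⁻ t in Ioo (0 : ℝ) (1 / 2), ENNReal.ofReal (t ^ (1 - 2 * σ)) * pathMean p x t

theorem measurable_path {p : Space n → ℝ≥0∞} (hp : Measurable p) :
    Measurable fun q : (Flat n × ℝ) × Space n => p ((1 - q.1.2) • flat q.1.1 + q.1.2 • q.2) := by
  refine hp.comp (Continuous.measurable ?_)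
  have := continuous_flat (n := n)
  fun_prop

theorem measurable_pathMean {p : Space n → ℝ≥0∞} (hp : Measurable p) :
    Measurable fun q : Flat n × ℝ => pathMean p q.1 q.2 :=
  Measurable.lintegral_prod_right' (ν := volume.restrict (interiorBall n)) (measurable_path hp)

theorem measurable_pathMean_right {p : Space n → ℝ≥0∞} (hp : Measurable p) (x : Flat n) :
    Measurable fun t : ℝ => pathMean p x t :=
  (measurable_pathMean hp).comp (by fun_prop : Measurable fun t : ℝ => (x, t))

theorem measurable_pathPotential (σ : ℝ) {p : Space n → ℝ≥0∞} (hp : Measurable p) :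
    Measurable (pathPotential σ p) := by
  have : Measurable fun q : Flat n × ℝ =>
      ENNReal.ofReal (q.2 ^ (1 - 2 * σ)) * pathMean p q.1 q.2 :=
    Measurable.mul (by fun_prop) (measurable_pathMean hp)
  exact Measurable.lintegral_prod_right' (ν := volume.restrict (Ioo (0 : ℝ) (1 / 2))) this

theorem measurable_path_swap {p : Space n → ℝ≥0∞} (hp : Measurable p) (x : Flat n) :
    Measurable fun q : Space n × ℝ => p ((1 - q.2) • flat x + q.2 • q.1) ^ (1 / 2 : ℝ) :=
  ((measurable_path hp).comp (by fun_prop : Measurable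
    fun q : Space n × ℝ => ((x, q.2), q.1))).pow_const _

/-- Cauchy-Schwarz in Z replaces the average of the square root by the square root of the path mean.
Hedberg's splitting in t then applies, with its pointwise hypothesis supplied by `lintegral_path_le`
and its integral hypothesis by the potential. -/
theorem exists_lintegral_path_sqrt_le (hn : 1 ≤ n) {s : ℝ} (hs₀ : 0 < s) {σ : ℝ} (hσ0 : 0 < σ)
    (hσs : σ ≤ s) (hσn : 2 * σ < n) :
    ∃ K : ℝ≥0∞, K ≠ ⊤ ∧ ∀ p : Space n → ℝ≥0∞, Measurable p → ∀ S : ℝ, 0 < S →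
      ∫⁻ X, p X ∂wvol n s ≤ ENNReal.ofReal S → ∀ x : Flat n,
      ∫⁻ Z in interiorBall n, ∫⁻ t in Ioo (0 : ℝ) (1 / 2),
        p ((1 - t) • flat x + t • Z) ^ (1 / 2 : ℝ) ≤
        K * (ENNReal.ofReal S ^ (σ / n) *
          (pathPotential σ p x + ENNReal.ofReal S) ^ (1 / 2 - σ / n)) := by
  have hn0 : (0 : ℝ) < n := by exact_mod_cast hn
  obtain ⟨C, hC0, hC⟩ := lintegral_sqrt_le hσ0 hσn
  have hVt : volume (interiorBall n) ≠ ⊤ := measure_ball_lt_top.ne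
  have hq0 : 0 < 1 / 2 - σ / n := by
    rw [sub_pos, div_lt_iff₀ hn0]; linarith
  -- The maximum with 1 only keeps the constant nonzero, so that the right side is infinite where
  -- the potential is.
  refine ⟨max 1 (volume (interiorBall n) ^ (1 / 2 : ℝ) *
    (ENNReal.ofReal C * ENNReal.ofReal 4 ^ (σ / n))), ?_, ?_⟩
  · refine (max_lt ENNReal.one_lt_top (lt_top_iff_ne_top.2 ?_)).ne
    exact ENNReal.mul_ne_top (ENNReal.rpow_ne_top_of_nonneg (by norm_num) hVt)
      (ENNReal.mul_ne_top ENNReal.ofReal_ne_top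
        (ENNReal.rpow_ne_top_of_nonneg (by positivity) ENNReal.ofReal_ne_top))
  intro p hpm S hS hD x
  have hSe0 : ENNReal.ofReal S ≠ 0 := by simpa using hS
  by_cases hJt : pathPotential σ p x + ENNReal.ofReal S = ⊤
  · rw [hJt, ENNReal.top_rpow_of_pos hq0, ENNReal.mul_top, ENNReal.mul_top]
    · exact le_top
    · exact (zero_lt_one.trans_le (le_max_left _ _)).ne'
    · rw [Ne, ENNReal.rpow_eq_zero_iff]
      push Not
      exact ⟨fun h => absurd h hSe0, fun h => absurd h ENNReal.ofReal_ne_top⟩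
  refine le_trans ?_ (mul_le_mul_left (le_max_right _ _) _)
  rw [lintegral_lintegral_swap (measurable_path_swap hpm x).aemeasurable]
  have h1 : ∀ t, ∫⁻ Z in interiorBall n, p ((1 - t) • flat x + t • Z) ^ (1 / 2 : ℝ) ≤
      volume (interiorBall n) ^ (1 / 2 : ℝ) * pathMean p x t ^ (1 / 2 : ℝ) := by
    intro t
    have hcs := lintegral_sqrt_le_mul (volume.restrict (interiorBall n))
      (p := fun Z => p ((1 - t) • flat x + t • Z)) (by fun_prop)
    rwa [Measure.restrict_apply_univ] at hcs
  refine (lintegral_mono h1).trans ?_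
  rw [lintegral_const_mul _ ((measurable_pathMean_right hpm x).pow_const _), mul_assoc]
  gcongr _ * ?_
  -- Adding S to the potential makes the quantity strictly positive, as the splitting requires.
  set j := (pathPotential σ p x + ENNReal.ofReal S).toReal with hj
  have hjp : 0 < j := ENNReal.toReal_pos (by simp [hSe0]) hJt
  have hje : ENNReal.ofReal j = pathPotential σ p x + ENNReal.ofReal S := ENNReal.ofReal_toReal hJt
  have h6 := hC (pathMean p x) (4 * S) j (1 / 2) (measurable_pathMean_right hpm x) (by positivity)
    hjp (by
      intro t ht
      refine (lintegral_path_le hs₀ hσs hpm x ht.1 (by linarith [ht.2])).trans ?_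
      refine (mul_le_mul_right hD _).trans_eq ?_
      rw [← ENNReal.ofReal_mul (by have := ht.1; positivity)]
      congr 1; ring) (by rw [hje]; exact le_self_add)
  refine h6.trans_eq ?_
  rw [ENNReal.ofReal_mul hC0.le, ENNReal.ofReal_mul (by positivity),
    ← ENNReal.ofReal_rpow_of_nonneg (by positivity) (by positivity),
    ← ENNReal.ofReal_rpow_of_nonneg hjp.le hq0.le, hje,
    ENNReal.ofReal_mul (by norm_num), ENNReal.mul_rpow_of_nonneg _ _ (by positivity)]
  generalize ENNReal.ofReal C = c1
  generalize ENNReal.ofReal 4 ^ (σ / n) = c2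
  ring

/-- Averages `enorm_trace_le` over Z in the interior ball, which bounds the endpoint term by
`lintegral_interior_le` and the gradient term by the potential. -/
theorem exists_enorm_trace_le (hn : 1 ≤ n) {s : ℝ} (hs₀ : 0 < s) (hs : s < 1) {σ : ℝ}
    (hσ0 : 0 < σ) (hσs : σ ≤ s) (hσn : 2 * σ < n) :
    ∃ a₁ a₂ : ℝ≥0∞, a₁ ≠ ⊤ ∧ a₂ ≠ ⊤ ∧ ∀ w : Space n → ℝ, ContDiff ℝ ∞ w → ∀ S : ℝ, 0 < S →
      ∫⁻ X, gradDensity w X ∂wvol n s ≤ ENNReal.ofReal S → sphereMean s w 0 1 ≤ S →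
      ∀ x : Flat n, ‖x‖ < 1 → ‖w (flat x)‖ₑ ≤ a₁ * ENNReal.ofReal S ^ (1 / 2 : ℝ) +
        a₂ * (ENNReal.ofReal S ^ (σ / n) *
          (pathPotential σ (gradDensity w) x + ENNReal.ofReal S) ^ (1 / 2 - σ / n)) := by
  obtain ⟨K, hKt, hK⟩ := exists_lintegral_path_sqrt_le hn hs₀ hσ0 hσs hσn
  set V : ℝ≥0∞ := volume (interiorBall n) with hV
  have hVt : V ≠ ⊤ := measure_ball_lt_top.ne
  have hV0 : V ≠ 0 := (measure_ball_pos volume _ (by norm_num)).ne'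
  obtain ⟨κ, hκ⟩ : ∃ κ : ℝ≥0∞, κ = (V * (ENNReal.ofReal (4 * (1 / 2 : ℝ) ^ (-((n : ℝ) + 2 - 2 * s))) *
    ENNReal.ofReal (2 + 4 * 8 ^ (n + 1)))) ^ (1 / 2 : ℝ) := ⟨_, rfl⟩
  have hκt : κ ≠ ⊤ := by
    rw [hκ]
    refine ENNReal.rpow_ne_top_of_nonneg (by norm_num) ?_
    exact ENNReal.mul_ne_top hVt (ENNReal.mul_ne_top ENNReal.ofReal_ne_top ENNReal.ofReal_ne_top)
  refine ⟨V⁻¹ * κ, V⁻¹ * (2 * K), ENNReal.mul_ne_top (ENNReal.inv_ne_top.2 hV0) hκt,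
    ENNReal.mul_ne_top (ENNReal.inv_ne_top.2 hV0) (ENNReal.mul_ne_top (by simp) hKt), ?_⟩
  intro w hw S hS hD hH x hx
  have hwc := hw.continuous
  have hpm := measurable_gradDensity hw
  have hA := lintegral_interior_le hn hs₀ hs hw hS hD hH hx
  rw [← hV, ← hκ] at hA
  have hB := hK _ hpm S hS hD x
  set T := ENNReal.ofReal S ^ (σ / n) *
    (pathPotential σ (gradDensity w) x + ENNReal.ofReal S) ^ (1 / 2 - σ / n) with hT
  have hcomb : V * ‖w (flat x)‖ₑ ≤ κ * ENNReal.ofReal S ^ (1 / 2 : ℝ) + 2 * (K * T) := by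
    calc V * ‖w (flat x)‖ₑ = ∫⁻ Z in interiorBall n, ‖w (flat x)‖ₑ := by
          rw [setLIntegral_const, mul_comm]
      _ ≤ ∫⁻ Z in interiorBall n, (‖w ((1 - (1 / 2 : ℝ)) • flat x + (1 / 2 : ℝ) • Z)‖ₑ +
            2 * ∫⁻ t in Ioo (0 : ℝ) (1 / 2),
              gradDensity w ((1 - t) • flat x + t • Z) ^ (1 / 2 : ℝ)) :=
          setLIntegral_mono' measurableSet_interiorBall fun Z hZ => enorm_trace_le hw hx hZ
      _ = (∫⁻ Z in interiorBall n, ‖w ((1 - (1 / 2 : ℝ)) • flat x + (1 / 2 : ℝ) • Z)‖ₑ) +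
            2 * ∫⁻ Z in interiorBall n, ∫⁻ t in Ioo (0 : ℝ) (1 / 2),
              gradDensity w ((1 - t) • flat x + t • Z) ^ (1 / 2 : ℝ) := by
          rw [lintegral_add_left (Continuous.measurable (by fun_prop)), lintegral_const_mul]
          exact Measurable.lintegral_prod_right' (ν := volume.restrict (Ioo (0 : ℝ) (1 / 2)))
            (measurable_path_swap hpm x)
      _ ≤ _ := add_le_add hA (mul_le_mul_right hB _)
  calc ‖w (flat x)‖ₑ = V⁻¹ * (V * ‖w (flat x)‖ₑ) := by
        rw [← mul_assoc, ENNReal.inv_mul_cancel hV0 hVt, one_mul]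
    _ ≤ _ := mul_le_mul_right hcomb _
    _ = _ := by
        generalize ENNReal.ofReal S ^ (1 / 2 : ℝ) = c1
        ring

/-- The trace inequality in the unit half ball for smooth functions. -/
theorem exists_lintegral_trace_le (hn : 1 ≤ n) {s : ℝ} (hs₀ : 0 < s) (hs : s < 1) {τ : ℝ} (hτ : 0 < τ)
    (hτs : ((n : ℝ) - 2 * s) * τ ≤ 4 * s) :
    ∃ K : ℝ≥0∞, K ≠ ⊤ ∧ ∀ w : Space n → ℝ, ContDiff ℝ ∞ w → ∀ S : ℝ, 0 < S →
      ∫⁻ X, gradDensity w X ∂wvol n s ≤ ENNReal.ofReal S → sphereMean s w 0 1 ≤ S →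
      ∫⁻ x in ball (0 : Flat n) 1, ‖w (flat x)‖ₑ ^ (2 + τ) ≤
        K * ENNReal.ofReal S ^ ((2 + τ) / 2) := by
  have hn0 : (0 : ℝ) < n := by exact_mod_cast hn
  -- This σ makes (2+τ)(1/2 - σ/n) = 1, so the power 2+τ leaves the potential to the first power,
  -- whose integral over x is controlled. The condition σ ≤ s is exactly (n-2s)τ ≤ 4s, while 2σ < n
  -- always holds.
  set σ : ℝ := n * τ / (2 * (2 + τ)) with hσ
  have hσ0 : 0 < σ := by positivity
  have hσs : σ ≤ s := by
    rw [hσ, div_le_iff₀ (by positivity)]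
    nlinarith
  have hσn : 2 * σ < n := by
    rw [hσ, mul_div_assoc', div_lt_iff₀ (by positivity)]
    nlinarith
  have hσN : σ / n = τ / (2 * (2 + τ)) := by rw [hσ]; field_simp
  have hq : 1 / 2 - σ / n = 1 / (2 + τ) := by rw [hσN]; field_simp; ring
  obtain ⟨a₁, a₂, ha₁t, ha₂t, hpt⟩ := exists_enorm_trace_le hn hs₀ hs hσ0 hσs hσn
  set U : ℝ≥0∞ := volume (ball (0 : Flat n) 1) with hU
  have hUt : U ≠ ⊤ := measure_ball_lt_top.ne
  obtain ⟨c, hc⟩ : ∃ c : ℝ≥0∞, c = 2 ^ (2 + τ - 1 : ℝ) := ⟨_, rfl⟩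
  have hct : c ≠ ⊤ := by rw [hc]; exact ENNReal.rpow_ne_top_of_nonneg (by linarith) (by simp)
  obtain ⟨b, hb⟩ : ∃ b : ℝ≥0∞, b = ENNReal.ofReal (16 * 2 ^ n) * volume (interiorBall n) := ⟨_, rfl⟩
  have hbt : b ≠ ⊤ := by
    rw [hb]; exact ENNReal.mul_ne_top ENNReal.ofReal_ne_top measure_ball_lt_top.ne
  have hq0 : 0 ≤ 2 + τ := by linarith
  refine ⟨c * (a₁ ^ (2 + τ) * U + a₂ ^ (2 + τ) * (b + U)), ?_, ?_⟩
  · have := ENNReal.rpow_ne_top_of_nonneg hq0 ha₁t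
    have := ENNReal.rpow_ne_top_of_nonneg hq0 ha₂t
    finiteness
  intro w hw S hS hD hH
  have hpm := measurable_gradDensity hw
  have hpt := hpt w hw S hS hD hH
  set p := gradDensity w with hp
  have hJm := measurable_pathPotential σ hpm
  set J := pathPotential σ p with hJ
  have hSe0 : ENNReal.ofReal S ≠ 0 := by simpa using hS
  have hSet : ENNReal.ofReal S ≠ ⊤ := ENNReal.ofReal_ne_top
  generalize ENNReal.ofReal S = Se at *
  -- The potential is integrated over all boundary points with `lintegral_lintegral_path_le`; the
  -- constant term contributes the volume of the flat ball.
  have hJint : ∫⁻ x in ball (0 : Flat n) 1, (J x + Se) ≤ (b + U) * Se := by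
    rw [lintegral_add_right _ measurable_const, setLIntegral_const, add_mul, mul_comm Se, hb]
    gcongr
    exact (setLIntegral_le_lintegral _ _).trans
      ((lintegral_lintegral_path_le hs₀ hσs hpm).trans (by gcongr))
  have e1 : (Se ^ (1 / 2 : ℝ)) ^ (2 + τ) = Se ^ ((2 + τ) / 2) := by
    rw [← ENNReal.rpow_mul]; congr 1; ring
  have e2 : ∀ x, (Se ^ (σ / n) * (J x + Se) ^ (1 / 2 - σ / n)) ^ (2 + τ) =
      Se ^ (τ / 2) * (J x + Se) := by
    intro x
    rw [hq, ENNReal.mul_rpow_of_nonneg _ _ hq0, ← ENNReal.rpow_mul, ← ENNReal.rpow_mul,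
      one_div_mul_cancel (by linarith), ENNReal.rpow_one, hσN]
    congr 2
    field_simp
  have e3 : Se ^ (τ / 2) * Se = Se ^ ((2 + τ) / 2) := by
    nth_rewrite 2 [← ENNReal.rpow_one Se]
    rw [← ENNReal.rpow_add _ _ hSe0 hSet]
    congr 1; ring
  calc ∫⁻ x in ball (0 : Flat n) 1, ‖w (flat x)‖ₑ ^ (2 + τ)
      ≤ ∫⁻ x in ball (0 : Flat n) 1, c * (a₁ ^ (2 + τ) * Se ^ ((2 + τ) / 2) +
          a₂ ^ (2 + τ) * Se ^ (τ / 2) * (J x + Se)) := by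
        refine setLIntegral_mono' measurableSet_ball fun x hx => ?_
        refine (ENNReal.rpow_le_rpow (hpt x (mem_ball_zero_iff.1 hx)) hq0).trans ?_
        refine (ENNReal.rpow_add_le_mul_rpow_add_rpow _ _ (by linarith)).trans_eq ?_
        rw [ENNReal.mul_rpow_of_nonneg a₁ _ hq0, ENNReal.mul_rpow_of_nonneg a₂ _ hq0, e1, e2,
          mul_assoc (a₂ ^ (2 + τ)), hc]
    _ = c * (a₁ ^ (2 + τ) * Se ^ ((2 + τ) / 2) * U + a₂ ^ (2 + τ) * Se ^ (τ / 2) *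
          ∫⁻ x in ball (0 : Flat n) 1, (J x + Se)) := by
        rw [lintegral_const_mul _ (by fun_prop), lintegral_add_left measurable_const,
          setLIntegral_const, lintegral_const_mul _ (by fun_prop)]
    _ ≤ c * (a₁ ^ (2 + τ) * Se ^ ((2 + τ) / 2) * U + a₂ ^ (2 + τ) * Se ^ (τ / 2) *
          ((b + U) * Se)) := by gcongr
    _ = _ := by rw [← e3]; ring

end TraceUnit

/-! ### The trace inequality on arbitrary half balls and for Sobolev functions -/

section TraceScaled

variable {n : ℕ}

theorem eLpNorm_two_sq {α F : Type*} [MeasurableSpace α] [NormedAddCommGroup F] (f : α → F)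
    (μ : Measure α) : eLpNorm f 2 μ ^ 2 = ∫⁻ x, ‖f x‖ₑ ^ 2 ∂μ := by
  have h := eLpNorm_nnreal_pow_eq_lintegral (f := f) (μ := μ) (p := 2) (by norm_num)
  simpa using h

theorem gradient_comp_scale {w : Space n → ℝ} (hw : ContDiff ℝ ∞ w) (x₀ : Flat n) (r : ℝ)
    (X : Space n) : gradient (fun X => w (flat x₀ + r • X)) X = r • gradient w (flat x₀ + r • X) := by
  have h1 := ((hw.differentiable (by simp) (flat x₀ + r • X)).hasGradientAt)
  refine HasGradientAt.gradient ?_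
  rw [hasGradientAt_iff_hasFDerivAt] at h1 ⊢
  have h2 : HasFDerivAt (fun X : Space n => flat x₀ + r • X) (r • ContinuousLinearMap.id ℝ (Space n)) X :=
    ((hasFDerivAt_id X).const_smul r).const_add _
  refine (h1.comp X h2).congr_fderiv ?_
  ext e
  simp

/-- Rescaling to the unit half ball. The energy picks up r² from the gradient against r^(n+1+a) from
the weighted volume, which explains the normalisation r^(n-1+a). -/
theorem exists_lintegral_trace_ball_le (hn : 1 ≤ n) {s : ℝ} (hs₀ : 0 < s) (hs : s < 1) {τ : ℝ}
    (hτ : 0 < τ) (hτs : ((n : ℝ) - 2 * s) * τ ≤ 4 * s) :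
    ∃ K : ℝ≥0∞, K ≠ ⊤ ∧ ∀ w : Space n → ℝ, ContDiff ℝ ∞ w → ∀ (x₀ : Flat n) (r S : ℝ), 0 < r → 0 < S →
      ∫⁻ X in ball (flat x₀) r, ‖gradient w X‖ₑ ^ 2 ∂wvol n s ≤
        ENNReal.ofReal (r ^ ((n : ℝ) - 1 + weightExp s) * S) →
      sphereMean s w x₀ r ≤ S →
      ∫⁻ x in ball x₀ r, ‖w (flat x)‖ₑ ^ (2 + τ) ≤
        ENNReal.ofReal (r ^ n) * (K * ENNReal.ofReal S ^ ((2 + τ) / 2)) := by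
  obtain ⟨K, hKt, hK⟩ := exists_lintegral_trace_le hn hs₀ hs hτ hτs
  refine ⟨K, hKt, fun w hw x₀ r S hr hS hD hH => ?_⟩
  set W : Space n → ℝ := fun X => w (flat x₀ + r • X) with hW
  have hWd : ContDiff ℝ ∞ W := hw.comp (contDiff_const.add (contDiff_id.const_smul r))
  have hgc := continuous_gradient hw
  have hr' : 0 < r ^ ((n : ℝ) - 1 + weightExp s) := Real.rpow_pos_of_pos hr _
  have h1 : ENNReal.ofReal (r ^ ((n : ℝ) - 1 + weightExp s)) * ∫⁻ X, gradDensity W X ∂wvol n s =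
      ∫⁻ X in ball (flat x₀) r, ‖gradient w X‖ₑ ^ 2 ∂wvol n s := by
    have hm : Measurable fun X : Space n => ‖gradient w X‖ₑ ^ 2 := by fun_prop
    rw [setLIntegral_wvol s hm measurableSet_ball, ← halfBall_eq]
    have h2 := lintegral_halfBall_scale (fun X => ENNReal.ofReal (weight s X) * ‖gradient w X‖ₑ ^ 2)
      x₀ (R := 1) hr
    rw [mul_one] at h2
    have hmW : Measurable fun X : Space n => ‖gradient W X‖ₑ ^ 2 := by
      have := continuous_gradient hWd
      fun_prop
    have hmW' : Measurable fun X : Space n => ENNReal.ofReal (weight s X) * ‖gradient W X‖ₑ ^ 2 :=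
      (measurable_ofReal_weight s).mul hmW
    have hmw' : Measurable fun X : Space n => ENNReal.ofReal (weight s (flat x₀ + r • X)) *
        ‖gradient w (flat x₀ + r • X)‖ₑ ^ 2 :=
      ((measurable_ofReal_weight s).mul hm).comp (by fun_prop : Measurable fun X : Space n =>
        flat x₀ + r • X)
    rw [h2]
    simp only [gradDensity]
    rw [lintegral_indicator measurableSet_ball, setLIntegral_wvol s hmW measurableSet_ball,
      ← halfBall_eq, ← lintegral_const_mul _ hmW', ← lintegral_const_mul _ hmw']
    refine setLIntegral_congr_fun (measurableSet_halfBall _ _) fun X hX => ?_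
    rw [gradient_comp_scale hw, enorm_smul, weight_smul hr.le x₀ (le_of_lt hX.2),
      ENNReal.ofReal_mul (by positivity), mul_pow, ← ofReal_norm r, Real.norm_of_nonneg hr.le,
      ← ENNReal.ofReal_pow hr.le]
    have h3 : r ^ ((n : ℝ) - 1 + weightExp s) * r ^ 2 = r ^ (n + 1) * r ^ weightExp s := by
      rw [← Real.rpow_natCast, ← Real.rpow_natCast, ← Real.rpow_add hr, ← Real.rpow_add hr]
      congr 1; push_cast; ring
    have h4 := congrArg ENNReal.ofReal h3
    rw [ENNReal.ofReal_mul (by positivity), ENNReal.ofReal_mul (by positivity)] at h4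
    calc _ = ENNReal.ofReal (r ^ ((n : ℝ) - 1 + weightExp s)) * ENNReal.ofReal (r ^ 2) *
          (ENNReal.ofReal (weight s X) * ‖gradient w (flat x₀ + r • X)‖ₑ ^ 2) := by ring
      _ = _ := by rw [h4]; ring
  have h5 : ∫⁻ X, gradDensity W X ∂wvol n s ≤ ENNReal.ofReal S := by
    rw [← h1, ENNReal.ofReal_mul hr'.le] at hD
    exact (ENNReal.mul_le_mul_iff_right (by simpa using hr') ENNReal.ofReal_ne_top).1 hD
  have h6 : sphereMean s W 0 1 ≤ S := by
    have : sphereMean s W 0 1 = sphereMean s w x₀ r := by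
      simp [sphereMean, hW, flat_zero]
    rwa [this]
  have h7 := hK W hWd S hS h5 h6
  rw [← lintegral_indicator measurableSet_ball, lintegral_scale volume _ x₀ hr,
    finrank_euclideanSpace_fin]
  gcongr _ * ?_
  refine le_trans (le_of_eq ?_) h7
  rw [← lintegral_indicator measurableSet_ball]
  refine lintegral_congr fun x => ?_
  have hmem : x₀ + r • x ∈ ball x₀ r ↔ x ∈ ball (0 : Flat n) 1 := by
    rw [mem_ball, dist_eq_norm, add_sub_cancel_left, norm_smul, Real.norm_of_nonneg hr.le,
      mem_ball_zero_iff]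
    constructor
    · intro h; nlinarith
    · intro h; nlinarith
  by_cases h : x ∈ ball (0 : Flat n) 1
  · rw [indicator_of_mem h, indicator_of_mem (hmem.2 h), hW]
    simp only [flat_add, flat_smul]
  · rw [indicator_of_notMem h, indicator_of_notMem fun h' => h (hmem.1 h')]

/-- The trace inequality with the critical or a subcritical exponent. -/
theorem exists_trace_le (hn : 1 ≤ n) {s : ℝ} (hs₀ : 0 < s) (hs : s < 1) {τ : ℝ}
    (hτ : 0 < τ) (hτs : ((n : ℝ) - 2 * s) * τ ≤ 4 * s) :
    ∃ K : ℝ, 0 ≤ K ∧ ∀ (v : Space n → ℝ) (g : Space n → Space n), ContinuousOn v (closedUpper n 1) →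
      IsWeightedSobolevLoc s v g → ∀ (x₀ : Flat n) (r S : ℝ), 0 < r → ‖x₀‖ + r < 1 → 0 ≤ S →
      ∫ X in halfBall (flat x₀) r, weight s X * ‖g X‖ ^ 2 ≤ r ^ ((n : ℝ) - 1 + weightExp s) * S →
      sphereMean s v x₀ r ≤ S →
      ∫ x in ball x₀ r, |v (flat x)| ^ (2 + τ) ≤ r ^ n * (K * S ^ ((2 + τ) / 2)) := by
  obtain ⟨K, hKt, hK⟩ := exists_lintegral_trace_ball_le hn hs₀ hs hτ hτs
  refine ⟨K.toReal, ENNReal.toReal_nonneg, fun v g hv hg x₀ r S hr hxr hS hD hH => ?_⟩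
  set ρ := (‖x₀‖ + r + 1) / 2 with hρdef
  have hρ1 : ρ < 1 := by rw [hρdef]; linarith
  have hρr : ‖x₀‖ + r < ρ := by rw [hρdef]; linarith
  have hρ0 : 0 < ρ := by have := norm_nonneg x₀; linarith
  obtain ⟨w, hw⟩ := exists_isApprox hs₀ hs hv hg hρ0 hρ1
  obtain ⟨B, hB0, hBv, hBw⟩ := hw.bound
  have hfin : IsFiniteMeasure (wsphere n s) := isFiniteMeasure_wsphere hs
  set l := r ^ ((n : ℝ) - 1 + weightExp s) with hl
  have hl0 : 0 < l := Real.rpow_pos_of_pos hr _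
  have hsub : ball (flat x₀ : Space n) r ⊆ ball 0 ρ := ball_flat_subset hρr.le
  have hsubf : ball x₀ r ⊆ ball (0 : Flat n) ρ := ball_subset_ball' (by
    rw [dist_zero_right]; linarith)
  have hgL := hg.memLp_grad hρ1
  set μ := (wvol n s).restrict (ball (flat x₀) r) with hμ
  have hμle : μ ≤ (wvol n s).restrict (ball 0 ρ) := Measure.restrict_mono hsub le_rfl
  have hgL' : MemLp g 2 μ := hgL.mono_measure hμle
  have hwL : ∀ j, MemLp (gradient (w j)) 2 μ := fun j =>
    (memLp_of_continuous_ball hs (continuous_gradient (hw.contDiff j)) 2 ρ).mono_measure hμle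
  have hgle : eLpNorm g 2 μ ≤ ENNReal.ofReal √(l * S) := by
    have h1 : eLpNorm g 2 μ ^ 2 ≤ ENNReal.ofReal √(l * S) ^ 2 := by
      rw [eLpNorm_two_sq, ← ENNReal.ofReal_pow (Real.sqrt_nonneg _), Real.sq_sqrt (by positivity)]
      have hi : Integrable (fun X => ‖g X‖ ^ 2) μ := by
        simpa only [real_inner_self_eq_norm_sq] using integrable_inner_of_memLp hgL' hgL'
      have h2 := ofReal_integral_eq_lintegral_ofReal hi (Eventually.of_forall fun X => by positivity)
      rw [hμ, setIntegral_wvol s _ measurableSet_ball, ← halfBall_eq, ← hμ] at h2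
      calc ∫⁻ X, ‖g X‖ₑ ^ 2 ∂μ = ∫⁻ X, ENNReal.ofReal (‖g X‖ ^ 2) ∂μ := by
            refine lintegral_congr fun X => ?_
            rw [ENNReal.ofReal_pow (norm_nonneg _), ofReal_norm]
        _ ≤ _ := by rw [← h2]; exact ENNReal.ofReal_le_ofReal hD
    exact (ENNReal.pow_le_pow_left_iff two_ne_zero).1 h1
  have hwH : Tendsto (fun j => sphereMean s (w j) x₀ r) atTop (𝓝 (sphereMean s v x₀ r)) := by
    refine tendsto_integral_filter_of_dominated_convergence (fun _ => B ^ 2) ?_ ?_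
      (integrable_const _) ?_
    · refine Eventually.of_forall fun j => Continuous.aestronglyMeasurable ?_
      have := (hw.contDiff j).continuous
      fun_prop
    · filter_upwards [hBw] with j hj
      filter_upwards [ae_wsphere_pos s] with θ hθ
      have := hj _ (mem_closedUpper_of_sphere hr.le hρr hθ.le)
      rw [norm_pow]
      exact pow_le_pow_left₀ (norm_nonneg _) this 2
    · filter_upwards [ae_wsphere_pos s] with θ hθ
      exact (hw.tendsto (mem_closedUpper_of_sphere hr.le hρr hθ.le)).pow 2
  -- The smooth approximations satisfy the hypotheses only up to a small error; (√S + ε)² leaves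
  -- room for it through the triangle inequality in L².
  have hmain : ∀ ε > 0, ∫⁻ x in ball x₀ r, ‖v (flat x)‖ₑ ^ (2 + τ) ≤
      ENNReal.ofReal (r ^ n) * (K * ENNReal.ofReal ((√S + ε) ^ 2) ^ ((2 + τ) / 2)) := by
    intro ε hε
    have hS' : S < (√S + ε) ^ 2 := by
      have := Real.sq_sqrt hS
      nlinarith [Real.sqrt_nonneg S]
    have e1 : ∀ᶠ j in atTop, sphereMean s (w j) x₀ r ≤ (√S + ε) ^ 2 :=
      (hwH.eventually (gt_mem_nhds (hH.trans_lt hS'))).mono fun j hj => hj.le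
    have e2 : ∀ᶠ j in atTop, eLpNorm (fun X => gradient (w j) X - g X) 2
        ((wvol n s).restrict (ball 0 ρ)) < ENNReal.ofReal (√l * ε) :=
      hw.tendsto_grad.eventually (gt_mem_nhds (by
        rw [ENNReal.ofReal_pos]; exact mul_pos (Real.sqrt_pos.2 hl0) hε))
    have e3 : ∀ᶠ j in atTop, ∫⁻ x in ball x₀ r, ‖w j (flat x)‖ₑ ^ (2 + τ) ≤
        ENNReal.ofReal (r ^ n) * (K * ENNReal.ofReal ((√S + ε) ^ 2) ^ ((2 + τ) / 2)) := by
      filter_upwards [e1, e2] with j h1 h2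
      refine hK (w j) (hw.contDiff j) x₀ r _ hr (by positivity) ?_ h1
      rw [← eLpNorm_two_sq, ← hμ, ← hl]
      have h3 : eLpNorm (gradient (w j)) 2 μ ≤ ENNReal.ofReal (√l * (√S + ε)) := by
        calc eLpNorm (gradient (w j)) 2 μ = eLpNorm (g + fun X => gradient (w j) X - g X) 2 μ := by
              congr 1; funext X; simp
          _ ≤ eLpNorm g 2 μ + eLpNorm (fun X => gradient (w j) X - g X) 2 μ :=
              eLpNorm_add_le hgL'.1 ((hwL j).1.sub hgL'.1) (by norm_num)
          _ ≤ ENNReal.ofReal √(l * S) + ENNReal.ofReal (√l * ε) :=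
              add_le_add hgle ((eLpNorm_mono_measure _ hμle).trans h2.le)
          _ = _ := by
              rw [← ENNReal.ofReal_add (by positivity) (by positivity), Real.sqrt_mul hl0.le]
              congr 1; ring
      calc eLpNorm (gradient (w j)) 2 μ ^ 2 ≤ ENNReal.ofReal (√l * (√S + ε)) ^ 2 := by gcongr
        _ = _ := by
            rw [← ENNReal.ofReal_pow (by positivity), mul_pow, Real.sq_sqrt hl0.le]
    -- Fatou's lemma passes the bound to the limit, the traces converging pointwise.
    have hF := lintegral_liminf_le (μ := volume.restrict (ball x₀ r)) (u := atTop)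
      (f := fun j x => ‖w j (flat x)‖ₑ ^ (2 + τ)) (fun j => by
        have := (hw.contDiff j).continuous
        have := continuous_flat (n := n)
        exact ((continuous_enorm.comp (by fun_prop : Continuous fun x : Flat n =>
          w j (flat x))).measurable).pow_const _)
    have hle : ∫⁻ x in ball x₀ r, ‖v (flat x)‖ₑ ^ (2 + τ) =
        ∫⁻ x in ball x₀ r, liminf (fun j => ‖w j (flat x)‖ₑ ^ (2 + τ)) atTop := by
      refine setLIntegral_congr_fun measurableSet_ball fun x hx => ?_
      have h4 := hw.tendsto (flat_mem_closedUpper (mem_ball_zero_iff.1 (hsubf hx)))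
      exact (((ENNReal.continuous_rpow_const (y := 2 + τ)).tendsto _).comp
        ((continuous_enorm.tendsto _).comp h4)).liminf_eq.symm
    rw [hle]
    refine hF.trans ?_
    refine (liminf_le_liminf e3).trans_eq ?_
    simp
  have hlim : Tendsto (fun ε : ℝ => ENNReal.ofReal (r ^ n) *
      (K * ENNReal.ofReal ((√S + ε) ^ 2) ^ ((2 + τ) / 2))) (𝓝[>] 0)
      (𝓝 (ENNReal.ofReal (r ^ n) * (K * ENNReal.ofReal ((√S + 0) ^ 2) ^ ((2 + τ) / 2)))) := by
    refine ENNReal.Tendsto.const_mul (ENNReal.Tendsto.const_mul ?_ (Or.inr hKt))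
      (Or.inr ENNReal.ofReal_ne_top)
    refine ((ENNReal.continuous_rpow_const (y := (2 + τ) / 2)).tendsto _).comp ?_
    refine (ENNReal.continuous_ofReal.tendsto _).comp ?_
    refine Tendsto.mono_left (Continuous.tendsto (by fun_prop) 0) nhdsWithin_le_nhds
  have hfinal := ge_of_tendsto hlim (by
    filter_upwards [self_mem_nhdsWithin] with ε hε using hmain ε hε)
  rw [add_zero, Real.sq_sqrt hS] at hfinal
  have hint : ∫ x in ball x₀ r, |v (flat x)| ^ (2 + τ) =
      (∫⁻ x in ball x₀ r, ‖v (flat x)‖ₑ ^ (2 + τ)).toReal := by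
    rw [integral_eq_lintegral_of_nonneg_ae (Eventually.of_forall fun X => by positivity)]
    · congr 1
      refine lintegral_congr fun x => ?_
      rw [← ENNReal.ofReal_rpow_of_nonneg (abs_nonneg _) (by linarith), ← ofReal_norm]
      rfl
    · have hc := (continuousOn_trace (hv.mono (closedUpper_mono hρ1.le))).mono hsubf
      exact (hc.abs.rpow_const fun x _ => Or.inr (by linarith)).aestronglyMeasurable measurableSet_ball
  rw [hint]
  refine ENNReal.toReal_le_of_le_ofReal (by positivity) (hfinal.trans_eq ?_)
  rw [ENNReal.ofReal_mul (by positivity), ENNReal.ofReal_mul ENNReal.toReal_nonneg,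
    ENNReal.ofReal_toReal hKt, ENNReal.ofReal_rpow_of_nonneg hS (by linarith)]

end TraceScaled

/-! ### The abstract frequency function: monotonicity, unique continuation, limit -/

section Frequency

theorem AbsolutelyContinuousOnInterval_comp_lipschitz {f φ : ℝ → ℝ} {a b : ℝ} {K : ℝ≥0} {s : Set ℝ}
    (hf : AbsolutelyContinuousOnInterval f a b) (hs : MapsTo f (uIcc a b) s)
    (hφ : LipschitzOnWith K φ s) : AbsolutelyContinuousOnInterval (fun x => φ (f x)) a b := by
  rw [absolutelyContinuousOnInterval_iff] at hf ⊢
  intro ε hε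
  obtain ⟨δ, hδ, h⟩ := hf (ε / (K + 1)) (by positivity)
  refine ⟨δ, hδ, fun I hI hlt => ?_⟩
  have h1 := h I hI hlt
  calc ∑ i ∈ Finset.range I.1, dist (φ (f (I.2 i).1)) (φ (f (I.2 i).2))
      ≤ ∑ i ∈ Finset.range I.1, K * dist (f (I.2 i).1) (f (I.2 i).2) := by
        refine Finset.sum_le_sum fun i hi => hφ.dist_le_mul _ (hs (hI.1 i hi).1) _ (hs (hI.1 i hi).2)
    _ = K * ∑ i ∈ Finset.range I.1, dist (f (I.2 i).1) (f (I.2 i).2) := (Finset.mul_sum _ _ _).symm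
    _ ≤ K * (ε / (K + 1)) := by gcongr
    _ < (K + 1) * (ε / (K + 1)) := by gcongr; linarith
    _ = ε := by field_simp

theorem AbsolutelyContinuousOnInterval_comp_contDiffOn {f φ : ℝ → ℝ} {a b c d : ℝ}
    (hf : AbsolutelyContinuousOnInterval f a b) (hs : MapsTo f (uIcc a b) (Icc c d))
    (hφ : ContDiffOn ℝ 1 φ (Icc c d)) :
    AbsolutelyContinuousOnInterval (fun x => φ (f x)) a b := by
  obtain ⟨K, hK⟩ := hφ.exists_lipschitzOnWith (by decide) (convex_Icc _ _) isCompact_Icc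
  exact AbsolutelyContinuousOnInterval_comp_lipschitz hf hs hK

/-- The differential relations behind the monotonicity of a frequency `E / H`. -/
structure FrequencyData (R : ℝ) (E H k : ℝ → ℝ) : Prop where
  hasDerivAt : ∀ r ∈ Ioo 0 R, HasDerivAt H (2 * E r / r) r
  nonneg : ∀ r ∈ Ioo 0 R, 0 ≤ H r
  ac : ∀ r₁ r₂, 0 < r₁ → r₁ ≤ r₂ → r₂ < R → AbsolutelyContinuousOnInterval E r₁ r₂
  integrable : ∀ r ∈ Ioo 0 R, IntervalIntegrable k volume 0 r
  ae_le : ∀ᵐ r, r ∈ Ioo 0 R →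
    -(k r) * (E r + H r) * H r ≤ deriv E r * H r - 2 * E r ^ 2 / r
  add_nonneg : ∀ r ∈ Ioo 0 R, 0 ≤ E r + H r
  eq_zero : ∀ r ∈ Ioo 0 R, E r + H r = 0 → ∀ t ∈ Ioc 0 r, H t = 0

namespace FrequencyData

variable {R : ℝ} {E H k : ℝ → ℝ}

theorem continuousOn_E (h : FrequencyData R E H k) {r₁ r₂ : ℝ} (h₁ : 0 < r₁) (h₁₂ : r₁ ≤ r₂)
    (h₂ : r₂ < R) : ContinuousOn E (Icc r₁ r₂) := by
  have := (h.ac r₁ r₂ h₁ h₁₂ h₂).continuousOn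
  rwa [uIcc_of_le h₁₂] at this

theorem continuousOn_H (h : FrequencyData R E H k) : ContinuousOn H (Ioo 0 R) := fun r hr =>
  (h.hasDerivAt r hr).continuousAt.continuousWithinAt

/-- The derivative 2E/r is continuous, hence bounded, on compact intervals, which makes H Lipschitz
there. -/
theorem ac_H (h : FrequencyData R E H k) {r₁ r₂ : ℝ} (h₁ : 0 < r₁) (h₁₂ : r₁ ≤ r₂)
    (h₂ : r₂ < R) : AbsolutelyContinuousOnInterval H r₁ r₂ := by
  have hc : ContinuousOn (fun r => 2 * E r / r) (Icc r₁ r₂) := by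
    refine (continuousOn_const.mul (h.continuousOn_E h₁ h₁₂ h₂)).div continuousOn_id fun r hr => ?_
    exact (h₁.trans_le hr.1).ne'
  obtain ⟨B, hB⟩ := isCompact_Icc.exists_bound_of_continuousOn hc
  refine LipschitzOnWith.absolutelyContinuousOnInterval (K := B.toNNReal) ?_
  rw [uIcc_of_le h₁₂]
  refine (convex_Icc _ _).lipschitzOnWith_of_nnnorm_hasDerivWithin_le (f' := fun r => 2 * E r / r)
    (fun r hr => (h.hasDerivAt r ⟨h₁.trans_le hr.1, hr.2.trans_lt h₂⟩).hasDerivWithinAt)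
    fun r hr => ?_
  rw [← NNReal.coe_le_coe, coe_nnnorm]
  exact (hB r hr).trans (Real.le_coe_toNNReal _)

/-- The monotone quantity. -/
theorem exp_mul_le (h : FrequencyData R E H k) {r₁ r₂ : ℝ} (h₁ : 0 < r₁) (h₁₂ : r₁ ≤ r₂)
    (h₂ : r₂ < R) (hpos : ∀ r ∈ Icc r₁ r₂, 0 < H r) :
    Real.exp (∫ t in (0 : ℝ)..r₁, k t) * (E r₁ / H r₁ + 1) ≤
      Real.exp (∫ t in (0 : ℝ)..r₂, k t) * (E r₂ / H r₂ + 1) := by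
  have hmem : ∀ r ∈ Icc r₁ r₂, r ∈ Ioo 0 R := fun r hr => ⟨h₁.trans_le hr.1, hr.2.trans_lt h₂⟩
  have hk := h.integrable r₂ (hmem r₂ ⟨h₁₂, le_rfl⟩)
  set K : ℝ → ℝ := fun r => ∫ t in (0 : ℝ)..r, k t with hK
  have hr₂0 : 0 ≤ r₂ := h₁.le.trans h₁₂
  have hKac0 : AbsolutelyContinuousOnInterval K 0 r₂ :=
    hk.absolutelyContinuousOnInterval_intervalIntegral (by simp)
  have hKac : AbsolutelyContinuousOnInterval K r₁ r₂ := hKac0.mono (by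
    rw [uIcc_of_le h₁₂, uIcc_of_le hr₂0]
    exact Icc_subset_Icc_left h₁.le)
  have hexp : AbsolutelyContinuousOnInterval (fun r => Real.exp (K r)) r₁ r₂ := by
    obtain ⟨B, hB⟩ := isCompact_uIcc.exists_bound_of_continuousOn hKac.continuousOn
    exact AbsolutelyContinuousOnInterval_comp_contDiffOn hKac (c := -B) (d := B)
      (fun r hr => abs_le.1 (hB r hr)) Real.contDiff_exp.contDiffOn
  -- On the compact interval H has a positive minimum, so inversion is Lipschitz on its range.
  have hinv : AbsolutelyContinuousOnInterval (fun r => (H r)⁻¹) r₁ r₂ := by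
    have hHac := h.ac_H h₁ h₁₂ h₂
    have hHc := hHac.continuousOn
    rw [uIcc_of_le h₁₂] at hHc
    obtain ⟨rm, hrm, hmin⟩ := isCompact_Icc.exists_isMinOn ⟨r₁, le_rfl, h₁₂⟩ hHc
    obtain ⟨rM, hrM, hmax⟩ := isCompact_Icc.exists_isMaxOn ⟨r₁, le_rfl, h₁₂⟩ hHc
    refine AbsolutelyContinuousOnInterval_comp_contDiffOn hHac (c := H rm) (d := H rM)
      (fun r hr => ?_) (fun x hx => ?_)
    · rw [uIcc_of_le h₁₂] at hr
      exact ⟨hmin hr, hmax hr⟩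
    · exact (contDiffAt_inv ℝ ((hpos rm hrm).trans_le hx.1).ne').contDiffWithinAt
  have hN : AbsolutelyContinuousOnInterval (fun r => E r / H r + 1) r₁ r₂ := by
    have h1 := (h.ac r₁ r₂ h₁ h₁₂ h₂).mul hinv
    have h2 : AbsolutelyContinuousOnInterval (fun _ : ℝ => (1 : ℝ)) r₁ r₂ :=
      (contDiff_const (n := 1)).contDiffOn.absolutelyContinuousOnInterval
    exact h1.add h2
  have hΦ : AbsolutelyContinuousOnInterval (fun r => Real.exp (K r) * (E r / H r + 1)) r₁ r₂ :=
    hexp.mul hN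
  -- The monotone quantity is absolutely continuous, so a nonnegative derivative almost everywhere
  -- suffices. The inequality `ae_le` is exactly the nonnegativity of the numerator after clearing
  -- H².
  have hderiv : ∀ᵐ r, r ∈ Icc r₁ r₂ → 0 ≤ deriv (fun r => Real.exp (K r) * (E r / H r + 1)) r := by
    have hK' := hk.ae_hasDerivAt_integral
    have hE' := (h.ac r₁ r₂ h₁ h₁₂ h₂).ae_differentiableAt
    filter_upwards [hK', hE', h.ae_le] with r a1 a2 a3 hr
    have hr0 : 0 < r := h₁.trans_le hr.1
    have b1 : HasDerivAt K (k r) r := a1 (by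
      rw [uIcc_of_le hr₂0]; exact ⟨hr0.le, hr.2⟩) 0 (by simp)
    have b2 := (a2 (by rwa [uIcc_of_le h₁₂])).hasDerivAt
    have b3 := a3 (hmem r hr)
    have hH := hpos r hr
    have b4 := b1.exp.mul ((b2.div (h.hasDerivAt r (hmem r hr)) hH.ne').add_const 1)
    have b5 : deriv (fun r => Real.exp (K r) * (E r / H r + 1)) r = _ := b4.deriv
    rw [b5]
    have b6 : Real.exp (K r) * k r * (E r / H r + 1) + Real.exp (K r) *
        ((deriv E r * H r - E r * (2 * E r / r)) / H r ^ 2) =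
        Real.exp (K r) * ((deriv E r * H r - 2 * E r ^ 2 / r + k r * (E r + H r) * H r) / H r ^ 2) := by
      field_simp
      ring
    refine le_of_le_of_eq ?_ b6.symm
    refine mul_nonneg (Real.exp_pos _).le (div_nonneg ?_ (by positivity))
    linarith
  have hint := hΦ.integral_deriv_eq_sub
  have hnn : 0 ≤ ∫ r in r₁..r₂, deriv (fun r => Real.exp (K r) * (E r / H r + 1)) r := by
    refine intervalIntegral.integral_nonneg_of_ae_restrict h₁₂ ?_
    rw [Filter.EventuallyLE, ae_restrict_iff' measurableSet_Icc]
    filter_upwards [hderiv] with r hr using hr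
  rw [hint] at hnn
  linarith

theorem monotoneOn (h : FrequencyData R E H k) (hpos : ∀ r ∈ Ioo 0 R, 0 < H r) :
    MonotoneOn (fun r => Real.exp (∫ t in (0 : ℝ)..r, k t) * (E r / H r + 1)) (Ioo 0 R) :=
  fun _ hr₁ _ hr₂ h₁₂ => h.exp_mul_le hr₁.1 h₁₂ hr₂.2 fun r hr =>
    hpos r ⟨hr₁.1.trans_le hr.1, hr.2.trans_lt hr₂.2⟩

/-- If `E ≤ b H` then `r ^ (-2 b) H` is nonincreasing. -/
theorem antitoneOn_rpow_mul (h : FrequencyData R E H k) {r₁ r₂ b : ℝ} (h₁ : 0 ≤ r₁) (h₂ : r₂ < R)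
    (hb : ∀ r ∈ Ioc r₁ r₂, E r ≤ b * H r) :
    AntitoneOn (fun r => r ^ (-(2 * b)) * H r) (Ioc r₁ r₂) := by
  have hmem : ∀ r ∈ Ioc r₁ r₂, r ∈ Ioo 0 R := fun r hr => ⟨h₁.trans_lt hr.1, hr.2.trans_lt h₂⟩
  have hd : ∀ r ∈ Ioc r₁ r₂, HasDerivAt (fun r => r ^ (-(2 * b)) * H r)
      (-(2 * b) * r ^ (-(2 * b) - 1) * H r + r ^ (-(2 * b)) * (2 * E r / r)) r := fun r hr =>
    (Real.hasDerivAt_rpow_const (Or.inl (hmem r hr).1.ne')).mul (h.hasDerivAt r (hmem r hr))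
  refine antitoneOn_of_deriv_nonpos (convex_Ioc _ _)
    (fun r hr => (hd r hr).continuousAt.continuousWithinAt)
    (fun r hr => (hd r (interior_subset hr)).differentiableAt.differentiableWithinAt) fun r hr => ?_
  have hr := interior_subset hr
  rw [(hd r hr).deriv, Real.rpow_sub_one (hmem r hr).1.ne']
  have hr0 := (hmem r hr).1
  have := hb r hr
  have h3 : 0 < r ^ (-(2 * b)) := Real.rpow_pos_of_pos hr0 _
  -- Since H' = 2E/r, the derivative of r^(-2b) H is a positive multiple of E - b H.
  have : -(2 * b) * (r ^ (-(2 * b)) / r) * H r + r ^ (-(2 * b)) * (2 * E r / r) =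
      2 * (r ^ (-(2 * b)) / r) * (E r - b * H r) := by field_simp; ring
  rw [this]
  exact mul_nonpos_of_nonneg_of_nonpos (by positivity) (by linarith)

/-- Unique continuation: if `H` vanishes somewhere, then it vanishes identically. -/
theorem eq_zero_of_eq_zero (h : FrequencyData R E H k) {r₀ : ℝ} (hr₀ : r₀ ∈ Ioo 0 R)
    (h0 : H r₀ = 0) : ∀ r ∈ Ioo 0 R, H r = 0 := by
  -- Downward propagation: a zero of the nonnegative H is a minimum, so H' and with it E vanish
  -- there, and the field `eq_zero` applies.
  have hdown : ∀ r ∈ Ioo 0 R, H r = 0 → ∀ t ∈ Ioc 0 r, H t = 0 := by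
    intro r hr hr0
    have hmin : IsLocalMin H r := by
      filter_upwards [Ioo_mem_nhds hr.1 hr.2] with t ht
      rw [hr0]; exact h.nonneg t ht
    have hd := hmin.hasDerivAt_eq_zero (h.hasDerivAt r hr)
    have hE : E r = 0 := by
      have := hr.1.ne'
      field_simp at hd
      simpa using hd
    exact h.eq_zero r hr (by rw [hE, hr0, add_zero])
  by_contra hcon
  push Not at hcon
  obtain ⟨r₁, hr₁, hH₁⟩ := hcon
  have hlt : r₀ < r₁ := by
    by_contra hle
    exact hH₁ (hdown r₀ hr₀ h0 r₁ ⟨hr₁.1, not_lt.1 hle⟩)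
  -- Upward propagation looks at the last zero rs before a radius r₁ with H > 0. On (rs, r₁] the
  -- monotone quantity is defined.
  set Z : Set ℝ := {r | r ∈ Icc r₀ r₁ ∧ H r = 0} with hZ
  have hZne : Z.Nonempty := ⟨r₀, ⟨le_rfl, hlt.le⟩, h0⟩
  have hZc : IsCompact Z := by
    have hc : ContinuousOn H (Icc r₀ r₁) := h.continuousOn_H.mono fun r hr =>
      ⟨hr₀.1.trans_le hr.1, hr.2.trans_lt hr₁.2⟩
    have := hc.preimage_isClosed_of_isClosed isClosed_Icc (isClosed_singleton (x := (0 : ℝ)))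
    exact isCompact_Icc.of_isClosed_subset this fun r hr => hr.1
  obtain ⟨rs, hrs, hmax⟩ := hZc.exists_isGreatest hZne
  have hrs0 : 0 < rs := hr₀.1.trans_le hrs.1.1
  have hrslt : rs < r₁ := lt_of_le_of_ne hrs.1.2 fun he => hH₁ (he ▸ hrs.2)
  have hpos : ∀ r ∈ Ioc rs r₁, 0 < H r := by
    intro r hr
    refine lt_of_le_of_ne (h.nonneg r ⟨hrs0.trans hr.1, hr.2.trans_lt hr₁.2⟩) fun he => ?_
    have := hmax (show r ∈ Z from ⟨⟨hrs.1.1.trans hr.1.le, hr.2⟩, he.symm⟩)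
    linarith [hr.1]
  set K : ℝ → ℝ := fun r => ∫ t in (0 : ℝ)..r, k t with hK
  have hKc : ContinuousOn K (Icc rs r₁) := by
    have := (h.integrable r₁ hr₁).absolutelyContinuousOnInterval_intervalIntegral (c := 0) (by simp)
    refine this.continuousOn.mono ?_
    rw [uIcc_of_le hr₁.1.le]
    exact Icc_subset_Icc_left hrs0.le
  obtain ⟨B, hB⟩ := isCompact_Icc.exists_bound_of_continuousOn hKc
  -- Monotonicity bounds N + 1 on (rs, r₁] by its value at r₁; the factor exp(2B) absorbs the
  -- variation of the exponential, whose exponent lies in [-B, B].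
  set b := Real.exp (2 * B) * (E r₁ / H r₁ + 1) with hb
  have hN1 : 0 ≤ E r₁ / H r₁ + 1 := by
    have hp := hpos r₁ ⟨hrslt, le_rfl⟩
    rw [div_add_one hp.ne']
    exact div_nonneg (h.add_nonneg r₁ hr₁) hp.le
  have hbound : ∀ r ∈ Ioc rs r₁, E r ≤ b * H r := by
    intro r hr
    have h1 := h.exp_mul_le (hrs0.trans hr.1) hr.2 hr₁.2 fun t ht =>
      hpos t ⟨hr.1.trans_le ht.1, ht.2⟩
    have hp := hpos r hr
    have h2 : E r / H r + 1 ≤ b := by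
      have h3 : Real.exp (K r) * (E r / H r + 1) ≤ Real.exp (K r₁) * (E r₁ / H r₁ + 1) := h1
      have h4 : Real.exp (K r₁) ≤ Real.exp (K r) * Real.exp (2 * B) := by
        rw [← Real.exp_add]
        refine Real.exp_le_exp.2 ?_
        have := (abs_le.1 (hB r₁ ⟨hrslt.le, le_rfl⟩)).2
        have := (abs_le.1 (hB r ⟨hr.1.le, hr.2⟩)).1
        linarith
      have h5 : Real.exp (K r) * (E r / H r + 1) ≤ Real.exp (K r) * b := by
        rw [hb, ← mul_assoc]
        exact h3.trans (mul_le_mul_of_nonneg_right h4 hN1)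
      exact le_of_mul_le_mul_left h5 (Real.exp_pos _)
    have h6 : E r / H r ≤ b := by linarith
    rwa [div_le_iff₀ hp] at h6
  have hanti := h.antitoneOn_rpow_mul hrs0.le hr₁.2 hbound
  -- The nonincreasing function r^(-2b) H tends to 0 at rs, so it cannot be positive at r₁.
  have hlim : Tendsto (fun r => r ^ (-(2 * b)) * H r) (𝓝[>] rs) (𝓝 (rs ^ (-(2 * b)) * H rs)) := by
    have h1 : ContinuousAt (fun r => r ^ (-(2 * b)) * H r) rs :=
      (Real.continuousAt_rpow_const _ _ (Or.inl hrs0.ne')).mul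
        (h.hasDerivAt rs ⟨hrs0, hrslt.trans hr₁.2⟩).continuousAt
    exact h1.tendsto.mono_left nhdsWithin_le_nhds
  rw [hrs.2, mul_zero] at hlim
  have hge : r₁ ^ (-(2 * b)) * H r₁ ≤ 0 := by
    refine ge_of_tendsto hlim ?_
    filter_upwards [Ioc_mem_nhdsGT hrslt] with r hr
    exact hanti hr ⟨hrslt, le_rfl⟩ hr.2
  have := mul_pos (Real.rpow_pos_of_pos hr₁.1 (-(2 * b))) (hpos r₁ ⟨hrslt, le_rfl⟩)
  linarith

/-- The frequency has a limit at `0`. -/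
theorem exists_tendsto (h : FrequencyData R E H k) (hR : 0 < R) (hpos : ∀ r ∈ Ioo 0 R, 0 < H r) :
    ∃ L, Tendsto (fun r => E r / H r) (𝓝[>] 0) (𝓝 L) ∧
      ∀ r ∈ Ioo 0 R, L + 1 ≤ Real.exp (∫ t in (0 : ℝ)..r, k t) * (E r / H r + 1) := by
  set Φ : ℝ → ℝ := fun r => Real.exp (∫ t in (0 : ℝ)..r, k t) * (E r / H r + 1) with hΦ
  have hm : MonotoneOn Φ (Ioo 0 R) := h.monotoneOn hpos
  have hnn : ∀ r ∈ Ioo 0 R, 0 ≤ Φ r := by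
    intro r hr
    refine mul_nonneg (Real.exp_pos _).le ?_
    rw [div_add_one (hpos r hr).ne']
    exact div_nonneg (h.add_nonneg r hr) (hpos r hr).le
  have hne : (Φ '' Ioo 0 R).Nonempty := (nonempty_Ioo.2 hR).image _
  have hbdd : BddBelow (Φ '' Ioo 0 R) := ⟨0, by rintro _ ⟨r, hr, rfl⟩; exact hnn r hr⟩
  have hlim : Tendsto Φ (𝓝[>] 0) (𝓝 (sInf (Φ '' Ioo 0 R))) :=
    hm.tendsto_nhdsWithin_Ioo_right (nonempty_Ioo.2 hR) hbdd
  have hK : Tendsto (fun r => ∫ t in (0 : ℝ)..r, k t) (𝓝[>] 0) (𝓝 0) := by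
    have hr : R / 2 ∈ Ioo 0 R := ⟨by linarith, by linarith⟩
    have h1 := ((h.integrable _ hr).absolutelyContinuousOnInterval_intervalIntegral
      (c := 0) (by simp)).continuousOn 0 (by simp)
    have h2 : Tendsto (fun r => ∫ t in (0 : ℝ)..r, k t) (𝓝[uIcc 0 (R / 2)] 0)
        (𝓝 (∫ t in (0 : ℝ)..0, k t)) := h1
    rw [intervalIntegral.integral_same] at h2
    refine h2.mono_left ?_
    rw [uIcc_of_le hr.1.le, ← nhdsWithin_Ioc_eq_nhdsGT hr.1]
    exact nhdsWithin_mono _ Ioc_subset_Icc_self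
  have hexp : Tendsto (fun r => Real.exp (-∫ t in (0 : ℝ)..r, k t)) (𝓝[>] 0) (𝓝 1) := by
    have := (Real.continuous_exp.tendsto _).comp hK.neg
    rw [neg_zero, Real.exp_zero] at this
    exact this
  -- The monotone quantity tends to its infimum while the exponential factor tends to 1; the infimum
  -- also gives the lower bound at every radius.
  refine ⟨sInf (Φ '' Ioo 0 R) - 1, ?_, fun r hr => ?_⟩
  · have h1 := (hexp.mul hlim).sub_const 1
    rw [one_mul] at h1
    refine h1.congr fun r => ?_
    rw [hΦ]
    simp only
    rw [← mul_assoc, ← Real.exp_add]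
    simp
  · rw [sub_add_cancel]
    exact csInf_le hbdd ⟨r, hr, rfl⟩

/-- A growth bound on `H` bounds the limit frequency from below. -/
theorem le_of_tendsto (h : FrequencyData R E H k) (hR : 0 < R) (hpos : ∀ r ∈ Ioo 0 R, 0 < H r)
    {L α C : ℝ} (hL : Tendsto (fun r => E r / H r) (𝓝[>] 0) (𝓝 L))
    (hH : ∀ᶠ r in 𝓝[>] 0, H r ≤ C * r ^ (2 * α)) : α ≤ L := by
  by_contra hlt
  push Not at hlt
  -- With L < b < α, r^(-2b) H is nonincreasing near 0 and yet bounded by C r^(2α-2b), which tends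
  -- to 0; this contradicts H > 0.
  obtain ⟨b, hb1, hb2⟩ := exists_between hlt
  have hev : ∀ᶠ r in 𝓝[>] (0 : ℝ), E r / H r ≤ b :=
    (hL.eventually (gt_mem_nhds hb1)).mono fun r hr => hr.le
  obtain ⟨r₁, hr₁, hsub⟩ := mem_nhdsGT_iff_exists_Ioo_subset.1 hev
  set r₂ := min r₁ R / 2 with hr₂
  have hm : 0 < min r₁ R := lt_min hr₁ hR
  have hr₂0 : 0 < r₂ := by rw [hr₂]; linarith
  have hr₂R : r₂ < R := by rw [hr₂]; linarith [min_le_right r₁ R]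
  have hr₂1 : r₂ < r₁ := by rw [hr₂]; linarith [min_le_left r₁ R]
  have hanti := h.antitoneOn_rpow_mul le_rfl hr₂R (b := b) (r₁ := 0) fun r hr => by
    have h1 : E r / H r ≤ b := hsub ⟨hr.1, hr.2.trans_lt hr₂1⟩
    rwa [div_le_iff₀ (hpos r ⟨hr.1, hr.2.trans_lt hr₂R⟩)] at h1
  have hlim : Tendsto (fun r : ℝ => C * r ^ (2 * α - 2 * b)) (𝓝[>] 0) (𝓝 0) := by
    have h1 : Tendsto (fun r : ℝ => r ^ (2 * α - 2 * b)) (𝓝[>] 0) (𝓝 (0 ^ (2 * α - 2 * b))) :=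
      (Real.continuousAt_rpow_const 0 _ (Or.inr (by linarith))).tendsto.mono_left nhdsWithin_le_nhds
    rw [Real.zero_rpow (by linarith)] at h1
    simpa using h1.const_mul C
  have hle : r₂ ^ (-(2 * b)) * H r₂ ≤ 0 := by
    refine ge_of_tendsto hlim ?_
    filter_upwards [hH, Ioc_mem_nhdsGT hr₂0] with r hr1 hr2
    refine (hanti hr2 ⟨hr₂0, le_rfl⟩ hr2.2).trans ?_
    have h2 : 0 < r ^ (-(2 * b)) := Real.rpow_pos_of_pos hr2.1 _
    calc r ^ (-(2 * b)) * H r ≤ r ^ (-(2 * b)) * (C * r ^ (2 * α)) := by gcongr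
      _ = C * r ^ (2 * α - 2 * b) := by
          rw [sub_eq_add_neg, Real.rpow_add hr2.1]; ring
  have := mul_pos (Real.rpow_pos_of_pos hr₂0 (-(2 * b))) (hpos r₂ ⟨hr₂0, hr₂R⟩)
  linarith

end FrequencyData

end Frequency

/-! ### Real-variable estimates for the radial functions -/

section Radial

/-- The functions of the radius entering Almgren's frequency: the energy `D`, the potential terms
`V` and `W`, the boundary mass `g`, the height `H`, the radial derivatives `d`, `v`, `w`, `m` of
`D`, `V`, `W`, `g`, and the radial energy `T`. -/
structure RadialProfile where
  (D V W g H d v w m T : ℝ → ℝ)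

namespace RadialProfile

/-- The normalized difference of energy and potential. -/
def E (P : RadialProfile) (p r : ℝ) : ℝ := 1 / r ^ p * (P.D r - P.V r)

/-- The sum of the normalized energy and the height. -/
def S (P : RadialProfile) (p r : ℝ) : ℝ := 1 / r ^ p * P.D r + P.H r

/-- The normalized boundary mass. -/
def γ (P : RadialProfile) (n : ℕ) (r : ℝ) : ℝ := 1 / r ^ (n : ℝ) * P.g r

/-- The function `ψ`. -/
def ψ (P : RadialProfile) (n : ℕ) (τ r : ℝ) : ℝ := r * (P.γ n r) ^ (τ / (2 + τ))

/-- The density of `Ψ`. -/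
def ψRate (P : RadialProfile) (n : ℕ) (τ a r : ℝ) : ℝ := r ^ (-a) * (1 + deriv (P.ψ n τ) r)

end RadialProfile

/-- The relations between the radial functions on `(0, R)`. -/
structure IsAlmgren (n : ℕ) (a τ R K B C₁ : ℝ) (P : RadialProfile) : Prop where
  integrable : ∀ r ∈ Ioo 0 R, IntegrableOn P.d (Ioo 0 r)
  D_eq : ∀ r ∈ Ioo 0 R, P.D r = ∫ t in Ioo 0 r, P.d t
  d_nonneg : ∀ r ∈ Ioo 0 R, 0 ≤ P.d r
  hasDerivAt_V : ∀ r ∈ Ioo 0 R, HasDerivAt P.V (P.v r) r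
  hasDerivAt_g : ∀ r ∈ Ioo 0 R, HasDerivAt P.g (P.m r) r
  continuousOn_m : ContinuousOn P.m (Ioo 0 R)
  hasDerivAt_H : ∀ r ∈ Ioo 0 R, HasDerivAt P.H (2 * P.E ((n : ℝ) - 1 + a) r / r) r
  H_nonneg : ∀ r ∈ Ioo 0 R, 0 ≤ P.H r
  g_nonneg : ∀ r ∈ Ioo 0 R, 0 ≤ P.g r
  m_nonneg : ∀ r ∈ Ioo 0 R, 0 ≤ P.m r
  V_le : ∀ r ∈ Ioo 0 R, |P.V r| ≤ C₁ * P.g r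
  W_le : ∀ r ∈ Ioo 0 R, |P.W r| ≤ C₁ * P.g r
  v_le : ∀ r ∈ Ioo 0 R, |P.v r| ≤ C₁ * P.m r
  w_le : ∀ r ∈ Ioo 0 R, |P.w r| ≤ C₁ * P.m r
  g_le : ∀ r ∈ Ioo 0 R, P.g r ≤ r ^ (n : ℝ) * B
  trace : ∀ r ∈ Ioo 0 R, P.g r ≤ r ^ (n : ℝ) * (K * P.S ((n : ℝ) - 1 + a) r ^ ((2 + τ) / 2))
  pohozaev : ∀ᵐ r, r ∈ Ioo 0 R →
    (1 - a - n) * P.D r + r * P.d r + 2 * n * P.W r - 2 * r * P.w r = 2 * r * P.T r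
  T_nonneg : ∀ r ∈ Ioo 0 R, 0 ≤ P.T r
  T_le : ∀ᵐ r, r ∈ Ioo 0 R → P.T r ≤ P.d r
  cauchy : ∀ᵐ r, r ∈ Ioo 0 R → (P.D r - P.V r) ^ 2 ≤ r ^ ((n : ℝ) + a) * P.H r * P.T r

/-- Countably many radii increasing to R suffice. This is what allows R = 1 - |x₀|, where
integrability up to the unit sphere is unavailable. -/
theorem ae_Ioo_of_forall_lt {p : ℝ → Prop} {R : ℝ}
    (h : ∀ r ∈ Ioo 0 R, ∀ᵐ t, t ∈ Ioo 0 r → p t) : ∀ᵐ t, t ∈ Ioo 0 R → p t := by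
  rcases le_or_gt R 0 with hR | hR
  · exact Eventually.of_forall fun t ht => absurd (ht.1.trans ht.2) (not_lt.2 hR)
  have hmem : ∀ j : ℕ, R - R / (j + 2) ∈ Ioo 0 R := fun j => by
    have h1 : (1 : ℝ) < j + 2 := by have : (0 : ℝ) ≤ j := j.cast_nonneg; linarith
    have h2 : R / (j + 2) < R := div_lt_self hR h1
    have h3 : 0 < R / ((j : ℝ) + 2) := by positivity
    exact ⟨by linarith, by linarith⟩
  filter_upwards [ae_all_iff.2 fun j : ℕ => h _ (hmem j)] with t ht htR
  obtain ⟨j, hj⟩ := exists_nat_gt (R / (R - t))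
  refine ht j ⟨htR.1, ?_⟩
  have h1 : 0 < R - t := by linarith [htR.2]
  have h2 : R / ((j : ℝ) + 2) < R - t := by
    rw [div_lt_iff₀ (by positivity)]
    rw [div_lt_iff₀ h1] at hj
    nlinarith
  linarith

theorem absolutelyContinuousOnInterval_of_hasDerivAt {f f' : ℝ → ℝ} {r₁ r₂ B : ℝ} (h : r₁ ≤ r₂)
    (hf : ∀ r ∈ Icc r₁ r₂, HasDerivAt f (f' r) r) (hB : ∀ r ∈ Icc r₁ r₂, |f' r| ≤ B) :
    AbsolutelyContinuousOnInterval f r₁ r₂ := by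
  refine LipschitzOnWith.absolutelyContinuousOnInterval (K := B.toNNReal) ?_
  rw [uIcc_of_le h]
  refine (convex_Icc _ _).lipschitzOnWith_of_nnnorm_hasDerivWithin_le (f' := f')
    (fun r hr => (hf r hr).hasDerivWithinAt) fun r hr => ?_
  rw [← NNReal.coe_le_coe, coe_nnnorm]
  exact (hB r hr).trans (Real.le_coe_toNNReal _)

namespace IsAlmgren

variable {n : ℕ} {a τ R K B C₁ : ℝ} {P : RadialProfile}

theorem D_nonneg (h : IsAlmgren n a τ R K B C₁ P) {r : ℝ} (hr : r ∈ Ioo 0 R) : 0 ≤ P.D r := by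
  rw [h.D_eq r hr]
  exact setIntegral_nonneg measurableSet_Ioo fun t ht => h.d_nonneg t ⟨ht.1, ht.2.trans hr.2⟩

theorem S_nonneg (h : IsAlmgren n a τ R K B C₁ P) {r : ℝ} (hr : r ∈ Ioo 0 R) :
    0 ≤ P.S ((n : ℝ) - 1 + a) r :=
  add_nonneg (mul_nonneg (one_div_nonneg.2 (Real.rpow_nonneg hr.1.le _)) (h.D_nonneg hr))
    (h.H_nonneg r hr)

theorem γ_nonneg (h : IsAlmgren n a τ R K B C₁ P) {r : ℝ} (hr : r ∈ Ioo 0 R) : 0 ≤ P.γ n r :=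
  mul_nonneg (one_div_nonneg.2 (Real.rpow_nonneg hr.1.le _)) (h.g_nonneg r hr)

theorem γ_le (h : IsAlmgren n a τ R K B C₁ P) {r : ℝ} (hr : r ∈ Ioo 0 R) : P.γ n r ≤ B := by
  have h1 : 0 < r ^ (n : ℝ) := Real.rpow_pos_of_pos hr.1 _
  rw [RadialProfile.γ, one_div_mul_eq_div, div_le_iff₀ h1, mul_comm]
  exact h.g_le r hr

/-- The trace inequality raised to the power 2/(2+τ), which makes its right side linear in S. -/
theorem γ_rpow_le (h : IsAlmgren n a τ R K B C₁ P) (hτ : 0 < τ) (hK : 0 ≤ K) {r : ℝ}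
    (hr : r ∈ Ioo 0 R) :
    P.γ n r ^ (2 / (2 + τ)) ≤ K ^ (2 / (2 + τ)) * P.S ((n : ℝ) - 1 + a) r := by
  have h1 : 0 < r ^ (n : ℝ) := Real.rpow_pos_of_pos hr.1 _
  have h2 : P.γ n r ≤ K * P.S ((n : ℝ) - 1 + a) r ^ ((2 + τ) / 2) := by
    rw [RadialProfile.γ, one_div_mul_eq_div, div_le_iff₀ h1, mul_comm]
    exact h.trace r hr
  have hS := h.S_nonneg hr
  have h3 := Real.rpow_le_rpow (h.γ_nonneg hr) h2 (z := 2 / (2 + τ)) (by positivity)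
  rwa [Real.mul_rpow hK (by positivity), ← Real.rpow_mul hS,
    show (2 + τ) / 2 * (2 / (2 + τ)) = 1 by field_simp, Real.rpow_one] at h3

theorem γ_split (h : IsAlmgren n a τ R K B C₁ P) (hτ : 0 < τ) {r : ℝ} (hr : r ∈ Ioo 0 R) :
    P.γ n r = P.γ n r ^ (2 / (2 + τ)) * P.γ n r ^ (τ / (2 + τ)) := by
  rw [← Real.rpow_add_of_nonneg (h.γ_nonneg hr) (by positivity) (by positivity), ← add_div,
    div_self (by positivity), Real.rpow_one]

/-- One factor of γ is controlled by S and the complementary power by the bound on u. -/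
theorem γ_le_S (h : IsAlmgren n a τ R K B C₁ P) (hτ : 0 < τ) (hK : 0 ≤ K) {r : ℝ}
    (hr : r ∈ Ioo 0 R) :
    P.γ n r ≤ K ^ (2 / (2 + τ)) * B ^ (τ / (2 + τ)) * P.S ((n : ℝ) - 1 + a) r := by
  have hS := h.S_nonneg hr
  rw [h.γ_split hτ hr]
  calc P.γ n r ^ (2 / (2 + τ)) * P.γ n r ^ (τ / (2 + τ))
      ≤ (K ^ (2 / (2 + τ)) * P.S ((n : ℝ) - 1 + a) r) * B ^ (τ / (2 + τ)) :=
        mul_le_mul (h.γ_rpow_le hτ hK hr)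
          (Real.rpow_le_rpow (h.γ_nonneg hr) (h.γ_le hr) (by positivity))
          (Real.rpow_nonneg (h.γ_nonneg hr) _) (by positivity)
    _ = _ := by ring

theorem hasDerivAt_ψ (h : IsAlmgren n a τ R K B C₁ P) {r : ℝ} (hr : r ∈ Ioo 0 R)
    (hg : 0 < P.g r) : HasDerivAt (P.ψ n τ)
      ((1 - n * (τ / (2 + τ))) * P.γ n r ^ (τ / (2 + τ)) +
        τ / (2 + τ) * P.γ n r ^ (τ / (2 + τ) - 1) * (r / r ^ (n : ℝ) * P.m r)) r := by
  have h1 : 0 < r ^ (n : ℝ) := Real.rpow_pos_of_pos hr.1 _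
  have hr0 := hr.1
  have hγ : 0 < P.γ n r := mul_pos (one_div_pos.2 h1) hg
  have e1 : HasDerivAt (fun t : ℝ => 1 / t ^ (n : ℝ)) (-((n : ℝ) * r ^ ((n : ℝ) - 1)) / (r ^ (n : ℝ)) ^ 2) r := by
    simp only [one_div]
    exact (Real.hasDerivAt_rpow_const (p := (n : ℝ)) (Or.inl hr0.ne')).inv h1.ne'
  have e2 : HasDerivAt (P.γ n) _ r := e1.mul (h.hasDerivAt_g r hr)
  have e3 := (hasDerivAt_id r).mul (e2.rpow_const (p := τ / (2 + τ)) (Or.inl hγ.ne'))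
  refine e3.congr_deriv ?_
  rw [id, one_mul, Real.rpow_sub_one hγ.ne', Real.rpow_sub_one hr0.ne']
  have hg' : P.g r = P.γ n r * r ^ (n : ℝ) := by
    rw [RadialProfile.γ]; field_simp
  rw [hg']
  field_simp
  ring

/-- The exponent τ/(2+τ) is below 1, so the chain rule is unavailable where g = 0; but such a radius
is a minimum of ψ. -/
theorem deriv_ψ_of_g_eq_zero (h : IsAlmgren n a τ R K B C₁ P) (hτ : 0 < τ) {r : ℝ}
    (hr : r ∈ Ioo 0 R) (hg : P.g r = 0) : deriv (P.ψ n τ) r = 0 := by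
  refine IsLocalMin.deriv_eq_zero ?_
  have h0 : P.ψ n τ r = 0 := by
    rw [RadialProfile.ψ, RadialProfile.γ, hg, mul_zero, Real.zero_rpow (by positivity), mul_zero]
  filter_upwards [Ioo_mem_nhds hr.1 hr.2] with t ht
  rw [h0]
  exact mul_nonneg ht.1.le (Real.rpow_nonneg (h.γ_nonneg ht) _)

theorem m_eq_zero (h : IsAlmgren n a τ R K B C₁ P) {r : ℝ} (hr : r ∈ Ioo 0 R) (hg : P.g r = 0) :
    P.m r = 0 := by
  refine IsLocalMin.hasDerivAt_eq_zero ?_ (h.hasDerivAt_g r hr)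
  filter_upwards [Ioo_mem_nhds hr.1 hr.2] with t ht
  rw [hg]
  exact h.g_nonneg t ht

theorem exponent_pos (hτ : 0 < τ) (hτn : ((n : ℝ) - 1) * τ < 2) : 0 < 1 - n * (τ / (2 + τ)) := by
  have : 1 - n * (τ / (2 + τ)) = (2 - (n - 1) * τ) / (2 + τ) := by field_simp; ring
  rw [this]
  exact div_pos (by linarith) (by positivity)

theorem deriv_ψ_nonneg (h : IsAlmgren n a τ R K B C₁ P) (hτ : 0 < τ)
    (hτn : ((n : ℝ) - 1) * τ < 2) {r : ℝ} (hr : r ∈ Ioo 0 R) : 0 ≤ deriv (P.ψ n τ) r := by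
  rcases (h.g_nonneg r hr).eq_or_lt with hg | hg
  · rw [h.deriv_ψ_of_g_eq_zero hτ hr hg.symm]
  · rw [(h.hasDerivAt_ψ hr hg).deriv]
    have h1 := exponent_pos hτ hτn
    have h2 := h.γ_nonneg hr
    have h3 := h.m_nonneg r hr
    have h4 := hr.1
    positivity

/-- In ψ' both terms are nonnegative, by (n-1)τ < 2, so the term containing g' is at most ψ'.
Multiplying by γ^(2/(2+τ)) cancels its power of γ, and this factor is at most a multiple of S. Where
g = 0 also g' = 0. -/
theorem mass_rate_le (h : IsAlmgren n a τ R K B C₁ P) (hτ : 0 < τ)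
    (hτn : ((n : ℝ) - 1) * τ < 2) (hK : 0 ≤ K) {r : ℝ} (hr : r ∈ Ioo 0 R) :
    r / r ^ (n : ℝ) * P.m r ≤
      (2 + τ) / τ * K ^ (2 / (2 + τ)) * (deriv (P.ψ n τ) r * P.S ((n : ℝ) - 1 + a) r) := by
  rcases (h.g_nonneg r hr).eq_or_lt with hg | hg
  · rw [h.deriv_ψ_of_g_eq_zero hτ hr hg.symm, h.m_eq_zero hr hg.symm]
    simp
  have h1 : 0 < r ^ (n : ℝ) := Real.rpow_pos_of_pos hr.1 _
  have hγ : 0 < P.γ n r := mul_pos (one_div_pos.2 h1) hg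
  have hd0 := h.deriv_ψ_nonneg hτ hτn hr
  have hd : τ / (2 + τ) * P.γ n r ^ (τ / (2 + τ) - 1) * (r / r ^ (n : ℝ) * P.m r) ≤
      deriv (P.ψ n τ) r := by
    rw [(h.hasDerivAt_ψ hr hg).deriv]
    have := exponent_pos hτ hτn
    have : 0 ≤ (1 - n * (τ / (2 + τ))) * P.γ n r ^ (τ / (2 + τ)) := by positivity
    linarith
  have hinv : P.γ n r ^ (τ / (2 + τ) - 1) * P.γ n r ^ (2 / (2 + τ)) = 1 := by
    rw [← Real.rpow_add hγ, show τ / (2 + τ) - 1 + 2 / (2 + τ) = 0 by field_simp; ring,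
      Real.rpow_zero]
  calc r / r ^ (n : ℝ) * P.m r
      = (2 + τ) / τ * (τ / (2 + τ) * P.γ n r ^ (τ / (2 + τ) - 1) * (r / r ^ (n : ℝ) * P.m r)) *
          P.γ n r ^ (2 / (2 + τ)) := by
        rw [show (2 + τ) / τ * (τ / (2 + τ) * P.γ n r ^ (τ / (2 + τ) - 1) * (r / r ^ (n : ℝ) * P.m r)) *
          P.γ n r ^ (2 / (2 + τ)) = ((2 + τ) / τ * (τ / (2 + τ))) * (P.γ n r ^ (τ / (2 + τ) - 1) *
          P.γ n r ^ (2 / (2 + τ))) * (r / r ^ (n : ℝ) * P.m r) by ring, hinv,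
          show (2 + τ) / τ * (τ / (2 + τ)) = 1 by field_simp]
        ring
    _ ≤ (2 + τ) / τ * deriv (P.ψ n τ) r * (K ^ (2 / (2 + τ)) * P.S ((n : ℝ) - 1 + a) r) := by
        refine mul_le_mul (mul_le_mul_of_nonneg_left hd (by positivity)) (h.γ_rpow_le hτ hK hr)
          (by positivity) (by positivity)
    _ = _ := by ring

theorem one_div_rpow {r : ℝ} (hr : 0 < r) :
    1 / r ^ ((n : ℝ) - 1 + a) = r ^ (-a) * (r / r ^ (n : ℝ)) := by
  rw [Real.rpow_add hr, Real.rpow_sub_one hr.ne', Real.rpow_neg hr.le]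
  have := Real.rpow_pos_of_pos hr a
  have := Real.rpow_pos_of_pos hr n
  field_simp

/-- The term with g/r is bounded by S through `γ_le_S`, the term with g' by ψ' S. Their sum explains
the shape 1 + ψ' of the density of Ψ, and the factor r^(-a) is the mismatch between r^(n-1+a) and
r^(n-1). -/
theorem error_le (h : IsAlmgren n a τ R K B C₁ P) (hτ : 0 < τ)
    (hτn : ((n : ℝ) - 1) * τ < 2) (hK : 0 ≤ K) (hB : 0 ≤ B) {r : ℝ} (hr : r ∈ Ioo 0 R) :
    1 / r ^ ((n : ℝ) - 1 + a) * (P.g r / r + P.m r) ≤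
      (K ^ (2 / (2 + τ)) * B ^ (τ / (2 + τ)) + (2 + τ) / τ * K ^ (2 / (2 + τ))) *
        (P.ψRate n τ a r * P.S ((n : ℝ) - 1 + a) r) := by
  have h1 := h.γ_le_S hτ hK hr
  have h2 := h.mass_rate_le hτ hτn hK hr
  have h3 := h.deriv_ψ_nonneg hτ hτn hr
  have hr0 := hr.1
  have hS := h.S_nonneg hr
  have h4 : 1 / r ^ ((n : ℝ) - 1 + a) * (P.g r / r + P.m r) =
      r ^ (-a) * (P.γ n r + r / r ^ (n : ℝ) * P.m r) := by
    rw [one_div_rpow hr0, RadialProfile.γ]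
    have := Real.rpow_pos_of_pos hr0 n
    field_simp
  rw [h4, RadialProfile.ψRate]
  have h5 : 0 ≤ r ^ (-a) := Real.rpow_nonneg hr0.le _
  set A₁ := K ^ (2 / (2 + τ)) * B ^ (τ / (2 + τ))
  set A₂ := (2 + τ) / τ * K ^ (2 / (2 + τ))
  have hA₁ : 0 ≤ A₁ := by positivity
  have hA₂ : 0 ≤ A₂ := by positivity
  set S := P.S ((n : ℝ) - 1 + a) r
  set q := deriv (P.ψ n τ) r
  have h6 : P.γ n r + r / r ^ (n : ℝ) * P.m r ≤ (A₁ + A₂) * ((1 + q) * S) := by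
    have : 0 ≤ A₁ * (q * S) := by positivity
    have : 0 ≤ A₂ * S := by positivity
    nlinarith
  calc r ^ (-a) * (P.γ n r + r / r ^ (n : ℝ) * P.m r)
      ≤ r ^ (-a) * ((A₁ + A₂) * ((1 + q) * S)) := mul_le_mul_of_nonneg_left h6 h5
    _ = _ := by ring

/-- The normalised potential is at most a constant times r^(1-a) S. Since a < 1 this is at most S/2
for small radii, which is where the smallness of the radius enters. -/
theorem half_S_le (h : IsAlmgren n a τ R K B C₁ P) (hτ : 0 < τ) (hK : 0 ≤ K) (hC₁ : 0 ≤ C₁)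
    {r : ℝ} (hr : r ∈ Ioo 0 R)
    (hsmall : C₁ * (K ^ (2 / (2 + τ)) * B ^ (τ / (2 + τ))) * r ^ (1 - a) ≤ 1 / 2) :
    P.S ((n : ℝ) - 1 + a) r / 2 ≤ P.E ((n : ℝ) - 1 + a) r + P.H r := by
  have h1 := h.γ_le_S hτ hK hr
  have hr0 := hr.1
  have h2 := (abs_le.1 (h.V_le r hr)).2
  have hS := h.S_nonneg hr
  have h3 : 1 / r ^ ((n : ℝ) - 1 + a) * P.V r ≤ P.S ((n : ℝ) - 1 + a) r / 2 := by
    calc 1 / r ^ ((n : ℝ) - 1 + a) * P.V r ≤ 1 / r ^ ((n : ℝ) - 1 + a) * (C₁ * P.g r) :=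
          mul_le_mul_of_nonneg_left h2 (one_div_nonneg.2 (Real.rpow_nonneg hr0.le _))
      _ = C₁ * r ^ (1 - a) * P.γ n r := by
          rw [one_div_rpow hr0, RadialProfile.γ, sub_eq_add_neg, Real.rpow_add hr0, Real.rpow_one]
          ring
      _ ≤ C₁ * r ^ (1 - a) * (K ^ (2 / (2 + τ)) * B ^ (τ / (2 + τ)) * P.S ((n : ℝ) - 1 + a) r) :=
          mul_le_mul_of_nonneg_left h1 (mul_nonneg hC₁ (Real.rpow_nonneg hr0.le _))
      _ = (C₁ * (K ^ (2 / (2 + τ)) * B ^ (τ / (2 + τ))) * r ^ (1 - a)) *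
            P.S ((n : ℝ) - 1 + a) r := by ring
      _ ≤ 1 / 2 * P.S ((n : ℝ) - 1 + a) r := mul_le_mul_of_nonneg_right hsmall hS
      _ = _ := by ring
  have h4 : P.E ((n : ℝ) - 1 + a) r + P.H r =
      P.S ((n : ℝ) - 1 + a) r - 1 / r ^ ((n : ℝ) - 1 + a) * P.V r := by
    rw [RadialProfile.E, RadialProfile.S]; ring
  linarith

end IsAlmgren

end Radial

/-! ### Integrability of the rate and the differential inequality for the frequency -/

section RadialFrequency

namespace IsAlmgren

variable {n : ℕ} {a τ R K B C₁ : ℝ} {P : RadialProfile}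

theorem monotoneOn_g (h : IsAlmgren n a τ R K B C₁ P) : MonotoneOn P.g (Ioo 0 R) :=
  monotoneOn_of_deriv_nonneg (convex_Ioo 0 R)
    (fun r hr => (h.hasDerivAt_g r hr).continuousAt.continuousWithinAt)
    (fun r hr => (h.hasDerivAt_g r (interior_subset hr)).differentiableAt.differentiableWithinAt)
    fun r hr => by
      rw [(h.hasDerivAt_g r (interior_subset hr)).deriv]
      exact h.m_nonneg r (interior_subset hr)

theorem rpow_mul_ψ {r : ℝ} (hr : 0 < r) :
    r ^ (-a) * P.ψ n τ r = r ^ (1 - a) * P.γ n r ^ (τ / (2 + τ)) := by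
  rw [RadialProfile.ψ, sub_eq_add_neg, Real.rpow_add hr, Real.rpow_one]; ring

/-- Up to regrouping, t^(-a) ψ is t^e g^(τ/(2+τ)) with e = 1 - a - nτ/(2+τ) ≥ 0, a product of
nondecreasing functions. -/
theorem monotoneOn_rpow_mul_ψ (h : IsAlmgren n a τ R K B C₁ P) (hτ : 0 < τ)
    (he : 0 ≤ 1 - a - n * (τ / (2 + τ))) {r : ℝ} (hr : r ∈ Ioo 0 R) :
    MonotoneOn (fun t => t ^ (-a) * P.ψ n τ t) (Icc 0 r) := by
  have hnn : ∀ t ∈ Ioc 0 r, 0 ≤ t ^ (-a) * P.ψ n τ t := fun t ht => by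
    rw [rpow_mul_ψ ht.1]
    exact mul_nonneg (Real.rpow_nonneg ht.1.le _)
      (Real.rpow_nonneg (h.γ_nonneg ⟨ht.1, ht.2.trans_lt hr.2⟩) _)
  have heq : ∀ t ∈ Ioc 0 r, t ^ (-a) * P.ψ n τ t =
      t ^ (1 - a - n * (τ / (2 + τ))) * P.g t ^ (τ / (2 + τ)) := fun t ht => by
    have h1 : 0 < t ^ (n : ℝ) := Real.rpow_pos_of_pos ht.1 _
    rw [rpow_mul_ψ ht.1, RadialProfile.γ, one_div,
      Real.mul_rpow (by positivity) (h.g_nonneg t ⟨ht.1, ht.2.trans_lt hr.2⟩),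
      Real.inv_rpow h1.le, ← Real.rpow_mul ht.1.le, Real.rpow_sub ht.1 (1 - a)]
    ring
  intro t₁ h₁ t₂ h₂ h₁₂
  rcases h₁.1.eq_or_lt with h0 | h0
  · rcases h₂.1.eq_or_lt with h0' | h0'
    · rw [← h0, ← h0']
    · refine le_of_eq_of_le ?_ (hnn t₂ ⟨h0', h₂.2⟩)
      rw [← h0]
      simp [RadialProfile.ψ]
  · have h0' := h0.trans_le h₁₂
    simp only
    rw [heq t₁ ⟨h0, h₁.2⟩, heq t₂ ⟨h0', h₂.2⟩]
    have m1 : t₁ ∈ Ioo 0 R := ⟨h0, h₁.2.trans_lt hr.2⟩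
    have m2 : t₂ ∈ Ioo 0 R := ⟨h0', h₂.2.trans_lt hr.2⟩
    have hg := h.monotoneOn_g m1 m2 h₁₂
    have := h.g_nonneg t₁ m1
    gcongr

/-- With χ = t^(-a) ψ one has t^(-a) ψ' = χ' + a t^(-a) γ^(τ/(2+τ)). The function χ is monotone, so
its derivative is integrable with integral at most the increment; the last term is dominated by
t^(-a), which is integrable as a < 1. -/
theorem ψRate_integral (h : IsAlmgren n a τ R K B C₁ P) (hτ : 0 < τ) (ha : a < 1)
    (he : 0 ≤ 1 - a - n * (τ / (2 + τ))) {r : ℝ} (hr : r ∈ Ioo 0 R) :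
    IntervalIntegrable (P.ψRate n τ a) volume 0 r ∧
      ∫ t in (0 : ℝ)..r, P.ψRate n τ a t ≤
        ((1 + |a| * B ^ (τ / (2 + τ))) / (1 - a) + B ^ (τ / (2 + τ))) * r ^ (1 - a) := by
  have hr0 := hr.1
  have hmem : ∀ t ∈ Ioc 0 r, t ∈ Ioo 0 R := fun t ht => ⟨ht.1, ht.2.trans_lt hr.2⟩
  set b := B ^ (τ / (2 + τ)) with hb
  set χ : ℝ → ℝ := fun t => t ^ (-a) * P.ψ n τ t with hχ
  have hmono : MonotoneOn χ (uIcc 0 r) := by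
    rw [uIcc_of_le hr0.le]; exact h.monotoneOn_rpow_mul_ψ hτ he hr
  have hγb : ∀ t ∈ Ioc 0 r, P.γ n t ^ (τ / (2 + τ)) ≤ b := fun t ht =>
    Real.rpow_le_rpow (h.γ_nonneg (hmem t ht)) (h.γ_le (hmem t ht)) (by positivity)
  have hχ' := hmono.intervalIntegrable_deriv
  have hχint : ∫ t in (0 : ℝ)..r, deriv χ t ≤ r ^ (1 - a) * b := by
    have h1 := hmono.intervalIntegral_deriv_mem_uIcc
    have h2 : χ 0 = 0 := by simp [hχ, RadialProfile.ψ]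
    have h3 : 0 ≤ χ r := by rw [← h2]; exact hmono (by simp) (by simp) hr0.le
    rw [h2, sub_zero, uIcc_of_le h3] at h1
    refine h1.2.trans ?_
    rw [hχ]
    simp only
    rw [rpow_mul_ψ hr0]
    exact mul_le_mul_of_nonneg_left (hγb r ⟨hr0, le_rfl⟩) (by positivity)
  set j : ℝ → ℝ := fun t => a * (t ^ (-a) * P.γ n t ^ (τ / (2 + τ))) with hj
  have hpow : IntervalIntegrable (fun t : ℝ => t ^ (-a)) volume 0 r :=
    intervalIntegral.intervalIntegrable_rpow' (by linarith)
  have hpowint : ∫ t in (0 : ℝ)..r, t ^ (-a) = r ^ (1 - a) / (1 - a) := by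
    rw [integral_rpow (Or.inl (by linarith)), show -a + 1 = 1 - a by ring,
      Real.zero_rpow (by linarith), sub_zero]
  have hjle : ∀ t ∈ Ioc 0 r, ‖j t‖ ≤ |a| * b * t ^ (-a) := fun t ht => by
    have h1 : 0 ≤ t ^ (-a) := Real.rpow_nonneg ht.1.le _
    have h2 : 0 ≤ P.γ n t ^ (τ / (2 + τ)) := Real.rpow_nonneg (h.γ_nonneg (hmem t ht)) _
    rw [hj]
    simp only
    rw [Real.norm_eq_abs, abs_mul, abs_of_nonneg (mul_nonneg h1 h2), mul_assoc, mul_comm b]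
    exact mul_le_mul_of_nonneg_left (mul_le_mul_of_nonneg_left (hγb t ht) h1) (abs_nonneg _)
  have hjc : ContinuousOn j (Ioc 0 r) := by
    intro t ht
    have hne := (hmem t ht).1.ne'
    have c1 : ContinuousAt (P.γ n) t := by
      refine ContinuousAt.mul ?_ (h.hasDerivAt_g t (hmem t ht)).continuousAt
      exact continuousAt_const.div (Real.continuousAt_rpow_const _ _ (Or.inl hne))
        (Real.rpow_pos_of_pos ht.1 _).ne'
    have c2 : ContinuousAt j t := continuousAt_const.mul
      ((Real.continuousAt_rpow_const _ _ (Or.inl hne)).mul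
        (c1.rpow_const (Or.inr (by positivity))))
    exact c2.continuousWithinAt
  have hjint : IntervalIntegrable j volume 0 r := by
    refine (hpow.const_mul (|a| * b)).mono_fun' ?_ ?_
    · rw [uIoc_of_le hr0.le]
      exact hjc.aestronglyMeasurable measurableSet_Ioc
    · rw [uIoc_of_le hr0.le]
      filter_upwards [ae_restrict_mem measurableSet_Ioc] with t ht using hjle t ht
  have hjle' : ∫ t in (0 : ℝ)..r, j t ≤ |a| * b * (r ^ (1 - a) / (1 - a)) := by
    rw [← hpowint, ← intervalIntegral.integral_const_mul]
    refine intervalIntegral.integral_mono_on_of_le_Ioo hr0.le hjint (hpow.const_mul _) fun t ht => ?_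
    exact (le_abs_self _).trans (hjle t ⟨ht.1, ht.2.le⟩)
  have hae : ∀ᵐ t, t ∈ Ioc 0 r → t ^ (-a) + (deriv χ t + j t) = P.ψRate n τ a t := by
    -- The endpoint r is discarded so that differentiability within the interval becomes
    -- differentiability.
    have hne : ∀ᵐ t : ℝ, t ≠ r := by simp [ae_iff]
    filter_upwards [hmono.ae_differentiableWithinAt_of_mem, hne] with t h1 h2 ht
    have ht' : t < r := lt_of_le_of_ne ht.2 h2
    have d1 : HasDerivAt χ (deriv χ t) t := ((h1 (by
      rw [uIcc_of_le hr0.le]; exact ⟨ht.1.le, ht.2⟩)).differentiableAt (by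
      rw [uIcc_of_le hr0.le]; exact Icc_mem_nhds ht.1 ht')).hasDerivAt
    have d2 := (Real.hasDerivAt_rpow_const (p := a) (Or.inl ht.1.ne')).mul d1
    have d3 : HasDerivAt (P.ψ n τ) _ t := d2.congr_of_eventuallyEq (by
      filter_upwards [lt_mem_nhds ht.1] with x hx
      have := Real.rpow_pos_of_pos hx a
      simp only [hχ, Pi.mul_apply]
      rw [Real.rpow_neg hx.le]
      field_simp)
    rw [RadialProfile.ψRate, d3.deriv, hj]
    simp only
    have h3 : χ t = t * (t ^ (-a) * P.γ n t ^ (τ / (2 + τ))) := by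
      rw [hχ]
      simp only
      rw [RadialProfile.ψ]; ring
    have h4 := Real.rpow_pos_of_pos ht.1 a
    have h5 := ht.1.ne'
    rw [h3, Real.rpow_sub_one h5, Real.rpow_neg ht.1.le]
    field_simp
    ring
  have hall := hpow.add (hχ'.add hjint)
  have hae' : (fun t : ℝ => t ^ (-a) + (deriv χ t + j t)) =ᵐ[volume.restrict (uIoc 0 r)]
      P.ψRate n τ a := by
    rw [uIoc_of_le hr0.le]
    exact (ae_restrict_iff' measurableSet_Ioc).2 hae
  refine ⟨hall.congr_ae hae', ?_⟩
  rw [← intervalIntegral.integral_congr_ae_restrict hae',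
    intervalIntegral.integral_add hpow (hχ'.add hjint), intervalIntegral.integral_add hχ' hjint,
    hpowint]
  calc r ^ (1 - a) / (1 - a) + ((∫ t in (0 : ℝ)..r, deriv χ t) + ∫ t in (0 : ℝ)..r, j t)
      ≤ r ^ (1 - a) / (1 - a) + (r ^ (1 - a) * b + |a| * b * (r ^ (1 - a) / (1 - a))) := by
        gcongr
    _ = _ := by ring

theorem ae_hasDerivAt_D (h : IsAlmgren n a τ R K B C₁ P) :
    ∀ᵐ r, r ∈ Ioo 0 R → HasDerivAt P.D (P.d r) r := by
  refine ae_Ioo_of_forall_lt fun r₁ hr₁ => ?_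
  have hi : IntervalIntegrable P.d volume 0 r₁ :=
    (intervalIntegrable_iff_integrableOn_Ioo_of_le hr₁.1.le).2 (h.integrable r₁ hr₁)
  filter_upwards [hi.ae_hasDerivAt_integral] with r hr hr1
  refine (hr (by rw [uIcc_of_le hr₁.1.le]; exact ⟨hr1.1.le, hr1.2.le⟩) 0 (by simp)).congr_of_eventuallyEq ?_
  filter_upwards [Ioo_mem_nhds hr1.1 hr1.2] with t ht
  rw [h.D_eq t ⟨ht.1, ht.2.trans hr₁.2⟩, intervalIntegral.integral_of_le ht.1.le,
    integral_Ioc_eq_integral_Ioo]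

theorem absolutelyContinuous_E (h : IsAlmgren n a τ R K B C₁ P) {r₁ r₂ : ℝ} (h₁ : 0 < r₁)
    (h₁₂ : r₁ ≤ r₂) (h₂ : r₂ < R) (p : ℝ) :
    AbsolutelyContinuousOnInterval (P.E p) r₁ r₂ := by
  have hmem : ∀ r ∈ Icc r₁ r₂, r ∈ Ioo 0 R := fun r hr => ⟨h₁.trans_le hr.1, hr.2.trans_lt h₂⟩
  have hr₂ := hmem r₂ ⟨h₁₂, le_rfl⟩
  have hi : IntervalIntegrable P.d volume 0 r₂ :=
    (intervalIntegrable_iff_integrableOn_Ioo_of_le hr₂.1.le).2 (h.integrable r₂ hr₂)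
  have hD0 : AbsolutelyContinuousOnInterval (fun r => ∫ t in (0 : ℝ)..r, P.d t) r₁ r₂ :=
    (hi.absolutelyContinuousOnInterval_intervalIntegral (c := 0) (by simp)).mono (by
      rw [uIcc_of_le h₁₂, uIcc_of_le hr₂.1.le]; exact Icc_subset_Icc_left h₁.le)
  obtain ⟨M, hM⟩ := isCompact_Icc.exists_bound_of_continuousOn
    (h.continuousOn_m.mono fun r hr => hmem r hr : ContinuousOn P.m (Icc r₁ r₂))
  have hV : AbsolutelyContinuousOnInterval P.V r₁ r₂ := by
    refine absolutelyContinuousOnInterval_of_hasDerivAt h₁₂ (B := |C₁| * M)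
      (fun r hr => h.hasDerivAt_V r (hmem r hr)) fun r hr => (h.v_le r (hmem r hr)).trans ?_
    calc C₁ * P.m r ≤ |C₁| * |P.m r| := by rw [← abs_mul]; exact le_abs_self _
      _ ≤ |C₁| * M := mul_le_mul_of_nonneg_left (hM r hr) (abs_nonneg _)
  have hpow : AbsolutelyContinuousOnInterval (fun r : ℝ => 1 / r ^ p) r₁ r₂ := by
    refine ContDiffOn.absolutelyContinuousOnInterval ?_
    rw [uIcc_of_le h₁₂]
    intro r hr
    have hr0 := (hmem r hr).1
    exact (contDiffAt_const.div (Real.contDiffAt_rpow_const_of_ne hr0.ne')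
      (Real.rpow_pos_of_pos hr0 _).ne').contDiffWithinAt
  have hall := hpow.mul (hD0.sub hV)
  rw [absolutelyContinuousOnInterval_iff] at hall ⊢
  intro ε hε
  obtain ⟨δ, hδ, hh⟩ := hall ε hε
  refine ⟨δ, hδ, fun I hI hlt => ?_⟩
  refine (le_of_eq (Finset.sum_congr rfl fun i hi => ?_)).trans_lt (hh I hI hlt)
  have hE : ∀ r ∈ uIcc r₁ r₂, P.E p r =
      ((fun r : ℝ => 1 / r ^ p) * ((fun r => ∫ t in (0 : ℝ)..r, P.d t) - P.V)) r := fun r hr => by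
    rw [uIcc_of_le h₁₂] at hr
    rw [RadialProfile.E, h.D_eq r (hmem r hr), Pi.mul_apply, Pi.sub_apply,
      intervalIntegral.integral_of_le (hmem r hr).1.le, integral_Ioc_eq_integral_Ioo]
  rw [hE _ (hI.1 i hi).1, hE _ (hI.1 i hi).2]

/-- Pohozaev replaces D' by 2T + pD/r plus potential terms, and pD/r cancels against the derivative
of the factor r^(-p). Cauchy-Schwarz makes 2T at least as large as needed for 2E²/r, and what
remains are the terms in V, V', W, W'. -/
theorem ae_deriv_E (h : IsAlmgren n a τ R K B C₁ P) :
    ∀ᵐ r, r ∈ Ioo 0 R →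
      -(C₁ * (|(n : ℝ) - 1 + a| + 2 * n + 3)) *
          (1 / r ^ ((n : ℝ) - 1 + a) * (P.g r / r + P.m r)) * P.H r ≤
        deriv (P.E ((n : ℝ) - 1 + a)) r * P.H r - 2 * P.E ((n : ℝ) - 1 + a) r ^ 2 / r := by
  filter_upwards [h.ae_hasDerivAt_D, h.pohozaev, h.cauchy] with r hD hP hC hr
  have hr0 := hr.1
  set p := (n : ℝ) - 1 + a with hp
  set x := r ^ p with hx
  have hx0 : 0 < x := Real.rpow_pos_of_pos hr0 _
  have e1 : HasDerivAt (fun t : ℝ => 1 / t ^ p) (-(p * r ^ (p - 1)) / (r ^ p) ^ 2) r := by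
    simp only [one_div]
    exact (Real.hasDerivAt_rpow_const (Or.inl hr0.ne')).inv hx0.ne'
  have e2 : HasDerivAt (P.E p) _ r := e1.mul ((hD hr).sub (h.hasDerivAt_V r hr))
  have hP' := hP hr
  have hC' := hC hr
  -- Collects the potential contributions: p and 2n multiply terms of size g/r, while 2w and v
  -- contribute 3 g'. This is the origin of the constant |p| + 2n + 3.
  set err := p * P.V r / r - 2 * n * P.W r / r + 2 * P.w r - P.v r with herr
  have hd : P.d r = 2 * P.T r + p * P.D r / r - 2 * n * P.W r / r + 2 * P.w r := by
    field_simp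
    rw [hp]
    linarith
  have e3 : deriv (P.E p) r = 1 / x * (2 * P.T r + err) := by
    rw [e2.deriv, Real.rpow_sub_one hr0.ne', ← hx, hd, herr]
    field_simp
    ring
  have hH := h.H_nonneg r hr
  have hg := h.g_nonneg r hr
  have hm := h.m_nonneg r hr
  have e4 : 2 * P.E p r ^ 2 / r ≤ 1 / x * (2 * P.T r) * P.H r := by
    have hpow : r ^ ((n : ℝ) + a) = x * r := by
      rw [hx, ← Real.rpow_add_one hr0.ne', hp]; congr 1; ring
    rw [hpow] at hC'
    rw [RadialProfile.E, ← hx]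
    have : 2 * (1 / x * (P.D r - P.V r)) ^ 2 / r = 2 / (x ^ 2 * r) * (P.D r - P.V r) ^ 2 := by
      field_simp
    rw [this]
    calc 2 / (x ^ 2 * r) * (P.D r - P.V r) ^ 2 ≤ 2 / (x ^ 2 * r) * (x * r * P.H r * P.T r) :=
          mul_le_mul_of_nonneg_left hC' (by positivity)
      _ = _ := by field_simp
  have e5 : -(C₁ * (|p| + 2 * n + 3)) * (P.g r / r + P.m r) ≤ err := by
    have hV := h.V_le r hr
    have hW := h.W_le r hr
    have hv := abs_le.1 (h.v_le r hr)
    have hw := abs_le.1 (h.w_le r hr)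
    have a1 : -(|p| * (C₁ * P.g r) / r) ≤ p * P.V r / r := by
      rw [← neg_div]
      refine div_le_div_of_nonneg_right ?_ hr0.le
      have : |p * P.V r| ≤ |p| * (C₁ * P.g r) := by
        rw [abs_mul]; exact mul_le_mul_of_nonneg_left hV (abs_nonneg _)
      linarith [(abs_le.1 this).1]
    have a2 : 2 * n * P.W r / r ≤ 2 * n * (C₁ * P.g r) / r := by
      refine div_le_div_of_nonneg_right ?_ hr0.le
      exact mul_le_mul_of_nonneg_left (abs_le.1 hW).2 (by positivity)
    have b1 : 0 ≤ C₁ * P.g r := (abs_nonneg _).trans hV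
    have b2 : 0 ≤ C₁ * P.m r := (abs_nonneg _).trans (h.v_le r hr)
    have b3 : (C₁ * (|p| + 2 * n + 3)) * (P.g r / r + P.m r) =
        |p| * (C₁ * P.g r) / r + 2 * n * (C₁ * P.g r) / r + 3 * (C₁ * P.g r / r) +
          (|p| + 2 * n) * (C₁ * P.m r) + 3 * (C₁ * P.m r) := by
      field_simp
      ring
    have b4 : 0 ≤ 3 * (C₁ * P.g r / r) := by positivity
    have b5 : 0 ≤ (|p| + 2 * n) * (C₁ * P.m r) := by positivity
    rw [herr]
    linarith
  rw [e3]
  have e6 : 1 / x * (-(C₁ * (|p| + 2 * n + 3)) * (P.g r / r + P.m r)) * P.H r ≤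
      1 / x * err * P.H r :=
    mul_le_mul_of_nonneg_right (mul_le_mul_of_nonneg_left e5 (by positivity)) hH
  have e7 : 1 / x * (2 * P.T r + err) * P.H r =
      1 / x * (2 * P.T r) * P.H r + 1 / x * err * P.H r := by ring
  rw [e7]
  have e8 : -(C₁ * (|p| + 2 * n + 3)) * (1 / x * (P.g r / r + P.m r)) * P.H r =
      1 / x * (-(C₁ * (|p| + 2 * n + 3)) * (P.g r / r + P.m r)) * P.H r := by ring
  rw [e8]
  linarith

/-- If the energy vanishes then D' and hence T vanish almost everywhere below r, so Cauchy-Schwarz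
gives E = 0 almost everywhere and, by continuity, everywhere on (0, r). Then H' = 0, and H keeps its
value 0. -/
theorem H_eq_zero_of_S_eq_zero (h : IsAlmgren n a τ R K B C₁ P) {r : ℝ} (hr : r ∈ Ioo 0 R)
    (hS : P.S ((n : ℝ) - 1 + a) r = 0) : ∀ t ∈ Ioc 0 r, P.H t = 0 := by
  set p := (n : ℝ) - 1 + a with hp
  have hx0 : 0 < r ^ p := Real.rpow_pos_of_pos hr.1 _
  have hD0 := h.D_nonneg hr
  have hH0 := h.H_nonneg r hr
  have hsub : ∀ t ∈ Ioo 0 r, t ∈ Ioo 0 R := fun t ht => ⟨ht.1, ht.2.trans hr.2⟩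
  rw [RadialProfile.S] at hS
  have hxD : 0 ≤ 1 / r ^ p * P.D r := by positivity
  have hH : P.H r = 0 := by linarith
  have hD : P.D r = 0 := by
    have : 1 / r ^ p * P.D r = 0 := by linarith
    rcases mul_eq_zero.1 this with h1 | h1
    · exact absurd h1 (by positivity)
    · exact h1
  rw [h.D_eq r hr, setIntegral_eq_zero_iff_of_nonneg_ae
    ((ae_restrict_iff' measurableSet_Ioo).2 (Eventually.of_forall fun t ht => h.d_nonneg t (hsub t ht)))
    (h.integrable r hr)] at hD
  have hcE : ContinuousOn (P.E p) (Ioo 0 r) := fun t ht => by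
    have h2 := (h.absolutelyContinuous_E (p := p) (r₁ := t / 2) (r₂ := (t + r) / 2)
      (by linarith [ht.1]) (by linarith [ht.1, ht.2]) (by linarith [ht.2, hr.2])).continuousOn
    rw [uIcc_of_le (by linarith [ht.1, ht.2])] at h2
    exact (h2.continuousAt (Icc_mem_nhds (by linarith [ht.1]) (by linarith [ht.2]))).continuousWithinAt
  have hE : EqOn (P.E p) (fun _ => 0) (Ioo 0 r) := by
    refine Measure.eqOn_open_of_ae_eq (μ := volume) ?_ isOpen_Ioo hcE continuousOn_const
    rw [Filter.EventuallyEq, ae_restrict_iff' measurableSet_Ioo] at hD ⊢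
    filter_upwards [hD, h.T_le, h.cauchy] with t h1 h2 h3 ht
    have hT : P.T t = 0 := le_antisymm ((h2 (hsub t ht)).trans (h1 ht).le) (h.T_nonneg t (hsub t ht))
    have h4 := h3 (hsub t ht)
    rw [hT, mul_zero] at h4
    have h5 : P.D t - P.V t = 0 := pow_eq_zero_iff two_ne_zero |>.1 (le_antisymm h4 (sq_nonneg _))
    rw [RadialProfile.E, h5, mul_zero]
  intro t ht
  rw [← hH]
  have hcH : ContinuousOn P.H (Icc t r) := fun x hx =>
    (h.hasDerivAt_H x ⟨ht.1.trans_le hx.1, hx.2.trans_lt hr.2⟩).continuousAt.continuousWithinAt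
  have := constant_of_has_deriv_right_zero hcH (fun x hx => by
    have hx' : x ∈ Ioo 0 r := ⟨ht.1.trans_le hx.1, hx.2⟩
    have h6 := h.hasDerivAt_H x (hsub x hx')
    rw [← hp, hE hx'] at h6
    simpa using h6.hasDerivWithinAt) r ⟨ht.2, le_rfl⟩
  exact this.symm

/-- The radial functions satisfy the differential relations behind the monotonicity formula. -/
theorem frequencyData (h : IsAlmgren n a τ R K B C₁ P) (hτ : 0 < τ)
    (hτn : ((n : ℝ) - 1) * τ < 2) (ha : a < 1) (he : 0 ≤ 1 - a - n * (τ / (2 + τ)))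
    (hK : 0 ≤ K) (hB : 0 ≤ B) (hC₁ : 0 ≤ C₁)
    (hsmall : C₁ * (K ^ (2 / (2 + τ)) * B ^ (τ / (2 + τ))) * R ^ (1 - a) ≤ 1 / 2) {C : ℝ}
    (hC : 2 * (C₁ * (|(n : ℝ) - 1 + a| + 2 * n + 3)) *
      (K ^ (2 / (2 + τ)) * B ^ (τ / (2 + τ)) + (2 + τ) / τ * K ^ (2 / (2 + τ))) ≤ C) :
    FrequencyData R (P.E ((n : ℝ) - 1 + a)) P.H (fun r => C * P.ψRate n τ a r) where
  hasDerivAt := h.hasDerivAt_H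
  nonneg := h.H_nonneg
  ac := fun _ _ h₁ h₁₂ h₂ => h.absolutelyContinuous_E h₁ h₁₂ h₂ _
  integrable := fun r hr => ((h.ψRate_integral hτ ha he hr).1).const_mul C
  ae_le := by
    filter_upwards [h.ae_deriv_E] with r h1 hr
    refine le_trans ?_ (h1 hr)
    have hsm : C₁ * (K ^ (2 / (2 + τ)) * B ^ (τ / (2 + τ))) * r ^ (1 - a) ≤ 1 / 2 :=
      (mul_le_mul_of_nonneg_left (Real.rpow_le_rpow hr.1.le hr.2.le (by linarith))
        (by positivity)).trans hsmall
    have h2 := h.half_S_le hτ hK hC₁ hr hsm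
    have h3 := h.error_le hτ hτn hK hB hr
    have h4 : 0 ≤ P.ψRate n τ a r := by
      have := h.deriv_ψ_nonneg hτ hτn hr
      exact mul_nonneg (Real.rpow_nonneg hr.1.le _) (by linarith)
    have hH := h.H_nonneg r hr
    set p := (n : ℝ) - 1 + a
    set C₀ := K ^ (2 / (2 + τ)) * B ^ (τ / (2 + τ)) + (2 + τ) / τ * K ^ (2 / (2 + τ)) with hC₀
    set C₂ := C₁ * (|p| + 2 * n + 3) with hC₂
    have hC₀0 : 0 ≤ C₀ := by positivity
    have hC₂0 : 0 ≤ C₂ := by positivity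
    have hS := h.S_nonneg hr
    set q := P.ψRate n τ a r
    -- The factor 2 in the condition on C comes from replacing S/2 by E + H.
    have h5 : C₂ * (1 / r ^ p * (P.g r / r + P.m r)) ≤ C * q * (P.E p r + P.H r) := by
      calc C₂ * (1 / r ^ p * (P.g r / r + P.m r)) ≤ C₂ * (C₀ * (q * P.S p r)) :=
            mul_le_mul_of_nonneg_left h3 hC₂0
        _ = (2 * C₂ * C₀) * (q * (P.S p r / 2)) := by ring
        _ ≤ C * (q * (P.E p r + P.H r)) := by
            have : 0 ≤ P.S p r / 2 := by positivity
            gcongr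
            exact (by positivity : 0 ≤ 2 * C₂ * C₀).trans hC
        _ = _ := by ring
    have h6 := mul_le_mul_of_nonneg_right h5 hH
    linarith
  add_nonneg := fun r hr => by
    have hsm : C₁ * (K ^ (2 / (2 + τ)) * B ^ (τ / (2 + τ))) * r ^ (1 - a) ≤ 1 / 2 :=
      (mul_le_mul_of_nonneg_left (Real.rpow_le_rpow hr.1.le hr.2.le (by linarith))
        (by positivity)).trans hsmall
    exact (div_nonneg (h.S_nonneg hr) zero_le_two).trans (h.half_S_le hτ hK hC₁ hr hsm)
  eq_zero := fun r hr h0 => by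
    have hsm : C₁ * (K ^ (2 / (2 + τ)) * B ^ (τ / (2 + τ))) * r ^ (1 - a) ≤ 1 / 2 :=
      (mul_le_mul_of_nonneg_left (Real.rpow_le_rpow hr.1.le hr.2.le (by linarith))
        (by positivity)).trans hsmall
    have h1 := h.half_S_le hτ hK hC₁ hr hsm
    exact h.H_eq_zero_of_S_eq_zero hr (le_antisymm (by linarith) (h.S_nonneg hr))

end IsAlmgren

end RadialFrequency

/-! ### Growth of the reactions, continuity up to the boundary, flat spheres -/

section Trace

variable {n : ℕ}

/-- The value 0 is a minimum of f, so f'(0) = 0 and the Hölder condition gives |f'(x)| ≤ L|x|^τ; the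
mean value inequality yields |f(t)| ≤ L|t|^(1+τ). No lower bound on the order beyond 2+τ is needed
for the potentials. -/
theorem IsReaction.exists_bound {τ : ℝ} (hτ : 0 < τ) {f : ℝ → ℝ} (hf : IsReaction τ f) (M : ℝ) :
    ∃ C, 0 ≤ C ∧ ∀ t, |t| ≤ M →
      |t * f t| ≤ C * |t| ^ (2 + τ) ∧ |primitive f t| ≤ C * |t| ^ (2 + τ) := by
  obtain ⟨L, hL⟩ := hf.holder M
  have hd0 : deriv f 0 = 0 := IsLocalMin.deriv_eq_zero
    (Eventually.of_forall fun t => by rw [hf.zero]; exact hf.nonneg t)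
  have hfle : ∀ t, |t| ≤ M → |f t| ≤ |L| * |t| ^ τ * |t| := by
    intro t ht
    have hM : 0 ≤ M := (abs_nonneg t).trans ht
    have h1 := (convex_Icc (-|t|) |t|).norm_image_sub_le_of_norm_deriv_le (f := f)
      (C := |L| * |t| ^ τ) (x := 0) (y := t)
      (fun x _ => (hf.contDiff.differentiable one_ne_zero) x) (fun x hx => ?_)
      ⟨by linarith [abs_nonneg t], abs_nonneg t⟩ ⟨neg_abs_le t, le_abs_self t⟩
    · simpa [hf.zero] using h1
    · have hx' : |x| ≤ |t| := abs_le.2 hx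
      have h2 := hL x (abs_le.1 (hx'.trans ht)) 0 ⟨by linarith, hM⟩
      rw [hd0, sub_zero, sub_zero] at h2
      rw [Real.norm_eq_abs]
      exact h2.trans (mul_le_mul (le_abs_self L) (Real.rpow_le_rpow (abs_nonneg _) hx' hτ.le)
        (by positivity) (abs_nonneg _))
  have hpow : ∀ t : ℝ, |t| ^ (2 + τ) = |t| ^ τ * |t| * |t| := by
    intro t
    rcases (abs_nonneg t).eq_or_lt with h | h
    · rw [← h, Real.zero_rpow (by positivity)]; simp
    · rw [add_comm, Real.rpow_add h, Real.rpow_two]; ring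
  refine ⟨|L|, abs_nonneg _, fun t ht => ⟨?_, ?_⟩⟩
  · rw [abs_mul, hpow]
    calc |t| * |f t| ≤ |t| * (|L| * |t| ^ τ * |t|) :=
          mul_le_mul_of_nonneg_left (hfle t ht) (abs_nonneg _)
      _ = _ := by ring
  · have h1 := intervalIntegral.norm_integral_le_of_norm_le_const (a := 0) (b := t) (f := f)
      (C := |L| * |t| ^ τ * |t|) fun x hx => ?_
    · rw [sub_zero, Real.norm_eq_abs] at h1
      rw [primitive, hpow]
      linarith
    · have hx' : |x| ≤ |t| := by
        have hx2 := uIoc_subset_uIcc hx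
        rcases le_total 0 t with h | h
        · rw [uIcc_of_le h] at hx2
          rw [abs_of_nonneg hx2.1, abs_of_nonneg h]; exact hx2.2
        · rw [uIcc_of_ge h] at hx2
          rw [abs_of_nonpos hx2.2, abs_of_nonpos h]; linarith [hx2.1]
      refine (hfle x (hx'.trans ht)).trans ?_
      gcongr

theorem tendsto_add_vert (X : Space n) :
    Tendsto (fun ε : ℝ => X + ε • (vert : Space n)) (𝓝[>] 0) (𝓝 X) := by
  have h : Continuous fun ε : ℝ => X + ε • (vert : Space n) := by fun_prop
  have := (h.tendsto 0).mono_left (nhdsWithin_le_nhds (s := Ioi 0))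
  simpa using this

theorem eventually_add_vert_mem {X : Space n} {ρ : ℝ} (hX : X ∈ closedUpper n ρ) :
    ∀ᶠ ε : ℝ in 𝓝[>] 0, X + ε • (vert : Space n) ∈ halfBall 0 ρ := by
  have h1 : ball (0 : Space n) ρ ∈ 𝓝 X := isOpen_ball.mem_nhds (mem_ball_zero_iff.2 hX.1)
  filter_upwards [(tendsto_add_vert X).eventually h1, self_mem_nhdsWithin] with ε h2 h3
  refine ⟨h2, ?_⟩
  rw [height_add, height_smul, height_vert, mul_one]
  have := hX.2
  have : (0 : ℝ) < ε := h3
  linarith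

theorem alphaStar_pos {s : ℝ} (hs₀ : 0 < s) : 0 < alphaStar s := by
  rw [alphaStar]
  split_ifs with h <;> linarith

section Class

variable {k : ℕ} {s τ : ℝ} {f : Fin k → ℝ → ℝ} {u : Space n → EuclideanSpace ℝ (Fin k)}
  {G : Fin k → Space n → Space n}

theorem closedUpper_subset_closure {ρ : ℝ} (hρ : ρ < 1) :
    closedUpper n ρ ⊆ closure (closedBall (0 : Space n) ρ ∩ halfBall 0 1) := fun X hX => by
  refine mem_closure_of_tendsto (tendsto_add_vert X) ?_
  filter_upwards [eventually_add_vert_mem hX] with ε hε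
  exact ⟨ball_subset_closedBall hε.1, ball_subset_ball hρ.le hε.1, hε.2⟩

/-- Any admissible Hölder exponent will do, here α*/2; a slightly larger compact ball is chosen
around each point. -/
theorem IsSegregated.continuousOn (hs₀ : 0 < s) (hu : IsSegregated s τ f u G) :
    ContinuousOn u (closedUpper n 1) := by
  intro X hX
  have hX1 := hX.1
  set ρ := (1 + ‖X‖) / 2 with hρ
  have hρ1 : ρ < 1 := by rw [hρ]; linarith
  have hα := alphaStar_pos hs₀
  obtain ⟨L, hL⟩ := hu.holder (closedBall 0 ρ) (isCompact_closedBall _ _)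
    (closedBall_subset_ball hρ1) (alphaStar s / 2).toNNReal
    (Real.toNNReal_pos.2 (half_pos hα)) (by
      rw [Real.coe_toNNReal _ (half_pos hα).le]; exact half_lt_self hα)
  have hc : ContinuousOn u (closedUpper n ρ) :=
    (hL.continuousOn (Real.toNNReal_pos.2 (half_pos hα))).mono
      (closedUpper_subset_closure hρ1)
  have hXρ : ‖X‖ < ρ := by rw [hρ]; linarith
  refine (hc X ⟨hXρ, hX.2⟩).mono_of_mem_nhdsWithin ?_
  filter_upwards [self_mem_nhdsWithin,
    mem_nhdsWithin_of_mem_nhds (isOpen_ball.mem_nhds (mem_ball_zero_iff.2 hXρ))] with Y h1 h2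
  exact ⟨mem_ball_zero_iff.1 h2, h1.2⟩

theorem norm_le_of_halfBall (hc : ContinuousOn u (closedUpper n 1)) {M : ℝ}
    (hM : ∀ X ∈ halfBall (0 : Space n) 1, ‖u X‖ ≤ M) {X : Space n} (hX : X ∈ closedUpper n 1) :
    ‖u X‖ ≤ M := by
  have h1 : Tendsto (fun ε : ℝ => X + ε • (vert : Space n)) (𝓝[>] 0) (𝓝[closedUpper n 1] X) := by
    refine tendsto_nhdsWithin_iff.2 ⟨tendsto_add_vert X, ?_⟩
    filter_upwards [eventually_add_vert_mem hX] with ε hε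
    exact ⟨mem_ball_zero_iff.1 hε.1, hε.2.le⟩
  refine _root_.le_of_tendsto ((hc X hX).tendsto.comp h1).norm ?_
  filter_upwards [eventually_add_vert_mem hX] with ε hε using hM _ hε

end Class

section FlatSphere

theorem add_smul_sphere_mem {x₀ : Flat n} {r : ℝ} (hr : 0 ≤ r) (h : ‖x₀‖ + r < 1)
    (θ : sphere (0 : Flat n) 1) : x₀ + r • (θ : Flat n) ∈ ball (0 : Flat n) 1 := by
  rw [mem_ball_zero_iff]
  refine (norm_add_le _ _).trans_lt ?_
  rw [norm_smul, Real.norm_of_nonneg hr, mem_sphere_zero_iff_norm.1 θ.2, mul_one]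
  exact h

theorem continuous_comp_sphere {h : Flat n → ℝ} (hh : ContinuousOn h (ball 0 1)) {x₀ : Flat n}
    {r : ℝ} (hr : 0 ≤ r) (hr1 : ‖x₀‖ + r < 1) :
    Continuous fun θ : sphere (0 : Flat n) 1 => h (x₀ + r • (θ : Flat n)) :=
  hh.comp_continuous (by fun_prop) fun θ => add_smul_sphere_mem hr hr1 θ

theorem integrable_comp_sphere {h : Flat n → ℝ} (hh : ContinuousOn h (ball 0 1)) {x₀ : Flat n}
    {r : ℝ} (hr : 0 ≤ r) (hr1 : ‖x₀‖ + r < 1) :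
    Integrable (fun θ : sphere (0 : Flat n) 1 => h (x₀ + r • (θ : Flat n)))
      ((volume : Measure (Flat n)).toSphere) :=
  (continuous_comp_sphere hh hr hr1).integrable_of_hasCompactSupport
    (HasCompactSupport.of_compactSpace _)

theorem abs_flatSphereIntegral_le {h₁ h₂ : Flat n → ℝ} (c₂ : ContinuousOn h₂ (ball 0 1)) {C : ℝ}
    (hle : ∀ x ∈ ball (0 : Flat n) 1, |h₁ x| ≤ C * h₂ x) {x₀ : Flat n} {r : ℝ} (hr : 0 ≤ r)
    (hr1 : ‖x₀‖ + r < 1) : |flatSphereIntegral x₀ r h₁| ≤ C * flatSphereIntegral x₀ r h₂ := by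
  have h0 : 0 ≤ r ^ ((n : ℝ) - 1) := Real.rpow_nonneg hr _
  rw [flatSphereIntegral, flatSphereIntegral, abs_mul, abs_of_nonneg h0, mul_left_comm]
  refine mul_le_mul_of_nonneg_left ?_ h0
  rw [← integral_const_mul]
  rw [← Real.norm_eq_abs]
  refine norm_integral_le_of_norm_le ((integrable_comp_sphere c₂ hr hr1).const_mul C)
    (Eventually.of_forall fun θ => ?_)
  exact hle _ (add_smul_sphere_mem hr hr1 θ)

theorem flatSphereIntegral_nonneg {h : Flat n → ℝ} (h0 : ∀ x, 0 ≤ h x) (x₀ : Flat n) {r : ℝ}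
    (hr : 0 ≤ r) : 0 ≤ flatSphereIntegral x₀ r h :=
  mul_nonneg (Real.rpow_nonneg hr _) (integral_nonneg fun _ => h0 _)

theorem ball_subset_ball_zero {x₀ : Flat n} {r : ℝ} (h : ‖x₀‖ + r ≤ 1) :
    ball x₀ r ⊆ ball (0 : Flat n) 1 := fun x hx => by
  rw [mem_ball_zero_iff]
  rw [mem_ball_iff_norm] at hx
  have := norm_add_le (x - x₀) x₀
  rw [sub_add_cancel] at this
  linarith

theorem integrableOn_flat_ball {h : Flat n → ℝ} (hh : ContinuousOn h (ball 0 1)) {x₀ : Flat n}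
    {r : ℝ} (hr1 : ‖x₀‖ + r < 1) : IntegrableOn h (ball x₀ r) := by
  have hsub : closedBall x₀ r ⊆ ball (0 : Flat n) 1 := fun x hx => by
    rw [mem_ball_zero_iff]
    rw [mem_closedBall_iff_norm] at hx
    have := norm_add_le (x - x₀) x₀
    rw [sub_add_cancel] at this
    linarith
  exact ((hh.mono hsub).integrableOn_compact (isCompact_closedBall _ _)).mono_set
    ball_subset_closedBall

theorem continuousOn_flatSphereIntegral {h : Flat n → ℝ} (hh : ContinuousOn h (ball 0 1))
    {x₀ : Flat n} {R : ℝ} (hR : ‖x₀‖ + R ≤ 1) :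
    ContinuousOn (fun r => flatSphereIntegral x₀ r h) (Ioo 0 R) := by
  intro r hr
  have hr0 := hr.1
  set ρ := (r + R) / 2 with hρ
  have hρR : ρ < R := by rw [hρ]; linarith [hr.2]
  have hrρ : r < ρ := by rw [hρ]; linarith [hr.2]
  have hsub : closedBall x₀ ρ ⊆ ball (0 : Flat n) 1 :=
    (closedBall_subset_ball hρR).trans (ball_subset_ball_zero hR)
  obtain ⟨B, hB⟩ := (isCompact_closedBall x₀ ρ).exists_bound_of_continuousOn (hh.mono hsub)
  have hmem : ∀ t ∈ Icc 0 ρ, ∀ θ : sphere (0 : Flat n) 1, x₀ + t • (θ : Flat n) ∈ closedBall x₀ ρ := by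
    intro t ht θ
    rw [mem_closedBall_iff_norm, add_sub_cancel_left, norm_smul, Real.norm_of_nonneg ht.1,
      mem_sphere_zero_iff_norm.1 θ.2, mul_one]
    exact ht.2
  have hIcc : Icc 0 ρ ∈ 𝓝 r := Icc_mem_nhds hr0 hrρ
  refine ContinuousAt.continuousWithinAt (ContinuousAt.mul
    (Real.continuousAt_rpow_const _ _ (Or.inl hr0.ne')) ?_)
  refine continuousAt_of_dominated (bound := fun _ => B) ?_ ?_ (integrable_const B) ?_
  · filter_upwards [hIcc] with t ht
    exact (continuous_comp_sphere hh ht.1 (by linarith [ht.2])).aestronglyMeasurable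
  · filter_upwards [hIcc] with t ht
    exact Eventually.of_forall fun θ => hB _ (hmem t ht θ)
  · refine Eventually.of_forall fun θ => ?_
    have h1 : ContinuousAt h (x₀ + r • (θ : Flat n)) :=
      hh.continuousAt (isOpen_ball.mem_nhds (hsub (hmem r ⟨hr0.le, hrρ.le⟩ θ)))
    exact ContinuousAt.comp (f := fun t : ℝ => x₀ + t • (θ : Flat n)) h1 (by fun_prop)

/-- Polar coordinates give an integral of sphere integrals, and continuity of these in the radius
upgrades differentiability from almost every radius to every radius. -/
theorem hasDerivAt_integral_ball (hn : 1 ≤ n) {h : Flat n → ℝ} (hh : ContinuousOn h (ball 0 1))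
    {x₀ : Flat n} {R : ℝ} (hR : ‖x₀‖ + R ≤ 1) {r : ℝ} (hr : r ∈ Ioo 0 R) :
    HasDerivAt (fun r => ∫ x in ball x₀ r, h x) (flatSphereIntegral x₀ r h) r := by
  set ρ := (r + R) / 2 with hρ
  have hρR : ρ < R := by rw [hρ]; linarith [hr.2]
  have hrρ : r < ρ := by rw [hρ]; linarith [hr.2]
  obtain ⟨h1, h2⟩ := polar_flat hn x₀ h (integrableOn_flat_ball hh (x₀ := x₀) (r := ρ) (by linarith))
  have hi : IntervalIntegrable (fun t => flatSphereIntegral x₀ t h) volume 0 r :=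
    (intervalIntegrable_iff_integrableOn_Ioo_of_le hr.1.le).2
      (h1.mono_set (Ioo_subset_Ioo_right hrρ.le))
  have hc := continuousOn_flatSphereIntegral hh hR
  have h3 := intervalIntegral.integral_hasDerivAt_right hi
    (hc.stronglyMeasurableAtFilter isOpen_Ioo r hr)
    (hc.continuousAt (Ioo_mem_nhds hr.1 hr.2))
  refine h3.congr_of_eventuallyEq ?_
  filter_upwards [Ioo_mem_nhds hr.1 hrρ] with t ht
  rw [h2 t ht.2.le, intervalIntegral.integral_of_le ht.1.le, integral_Ioc_eq_integral_Ioo]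

end FlatSphere

end Trace

/-! ### Almost every half sphere: integrability and Cauchy-Schwarz -/

section Profile

variable {n : ℕ}

theorem integrable_wsphere_iff (s : ℝ) (F : sphere (0 : Space n) 1 → ℝ) :
    Integrable F (wsphere n s) ↔ IntegrableOn (fun θ : sphere (0 : Space n) 1 =>
      weight s (θ : Space n) * F θ) (upperSphere n) (volume : Measure (Space n)).toSphere := by
  have hm : Measurable fun θ : sphere (0 : Space n) 1 => (weight s (θ : Space n)).toNNReal :=
    (measurable_weight_sphere s).real_toNNReal
  change Integrable F (((volume : Measure (Space n)).toSphere.restrict (upperSphere n)).withDensity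
    fun θ => ((weight s (θ : Space n)).toNNReal : ℝ≥0∞)) ↔ _
  rw [integrable_withDensity_iff_integrable_smul hm]
  refine integrableOn_congr_fun (fun θ hθ => ?_) measurableSet_upperSphere
  simp [NNReal.smul_def, Real.coe_toNNReal _ (weight_nonneg (le_of_lt hθ))]

theorem ae_integrable_wsphere {s : ℝ} {x₀ : Flat n} {R : ℝ} (F : Space n → Space n → ℝ)
    (hF : IntegrableOn (fun X => F X (normalDir x₀ X)) (ball (flat x₀) R) (wvol n s)) :
    ∀ᵐ r, r ∈ Ioo 0 R →
      Integrable (fun θ : sphere (0 : Space n) 1 => F (flat x₀ + r • (θ : Space n)) θ)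
        (wsphere n s) := by
  have h := (polar_halfBall x₀ (R := R) (fun X ν => weight s X * F X ν)
    ((integrableOn_wvol s _ measurableSet_ball).1 hF)).2.2
  filter_upwards [h] with r hr hmem
  rw [integrable_wsphere_iff]
  have h4 := (hr hmem).const_mul ((r ^ weightExp s)⁻¹)
  refine IntegrableOn.congr_fun h4 (fun θ hθ => ?_) measurableSet_upperSphere
  have h5 : 0 < r ^ weightExp s := Real.rpow_pos_of_pos hmem.1 _
  rw [weight_smul hmem.1.le _ (le_of_lt hθ), ← mul_assoc, ← mul_assoc, inv_mul_cancel₀ h5.ne',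
    one_mul]

theorem aestronglyMeasurable_wsphere {s : ℝ} {v : Space n → ℝ}
    (hv : ContinuousOn v (closedUpper n 1)) {x₀ : Flat n} {r : ℝ} (hr : 0 ≤ r)
    (hr1 : ‖x₀‖ + r < 1) :
    AEStronglyMeasurable (fun θ : sphere (0 : Space n) 1 => v (flat x₀ + r • (θ : Space n)))
      (wsphere n s) := by
  have h : ContinuousOn (fun θ : sphere (0 : Space n) 1 => v (flat x₀ + r • (θ : Space n)))
      (upperSphere n) :=
    hv.comp (by fun_prop) fun θ hθ => mem_closedUpper_of_sphere hr hr1 (le_of_lt hθ)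
  exact (h.aestronglyMeasurable measurableSet_upperSphere).mono_ac
    (withDensity_absolutelyContinuous _ _)

/-- The discriminant of the nonnegative quadratic obtained by integrating Σ (p_i t + q_i)². -/
theorem sq_integral_sum_mul_le {α ι : Type*} [Fintype ι] [MeasurableSpace α] {μ : Measure α}
    {p q : ι → α → ℝ} (hp : ∀ i, Integrable (fun x => p i x ^ 2) μ)
    (hq : ∀ i, Integrable (fun x => q i x ^ 2) μ) (hpq : ∀ i, Integrable (fun x => p i x * q i x) μ) :
    (∫ x, ∑ i, p i x * q i x ∂μ) ^ 2 ≤ (∫ x, ∑ i, p i x ^ 2 ∂μ) * ∫ x, ∑ i, q i x ^ 2 ∂μ := by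
  have h1 := integrable_finsetSum Finset.univ fun i _ => hp i
  have h2 := integrable_finsetSum Finset.univ fun i _ => hq i
  have h3 := integrable_finsetSum Finset.univ fun i _ => hpq i
  have h : ∀ t : ℝ, 0 ≤ (∫ x, ∑ i, p i x ^ 2 ∂μ) * (t * t) +
      (2 * ∫ x, ∑ i, p i x * q i x ∂μ) * t + ∫ x, ∑ i, q i x ^ 2 ∂μ := by
    intro t
    have h4 : 0 ≤ ∫ x, (∑ i, p i x ^ 2) * (t * t) + (∑ i, p i x * q i x) * (2 * t) +
        ∑ i, q i x ^ 2 ∂μ := by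
      refine integral_nonneg fun x => ?_
      have : (∑ i, p i x ^ 2) * (t * t) + (∑ i, p i x * q i x) * (2 * t) + ∑ i, q i x ^ 2 =
          ∑ i, (p i x * t + q i x) ^ 2 := by
        rw [Finset.sum_mul, Finset.sum_mul, ← Finset.sum_add_distrib, ← Finset.sum_add_distrib]
        exact Finset.sum_congr rfl fun i _ => by ring
      simp only [this]
      exact Finset.sum_nonneg fun i _ => sq_nonneg _
    have h5 : Integrable (fun x => (∑ i, p i x ^ 2) * (t * t) + (∑ i, p i x * q i x) * (2 * t)) μ :=
      (h1.mul_const _).add (h3.mul_const _)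
    rw [integral_add h5 h2,
      integral_add (h1.mul_const _) (h3.mul_const _), integral_mul_const, integral_mul_const] at h4
    linarith
  have h5 := discrim_le_zero h
  rw [discrim] at h5
  linarith

theorem norm_rpow_le_sum {k : ℕ} (x : EuclideanSpace ℝ (Fin k)) {q : ℝ} (hq : 2 ≤ q) :
    ‖x‖ ^ q ≤ (k : ℝ) ^ (q / 2 - 1) * ∑ i, |x i| ^ q := by
  have h := Real.rpow_sum_le_const_mul_sum_rpow (Finset.univ : Finset (Fin k))
    (fun i => x i ^ 2) (p := q / 2) (by linarith)
  have h1 : ∀ t : ℝ, |t ^ 2| ^ (q / 2) = |t| ^ q := fun t => by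
    rw [abs_pow, ← Real.rpow_natCast, ← Real.rpow_mul (abs_nonneg t)]
    congr 1; push_cast; ring
  have h2 : ∑ i, |x i ^ 2| = ‖x‖ ^ 2 := by
    rw [EuclideanSpace.norm_sq_eq]
    exact Finset.sum_congr rfl fun i _ => by rw [abs_pow, Real.norm_eq_abs]
  rw [h2, Finset.card_univ, Fintype.card_fin] at h
  simp only [h1] at h
  refine le_of_eq_of_le ?_ h
  rw [← Real.rpow_natCast, ← Real.rpow_mul (norm_nonneg x)]
  congr 1; push_cast; ring

section Profile

variable {k : ℕ} {s τ : ℝ} {f : Fin k → ℝ → ℝ} {u : Space n → EuclideanSpace ℝ (Fin k)}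
  {G : Fin k → Space n → Space n}

/-- The radial functions at the boundary point `x₀`. -/
def profile (s τ : ℝ) (f : Fin k → ℝ → ℝ) (u : Space n → EuclideanSpace ℝ (Fin k))
    (G : Fin k → Space n → Space n) (x₀ : Flat n) : RadialProfile where
  D := energy s G x₀
  V := fun r => ∫ x in ball x₀ r, ∑ i, u (flat x) i * f i (u (flat x) i)
  W := fun r => ∫ x in ball x₀ r, ∑ i, primitive (f i) (u (flat x) i)
  g := fun r => ∫ x in ball x₀ r, ‖u (flat x)‖ ^ (2 + τ)
  H := almgrenH s u x₀
  d := fun r => halfSphereIntegral x₀ r (fun X _ => weight s X * gradSq G X)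
  v := fun r => flatSphereIntegral x₀ r fun x => ∑ i, u (flat x) i * f i (u (flat x) i)
  w := fun r => flatSphereIntegral x₀ r fun x => ∑ i, primitive (f i) (u (flat x) i)
  m := fun r => flatSphereIntegral x₀ r fun x => ‖u (flat x)‖ ^ (2 + τ)
  T := fun r => halfSphereIntegral x₀ r (fun X ν => weight s X * ∑ i, ⟪G i X, ν⟫ ^ 2)

/-- The identifications with the abstract radial quantities hold by definition, so the abstract
results transfer without rewriting integrals. -/
theorem profile_E (x₀ : Flat n) :
    (profile s τ f u G x₀).E ((n : ℝ) - 1 + weightExp s) = almgrenE s f u G x₀ := rfl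

theorem profile_H (x₀ : Flat n) : (profile s τ f u G x₀).H = almgrenH s u x₀ := rfl

theorem integral_profile_ψRate (x₀ : Flat n) (r : ℝ) :
    ∫ t in (0 : ℝ)..r, (profile s τ f u G x₀).ψRate n τ (weightExp s) t = bigPsi s τ u x₀ r := rfl

theorem almgrenH_eq {x₀ : Flat n} {r : ℝ} (hr : 0 < r) :
    almgrenH s u x₀ r = ∫ θ, ‖u (flat x₀ + r • (θ : Space n))‖ ^ 2 ∂wsphere n s := by
  have := Real.rpow_pos_of_pos hr ((n : ℝ) + weightExp s)
  rw [almgrenH, halfSphereIntegral_weight hr x₀ (fun X _ => ‖u X‖ ^ 2), ← mul_assoc,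
    one_div_mul_cancel this.ne', one_mul]

theorem continuousOn_component (hc : ContinuousOn u (closedUpper n 1)) (i : Fin k) :
    ContinuousOn (fun X => u X i) (closedUpper n 1) :=
  (PiLp.continuous_apply 2 (fun _ : Fin k => ℝ) i).comp_continuousOn hc

theorem integrable_sq_component (hs₁ : s < 1) (hc : ContinuousOn u (closedUpper n 1)) {M : ℝ}
    (hM : ∀ X ∈ closedUpper n 1, ‖u X‖ ≤ M) {x₀ : Flat n} {r : ℝ} (hr : 0 ≤ r)
    (hr1 : ‖x₀‖ + r < 1) (i : Fin k) :
    Integrable (fun θ : sphere (0 : Space n) 1 => u (flat x₀ + r • (θ : Space n)) i ^ 2)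
      (wsphere n s) := by
  have : IsFiniteMeasure (wsphere n s) := isFiniteMeasure_wsphere hs₁
  refine Integrable.of_bound ((aestronglyMeasurable_wsphere (continuousOn_component hc i) hr
    hr1).pow 2) (M ^ 2) ?_
  filter_upwards [ae_wsphere_pos s] with θ hθ
  rw [norm_pow]
  exact pow_le_pow_left₀ (norm_nonneg _) ((PiLp.norm_apply_le _ i).trans
    (hM _ (mem_closedUpper_of_sphere hr hr1 hθ.le))) 2

theorem almgrenH_eq_sum (hs₁ : s < 1) (hc : ContinuousOn u (closedUpper n 1)) {M : ℝ}
    (hM : ∀ X ∈ closedUpper n 1, ‖u X‖ ≤ M) {x₀ : Flat n} {r : ℝ} (hr : 0 < r)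
    (hr1 : ‖x₀‖ + r < 1) : almgrenH s u x₀ r = ∑ i, sphereMean s (fun X => u X i) x₀ r := by
  rw [almgrenH_eq hr]
  simp only [EuclideanSpace.norm_sq_eq, Real.norm_eq_abs, sq_abs]
  exact integral_finsetSum _ fun i _ => integrable_sq_component hs₁ hc hM hr.le hr1 i

theorem halfBall_subset_ball {x₀ : Flat n} {r : ℝ} (h : ‖x₀‖ + r ≤ 1) :
    halfBall (flat x₀) r ⊆ halfBall 0 1 := fun _ hX => ⟨ball_flat_subset h hX.1, hX.2⟩

theorem IsWeightedSobolevLoc.integrableOn_sq {v : Space n → ℝ} {g : Space n → Space n}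
    (hg : IsWeightedSobolevLoc s v g) {x₀ : Flat n} {r : ℝ} (h : ‖x₀‖ + r < 1) :
    IntegrableOn (fun X => weight s X * ‖g X‖ ^ 2) (halfBall (flat x₀) r) := by
  refine (hg.integrable_grad_sq (closedBall 0 (‖x₀‖ + r)) (isCompact_closedBall _ _)
    (closedBall_subset_ball h)).mono_set fun X hX => ⟨?_, halfBall_subset_ball h.le hX⟩
  exact ball_subset_closedBall (ball_flat_subset le_rfl hX.1)

theorem IsWeightedSobolevLoc.integrableOn_wvol_sq {v : Space n → ℝ} {g : Space n → Space n}
    (hg : IsWeightedSobolevLoc s v g) {x₀ : Flat n} {r : ℝ} (h : ‖x₀‖ + r < 1) :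
    IntegrableOn (fun X => ‖g X‖ ^ 2) (ball (flat x₀) r) (wvol n s) :=
  (integrableOn_wvol s _ measurableSet_ball).2 (hg.integrableOn_sq h)

theorem IsWeightedSobolevLoc.integrableOn_inner (hs₁ : s < 1) {v : Space n → ℝ}
    {g : Space n → Space n} (hg : IsWeightedSobolevLoc s v g) {x₀ : Flat n} {r : ℝ}
    (h : ‖x₀‖ + r < 1) :
    IntegrableOn (fun X => ⟪g X, normalDir x₀ X⟫) (ball (flat x₀) r) (wvol n s) :=
  IntegrableOn.mono_set (integrable_inner_of_memLp (hg.memLp_grad h) (memLp_normalDir hs₁ x₀ _))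
    (ball_flat_subset le_rfl)

theorem IsWeightedSobolevLoc.integrableOn_inner_sq (hs₁ : s < 1) {v : Space n → ℝ}
    {g : Space n → Space n} (hg : IsWeightedSobolevLoc s v g) {x₀ : Flat n} {r : ℝ}
    (h : ‖x₀‖ + r < 1) :
    IntegrableOn (fun X => ⟪g X, normalDir x₀ X⟫ ^ 2) (ball (flat x₀) r) (wvol n s) := by
  refine Integrable.mono' (hg.integrableOn_wvol_sq h)
    ((hg.integrableOn_inner hs₁ h).aestronglyMeasurable.pow 2) (Eventually.of_forall fun X => ?_)
  rw [norm_pow]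
  refine pow_le_pow_left₀ (norm_nonneg _) ((norm_inner_le_norm _ _).trans ?_) 2
  exact mul_le_of_le_one_right (norm_nonneg _) (norm_normalDir_le x₀ X)

theorem energy_eq_sum (hg : ∀ i, IsWeightedSobolevLoc s (fun X => u X i) (G i)) {x₀ : Flat n}
    {r : ℝ} (h : ‖x₀‖ + r < 1) :
    energy s G x₀ r = ∑ i, ∫ X in halfBall (flat x₀) r, weight s X * ‖G i X‖ ^ 2 := by
  rw [energy]
  simp only [gradSq, Finset.mul_sum]
  exact integral_finsetSum _ fun i _ => (hg i).integrableOn_sq h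

theorem integrableOn_gradSq (hg : ∀ i, IsWeightedSobolevLoc s (fun X => u X i) (G i)) {x₀ : Flat n}
    {r : ℝ} (h : ‖x₀‖ + r < 1) :
    IntegrableOn (fun X => weight s X * gradSq G X) (halfBall (flat x₀) r) := by
  simp only [gradSq, Finset.mul_sum]
  exact integrable_finsetSum _ fun i _ => (hg i).integrableOn_sq h

theorem gradSq_nonneg (G : Fin k → Space n → Space n) (X : Space n) : 0 ≤ gradSq G X :=
  Finset.sum_nonneg fun _ _ => sq_nonneg _

theorem energy_nonneg (s : ℝ) (G : Fin k → Space n → Space n) (x₀ : Flat n) (r : ℝ) :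
    0 ≤ energy s G x₀ r :=
  setIntegral_nonneg (measurableSet_halfBall _ _) fun X hX =>
    mul_nonneg (weight_nonneg hX.2.le) (gradSq_nonneg G X)

/-- The relations that hold on almost every half sphere. -/
theorem ae_sphere (hs₁ : s < 1) (hc : ContinuousOn u (closedUpper n 1)) {M : ℝ}
    (hM : ∀ X ∈ closedUpper n 1, ‖u X‖ ≤ M)
    (hg : ∀ i, IsWeightedSobolevLoc s (fun X => u X i) (G i)) {x₀ : Flat n} {R : ℝ}
    (hR : ‖x₀‖ + R < 1) : ∀ᵐ r, r ∈ Ioo 0 R →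
      (profile s τ f u G x₀).T r ≤ (profile s τ f u G x₀).d r ∧
      (∑ i, radialFlux s (fun X => u X i) (G i) x₀ r) ^ 2 ≤
        r ^ ((n : ℝ) + weightExp s) * almgrenH s u x₀ r * (profile s τ f u G x₀).T r := by
  have h1 := ae_all_iff.2 fun i => ae_integrable_wsphere (fun X ν => ⟪G i X, ν⟫)
    ((hg i).integrableOn_inner hs₁ hR)
  have h2 := ae_all_iff.2 fun i => ae_integrable_wsphere (fun X ν => ⟪G i X, ν⟫ ^ 2)
    ((hg i).integrableOn_inner_sq hs₁ hR)
  have h3 := ae_all_iff.2 fun i => ae_integrable_wsphere (fun X _ => ‖G i X‖ ^ 2)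
    ((hg i).integrableOn_wvol_sq hR)
  filter_upwards [h1, h2, h3] with r i1 i2 i3 hr
  have hr1 : ‖x₀‖ + r < 1 := by linarith [hr.2]
  have hx : 0 < r ^ ((n : ℝ) + weightExp s) := Real.rpow_pos_of_pos hr.1 _
  have hT : (profile s τ f u G x₀).T r = r ^ ((n : ℝ) + weightExp s) *
      ∫ θ, ∑ i, ⟪G i (flat x₀ + r • (θ : Space n)), (θ : Space n)⟫ ^ 2 ∂wsphere n s :=
    halfSphereIntegral_weight hr.1 x₀ (fun X ν => ∑ i, ⟪G i X, ν⟫ ^ 2)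
  have hd : (profile s τ f u G x₀).d r = r ^ ((n : ℝ) + weightExp s) *
      ∫ θ, ∑ i, ‖G i (flat x₀ + r • (θ : Space n))‖ ^ 2 ∂wsphere n s :=
    halfSphereIntegral_weight hr.1 x₀ (fun X _ => gradSq G X)
  have hmul : ∀ i, Integrable (fun θ : sphere (0 : Space n) 1 =>
      u (flat x₀ + r • (θ : Space n)) i * ⟪G i (flat x₀ + r • (θ : Space n)), (θ : Space n)⟫)
      (wsphere n s) := fun i => by
    refine (i1 i hr).bdd_mul (c := M)
      (aestronglyMeasurable_wsphere (continuousOn_component hc i) hr.1.le hr1) ?_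
    filter_upwards [ae_wsphere_pos s] with θ hθ
    exact (PiLp.norm_apply_le _ i).trans (hM _ (mem_closedUpper_of_sphere hr.1.le hr1 hθ.le))
  constructor
  · rw [hT, hd]
    refine mul_le_mul_of_nonneg_left (integral_mono (integrable_finsetSum _ fun i _ => i2 i hr)
      (integrable_finsetSum _ fun i _ => i3 i hr) fun θ => Finset.sum_le_sum fun i _ => ?_) hx.le
    have hθ : ‖(θ : Space n)‖ = 1 := mem_sphere_zero_iff_norm.1 θ.2
    rw [← sq_abs]
    refine pow_le_pow_left₀ (abs_nonneg _) ((abs_real_inner_le_norm _ _).trans ?_) 2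
    rw [hθ, mul_one]
  · have hq : ∑ i, radialFlux s (fun X => u X i) (G i) x₀ r = r ^ ((n : ℝ) + weightExp s) *
        ∫ θ, ∑ i, u (flat x₀ + r • (θ : Space n)) i *
          ⟪G i (flat x₀ + r • (θ : Space n)), (θ : Space n)⟫ ∂wsphere n s := by
      rw [integral_finsetSum _ fun i _ => hmul i, Finset.mul_sum]
      exact Finset.sum_congr rfl fun i _ => halfSphereIntegral_weight hr.1 x₀
        (fun X ν => u X i * ⟪G i X, ν⟫)
    rw [hq, hT, almgrenH_eq hr.1]
    simp only [EuclideanSpace.norm_sq_eq, Real.norm_eq_abs, sq_abs]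
    have h4 := sq_integral_sum_mul_le
      (fun i => integrable_sq_component hs₁ hc hM hr.1.le hr1 i) (fun i => i2 i hr) hmul
    rw [mul_pow]
    calc _ ≤ (r ^ ((n : ℝ) + weightExp s)) ^ 2 * _ := mul_le_mul_of_nonneg_left h4 (sq_nonneg _)
      _ = _ := by ring

end Profile

end Profile

/-! ### The radial functions of a member of the class -/

section Relations

variable {n k : ℕ} {s τ : ℝ} {f : Fin k → ℝ → ℝ} {u : Space n → EuclideanSpace ℝ (Fin k)}
  {G : Fin k → Space n → Space n}

theorem energy_eq_integral (hg : ∀ i, IsWeightedSobolevLoc s (fun X => u X i) (G i)) {x₀ : Flat n}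
    {r : ℝ} (h : ‖x₀‖ + r < 1) :
    IntegrableOn (profile s τ f u G x₀).d (Ioo 0 r) ∧
      energy s G x₀ r = ∫ t in Ioo 0 r, (profile s τ f u G x₀).d t := by
  have h1 := polar_halfBall x₀ (R := r) (fun X _ => weight s X * gradSq G X)
    (integrableOn_gradSq hg h)
  exact ⟨h1.1, h1.2.1 r le_rfl⟩

theorem continuousOn_energy (hg : ∀ i, IsWeightedSobolevLoc s (fun X => u X i) (G i)) {x₀ : Flat n}
    {R : ℝ} (hR : ‖x₀‖ + R ≤ 1) : ContinuousOn (energy s G x₀) (Ioo 0 R) := by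
  intro r hr
  set ρ := (r + R) / 2 with hρ
  have hρR : ρ < R := by rw [hρ]; linarith [hr.2]
  have hrρ : r < ρ := by rw [hρ]; linarith [hr.2]
  -- The radial energy density does not depend on τ or on the reactions, so dummy values are used
  -- for them.
  have hi : IntervalIntegrable (profile s 0 0 u G x₀).d volume 0 ρ :=
    (intervalIntegrable_iff_integrableOn_Ioo_of_le (hr.1.trans hrρ).le).2
      (energy_eq_integral hg (by linarith)).1
  have h1 := (hi.absolutelyContinuousOnInterval_intervalIntegral (c := 0) (by simp)).continuousOn
  rw [uIcc_of_le (hr.1.trans hrρ).le] at h1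
  refine ((h1.continuousAt (Icc_mem_nhds hr.1 hrρ)).congr ?_).continuousWithinAt
  filter_upwards [Ioo_mem_nhds hr.1 hrρ] with t ht
  rw [(energy_eq_integral (τ := 0) (f := 0) hg (by linarith [ht.2])).2,
    intervalIntegral.integral_of_le ht.1.le, integral_Ioc_eq_integral_Ioo]

theorem continuousOn_trace_component (hc : ContinuousOn u (closedUpper n 1)) (i : Fin k) :
    ContinuousOn (fun x : Flat n => u (flat x) i) (ball 0 1) :=
  continuousOn_trace (continuousOn_component hc i)

theorem continuousOn_potential (hc : ContinuousOn u (closedUpper n 1))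
    (hf : ∀ i, IsReaction τ (f i)) :
    ContinuousOn (fun x : Flat n => ∑ i, u (flat x) i * f i (u (flat x) i)) (ball 0 1) :=
  continuousOn_finsetSum _ fun i _ => (continuousOn_trace_component hc i).mul
    ((hf i).contDiff.continuous.comp_continuousOn (continuousOn_trace_component hc i))

theorem continuousOn_trace_rpow (hc : ContinuousOn u (closedUpper n 1)) (hτ : 0 < τ) :
    ContinuousOn (fun x : Flat n => ‖u (flat x)‖ ^ (2 + τ)) (ball 0 1) := by
  refine ContinuousOn.rpow_const (hc.comp continuous_flat.continuousOn fun x hx => ?_).norm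
    fun x _ => Or.inr (by linarith)
  exact flat_mem_closedUpper (mem_ball_zero_iff.1 hx)

/-- Boundedness of u makes the constants of the growth estimate uniform in the boundary point. -/
theorem exists_potential_le (hτ : 0 < τ) (hf : ∀ i, IsReaction τ (f i)) {M : ℝ}
    (hM : ∀ X ∈ closedUpper n 1, ‖u X‖ ≤ M) :
    ∃ C, 0 ≤ C ∧ ∀ x ∈ ball (0 : Flat n) 1,
      |∑ i, u (flat x) i * f i (u (flat x) i)| ≤ C * ‖u (flat x)‖ ^ (2 + τ) ∧
      |∑ i, primitive (f i) (u (flat x) i)| ≤ C * ‖u (flat x)‖ ^ (2 + τ) := by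
  choose C hC0 hC using fun i => (hf i).exists_bound hτ M
  refine ⟨∑ i, C i, Finset.sum_nonneg fun i _ => hC0 i, fun x hx => ?_⟩
  have hx' := hM _ (flat_mem_closedUpper (mem_ball_zero_iff.1 hx))
  have h1 : ∀ i, |u (flat x) i| ≤ ‖u (flat x)‖ := fun i =>
    (Real.norm_eq_abs _).symm.trans_le (PiLp.norm_apply_le (u (flat x)) i)
  have h2 : ∀ i, C i * |u (flat x) i| ^ (2 + τ) ≤ C i * ‖u (flat x)‖ ^ (2 + τ) := fun i =>
    mul_le_mul_of_nonneg_left (Real.rpow_le_rpow (abs_nonneg _) (h1 i) (by linarith)) (hC0 i)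
  rw [Finset.sum_mul]
  exact ⟨(Finset.abs_sum_le_sum_abs _ _).trans (Finset.sum_le_sum fun i _ =>
    ((hC i _ ((h1 i).trans hx')).1).trans (h2 i)),
    (Finset.abs_sum_le_sum_abs _ _).trans (Finset.sum_le_sum fun i _ =>
    ((hC i _ ((h1 i).trans hx')).2).trans (h2 i))⟩

theorem abs_integral_ball_le {h₁ h₂ : Flat n → ℝ} (c₂ : ContinuousOn h₂ (ball 0 1)) {C : ℝ}
    (hle : ∀ x ∈ ball (0 : Flat n) 1, |h₁ x| ≤ C * h₂ x) {x₀ : Flat n} {r : ℝ}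
    (hr1 : ‖x₀‖ + r < 1) : |∫ x in ball x₀ r, h₁ x| ≤ C * ∫ x in ball x₀ r, h₂ x := by
  rw [← integral_const_mul, ← Real.norm_eq_abs]
  refine norm_integral_le_of_norm_le ((integrableOn_flat_ball c₂ hr1).const_mul C) ?_
  filter_upwards [ae_restrict_mem measurableSet_ball] with x hx
  exact hle x (ball_subset_ball_zero hr1.le hx)

theorem exists_mass_le (hτ : 0 < τ) {M : ℝ} (hM0 : 0 ≤ M)
    (hM : ∀ X ∈ closedUpper n 1, ‖u X‖ ≤ M) :
    ∃ B, 0 ≤ B ∧ ∀ (x₀ : Flat n) (r : ℝ), 0 < r → ‖x₀‖ + r < 1 →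
      ∫ x in ball x₀ r, ‖u (flat x)‖ ^ (2 + τ) ≤ r ^ (n : ℝ) * B := by
  refine ⟨(volume : Measure (Flat n)).real (ball 0 1) * M ^ (2 + τ), by positivity,
    fun x₀ r hr hr1 => ?_⟩
  have h1 : (volume : Measure (Flat n)).real (ball x₀ r) =
      r ^ (n : ℝ) * (volume : Measure (Flat n)).real (ball 0 1) := by
    rw [Measure.real, Measure.addHaar_ball_of_pos _ _ hr, ENNReal.toReal_mul, finrank_euclideanSpace_fin,
      ENNReal.toReal_ofReal (by positivity), Real.rpow_natCast]
    rfl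
  have h2 := norm_setIntegral_le_of_norm_le_const (μ := (volume : Measure (Flat n)))
    (s := ball x₀ r) (f := fun x => ‖u (flat x)‖ ^ (2 + τ)) (C := M ^ (2 + τ))
    measure_ball_lt_top fun x hx => by
      rw [Real.norm_of_nonneg (by positivity)]
      exact Real.rpow_le_rpow (norm_nonneg _) (hM _ (flat_mem_closedUpper
        (mem_ball_zero_iff.1 (ball_subset_ball_zero hr1.le hx)))) (by linarith)
  rw [h1] at h2
  refine (le_abs_self _).trans (h2.trans (le_of_eq ?_))
  ring

theorem almgrenH_nonneg (x₀ : Flat n) {r : ℝ} (hr : 0 < r) : 0 ≤ almgrenH s u x₀ r := by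
  rw [almgrenH_eq hr]
  exact integral_nonneg fun _ => sq_nonneg _

/-- The scalar inequality is applied to each component with the common S, which dominates the energy
and the spherical mean of every component. -/
theorem exists_trace_vector_le (hn : 1 ≤ n) (hs₀ : 0 < s) (hs₁ : s < 1) (hτ : 0 < τ)
    (hτs : ((n : ℝ) - 2 * s) * τ ≤ 4 * s) (hc : ContinuousOn u (closedUpper n 1)) {M : ℝ}
    (hM : ∀ X ∈ closedUpper n 1, ‖u X‖ ≤ M)
    (hg : ∀ i, IsWeightedSobolevLoc s (fun X => u X i) (G i)) :
    ∃ K, 0 ≤ K ∧ ∀ (x₀ : Flat n) (r : ℝ), 0 < r → ‖x₀‖ + r < 1 →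
      ∫ x in ball x₀ r, ‖u (flat x)‖ ^ (2 + τ) ≤ r ^ (n : ℝ) *
        (K * (1 / r ^ ((n : ℝ) - 1 + weightExp s) * energy s G x₀ r + almgrenH s u x₀ r) ^
          ((2 + τ) / 2)) := by
  obtain ⟨K, hK0, hK⟩ := exists_trace_le hn hs₀ hs₁ hτ hτs
  refine ⟨(k : ℝ) ^ ((2 + τ) / 2 - 1) * (k * K), by positivity, fun x₀ r hr hr1 => ?_⟩
  set S := 1 / r ^ ((n : ℝ) - 1 + weightExp s) * energy s G x₀ r + almgrenH s u x₀ r with hS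
  have hx : 0 < r ^ ((n : ℝ) - 1 + weightExp s) := Real.rpow_pos_of_pos hr _
  have hE := energy_nonneg s G x₀ r
  have hH := almgrenH_nonneg (s := s) (u := u) x₀ hr
  have hDn : 0 ≤ 1 / r ^ ((n : ℝ) - 1 + weightExp s) * energy s G x₀ r := by positivity
  have hcomp : ∀ i, ∫ x in ball x₀ r, |u (flat x) i| ^ (2 + τ) ≤
      r ^ n * (K * S ^ ((2 + τ) / 2)) := fun i => by
    refine hK _ _ (continuousOn_component hc i) (hg i) x₀ r S hr hr1 (add_nonneg hDn hH) ?_ ?_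
    · have h1 : ∫ X in halfBall (flat x₀) r, weight s X * ‖G i X‖ ^ 2 ≤ energy s G x₀ r := by
        rw [energy_eq_sum hg hr1]
        exact Finset.single_le_sum (f := fun i => ∫ X in halfBall (flat x₀) r,
          weight s X * ‖G i X‖ ^ 2) (fun j _ => setIntegral_nonneg (measurableSet_halfBall _ _)
            fun X hX => mul_nonneg (weight_nonneg hX.2.le) (sq_nonneg _)) (Finset.mem_univ i)
      refine h1.trans ?_
      calc energy s G x₀ r = r ^ ((n : ℝ) - 1 + weightExp s) *
            (1 / r ^ ((n : ℝ) - 1 + weightExp s) * energy s G x₀ r) := by field_simp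
        _ ≤ _ := mul_le_mul_of_nonneg_left (by rw [hS]; linarith) hx.le
    · have h1 : sphereMean s (fun X => u X i) x₀ r ≤ almgrenH s u x₀ r := by
        rw [almgrenH_eq_sum hs₁ hc hM hr hr1]
        exact Finset.single_le_sum (f := fun i => sphereMean s (fun X => u X i) x₀ r)
          (fun j _ => integral_nonneg fun _ => sq_nonneg _) (Finset.mem_univ i)
      rw [hS]; linarith
  have hint : ∀ i, IntegrableOn (fun x : Flat n => |u (flat x) i| ^ (2 + τ)) (ball x₀ r) := fun i =>
    integrableOn_flat_ball (ContinuousOn.rpow_const (continuousOn_trace_component hc i).abs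
      fun x _ => Or.inr (by linarith)) hr1
  calc ∫ x in ball x₀ r, ‖u (flat x)‖ ^ (2 + τ)
      ≤ ∫ x in ball x₀ r, (k : ℝ) ^ ((2 + τ) / 2 - 1) * ∑ i, |u (flat x) i| ^ (2 + τ) :=
        integral_mono_ae (integrableOn_flat_ball (continuousOn_trace_rpow hc hτ) hr1)
          ((integrable_finsetSum _ fun i _ => hint i).const_mul _)
          (Eventually.of_forall fun x => norm_rpow_le_sum _ (by linarith))
    _ = (k : ℝ) ^ ((2 + τ) / 2 - 1) * ∑ i, ∫ x in ball x₀ r, |u (flat x) i| ^ (2 + τ) := by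
        rw [integral_const_mul, integral_finsetSum _ fun i _ => hint i]
    _ ≤ (k : ℝ) ^ ((2 + τ) / 2 - 1) * ∑ _i : Fin k, r ^ n * (K * S ^ ((2 + τ) / 2)) := by
        gcongr with i
        exact hcomp i
    _ = _ := by
        rw [Finset.sum_const, Finset.card_univ, Fintype.card_fin, nsmul_eq_mul, Real.rpow_natCast]
        ring

theorem ae_sum_radialFlux_eq (hs₀ : 0 < s) (hs₁ : s < 1) (hu : IsSegregated s τ f u G)
    (hc : ContinuousOn u (closedUpper n 1)) {x₀ : Flat n} {R : ℝ} (hR : ‖x₀‖ + R ≤ 1) :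
    ∀ᵐ r, r ∈ Ioo 0 R → ∑ i, radialFlux s (fun X => u X i) (G i) x₀ r =
      energy s G x₀ r - ∫ x in ball x₀ r, ∑ i, u (flat x) i * f i (u (flat x) i) := by
  refine ae_Ioo_of_forall_lt fun r₁ hr₁ => ?_
  have h1 := ae_all_iff.2 fun i => (hu.solution i).ae_radialFlux_eq hs₀ hs₁
    (hu.reaction i).contDiff.continuous (continuousOn_component hc i) (hu.sobolev i) hr₁.1
    (x₀ := x₀) (by linarith [hr₁.2])
  filter_upwards [h1] with r h2 hr
  have hr1 : ‖x₀‖ + r < 1 := by linarith [hr.2, hr₁.2]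
  rw [energy_eq_sum hu.sobolev hr1, integral_finsetSum, ← Finset.sum_sub_distrib]
  · exact Finset.sum_congr rfl fun i _ => h2 i hr
  · exact fun i _ => integrableOn_flat_ball ((continuousOn_trace_component hc i).mul
      ((hu.reaction i).contDiff.continuous.comp_continuousOn (continuousOn_trace_component hc i))) hr1

theorem continuousOn_almgrenE (hn : 1 ≤ n) (hu : IsSegregated s τ f u G)
    (hc : ContinuousOn u (closedUpper n 1)) {x₀ : Flat n} {R : ℝ} (hR : ‖x₀‖ + R ≤ 1) :
    ContinuousOn (almgrenE s f u G x₀) (Ioo 0 R) := by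
  refine ContinuousOn.mul (fun r hr => ?_) ((continuousOn_energy hu.sobolev hR).sub fun r hr =>
    (hasDerivAt_integral_ball hn (continuousOn_potential hc hu.reaction) hR
      hr).continuousAt.continuousWithinAt)
  exact (continuousAt_const.div (Real.continuousAt_rpow_const _ _ (Or.inl hr.1.ne'))
    (Real.rpow_pos_of_pos hr.1 _).ne').continuousWithinAt

/-- The increments of H are integrals of the radial fluxes, which equal D - V for almost every
radius. The resulting integrand 2E/r is continuous, so the derivative exists at every radius. -/
theorem hasDerivAt_almgrenH (hn : 1 ≤ n) (hs₀ : 0 < s) (hs₁ : s < 1) (hu : IsSegregated s τ f u G)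
    (hc : ContinuousOn u (closedUpper n 1)) {M : ℝ} (hM : ∀ X ∈ closedUpper n 1, ‖u X‖ ≤ M)
    {x₀ : Flat n} {R : ℝ} (hR : ‖x₀‖ + R ≤ 1) {r : ℝ} (hr : r ∈ Ioo 0 R) :
    HasDerivAt (almgrenH s u x₀) (2 * almgrenE s f u G x₀ r / r) r := by
  have hcE : ContinuousOn (fun t => 2 * almgrenE s f u G x₀ t / t) (Ioo 0 R) :=
    (continuousOn_const.mul (continuousOn_almgrenE hn hu hc hR)).div continuousOn_id
      fun t ht => ht.1.ne'
  set r₁ := r / 2 with hr₁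
  have h10 : 0 < r₁ := by rw [hr₁]; linarith [hr.1]
  have h1r : r₁ < r := by rw [hr₁]; linarith [hr.1]
  have hsub : Icc r₁ r ⊆ Ioo 0 R := fun t ht => ⟨h10.trans_le ht.1, ht.2.trans_lt hr.2⟩
  have hi : IntervalIntegrable (fun t => 2 * almgrenE s f u G x₀ t / t) volume r₁ r := by
    refine ContinuousOn.intervalIntegrable ?_
    rw [uIcc_of_le h1r.le]
    exact hcE.mono hsub
  have h1 := (intervalIntegral.integral_hasDerivAt_right hi
    (hcE.stronglyMeasurableAtFilter isOpen_Ioo r hr)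
    (hcE.continuousAt (Ioo_mem_nhds hr.1 hr.2))).const_add (almgrenH s u x₀ r₁)
  refine h1.congr_of_eventuallyEq ?_
  filter_upwards [Ioo_mem_nhds h1r hr.2] with t ht
  have ht1 : ‖x₀‖ + t < 1 := by linarith [ht.2]
  have h11 : ‖x₀‖ + r₁ < 1 := by linarith [ht.1]
  have h2 := fun i => sphereMean_sub hs₀ hs₁ (continuousOn_component hc i) (hu.sobolev i) (x₀ := x₀)
    h10 ht.1.le ht1
  have h3 : almgrenH s u x₀ t - almgrenH s u x₀ r₁ = ∫ q in r₁..t, 2 * almgrenE s f u G x₀ q / q := by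
    rw [almgrenH_eq_sum hs₁ hc hM (h10.trans ht.1) ht1, almgrenH_eq_sum hs₁ hc hM h10 h11,
      ← Finset.sum_sub_distrib, Finset.sum_congr rfl fun i _ => (h2 i).2,
      ← intervalIntegral.integral_finsetSum fun i _ => (h2 i).1]
    refine intervalIntegral.integral_congr_ae ?_
    filter_upwards [ae_sum_radialFlux_eq hs₀ hs₁ hu hc hR] with q hq hmem
    rw [uIoc_of_le ht.1.le] at hmem
    have hq0 : 0 < q := h10.trans hmem.1
    rw [← Finset.mul_sum, hq ⟨hq0, hmem.2.trans_lt ht.2⟩, almgrenE, Real.rpow_neg hq0.le,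
      show (n : ℝ) + weightExp s = (n - 1 + weightExp s) + 1 by ring, Real.rpow_add_one hq0.ne']
    field_simp
  linarith

/-- The radial functions of an element of the class satisfy all the relations needed, with
constants independent of the boundary point. -/
theorem IsSegregated.exists_isAlmgren (hn : 1 ≤ n) (hs₀ : 0 < s) (hs₁ : s < 1) (hτ : 0 < τ)
    (hτs : ((n : ℝ) - 2 * s) * τ ≤ 4 * s) (hu : IsSegregated s τ f u G) {M : ℝ} (hM0 : 0 ≤ M)
    (hM : ∀ X ∈ closedUpper n 1, ‖u X‖ ≤ M) :
    ∃ K B C₁ : ℝ, 0 ≤ K ∧ 0 ≤ B ∧ 0 ≤ C₁ ∧ ∀ (x₀ : Flat n) (R : ℝ), ‖x₀‖ + R ≤ 1 →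
      IsAlmgren n (weightExp s) τ R K B C₁ (profile s τ f u G x₀) := by
  have hc := hu.continuousOn hs₀
  obtain ⟨K, hK0, hK⟩ := exists_trace_vector_le hn hs₀ hs₁ hτ hτs hc hM hu.sobolev
  obtain ⟨B, hB0, hB⟩ := exists_mass_le hτ hM0 hM
  obtain ⟨C₁, hC0, hC⟩ := exists_potential_le hτ hu.reaction hM
  refine ⟨K, B, C₁, hK0, hB0, hC0, fun x₀ R hR => ?_⟩
  have hlt : ∀ r ∈ Ioo 0 R, ‖x₀‖ + r < 1 := fun r hr => by linarith [hr.2]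
  have hcV := continuousOn_potential hc hu.reaction
  have hcg := continuousOn_trace_rpow hc hτ
  have hsph : ∀ᵐ r, r ∈ Ioo 0 R → (profile s τ f u G x₀).T r ≤ (profile s τ f u G x₀).d r ∧
      (∑ i, radialFlux s (fun X => u X i) (G i) x₀ r) ^ 2 ≤
        r ^ ((n : ℝ) + weightExp s) * almgrenH s u x₀ r * (profile s τ f u G x₀).T r :=
    ae_Ioo_of_forall_lt fun r₁ hr₁ => ae_sphere hs₁ hc hM hu.sobolev (hlt r₁ hr₁)
  have hnn : ∀ {h : Space n → Space n → ℝ}, (∀ X ν, 0 ≤ h X ν) → ∀ r ∈ Ioo 0 R,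
      0 ≤ halfSphereIntegral x₀ r (fun X ν => weight s X * h X ν) := fun {h} hh r hr => by
    rw [halfSphereIntegral_weight hr.1]
    exact mul_nonneg (Real.rpow_nonneg hr.1.le _) (integral_nonneg fun _ => hh _ _)
  exact
    { integrable := fun r hr => (energy_eq_integral hu.sobolev (hlt r hr)).1
      D_eq := fun r hr => (energy_eq_integral hu.sobolev (hlt r hr)).2
      d_nonneg := hnn (h := fun X _ => gradSq G X) fun X _ => gradSq_nonneg G X
      hasDerivAt_V := fun r hr => hasDerivAt_integral_ball hn hcV hR hr
      hasDerivAt_g := fun r hr => hasDerivAt_integral_ball hn hcg hR hr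
      continuousOn_m := continuousOn_flatSphereIntegral hcg hR
      hasDerivAt_H := fun r hr => hasDerivAt_almgrenH hn hs₀ hs₁ hu hc hM hR hr
      H_nonneg := fun r hr => almgrenH_nonneg x₀ hr.1
      g_nonneg := fun r _ => integral_nonneg fun _ => Real.rpow_nonneg (norm_nonneg _) _
      m_nonneg := fun r hr => flatSphereIntegral_nonneg
        (h := fun x => ‖u (flat x)‖ ^ (2 + τ)) (fun _ => by positivity) x₀ hr.1.le
      V_le := fun r hr => abs_integral_ball_le hcg (fun x hx => (hC x hx).1) (hlt r hr)
      W_le := fun r hr => abs_integral_ball_le hcg (fun x hx => (hC x hx).2) (hlt r hr)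
      v_le := fun r hr => abs_flatSphereIntegral_le hcg (fun x hx => (hC x hx).1) hr.1.le (hlt r hr)
      w_le := fun r hr => abs_flatSphereIntegral_le hcg (fun x hx => (hC x hx).2) hr.1.le (hlt r hr)
      g_le := fun r hr => hB x₀ r hr.1 (hlt r hr)
      trace := fun r hr => hK x₀ r hr.1 (hlt r hr)
      pohozaev := by
        -- For ‖x₀‖ ≥ 1 the interval of radii is empty.
        rcases lt_or_ge ‖x₀‖ 1 with hx | hx
        · filter_upwards [hu.pohozaev x₀ hx] with r h1 hr
          exact h1 hr.1 (by linarith [hr.2])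
        · exact Eventually.of_forall fun r hr => absurd (hlt r hr) (by linarith [hr.1])
      T_nonneg := hnn (h := fun X ν => ∑ i, ⟪G i X, ν⟫ ^ 2) fun X ν =>
        Finset.sum_nonneg fun _ _ => sq_nonneg _
      T_le := hsph.mono fun r h1 hr => (h1 hr).1
      cauchy := by
        filter_upwards [hsph, ae_sum_radialFlux_eq hs₀ hs₁ hu hc hR] with r h1 h2 hr
        have h3 := (h1 hr).2
        rw [h2 hr] at h3
        exact h3 }

end Relations

/-! ### Propagation of zeros and growth of the height -/

section UniqueContinuation

variable {n k : ℕ} {s τ : ℝ} {f : Fin k → ℝ → ℝ} {u : Space n → EuclideanSpace ℝ (Fin k)}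
  {G : Fin k → Space n → Space n}

theorem almgrenH_eq_zero {x₀ : Flat n} {ε : ℝ} (h : ∀ X ∈ halfBall (flat x₀) ε, u X = 0) {r : ℝ}
    (hr : r ∈ Ioo 0 ε) : almgrenH s u x₀ r = 0 := by
  rw [almgrenH_eq hr.1]
  refine integral_eq_zero_of_ae ?_
  filter_upwards [ae_wsphere_pos s] with θ hθ
  rw [h]
  · simp
  · refine ⟨?_, ?_⟩
    · rw [mem_ball_iff_norm, add_sub_cancel_left, norm_smul_sphere θ hr.1.le]
      exact hr.2
    · rw [height_add, height_flat, height_smul, zero_add]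
      exact mul_pos hr.1 hθ

/-- Integrating H over the radii gives a vanishing weighted integral of |u|²; the weight is positive
and u is continuous. -/
theorem eq_zero_of_almgrenH_eq_zero (hc : ContinuousOn u (closedUpper n 1))
    (hg : ∀ i, IsWeightedSobolevLoc s (fun X => u X i) (G i)) {x₀ : Flat n} {R : ℝ}
    (hR : ‖x₀‖ + R ≤ 1) (hH : ∀ r ∈ Ioo 0 R, almgrenH s u x₀ r = 0) :
    ∀ X ∈ halfBall (flat x₀) R, u X = 0 := by
  intro X hX
  obtain ⟨r, hXr, hrR⟩ := exists_between (mem_ball.1 hX.1)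
  have hr1 : ‖x₀‖ + r < 1 := by linarith
  have hsub := halfBall_subset_ball (n := n) hr1.le
  have hint : IntegrableOn (fun X => weight s X * ‖u X‖ ^ 2) (halfBall (flat x₀) r) := by
    simp only [EuclideanSpace.norm_sq_eq, Real.norm_eq_abs, sq_abs, Finset.mul_sum]
    refine integrable_finsetSum _ fun i _ => ?_
    refine ((hg i).integrable_sq (closedBall 0 (‖x₀‖ + r)) (isCompact_closedBall _ _)
      (closedBall_subset_ball hr1)).mono_set fun X hX => ⟨?_, hsub hX⟩
    exact ball_subset_closedBall (ball_flat_subset le_rfl hX.1)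
  have h1 := (polar_halfBall x₀ (R := r) (fun X _ => weight s X * ‖u X‖ ^ 2) hint).2.1 r le_rfl
  have h2 : ∫ t in Ioo 0 r, halfSphereIntegral x₀ t (fun X _ => weight s X * ‖u X‖ ^ 2) = 0 := by
    refine setIntegral_eq_zero_of_forall_eq_zero fun t ht => ?_
    have h3 := hH t ⟨ht.1, ht.2.trans hrR⟩
    have := Real.rpow_pos_of_pos ht.1 ((n : ℝ) + weightExp s)
    rw [almgrenH] at h3
    exact (mul_eq_zero.1 h3).resolve_left (by positivity)
  rw [h2, setIntegral_eq_zero_iff_of_nonneg_ae ((ae_restrict_iff' (measurableSet_halfBall _ _)).2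
    (Eventually.of_forall fun X hX => mul_nonneg (weight_nonneg hX.2.le) (sq_nonneg _))) hint] at h1
  have h3 : u =ᵐ[volume.restrict (halfBall (flat x₀) r)] fun _ => 0 := by
    filter_upwards [h1, ae_restrict_mem (measurableSet_halfBall _ _)] with Y hY hmem
    rcases mul_eq_zero.1 hY with h4 | h4
    · exact absurd h4 (weight_pos hmem.2).ne'
    · simpa using h4
  have hcu : ContinuousOn u (halfBall (flat x₀) r) := hc.mono fun Y hY =>
    ⟨mem_ball_zero_iff.1 (hsub hY).1, hY.2.le⟩
  exact Measure.eqOn_open_of_ae_eq h3 (isOpen_halfBall _ _) hcu continuousOn_const ⟨hXr, hX.2⟩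

theorem halfBall_flat_subset {x y : Flat n} {r : ℝ} :
    halfBall (flat x) (r - dist x y) ⊆ halfBall (flat y) r := fun X hX => by
  refine ⟨?_, hX.2⟩
  have h1 := mem_ball.1 hX.1
  have h2 := dist_triangle X (flat x) (flat y)
  rw [isometry_flat.dist_eq] at h2
  exact mem_ball.2 (by linarith)

theorem trace_eq_zero (hc : ContinuousOn u (closedUpper n 1)) {x : Flat n} (hx : ‖x‖ < 1) {ε : ℝ}
    (hε : 0 < ε) (h : ∀ X ∈ halfBall (flat x) ε, u X = 0) : u (flat x) = 0 := by
  have hmem := flat_mem_closedUpper hx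
  have h1 : Tendsto (fun t : ℝ => flat x + t • (vert : Space n)) (𝓝[>] 0)
      (𝓝[closedUpper n 1] (flat x)) := by
    refine tendsto_nhdsWithin_iff.2 ⟨tendsto_add_vert _, ?_⟩
    filter_upwards [eventually_add_vert_mem hmem] with t ht
    exact ⟨mem_ball_zero_iff.1 ht.1, ht.2.le⟩
  refine tendsto_nhds_unique (((hc _ hmem).tendsto.comp h1).congr' ?_) tendsto_const_nhds
  filter_upwards [eventually_add_vert_mem hmem,
    (tendsto_add_vert (flat x)).eventually (ball_mem_nhds _ hε)] with t h2 h3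
  exact h _ ⟨h3, h2.2⟩

/-- If vanishing in a half ball propagates to half balls of uniform radius, then it propagates to
the whole flat boundary. -/
theorem forall_exists_eq_zero {rbar : ℝ} (hrbar : 0 < rbar)
    (hprop : ∀ x : Flat n, ‖x‖ < 1 → (∃ ε > 0, ∀ X ∈ halfBall (flat x) ε, u X = 0) →
      ∀ X ∈ halfBall (flat x) (min rbar (1 - ‖x‖)), u X = 0)
    {x₀ : Flat n} (hx₀ : ‖x₀‖ < 1) (h₀ : ∃ ε > 0, ∀ X ∈ halfBall (flat x₀) ε, u X = 0) :
    ∀ x : Flat n, ‖x‖ < 1 → ∃ ε > 0, ∀ X ∈ halfBall (flat x) ε, u X = 0 := by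
  set Z : Set (Flat n) := {x | ‖x‖ < 1 ∧ ∃ ε > 0, ∀ X ∈ halfBall (flat x) ε, u X = 0} with hZ
  have hopen : IsOpen Z := by
    rw [Metric.isOpen_iff]
    rintro x ⟨hx, ε, hε, h⟩
    refine ⟨min ε (1 - ‖x‖), lt_min hε (by linarith), fun y hy => ⟨?_, ε - dist y x, ?_, fun X hX =>
      h X (halfBall_flat_subset hX)⟩⟩
    · have h1 := (mem_ball_iff_norm.1 hy).trans_le (min_le_right _ _)
      have h2 := norm_add_le (y - x) x
      rw [sub_add_cancel] at h2
      linarith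
    · have := (mem_ball.1 hy).trans_le (min_le_left _ _)
      linarith
  have hclosed : closure Z ∩ ball (0 : Flat n) 1 ⊆ Z := by
    rintro x ⟨hxc, hxb⟩
    have hx := mem_ball_zero_iff.1 hxb
    -- A point y of the vanishing set is taken so close to x that x lies within both rbar and 1 -
    -- ‖y‖ of y; the half ball gained at y then covers a half ball at x.
    obtain ⟨y, ⟨hy, hyε⟩, hxy⟩ := Metric.mem_closure_iff.1 hxc (min rbar ((1 - ‖x‖) / 2))
      (lt_min hrbar (by linarith))
    have h1 := hxy.trans_le (min_le_left _ _)
    have h2 := hxy.trans_le (min_le_right _ _)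
    have h3 := norm_add_le (y - x) x
    rw [sub_add_cancel, ← dist_eq_norm, dist_comm] at h3
    refine ⟨hx, min rbar (1 - ‖y‖) - dist x y, ?_, fun X hX =>
      hprop y hy hyε X (halfBall_flat_subset hX)⟩
    rw [gt_iff_lt, sub_pos]
    exact lt_min h1 (by linarith)
  have hsub := (convex_ball (0 : Flat n) 1).isPreconnected.subset_of_closure_inter_subset hopen
    ⟨x₀, mem_ball_zero_iff.2 hx₀, hx₀, h₀⟩ hclosed
  exact fun x hx => (hsub (mem_ball_zero_iff.2 hx)).2

/-- Since u vanishes at the centre, Hölder continuity bounds |u| by L r^α on the half sphere, whose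
weighted measure is finite after normalisation. -/
theorem almgrenH_le_of_holder (hs₁ : s < 1) {x₀ : Flat n} (hx₀ : ‖x₀‖ < 1)
    (hu₀ : u (flat x₀) = 0) (hu : IsSegregated s τ f u G) {α : ℝ} (hα : 0 < α)
    (hα' : α < alphaStar s) : ∃ C, ∀ᶠ r in 𝓝[>] 0, almgrenH s u x₀ r ≤ C * r ^ (2 * α) := by
  set ρ := (1 + ‖x₀‖) / 2 with hρ
  have hρ1 : ρ < 1 := by rw [hρ]; linarith
  have hxρ : ‖x₀‖ < ρ := by rw [hρ]; linarith
  obtain ⟨L, hL⟩ := hu.holder (closedBall 0 ρ) (isCompact_closedBall _ _)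
    (closedBall_subset_ball hρ1) α.toNNReal (Real.toNNReal_pos.2 hα)
    (by rwa [Real.coe_toNNReal _ hα.le])
  have hL' := hL.mono (closedUpper_subset_closure hρ1)
  have hfin : IsFiniteMeasure (wsphere n s) := isFiniteMeasure_wsphere hs₁
  refine ⟨L ^ 2 * (wsphere n s).real univ, ?_⟩
  filter_upwards [Ioo_mem_nhdsGT (show 0 < ρ - ‖x₀‖ by linarith)] with r hr
  rw [almgrenH_eq hr.1]
  have h1 : ∀ᵐ θ : sphere (0 : Space n) 1 ∂wsphere n s,
      ‖‖u (flat x₀ + r • (θ : Space n))‖ ^ 2‖ ≤ (L * r ^ α) ^ 2 := by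
    filter_upwards [ae_wsphere_pos s] with θ hθ
    have h2 := hL'.dist_le (mem_closedUpper_of_sphere (x₀ := x₀) (ρ := ρ) hr.1.le
      (by linarith [hr.2]) hθ.le) (flat_mem_closedUpper hxρ)
    rw [hu₀, dist_zero_right, dist_eq_norm, add_sub_cancel_left, norm_smul_sphere θ hr.1.le,
      Real.coe_toNNReal _ hα.le] at h2
    rw [norm_pow, norm_norm]
    exact pow_le_pow_left₀ (norm_nonneg _) h2 2
  have h3 := norm_integral_le_of_norm_le_const h1
  refine (le_abs_self _).trans (h3.trans (le_of_eq ?_))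
  rw [mul_pow, ← Real.rpow_natCast (r ^ α) 2, ← Real.rpow_mul hr.1.le, mul_comm α]
  push_cast
  ring

end UniqueContinuation

/-! ### Assembling the unique continuation argument -/

section Main

variable {n k : ℕ} {s τ : ℝ} {f : Fin k → ℝ → ℝ} {u : Space n → EuclideanSpace ℝ (Fin k)}
  {G : Fin k → Space n → Space n}

theorem exponent_nonneg (hτ : 0 < τ) (hτs : ((n : ℝ) - 2 * s) * τ ≤ 4 * s) :
    0 ≤ 1 - weightExp s - n * (τ / (2 + τ)) := by
  have : 1 - weightExp s - n * (τ / (2 + τ)) = (4 * s - (n - 2 * s) * τ) / (2 + τ) := by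
    rw [weightExp]; field_simp; ring
  rw [this]
  exact div_nonneg (by linarith) (by positivity)

/-- If the height vanishes for some radius, then `u` vanishes identically near that point. -/
theorem FrequencyData.eq_zero_near {x₀ : Flat n} {R : ℝ} {κ : ℝ → ℝ}
    (h : FrequencyData R (almgrenE s f u G x₀) (almgrenH s u x₀) κ)
    (hc : ContinuousOn u (closedUpper n 1))
    (hg : ∀ i, IsWeightedSobolevLoc s (fun X => u X i) (G i)) (hR : ‖x₀‖ + R ≤ 1) {r₀ : ℝ}
    (hr₀ : r₀ ∈ Ioo 0 R) (h0 : almgrenH s u x₀ r₀ = 0) :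
    ∀ X ∈ halfBall (flat x₀) R, u X = 0 :=
  eq_zero_of_almgrenH_eq_zero hc hg hR (h.eq_zero_of_eq_zero hr₀ h0)

theorem exists_mem_almgrenH_eq_zero {x : Flat n} {R : ℝ} (hR : 0 < R)
    (h : ∃ ε > 0, ∀ X ∈ halfBall (flat x) ε, u X = 0) : ∃ r ∈ Ioo 0 R, almgrenH s u x r = 0 := by
  obtain ⟨ε, hε, h⟩ := h
  have hm : 0 < min ε R := lt_min hε hR
  refine ⟨min ε R / 2, ⟨by positivity, ?_⟩, almgrenH_eq_zero h ⟨by positivity, ?_⟩⟩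
  · linarith [min_le_right ε R]
  · linarith [min_le_left ε R]

/-- A function of the class whose trace vanishes identically, and which vanishes near the origin,
vanishes. -/
theorem IsSegregated.eq_zero_of_trace_eq_zero (hn : 1 ≤ n) (hs₀ : 0 < s) (hs₁ : s < 1) (hτ : 0 < τ)
    (hτn : ((n : ℝ) - 1) * τ < 2) (hτs : ((n : ℝ) - 2 * s) * τ ≤ 4 * s)
    (hu : IsSegregated s τ f u G) {M : ℝ} (hM0 : 0 ≤ M) (hM : ∀ X ∈ closedUpper n 1, ‖u X‖ ≤ M)
    (htrace : ∀ x : Flat n, ‖x‖ < 1 → u (flat x) = 0)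
    (h₀ : ∃ ε > 0, ∀ X ∈ halfBall (flat (0 : Flat n)) ε, u X = 0) :
    ∀ X ∈ halfBall (0 : Space n) 1, u X = 0 := by
  have hc := hu.continuousOn hs₀
  obtain ⟨K, B, C₁, hK, hB, hC₁, hA⟩ := hu.exists_isAlmgren hn hs₀ hs₁ hτ hτs hM0 hM
  have hR : ‖(0 : Flat n)‖ + 1 ≤ 1 := by simp
  have hlt : ∀ r ∈ Ioo (0 : ℝ) 1, ‖(0 : Flat n)‖ + r < 1 := fun r hr => by simpa using hr.2
  have hcg := continuousOn_trace_rpow hc hτ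
  have hV : ∀ x ∈ ball (0 : Flat n) 1, |∑ i, u (flat x) i * f i (u (flat x) i)| ≤
      0 * ‖u (flat x)‖ ^ (2 + τ) := fun x hx => by
    simp [htrace x (mem_ball_zero_iff.1 hx)]
  have hW : ∀ x ∈ ball (0 : Flat n) 1, |∑ i, primitive (f i) (u (flat x) i)| ≤
      0 * ‖u (flat x)‖ ^ (2 + τ) := fun x hx => by
    simp [htrace x (mem_ball_zero_iff.1 hx), primitive]
  -- With zero trace all potential terms vanish and the constant C₁ can be taken to be 0. The
  -- smallness condition then holds up to radius 1, so one application at the origin covers the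
  -- whole half ball.
  have hA₀ : IsAlmgren n (weightExp s) τ 1 K B 0 (profile s τ f u G 0) :=
    { hA 0 1 hR with
      V_le := fun r hr => abs_integral_ball_le hcg hV (hlt r hr)
      W_le := fun r hr => abs_integral_ball_le hcg hW (hlt r hr)
      v_le := fun r hr => abs_flatSphereIntegral_le hcg hV hr.1.le (hlt r hr)
      w_le := fun r hr => abs_flatSphereIntegral_le hcg hW hr.1.le (hlt r hr) }
  have hF := hA₀.frequencyData hτ hτn (by rw [weightExp]; linarith) (exponent_nonneg hτ hτs)
    hK hB le_rfl (by simp) (C := 0) (by simp)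
  rw [profile_E, profile_H] at hF
  obtain ⟨r, hr, h0⟩ := exists_mem_almgrenH_eq_zero (s := s) one_pos h₀
  have := hF.eq_zero_near hc hu.sobolev hR hr h0
  rwa [flat_zero] at this

theorem tendsto_const_mul_rpow (c : ℝ) {e : ℝ} (he : 0 < e) :
    Tendsto (fun t : ℝ => c * t ^ e) (𝓝[>] 0) (𝓝 0) := by
  have h1 : Tendsto (fun r : ℝ => r ^ e) (𝓝[>] 0) (𝓝 (0 ^ e)) :=
    (Real.continuousAt_rpow_const 0 _ (Or.inr he.le)).tendsto.mono_left nhdsWithin_le_nhds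
  rw [Real.zero_rpow he.ne'] at h1
  simpa using h1.const_mul c

end Main

end Segregation

end

theorem proposition2p6 {n k : ℕ} (hn : 1 ≤ n) (s : ℝ) (hs₀ : 0 < s) (hs₁ : s < 1)
    (τ : ℝ) (hτ : 0 < τ) (hτn : ((n : ℝ) - 1) * τ < 2) (hτs : ((n : ℝ) - 2 * s) * τ ≤ 4 * s)
    (f : Fin k → ℝ → ℝ) (u : Segregation.Space n → EuclideanSpace ℝ (Fin k))
    (G : Fin k → Segregation.Space n → Segregation.Space n)
    (hu : Segregation.IsSegregated s τ f u G)
    (hbdd : ∃ M : ℝ, ∀ X ∈ Segregation.halfBall (0 : Segregation.Space n) 1, ‖u X‖ ≤ M)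
    (hne : ∃ X ∈ Segregation.halfBall (0 : Segregation.Space n) 1, u X ≠ 0) :
    ∃ C rbar : ℝ, 0 < C ∧ 0 < rbar ∧ ∀ x₀ ∈ Segregation.freeBoundary u,
      (∀ r ∈ Set.Ioo 0 (min rbar (1 - ‖x₀‖)),
        0 < Segregation.almgrenH s u x₀ r ∧ 0 < Segregation.almgrenN s f u G x₀ r) ∧
      MonotoneOn
        (fun r => Real.exp (C * Segregation.bigPsi s τ u x₀ r) *
          (Segregation.almgrenN s f u G x₀ r + 1))
        (Set.Ioo 0 (min rbar (1 - ‖x₀‖))) ∧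
      ∃ L : ℝ, Segregation.alphaStar s ≤ L ∧
        Filter.Tendsto (Segregation.almgrenN s f u G x₀) (𝓝[>] 0) (𝓝 L) := by
  open Segregation MeasureTheory Set Filter Metric in
  obtain ⟨M, hM'⟩ := hbdd
  obtain ⟨X₁, hX₁, hX₁0⟩ := hne
  have hc := hu.continuousOn hs₀
  have hM : ∀ X ∈ closedUpper n 1, ‖u X‖ ≤ M := fun X hX => norm_le_of_halfBall hc hM' hX
  have hM0 : 0 ≤ M := (norm_nonneg _).trans (hM' X₁ hX₁)
  obtain ⟨K, B, C₁, hK, hB, hC₁, hA⟩ := hu.exists_isAlmgren hn hs₀ hs₁ hτ hτs hM0 hM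
  have ha : weightExp s < 1 := by rw [weightExp]; linarith
  have he := exponent_nonneg (n := n) hτ hτs
  have hα := alphaStar_pos hs₀
  set A := K ^ (2 / (2 + τ)) * B ^ (τ / (2 + τ)) with hAdef
  -- The constant required by `IsAlmgren.frequencyData`; the added 1 makes it strictly positive.
  set C := 2 * (C₁ * (|(n : ℝ) - 1 + weightExp s| + 2 * n + 3)) *
      (A + (2 + τ) / τ * K ^ (2 / (2 + τ))) + 1 with hC
  set C₃ := (1 + |weightExp s| * B ^ (τ / (2 + τ))) / (1 - weightExp s) + B ^ (τ / (2 + τ)) with hC₃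
  have hA0 : 0 ≤ A := by positivity
  have hC0 : 0 < C := by positivity
  have hC₃0 : 0 ≤ C₃ := by
    have : 0 < 1 - weightExp s := by linarith
    positivity
  -- The first condition makes the potential at most half of S; the second forces exp(CΨ) < 1 + α*,
  -- which will give N > 0. Both are independent of the centre.
  obtain ⟨rbar, hrbar, hsmall₁, hsmall₂⟩ : ∃ r : ℝ, 0 < r ∧ C₁ * A * r ^ (1 - weightExp s) < 1 / 2 ∧
      C * C₃ * r ^ (1 - weightExp s) < Real.log (1 + alphaStar s) := by
    have h1 := (tendsto_const_mul_rpow (C₁ * A) (show 0 < 1 - weightExp s by linarith)).eventually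
      (gt_mem_nhds (show (0 : ℝ) < 1 / 2 by norm_num))
    have h2 := (tendsto_const_mul_rpow (C * C₃) (show 0 < 1 - weightExp s by linarith)).eventually
      (gt_mem_nhds (Real.log_pos (show 1 < 1 + alphaStar s by linarith)))
    obtain ⟨r, hr⟩ := ((h1.and h2).and self_mem_nhdsWithin).exists
    exact ⟨r, hr.2, hr.1.1, hr.1.2⟩
  have hsum : ∀ x : Flat n, ‖x‖ + min rbar (1 - ‖x‖) ≤ 1 := fun x => by
    linarith [min_le_right rbar (1 - ‖x‖)]
  have hRpos : ∀ x : Flat n, ‖x‖ < 1 → 0 < min rbar (1 - ‖x‖) := fun x hx =>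
    lt_min hrbar (by linarith)
  have hpow : ∀ r, 0 ≤ r → r ≤ rbar → r ^ (1 - weightExp s) ≤ rbar ^ (1 - weightExp s) :=
    fun r h0 h1 => Real.rpow_le_rpow h0 h1 (by linarith)
  have hF : ∀ x : Flat n, ‖x‖ < 1 → FrequencyData (min rbar (1 - ‖x‖)) (almgrenE s f u G x)
      (almgrenH s u x) (fun r => C * (profile s τ f u G x).ψRate n τ (weightExp s) r) := fun x hx => by
    have := (hA x _ (hsum x)).frequencyData hτ hτn ha he hK hB hC₁
      ((mul_le_mul_of_nonneg_left (hpow _ (hRpos x hx).le (min_le_left _ _))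
        (by positivity)).trans hsmall₁.le) (C := C) (by rw [hC]; linarith)
    rwa [profile_E, profile_H] at this
  -- The relations hold at every boundary point, whether or not u vanishes there, so a zero of H can
  -- be propagated through the whole flat ball.
  have hHpos : ∀ x : Flat n, ‖x‖ < 1 → ∀ r ∈ Ioo 0 (min rbar (1 - ‖x‖)), 0 < almgrenH s u x r := by
    intro x hx r hr
    refine lt_of_le_of_ne (almgrenH_nonneg x hr.1) fun h0 => ?_
    have hnear := (hF x hx).eq_zero_near hc hu.sobolev (hsum x) hr h0.symm
    have hall := forall_exists_eq_zero hrbar (fun y hy hyε => by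
      obtain ⟨t, ht, h2⟩ := exists_mem_almgrenH_eq_zero (s := s) (hRpos y hy) hyε
      exact (hF y hy).eq_zero_near hc hu.sobolev (hsum y) ht h2) hx ⟨_, hRpos x hx, hnear⟩
    refine hX₁0 (hu.eq_zero_of_trace_eq_zero hn hs₀ hs₁ hτ hτn hτs hM0 hM (fun y hy => ?_)
      (hall 0 (by simp)) X₁ hX₁)
    obtain ⟨ε, hε, h2⟩ := hall y hy
    exact trace_eq_zero hc hy hε h2
  refine ⟨C, rbar, hC0, hrbar, fun x₀ hx₀ => ?_⟩
  obtain ⟨hx₀1, hu₀⟩ := hx₀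
  have hF₀ := hF x₀ hx₀1
  have hpos := hHpos x₀ hx₀1
  have hint : ∀ r, ∫ t in (0 : ℝ)..r, C * (profile s τ f u G x₀).ψRate n τ (weightExp s) t =
      C * bigPsi s τ u x₀ r := fun r => by
    rw [intervalIntegral.integral_const_mul, integral_profile_ψRate]
  obtain ⟨L, hL, hLle⟩ := hF₀.exists_tendsto (hRpos x₀ hx₀1) hpos
  have hαL : alphaStar s ≤ L := by
    -- Hölder continuity is available only for exponents strictly between 0 and α*; the maximum with
    -- α*/2 keeps the exponent positive.
    refine le_of_forall_lt_imp_le_of_dense fun α hα' => ?_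
    have hm : max α (alphaStar s / 2) < alphaStar s := max_lt hα' (by linarith)
    obtain ⟨C₄, hC₄⟩ := almgrenH_le_of_holder hs₁ hx₀1 hu₀ hu
      (lt_max_of_lt_right (half_pos hα)) hm
    exact (le_max_left _ _).trans (hF₀.le_of_tendsto (hRpos x₀ hx₀1) hpos hL hC₄)
  refine ⟨fun r hr => ⟨hpos r hr, ?_⟩, ?_, L, hαL, hL⟩
  · have h1 := hLle r hr
    rw [hint] at h1
    have h2 := ((hA x₀ _ (hsum x₀)).ψRate_integral hτ ha he hr).2
    rw [integral_profile_ψRate] at h2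
    have h3 : C * bigPsi s τ u x₀ r < Real.log (1 + alphaStar s) := by
      calc C * bigPsi s τ u x₀ r ≤ C * (C₃ * r ^ (1 - weightExp s)) :=
            mul_le_mul_of_nonneg_left h2 hC0.le
        _ ≤ C * (C₃ * rbar ^ (1 - weightExp s)) :=
            mul_le_mul_of_nonneg_left (mul_le_mul_of_nonneg_left
              (hpow r hr.1.le (hr.2.le.trans (min_le_left _ _))) hC₃0) hC0.le
        _ = C * C₃ * rbar ^ (1 - weightExp s) := by ring
        _ < _ := hsmall₂
    have h4 : Real.exp (C * bigPsi s τ u x₀ r) < 1 + alphaStar s := by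
      rw [← Real.exp_log (show 0 < 1 + alphaStar s by linarith)]
      exact Real.exp_lt_exp.2 h3
    -- If N(r) ≤ 0, the monotone quantity would be at most exp(CΨ(r)) < 1 + α* ≤ L + 1,
    -- contradicting its lower bound.
    by_contra hcon
    have h5 : almgrenN s f u G x₀ r + 1 ≤ 1 := by linarith
    have h6 := mul_le_mul_of_nonneg_left h5 (Real.exp_pos (C * bigPsi s τ u x₀ r)).le
    rw [almgrenN] at h6
    linarith
  · have := hF₀.monotoneOn hpos
    simp only [hint] at this
    exact this
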